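/- Let $n\ge 1$, let $c\in\mathbb R$, and let $(N^{n+1},h)$ be a smooth Riemannian manifold of constant sectional curvature $c$ (for instance the space form $\mathbb M^{n+1}(c)$, i.e. Euclidean space, a sphere or a hyperbolic space). Let $(M^n,g)$ be a connected smooth Riemannian manifold, let $\phi:(M^n,g)\to (N^{n+1},h)$ be a smooth isometric immersion, and let $\xi$ be a smooth unit normal vector field along $\phi$ (such a field exists if $M$ and $N$ are orientable). Let $A$ be the Weingarten operator given by $\langle AX,Y\rangle=\langle \tilde\nabla_X d\phi(Y),\xi\rangle$; its eigenvalues are the principal curvatures, and $H=\frac1n\operatorname{trace}A$ is the mean curvature. Assume that 1. $\phi$ is biharmonic, i.e. its bitension field vanishes: $\tau_2(\phi)=\operatorname{trace}\nabla^2\tau(\phi)-\operatorname{trace}R^N(d\phi,\tau(\phi))d\phi=0$, where $\tau(\phi)=\operatorname{trace}\nabla d\phi$ is the tension field and $R^N(X,Y)Z=\nabla_X\nabla_YZ-\nabla_Y\nabla_XZ-\nabla_{[X,Y]}Z$; 2. the scalar curvature of $(M^n,g)$ is constant; 3. at every point of $M^n$ there are at most six distinct principal curvatures. Then the mean curvature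 $H$ is constant on $M^n$. -/

import Mathlib

open scoped Manifold ContDiff

namespace BiharmonicHypersurface

noncomputable section

/-! ## Riemannian geometry in local coordinates

All formulas are written for functions on `ℝ^m`; they are only evaluated at points of open sets
(coordinate domains) on which the functions in question are smooth. -/

/-- The coordinate space `ℝ^m`. -/
abbrev Coord (m : ℕ) := EuclideanSpace ℝ (Fin m)

/-- The coefficients `g_{ij}` of a metric in coordinates, as a matrix-valued function. -/
abbrev MetricField (m : ℕ) := Coord m → Matrix (Fin m) (Fin m) ℝ

/-- The partial derivative `∂_i f` at `x`. -/
def pd {m : ℕ} (i : Fin m) (f : Coord m → ℝ) (x : Coord m) : ℝ :=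
  fderiv ℝ f x (EuclideanSpace.single i 1)

/-- The Christoffel symbol `Γ^k_{ij}` of the Levi-Civita connection of `g`, at `x`. -/
def christoffel {m : ℕ} (g : MetricField m) (k i j : Fin m) (x : Coord m) : ℝ :=
  (1 / 2) * ∑ l, (g x)⁻¹ k l *
    (pd i (fun y => g y j l) x + pd j (fun y => g y i l) x - pd l (fun y => g y i j) x)

/-- The curvature component `R^l_{ijk}`, where `R(∂_i, ∂_j) ∂_k = ∑ l, R^l_{ijk} ∂_l` and
`R(X, Y) Z = ∇_X ∇_Y Z - ∇_Y ∇_X Z - ∇_{[X, Y]} Z`. -/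
def curvature {m : ℕ} (g : MetricField m) (l i j k : Fin m) (x : Coord m) : ℝ :=
  pd i (christoffel g l j k) x - pd j (christoffel g l i k) x +
    ∑ s, (christoffel g l i s x * christoffel g s j k x -
      christoffel g l j s x * christoffel g s i k x)

/-- The vector `R(X, Y) Z` at `x`. -/
def curvatureOp {m : ℕ} (g : MetricField m) (x : Coord m) (X Y Z : Fin m → ℝ) : Fin m → ℝ :=
  fun l => ∑ i, ∑ j, ∑ k, curvature g l i j k x * X i * Y j * Z k

/-- The inner product `⟨v, w⟩` of two vectors at `x`. -/
def innerAt {m : ℕ} (g : MetricField m) (x : Coord m) (v w : Fin m → ℝ) : ℝ :=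
  ∑ i, ∑ j, g x i j * v i * w j

/-- The scalar curvature `g^{jk} Ric_{jk}`, where `Ric(Y, Z) = trace (X ↦ R(X, Y) Z)`. -/
def scalarCurvatureIn {m : ℕ} (g : MetricField m) (x : Coord m) : ℝ :=
  ∑ j, ∑ k, (g x)⁻¹ j k * ∑ i, curvature g i i j k x

/-! ### Maps in coordinates

`F : ℝ^m → ℝ^k` is a map between two coordinate domains carrying the metrics `g` and `h`. A vector
field along `F` is given by its component function `W : ℝ^m → (Fin k → ℝ)`. -/

/-- The vector field `dF(∂_j)` along `F`. -/
def dMap {m k : ℕ} (F : Coord m → Coord k) (j : Fin m) : Coord m → Fin k → ℝ :=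
  fun x a => pd j (fun y => F y a) x

/-- The covariant derivative along `∂_i` of a vector field `W` along `F`, with respect to the
connection induced by the Levi-Civita connection of `h`. -/
def covDerivAlong {m k : ℕ} (h : MetricField k) (F : Coord m → Coord k) (i : Fin m)
    (W : Coord m → Fin k → ℝ) : Coord m → Fin k → ℝ :=
  fun x a => pd i (fun y => W y a) x +
    ∑ b, ∑ d, christoffel h a b d (F x) * dMap F i x b * W x d

/-- The tension field `τ(F) = trace ∇dF`. -/
def tension {m k : ℕ} (g : MetricField m) (h : MetricField k) (F : Coord m → Coord k) :
    Coord m → Fin k → ℝ :=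
  fun x a => ∑ i, ∑ j, (g x)⁻¹ i j *
    (covDerivAlong h F i (dMap F j) x a - ∑ l, christoffel g l i j x * dMap F l x a)

/-- The trace of the second covariant derivative of a vector field `W` along `F`. -/
def roughLaplacian {m k : ℕ} (g : MetricField m) (h : MetricField k) (F : Coord m → Coord k)
    (W : Coord m → Fin k → ℝ) : Coord m → Fin k → ℝ :=
  fun x a => ∑ i, ∑ j, (g x)⁻¹ i j *
    (covDerivAlong h F i (covDerivAlong h F j W) x a -
      ∑ l, christoffel g l i j x * covDerivAlong h F l W x a)

/-- The bitension field `τ₂(F) = trace ∇²τ(F) - trace R^h(dF, τ(F)) dF`. -/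
def bitension {m k : ℕ} (g : MetricField m) (h : MetricField k) (F : Coord m → Coord k) :
    Coord m → Fin k → ℝ :=
  fun x a => roughLaplacian g h F (tension g h F) x a -
    ∑ i, ∑ j, (g x)⁻¹ i j * curvatureOp h (F x) (dMap F i x) (tension g h F x) (dMap F j x) a

/-! ## Riemannian manifolds and hypersurfaces -/

/-- A smooth Riemannian metric on a smooth manifold of dimension `m` (without boundary). -/
abbrev RiemMetric (m : ℕ) (M : Type*) [TopologicalSpace M] [ChartedSpace (Coord m) M]
    [IsManifold (𝓡 m) ∞ M] :=
  Bundle.ContMDiffRiemannianMetric (𝓡 m) ∞ (Coord m) (fun p : M => TangentSpace (𝓡 m) p)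

/-- The smooth charts of `M`: all charts of the maximal atlas. -/
abbrev smoothCharts (m : ℕ) (M : Type*) [TopologicalSpace M] [ChartedSpace (Coord m) M] :
    Set (OpenPartialHomeomorph M (Coord m)) :=
  IsManifold.maximalAtlas (𝓡 m) ∞ M

section Manifold

variable {m : ℕ} {M : Type*} [TopologicalSpace M] [ChartedSpace (Coord m) M]
  [IsManifold (𝓡 m) ∞ M]

/-- The coordinate vector field `∂_i` of the chart `e`, at the point with coordinates `x`. -/
def coordVec (e : OpenPartialHomeomorph M (Coord m)) (i : Fin m) (x : Coord m) :
    TangentSpace (𝓡 m) (e.symm x) :=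
  mfderiv (𝓡 m) (𝓡 m) e.symm x (EuclideanSpace.single i (1 : ℝ) : Coord m)

/-- The coefficients `g_{ij} = g(∂_i, ∂_j)` of the metric `g` in the chart `e`. -/
def metricIn (g : RiemMetric m M) (e : OpenPartialHomeomorph M (Coord m)) : MetricField m :=
  fun x => Matrix.of fun i j => g.inner (e.symm x) (coordVec e i x) (coordVec e j x)

/-- `(M, g)` has constant sectional curvature `c`:
`⟨R(X, Y) Y, X⟩ = c (|X|² |Y|² - ⟨X, Y⟩²)` for all tangent vectors `X`, `Y` at all points. -/
def HasConstantSectionalCurvature (g : RiemMetric m M) (c : ℝ) : Prop :=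
  ∀ e ∈ smoothCharts m M, ∀ x ∈ e.target, ∀ X Y : Fin m → ℝ,
    innerAt (metricIn g e) x (curvatureOp (metricIn g e) x X Y Y) X =
      c * (innerAt (metricIn g e) x X X * innerAt (metricIn g e) x Y Y -
        innerAt (metricIn g e) x X Y ^ 2)

/-- The scalar curvature of `(M, g)` is constant. -/
def HasConstantScalarCurvature (g : RiemMetric m M) : Prop :=
  ∃ R : ℝ, ∀ e ∈ smoothCharts m M, ∀ x ∈ e.target, scalarCurvatureIn (metricIn g e) x = R

variable {k : ℕ} {N : Type*} [TopologicalSpace N] [ChartedSpace (Coord k) N]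
  [IsManifold (𝓡 k) ∞ N]

/-- The map `φ` in the charts `e` and `e'`. -/
def mapIn (φ : M → N) (e : OpenPartialHomeomorph M (Coord m))
    (e' : OpenPartialHomeomorph N (Coord k)) : Coord m → Coord k :=
  fun x => e' (φ (e.symm x))

/-- A smooth isometric immersion `φ : (M, g) → (N, h)`. (Injectivity of the differential follows
from `φ^* h = g`, since `g` is positive definite.) -/
structure IsIsometricImmersion (g : RiemMetric m M) (h : RiemMetric k N) (φ : M → N) : Prop where
  smooth : ContMDiff (𝓡 m) (𝓡 k) ∞ φ
  isometric : ∀ (p : M) (v w : TangentSpace (𝓡 m) p),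
    h.inner (φ p) (mfderiv (𝓡 m) (𝓡 k) φ p v) (mfderiv (𝓡 m) (𝓡 k) φ p w) = g.inner p v w

/-- The map `φ : (M, g) → (N, h)` is biharmonic: its bitension field vanishes. -/
def IsBiharmonic (g : RiemMetric m M) (h : RiemMetric k N) (φ : M → N) : Prop :=
  ∀ e ∈ smoothCharts m M, ∀ e' ∈ smoothCharts k N, ∀ p ∈ e.source, φ p ∈ e'.source →
    bitension (metricIn g e) (metricIn h e') (mapIn φ e e') (e p) = 0

/-- `ξ` is a smooth unit normal vector field along `φ`. -/
structure IsUnitNormalField (h : RiemMetric k N) (φ : M → N)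
    (ξ : ∀ p : M, TangentSpace (𝓡 k) (φ p)) : Prop where
  smooth : ContMDiff (𝓡 m) (𝓡 k).tangent ∞ (fun p => (⟨φ p, ξ p⟩ : TangentBundle (𝓡 k) N))
  unit : ∀ p : M, h.inner (φ p) (ξ p) (ξ p) = 1
  normal : ∀ (p : M) (v : TangentSpace (𝓡 m) p),
    h.inner (φ p) (mfderiv (𝓡 m) (𝓡 k) φ p v) (ξ p) = 0

/-- The components in the chart `e'` of the vector `ξ` tangent to `N` at `q`. -/
def vecIn (e' : OpenPartialHomeomorph N (Coord k)) (q : N) (ξ : TangentSpace (𝓡 k) q) :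
    Fin k → ℝ :=
  fun a => EuclideanSpace.proj (𝕜 := ℝ) a (show Coord k from mfderiv (𝓡 k) (𝓡 k) e' q ξ)

/-- The second fundamental form of `φ` in the direction of the normal field `ξ` at `p`, in
the charts `e` and `e'`: the matrix with entries `⟨h(∂_i, ∂_j), ξ⟩ = ⟨∇_{∂_i} dφ(∂_j), ξ⟩`. -/
def secondFundIn (h : RiemMetric k N) (φ : M → N) (ξ : ∀ p : M, TangentSpace (𝓡 k) (φ p))
    (e : OpenPartialHomeomorph M (Coord m)) (e' : OpenPartialHomeomorph N (Coord k)) (p : M) :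
    Matrix (Fin m) (Fin m) ℝ :=
  Matrix.of fun i j =>
    innerAt (metricIn h e') (e' (φ p))
      (covDerivAlong (metricIn h e') (mapIn φ e e') i (dMap (mapIn φ e e') j) (e p))
      (vecIn e' (φ p) (ξ p))

/-- The Weingarten operator `A` at `p`, defined by `⟨A X, Y⟩ = ⟨h(X, Y), ξ⟩`, as a matrix in
the basis of coordinate vectors of the chart `e`. -/
def weingartenIn (g : RiemMetric m M) (h : RiemMetric k N) (φ : M → N)
    (ξ : ∀ p : M, TangentSpace (𝓡 k) (φ p)) (e : OpenPartialHomeomorph M (Coord m))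
    (e' : OpenPartialHomeomorph N (Coord k)) (p : M) : Matrix (Fin m) (Fin m) ℝ :=
  (metricIn g e (e p))⁻¹ * secondFundIn h φ ξ e e' p

/-- At every point there are at most `d` distinct principal curvatures, i.e. eigenvalues of the
Weingarten operator. -/
def AtMostPrincipalCurvatures (d : ℕ) (g : RiemMetric m M) (h : RiemMetric k N) (φ : M → N)
    (ξ : ∀ p : M, TangentSpace (𝓡 k) (φ p)) : Prop :=
  ∀ e ∈ smoothCharts m M, ∀ e' ∈ smoothCharts k N, ∀ p ∈ e.source, φ p ∈ e'.source →
    {t : ℝ | ∃ v : Fin m → ℝ, v ≠ 0 ∧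
      (weingartenIn g h φ ξ e e' p).mulVec v = t • v}.encard ≤ d

/-- The mean curvature `H = (1 / m) trace A` is constant on `M`. -/
def HasConstantMeanCurvature (g : RiemMetric m M) (h : RiemMetric k N) (φ : M → N)
    (ξ : ∀ p : M, TangentSpace (𝓡 k) (φ p)) : Prop :=
  ∃ H : ℝ, ∀ e ∈ smoothCharts m M, ∀ e' ∈ smoothCharts k N, ∀ p ∈ e.source, φ p ∈ e'.source →
    (1 / (m : ℝ)) * (weingartenIn g h φ ξ e e' p).trace = H

end Manifold

end

end BiharmonicHypersurface

open scoped Manifold ContDiff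

namespace BiharmonicHypersurface

/-! ### The three reduced polynomial relations and their weighted homogeneity. -/

/-- The algebraic relation between the reduced variables `L, s, B, W` which expresses the
biharmonic
equation. -/
def reducedRel {R : Type*} [CommRing R] (nu m c C L s B W : R) : R :=
  27 * L ^ 3 * s ^ 2 +
    (-27) * L ^ 3 +
    (-6 * B * nu + 6 * W * m) * L ^ 2 * s +
    (6 * C - 3 * W ^ 2 * m - 27 * c - 9 * c * m + 6 * c * nu) * L * s ^ 2 +
    (6 * B ^ 2 * nu - 1 * B ^ 2 * nu ^ 2 - 6 * C + 3 * W ^ 2 * m - 1 * W ^ 2 * m ^ 2 + 27 * c +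
15 * c * m - 2 * c * m * nu - 6 * c * nu) * L +
    (-3 * W * c * m - 3 * W ^ 3 * m) * s ^ 3 +
    (-1 * B * C * nu + B * c * m * nu + C * W * m + 3 * W * c * m - 1 * W * c * m * nu - 1 * W *
c * m ^ 2 + 3 * W ^ 3 * m - 1 * W ^ 3 * m ^ 2) * s

/-- A combination of `reducedRel` and its derivative along the reduced flow. -/
def reducedRelDeriv {R : Type*} [CommRing R] (nu m c C L s B W : R) : R :=
  108 * L ^ 4 * s +
    (-54 * B + 12 * B * nu - 12 * W * m) * L ^ 3 +
    (27 * C - 21 * W ^ 2 * m - 15 * c * m - 6 * c * nu) * L ^ 2 * s +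
    (-3 * W * c * m - 3 * W ^ 3 * m) * L * s ^ 2 +
    (12 * B * C - 1 * B * C * nu - 54 * B * c - 30 * B * c * m + 5 * B * c * m * nu + 24 * B * c
* nu - 2 * B * c * nu ^ 2 + C * W * m + 15 * W * c * m - 1 * W * c * m * nu - 5 * W * c * m ^ 2 +
9 * W ^ 3 * m - 3 * W ^ 3 * m ^ 2) * L +
    (-9 * W ^ 2 * c * m - 9 * W ^ 4 * m) * s ^ 3 +
    (-2 * C * W ^ 2 * m - 9 * C * c - 3 * C * c * m + C * c * nu + 2 * C ^ 2 + 30 * W ^ 2 * c * m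
- 4 * W ^ 2 * c * m * nu - 2 * W ^ 2 * c * m ^ 2 + 9 * W ^ 4 * m - 3 * W ^ 4 * m ^ 2 + 21 * c ^ 2
* m - 4 * c ^ 2 * m * nu + c ^ 2 * m ^ 2) * s

/-- A combination of `reducedRel`, `reducedRelDeriv` and the derivative of the latter. -/
def reducedRelDerivTwo {R : Type*} [CommRing R] (nu m c C L s B W : R) : R :=
  (486 * B) * L ^ 5 +
    (378 * C - 54 * W ^ 2 * m - 3888 * c - 1026 * c * m + 972 * c * nu) * L ^ 4 * s +
    (-351 * W * c * m - 351 * W ^ 3 * m) * L ^ 3 * s ^ 2 +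
    (-648 * B * C + 126 * B * C * nu + 2916 * B * c + 1296 * B * c * m - 282 * B * c * m * nu -
1350 * B * c * nu + 132 * B * c * nu ^ 2 - 126 * C * W * m - 189 * W * c * m + 18 * W * c * m *
nu + 282 * W * c * m ^ 2 - 243 * W ^ 3 * m + 150 * W ^ 3 * m ^ 2) * L ^ 3 +
    (324 * W ^ 2 * c * m + 324 * W ^ 4 * m) * L ^ 2 * s ^ 3 +
    (-66 * C * W ^ 2 * m - 162 * C * c - 114 * C * c * m + 48 * C * c * nu + 36 * C ^ 2 - 864 * W
^ 2 * c * m + 156 * W ^ 2 * c * m * nu + 312 * W ^ 2 * c * m ^ 2 - 324 * W ^ 4 * m + 234 * W ^ 4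
* m ^ 2 - 648 * c ^ 2 * m + 204 * c ^ 2 * m * nu + 54 * c ^ 2 * m ^ 2 + 108 * c ^ 2 * nu - 24 * c
^ 2 * nu ^ 2) * L ^ 2 * s +
    (-60 * C * W * c * m - 60 * C * W ^ 3 * m + 27 * W * c ^ 2 * m + 42 * W * c ^ 2 * m * nu + 39
* W * c ^ 2 * m ^ 2 + 27 * W ^ 3 * c * m + 42 * W ^ 3 * c * m * nu + 120 * W ^ 3 * c * m ^ 2 + 81
* W ^ 5 * m ^ 2) * L * s ^ 2 +
    (-216 * B * C * c - 96 * B * C * c * m + 12 * B * C * c * m * nu + 84 * B * C * c * nu - 6 *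
B * C * c * nu ^ 2 + 24 * B * C ^ 2 + 486 * B * c ^ 2 + 432 * B * c ^ 2 * m - 156 * B * c ^ 2 * m
* nu + 15 * B * c ^ 2 * m * nu ^ 2 + 90 * B * c ^ 2 * m ^ 2 - 24 * B * c ^ 2 * m ^ 2 * nu - 378 *
B * c ^ 2 * nu + 90 * B * c ^ 2 * nu ^ 2 - 6 * B * c ^ 2 * nu ^ 3 + 30 * C * W * c * m - 12 * C *
W * c * m ^ 2 + 18 * C * W ^ 3 * m - 6 * C * W ^ 3 * m ^ 2 - 135 * W * c ^ 2 * m - 42 * W * c ^ 2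
* m * nu + 3 * W * c ^ 2 * m * nu ^ 2 - 51 * W * c ^ 2 * m ^ 2 + 18 * W * c ^ 2 * m ^ 2 * nu + 24
* W * c ^ 2 * m ^ 3 - 81 * W ^ 3 * c * m - 18 * W ^ 3 * c * m * nu - 96 * W ^ 3 * c * m ^ 2 + 12
* W ^ 3 * c * m ^ 2 * nu + 33 * W ^ 3 * c * m ^ 3 - 45 * W ^ 5 * m ^ 2 + 15 * W ^ 5 * m ^ 3) * L +
    (36 * W ^ 2 * c ^ 2 * m * nu + 3 * W ^ 2 * c ^ 2 * m ^ 2 + 36 * W ^ 4 * c * m * nu + 42 * W ^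
4 * c * m ^ 2 + 39 * W ^ 6 * m ^ 2) * s ^ 3 +
    (12 * C * W ^ 2 * c * m + 3 * C * W ^ 2 * c * m * nu + 3 * C * W ^ 2 * c * m ^ 2 + 3 * C * W
^ 4 * m ^ 2 + 12 * C * c ^ 2 * m + 3 * C * c ^ 2 * m * nu - 54 * W ^ 2 * c ^ 2 * m - 72 * W ^ 2 *
c ^ 2 * m * nu + 6 * W ^ 2 * c ^ 2 * m * nu ^ 2 - 105 * W ^ 2 * c ^ 2 * m ^ 2 + 30 * W ^ 2 * c ^
2 * m ^ 2 * nu + 9 * W ^ 2 * c ^ 2 * m ^ 3 - 36 * W ^ 4 * c * m * nu - 120 * W ^ 4 * c * m ^ 2 +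
21 * W ^ 4 * c * m ^ 2 * nu + 24 * W ^ 4 * c * m ^ 3 - 45 * W ^ 6 * m ^ 2 + 15 * W ^ 6 * m ^ 3 -
54 * c ^ 3 * m - 36 * c ^ 3 * m * nu + 6 * c ^ 3 * m * nu ^ 2 - 30 * c ^ 3 * m ^ 2 + 9 * c ^ 3 *
m ^ 2 * nu) * s


/-- Used to move the relation between real sequences, the ultrapower, a valuation ring and its
residue field. -/
theorem map_reducedRel {R S : Type*} [CommRing R] [CommRing S] (ρ : R →+* S)
    (nu m c C L s B W : R) :
    ρ (reducedRel nu m c C L s B W) =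
      reducedRel (ρ nu) (ρ m) (ρ c) (ρ C) (ρ L) (ρ s) (ρ B) (ρ W) := by
  simp only [reducedRel, map_add, map_mul, map_pow, map_sub, map_neg, map_one, map_ofNat]

theorem map_reducedRelDeriv {R S : Type*} [CommRing R] [CommRing S] (ρ : R →+* S)
    (nu m c C L s B W : R) :
    ρ (reducedRelDeriv nu m c C L s B W) =
      reducedRelDeriv (ρ nu) (ρ m) (ρ c) (ρ C) (ρ L) (ρ s) (ρ B) (ρ W) := by
  simp only [reducedRelDeriv, map_add, map_mul, map_pow, map_sub, map_neg, map_one, map_ofNat]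

theorem map_reducedRelDerivTwo {R S : Type*} [CommRing R] [CommRing S] (ρ : R →+* S)
    (nu m c C L s B W : R) :
    ρ (reducedRelDerivTwo nu m c C L s B W) =
      reducedRelDerivTwo (ρ nu) (ρ m) (ρ c) (ρ C) (ρ L) (ρ s) (ρ B) (ρ W) := by
  simp only [reducedRelDerivTwo, map_add, map_mul, map_pow, map_sub, map_neg, map_ofNat]

/-- The relation is weighted homogeneous: `L`, `B`, `W` have weight one, `c` and `C` weight two, and
`s` weight zero. At a place where `L` is infinite this permits normalising `L` to one, at the price
of making `c` and `C` infinitesimal. -/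
theorem reducedRel_smul {R : Type*} [CommRing R] (t nu m c C L s B W : R) :
    reducedRel nu m (t ^ 2 * c) (t ^ 2 * C) (t * L) s (t * B) (t * W) =
      t ^ 3 * reducedRel nu m c C L s B W := by
  simp only [reducedRel]; ring

theorem reducedRelDeriv_smul {R : Type*} [CommRing R] (t nu m c C L s B W : R) :
    reducedRelDeriv nu m (t ^ 2 * c) (t ^ 2 * C) (t * L) s (t * B) (t * W) =
      t ^ 4 * reducedRelDeriv nu m c C L s B W := by
  simp only [reducedRelDeriv]; ring

theorem reducedRelDerivTwo_smul {R : Type*} [CommRing R] (t nu m c C L s B W : R) :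
    reducedRelDerivTwo nu m (t ^ 2 * c) (t ^ 2 * C) (t * L) s (t * B) (t * W) =
      t ^ 6 * reducedRelDerivTwo nu m c C L s B W := by
  simp only [reducedRelDerivTwo]; ring


/-! ### Incompatibility of the leading terms. -/

/-- This polynomial in the multiplicity is what remains when `u` is eliminated from the quartic and
the sextic in `leading_forms_contradiction`. -/
theorem natCast_resultant_ne_zero {k : Type*} [Field k] [CharZero k] {m : ℕ} (hm : m ≠ 0) :
    (9037745167392 - 57299490323100 * (m : k) + 127991987376705 * (m : k) ^ 2
      - 118596959030835 * (m : k) ^ 3 + 36797233080960 * (m : k) ^ 4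
      + 10839192339456 * (m : k) ^ 5 - 9607309885440 * (m : k) ^ 6
      + 1757832806400 * (m : k) ^ 7) ≠ 0 := by
  have key : (9037745167392 - 57299490323100 * (m : ℤ) + 127991987376705 * (m : ℤ) ^ 2
      - 118596959030835 * (m : ℤ) ^ 3 + 36797233080960 * (m : ℤ) ^ 4
      + 10839192339456 * (m : ℤ) ^ 5 - 9607309885440 * (m : ℤ) ^ 6
      + 1757832806400 * (m : ℤ) ^ 7) ≠ 0 := by
    -- The values at one and two are computed. With `m = j + 3` all coefficients of the polynomial
    -- in `j` are positive; this needs an ordered ring, hence the detour through the integers.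
    rcases m with _ | _ | _ | j
    · exact absurd rfl hm
    · norm_num
    · norm_num
    · refine ne_of_gt ?_
      push_cast
      ring_nf
      positivity
  intro h
  apply key
  apply Int.cast_injective (α := k)
  simp only [Int.cast_add, Int.cast_sub, Int.cast_mul, Int.cast_pow, Int.cast_ofNat,
    Int.cast_natCast, Int.cast_zero]
  exact h

/-- The leading forms of the relations have no common zero with `b * w = 0`. -/
theorem leading_forms_contradiction {k : Type*} [Field k] [CharZero k] {m : ℕ} {nu s b w : k}
    (hbw : b * w = 0) (hm : m = 0 → w = 0)
    (hF : reducedRel nu (m : k) 0 0 1 s b w = 0)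
    (hG : reducedRelDeriv nu (m : k) 0 0 1 s b w = 0)
    (hE : reducedRelDerivTwo nu (m : k) 0 0 1 s b w = 0) : False := by
  simp only [reducedRel, reducedRelDeriv, reducedRelDerivTwo] at hF hG hE
  by_cases hw : w = 0
  · subst hw
    have hb : b = 0 := by
      have : (486 : k) * b = 0 := by linear_combination hE
      simpa using this
    subst hb
    have hs : s = 0 := by
      have : (108 : k) * s = 0 := by linear_combination hG
      simpa using this
    subst hs
    have : (27 : k) = 0 := by linear_combination -hF
    norm_num at this
  · have hb : b = 0 := by simpa [hw] using hbw
    subst hb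
    have hm' : m ≠ 0 := fun h => hw (hm h)
    have hmk : (m : k) ≠ 0 := by exact_mod_cast hm'
    have hF' : 27 * s ^ 2 - 27 + 6 * m * w * s - 3 * m * w ^ 2 * s ^ 2 +
        (3 * m - m ^ 2) * w ^ 2 - 3 * m * w ^ 3 * s ^ 3 + (3 * m - m ^ 2) * w ^ 3 * s = 0 := by
      linear_combination hF
    have hG' : 108 * s - 12 * m * w - 21 * m * w ^ 2 * s - 3 * m * w ^ 3 * s ^ 2 +
        (9 * m - 3 * m ^ 2) * w ^ 3 - 9 * m * w ^ 4 * s ^ 3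
        + (9 * m - 3 * m ^ 2) * w ^ 4 * s = 0 := by
      linear_combination hG
    -- In terms of `u = s w` the three relations yield `hA`, `hR`, `hB`, which are affine in `w ^
    -- 2`. Eliminating `w ^ 2` leaves the quartic `hP4` and the sextic `hP6` in `u` alone.
    obtain ⟨u, hu⟩ : ∃ u, u = s * w := ⟨_, rfl⟩
    have hA : 27 * u * (4 - 3 * u) + w ^ 2 * (81 - 12 * m - 39 * m * u + 6 * m * u ^ 2) = 0 := by
      rw [hu]
      linear_combination w * (hG' - 3 * w * hF')
    have hR : 9 * u * (6 * u ^ 2 + u - 1) + w ^ 2 * (-m * u ^ 3 + 6 * m * u ^ 2 +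
        54 * (m - 1) * u + 25 * m - 108) = 0 := by
      have : 6 * (m : k) * w * (9 * u * (6 * u ^ 2 + u - 1) + w ^ 2 * (-m * u ^ 3 + 6 * m * u ^ 2 +
          54 * (m - 1) * u + 25 * m - 108)) = 0 := by
        rw [hu]
        linear_combination hE + 15 * m * w ^ 3 * hF'
      simpa [hmk, hw] using this
    have hB : 9 * (12 - 4 * m * u - m * u ^ 2 + m * u ^ 3 - m * u ^ 4) +
        w ^ 2 * ((1 + u) * (3 * m - m ^ 2) * (3 * u - 4)) = 0 := by
      rw [hu]
      linear_combination s * hG' - 4 * hF'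
    have hP4 : 3 * m * u ^ 4 - 18 * m * u ^ 3 + 33 * m * u ^ 2 - (44 * m + 27) * u + 135
        - 32 * m = 0 := by
      have : w ^ 2 * (9 * (3 * m * u ^ 4 - 18 * m * u ^ 3 + 33 * m * u ^ 2 - (44 * m + 27) * u
          + 135 - 32 * m)) = 0 := by
        linear_combination (6 * u ^ 2 + u - 1) * hA + 3 * (3 * u - 4) * hR
      simpa [hw] using this
    have hP6 : (12 - 4 * m * u - m * u ^ 2 + m * u ^ 3 - m * u ^ 4) *
        (81 - 12 * m - 39 * m * u + 6 * m * u ^ 2)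
        + 3 * u * (1 + u) * (3 * m - m ^ 2) * (3 * u - 4) ^ 2 = 0 := by
      have : w ^ 2 * ((12 - 4 * m * u - m * u ^ 2 + m * u ^ 3 - m * u ^ 4) *
          (81 - 12 * m - 39 * m * u + 6 * m * u ^ 2)
          + 3 * u * (1 + u) * (3 * m - m ^ 2) * (3 * u - 4) ^ 2) = 0 := by
        linear_combination (12 - 4 * m * u - m * u ^ 2 + m * u ^ 3 - m * u ^ 4) * hA
          + 3 * u * (3 * u - 4) * hB
      simpa [hw] using this
    -- The coefficients below are a Bézout identity: a combination of the quartic and the sextic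
    -- that is free of `u`.
    apply natCast_resultant_ne_zero (k := k) hm'
    linear_combination ((223154201664 - 857375891064 * m + 1557391570587 * m ^ 2 - 2272239118881
      * m ^ 3 + 1003846378608 * m ^ 4 - 94681792512 * m ^ 5 - 54932275200 * m ^ 6) +
      (108477736920 * m - 516650465529 * m ^ 2 + 646952909679 * m ^ 3 - 24684998508 * m ^ 4 -
      145449381888 * m ^ 5 + 75531878400 * m ^ 6) * u + (-20662426080 * m + 155738785050 * m ^ 2
      - 426013714737 * m ^ 3 + 521767744452 * m ^ 4 - 287459648064 * m ^ 5 + 57047678976 * m ^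
      6) * u ^ 2 + (12397455648 * m - 109504480932 * m ^ 2 + 297506694798 * m ^ 3 - 314065764315
      * m ^ 4 + 159266033568 * m ^ 5 - 40067395584 * m ^ 6) * u ^ 3 + (-2181033864 * m ^ 2 -
      42037868835 * m ^ 3 + 143113776426 * m ^ 4 - 81575906436 * m ^ 5 + 23095068672 * m ^ 6) *
      u ^ 4 + (2295825120 * m ^ 2 - 143016678 * m ^ 3 - 16560873792 * m ^ 4 + 10112391864 * m ^
      5 - 2953261056 * m ^ 6) * u ^ 5) * hP4 + ((-21695547384 + 64262377161 * m - 103331400057 *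
      m ^ 2 + 229539229083 * m ^ 3 - 142366286880 * m ^ 4 + 36258820096 * m ^ 5) + (6198727824 -
      42326087004 * m + 116348968620 * m ^ 2 - 151132901814 * m ^ 3 + 80389487124 * m ^ 4 -
      20801120256 * m ^ 5) * u + (631351908 * m - 21126196926 * m ^ 2 + 59136232869 * m ^ 3 -
      33203659320 * m ^ 4 + 9332588544 * m ^ 5) * u ^ 2 + (1147912560 * m - 71508339 * m ^ 2 -
      8280436896 * m ^ 3 + 5056195932 * m ^ 4 - 1476630528 * m ^ 5) * u ^ 3) * hP6

/-- Two cubic relations with proportional leading coefficients have no common root at infinity. -/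
theorem no_infinite_root {O k : Type*} [CommRing O] [IsDomain O] [Field k] [CharZero k]
    (ρ : O →+* k) {τ w e f₀ f₁ f₂ f₃ g₀ g₁ : O} {m : ℕ} (hτ0 : τ ≠ 0) (hτ : ρ τ = 0)
    (hf₃ : f₃ = -3 * m * w * e) (he : ρ e = ρ w ^ 2) (hf₂ : ρ f₂ = 27 - 3 * m * ρ w ^ 2)
    (hF : f₃ + f₂ * τ + f₁ * τ ^ 2 + f₀ * τ ^ 3 = 0)
    (hG : 3 * w * f₃ + f₃ * τ + g₁ * τ ^ 2 + g₀ * τ ^ 3 = 0) : False := by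
  -- The first relation reads `f₃ = -Z τ`. Substituted into the second it gives `3 w Z = τ (...)`,
  -- so `w Z` vanishes at the residue; multiplied by `Z` it gives `Z ^ 2 = m e (...)`. Thus a
  -- vanishing `w` forces `Z = 0` against `Z = 27`, and a nonvanishing `w` forces `Z = 0` and `m =
  -- 0`, again against the value of `Z`.
  obtain ⟨Z, hZ⟩ : ∃ Z, Z = f₂ + f₁ * τ + f₀ * τ ^ 2 := ⟨_, rfl⟩
  have h1 : f₃ = -(Z * τ) := by rw [hZ]; linear_combination hF
  have h2 : 3 * w * Z = τ * (g₁ - Z + g₀ * τ) := by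
    apply mul_left_cancel₀ hτ0
    linear_combination -hG + (3 * w + τ) * h1
  have h3 : Z ^ 2 = m * e * (g₁ - Z + g₀ * τ) := by
    apply mul_left_cancel₀ hτ0
    linear_combination m * e * h2 + Z * h1 - Z * hf₃
  have hZρ : ρ Z = 27 - 3 * m * ρ w ^ 2 := by rw [hZ]; simp [hτ, hf₂]
  have h2ρ : ρ w * ρ Z = 0 := by
    have := congrArg ρ h2
    simp only [map_mul, hτ, zero_mul, map_ofNat] at this
    have h3 : (3 : k) ≠ 0 := by norm_num
    simpa [h3] using this
  by_cases hw : ρ w = 0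
  · have := congrArg ρ h3
    simp [he, hw, hZρ] at this
  · have hZ0 : ρ Z = 0 := by simpa [hw] using h2ρ
    have h4 := congrArg ρ h1
    rw [hf₃] at h4
    simp only [map_mul, map_neg, map_ofNat, map_natCast, hτ, mul_zero, neg_zero, he] at h4
    have hm : (m : k) = 0 := by simpa [hw] using h4
    rw [hZ0, hm] at hZρ
    norm_num at hZρ

/-! ### Places at which the reduced curvature would be infinite. -/

section Place

variable {K : Type*} [Field K] {V : ValuationSubring K}

open IsLocalRing

theorem exists_coe_eq_inv {x : K} (hx : x ∉ V) :
    ∃ y : V, (y : K) = x⁻¹ ∧ residue V y = 0 ∧ y ≠ 0 := by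
  have hx0 : x ≠ 0 := fun h => hx (h ▸ V.zero_mem)
  have hy : x⁻¹ ∈ V := (V.mem_or_inv_mem x).resolve_left hx
  refine ⟨⟨x⁻¹, hy⟩, rfl, ?_, fun h => inv_ne_zero hx0 (congrArg Subtype.val h)⟩
  rw [residue_eq_zero_iff, mem_maximalIdeal, mem_nonunits_iff]
  intro hu
  obtain ⟨z, hz⟩ := hu.exists_right_inv
  apply hx
  have : (z : K) = x := by
    have := congrArg (Subtype.val) hz
    simp only [MulMemClass.coe_mul, OneMemClass.coe_one] at this
    field_simp at this
    exact this
  exact this ▸ z.2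

/-- All reduced variables have at most the order of `L`. -/
theorem place_contradiction_of_bounded [CharZero (ResidueField V)] {nu c C s b w : V} {m : ℕ}
    (hc : residue V c = 0) (hC : residue V C = 0) (hbw : residue V (b * w) = 0)
    (hm : m = 0 → w = 0)
    (hF : reducedRel nu (m : V) c C 1 s b w = 0)
    (hG : reducedRelDeriv nu (m : V) c C 1 s b w = 0)
    (hE : reducedRelDerivTwo nu (m : V) c C 1 s b w = 0) : False := by
  have hF' := congrArg (residue V) hF
  have hG' := congrArg (residue V) hG
  have hE' := congrArg (residue V) hE
  rw [map_reducedRel, hc, hC, map_one, map_natCast, map_zero] at hF'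
  rw [map_reducedRelDeriv, hc, hC, map_one, map_natCast, map_zero] at hG'
  rw [map_reducedRelDerivTwo, hc, hC, map_one, map_natCast, map_zero] at hE'
  exact leading_forms_contradiction (by rw [← map_mul, hbw])
    (fun h => by rw [hm h, map_zero]) hF' hG' hE'

/-- Case where `B` and `W` are at most of the order of `L` but `s` is infinite. As polynomials in
`s` the first two relations are cubics with leading coefficients `f₃ = -3 m w (w ^ 2 + c)` and `3 w
f₃`, and the second has quadratic coefficient `f₃`: exactly the shape of `no_infinite_root` with `τ
= 1 / s`. -/
theorem place_contradiction_of_infinite_slope [CharZero (ResidueField V)] {nu c C τ b w : V}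
    {m : ℕ} (hτ0 : τ ≠ 0) (hτ : residue V τ = 0)
    (hc : residue V c = 0) (hC : residue V C = 0)
    (hF : reducedRel (nu : K) m c C 1 (τ : K)⁻¹ b w = 0)
    (hG : reducedRelDeriv (nu : K) m c C 1 (τ : K)⁻¹ b w = 0) : False := by
  have hτK : (τ : K) ≠ 0 := fun h => hτ0 (Subtype.ext h)
  refine no_infinite_root (residue V) (τ := τ) (w := w) (e := w ^ 2 + c) (m := m)
    (f₀ := -27 + 6 * b ^ 2 * nu - 1 * b ^ 2 * nu ^ 2 - 6 * C + 3 * w ^ 2 * m - 1 * w ^ 2 * m ^ 2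
      + 27 * c + 15 * c * m - 2 * c * m * nu - 6 * c * nu)
    (f₁ := -1 * b * C * nu + b * c * m * nu - 6 * b * nu + C * w * m + 3 * w * c * m
      - 1 * w * c * m * nu - 1 * w * c * m ^ 2 + 6 * w * m + 3 * w ^ 3 * m - 1 * w ^ 3 * m ^ 2)
    (f₂ := 27 + 6 * C - 3 * w ^ 2 * m - 27 * c - 9 * c * m + 6 * c * nu)
    (g₀ := -54 * b + 12 * b * C - 1 * b * C * nu - 54 * b * c - 30 * b * c * m
      + 5 * b * c * m * nu + 24 * b * c * nu - 2 * b * c * nu ^ 2 + 12 * b * nu + C * w * m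
      + 15 * w * c * m - 1 * w * c * m * nu - 5 * w * c * m ^ 2 - 12 * w * m + 9 * w ^ 3 * m
      - 3 * w ^ 3 * m ^ 2)
    (g₁ := 108 + 27 * C - 2 * C * w ^ 2 * m - 9 * C * c - 3 * C * c * m + C * c * nu + 2 * C ^ 2
      + 30 * w ^ 2 * c * m - 4 * w ^ 2 * c * m * nu - 2 * w ^ 2 * c * m ^ 2 - 21 * w ^ 2 * m
      + 9 * w ^ 4 * m - 3 * w ^ 4 * m ^ 2 - 15 * c * m - 6 * c * nu + 21 * c ^ 2 * m
      - 4 * c ^ 2 * m * nu + c ^ 2 * m ^ 2) hτ0 hτ rfl ?_ ?_ ?_ ?_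
  · simp [hc]
  · simp only [map_add, map_sub, map_mul, map_pow, map_ofNat, map_natCast, hc, hC]; ring
  · apply V.subtype_injective
    simp only [map_add, map_sub, map_mul, map_pow, map_ofNat, map_natCast, map_neg, map_one,
      map_zero, ValuationSubring.subtype_apply]
    simp only [reducedRel] at hF
    field_simp at hF
    linear_combination hF
  · apply V.subtype_injective
    simp only [map_add, map_sub, map_mul, map_pow, map_ofNat, map_natCast, map_neg, map_one,
      map_zero, ValuationSubring.subtype_apply]
    simp only [reducedRelDeriv] at hG
    field_simp at hG
    linear_combination hG

/-- Case where `B` dominates `L`. Dividing by `B` makes `B = 1` and `L = η` infinitesimal, and `B W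
= -c` becomes the stated value of `W`. With `s = t / η` both relations, freed of their powers of
`η`, are cubics in `t` over the valuation ring; `t` may be finite or infinite. -/
theorem place_contradiction_of_large_B [CharZero (ResidueField V)] {nu c C η : V} {s : K}
    {m : ℕ} (hη0 : η ≠ 0) (hη : residue V η = 0)
    (hc : residue V c = 0) (hC : residue V C = 0)
    (hF : reducedRel (nu : K) m (c * η ^ 2) (C * η ^ 2) η s 1 (-(c * η ^ 2)) = 0)
    (hG : reducedRelDeriv (nu : K) m (c * η ^ 2) (C * η ^ 2) η s 1 (-(c * η ^ 2)) = 0) :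
    False := by
  have hηK : (η : K) ≠ 0 := fun h => hη0 (Subtype.ext h)
  obtain ⟨t, rfl⟩ : ∃ t, s = t * (η : K)⁻¹ := ⟨s * η, by field_simp⟩
  obtain ⟨f₀, hf₀⟩ : ∃ f₀ : V, f₀ = -6 * C * η ^ 2 + 27 * c * η ^ 2 + 15 * c * η ^ 2 * m
    - 2 * c * η ^ 2 * m * nu - 6 * c * η ^ 2 * nu + 3 * c ^ 2 * η ^ 4 * m
    - c ^ 2 * η ^ 4 * m ^ 2 - 27 * η ^ 2 + 6 * nu - nu ^ 2 := ⟨_, rfl⟩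
  obtain ⟨f₁, hf₁⟩ : ∃ f₁ : V, f₁ = -C * c * η ^ 2 * m - C * nu - 6 * c * η ^ 2 * m
    + c * m * nu - 3 * c ^ 2 * η ^ 2 * m + c ^ 2 * η ^ 2 * m * nu + c ^ 2 * η ^ 2 * m ^ 2
    - 3 * c ^ 3 * η ^ 4 * m + c ^ 3 * η ^ 4 * m ^ 2 - 6 * nu := ⟨_, rfl⟩
  obtain ⟨f₂, hf₂⟩ : ∃ f₂ : V, f₂ = 27 + 6 * C - 27 * c - 9 * c * m + 6 * c * nu
    - 3 * c ^ 2 * η ^ 2 * m := ⟨_, rfl⟩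
  obtain ⟨f₃, hf₃⟩ : ∃ f₃ : V, f₃ = -3 * m * (-c) * (c * (1 + c * η ^ 2)) := ⟨_, rfl⟩
  obtain ⟨g₀, hg₀⟩ : ∃ g₀ : V, g₀ = -54 + 12 * C - C * c * η ^ 2 * m - C * nu - 54 * c
    + 12 * c * η ^ 2 * m - 30 * c * m + 5 * c * m * nu + 24 * c * nu - 2 * c * nu ^ 2
    - 15 * c ^ 2 * η ^ 2 * m + c ^ 2 * η ^ 2 * m * nu + 5 * c ^ 2 * η ^ 2 * m ^ 2
    - 9 * c ^ 3 * η ^ 4 * m + 3 * c ^ 3 * η ^ 4 * m ^ 2 + 12 * nu := ⟨_, rfl⟩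
  obtain ⟨g₁, hg₁⟩ : ∃ g₁ : V, g₁ = 108 + 27 * C - 9 * C * c - 3 * C * c * m + C * c * nu
    - 2 * C * c ^ 2 * η ^ 2 * m + 2 * C ^ 2 - 15 * c * m - 6 * c * nu - 21 * c ^ 2 * η ^ 2 * m
    + 21 * c ^ 2 * m - 4 * c ^ 2 * m * nu + c ^ 2 * m ^ 2 + 30 * c ^ 3 * η ^ 2 * m
    - 4 * c ^ 3 * η ^ 2 * m * nu - 2 * c ^ 3 * η ^ 2 * m ^ 2 + 9 * c ^ 4 * η ^ 4 * m
    - 3 * c ^ 4 * η ^ 4 * m ^ 2 := ⟨_, rfl⟩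
  have hF' : (f₃ : K) * t ^ 3 + f₂ * t ^ 2 + f₁ * t + f₀ = 0 := by
    have e3 := congrArg V.subtype hf₃
    have e2 := congrArg V.subtype hf₂
    have e1 := congrArg V.subtype hf₁
    have e0 := congrArg V.subtype hf₀
    simp only [map_add, map_sub, map_mul, map_pow, map_ofNat, map_natCast, map_neg, map_one,
      map_zero, ValuationSubring.subtype_apply] at e0 e1 e2 e3
    rw [e0, e1, e2, e3]
    apply mul_left_cancel₀ hηK
    rw [mul_zero, ← hF]
    simp only [reducedRel]
    field_simp
    ring
  have hG' : 3 * (-(c : K)) * f₃ * t ^ 3 + f₃ * t ^ 2 + g₁ * t + g₀ = 0 := by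
    have e3 := congrArg V.subtype hf₃
    have e1 := congrArg V.subtype hg₁
    have e0 := congrArg V.subtype hg₀
    simp only [map_add, map_sub, map_mul, map_pow, map_ofNat, map_natCast, map_neg, map_one,
      map_zero, ValuationSubring.subtype_apply] at e0 e1 e3
    rw [e0, e1, e3]
    apply mul_left_cancel₀ (pow_ne_zero 3 hηK)
    rw [mul_zero, ← hG]
    simp only [reducedRelDeriv]
    field_simp
    ring
  by_cases ht : t ∈ V
  · lift t to V using ht
    have hF'' : f₃ * t ^ 3 + f₂ * t ^ 2 + f₁ * t + f₀ = 0 := by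
      apply V.subtype_injective
      simpa using hF'
    have hG'' : 3 * (-c) * f₃ * t ^ 3 + f₃ * t ^ 2 + g₁ * t + g₀ = 0 := by
      apply V.subtype_injective
      simp only [map_add, map_mul, map_pow, map_ofNat, map_neg,
        map_zero, ValuationSubring.subtype_apply]
      exact hG'
    have h1 := congrArg (residue V) hF''
    have h2 := congrArg (residue V) hG''
    simp only [hf₀, hf₁, hf₂, hf₃, hg₀, hg₁, map_add, map_sub, map_mul, map_pow, map_ofNat,
      map_natCast, map_neg, map_one, map_zero, hη, hc, hC] at h1 h2
    -- For finite `t` the residues are `27 t ^ 2 - 6 ν t + 6 ν - ν ^ 2 = 0` and `108 t = 54 - 12 ν`.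
    -- Inserting the second into the first leaves `27 / 4 = 0`, whatever `ν` is.
    have h3 : (27 * 108 : ResidueField V) = 0 := by
      linear_combination 432 * h1 +
        (-108 * residue V t - 54 + 36 * residue V nu) * h2
    norm_num at h3
  · obtain ⟨τ, hτt, hτ, hτ0⟩ := exists_coe_eq_inv ht
    have ht0 : t ≠ 0 := fun h => ht (h ▸ V.zero_mem)
    have htτ : t = (τ : K)⁻¹ := by rw [hτt, inv_inv]
    have hτK : (τ : K) ≠ 0 := fun h => hτ0 (Subtype.ext h)
    subst htτ
    refine no_infinite_root (residue V) (τ := τ) (w := -c) (e := c * (1 + c * η ^ 2)) (m := m)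
      (f₀ := f₀) (f₁ := f₁) (f₂ := f₂) (f₃ := f₃) (g₀ := g₀) (g₁ := g₁) hτ0 hτ hf₃ ?_ ?_ ?_ ?_
    · simp [hc]
    · simp [hf₂, hc, hC, map_ofNat]
    · apply V.subtype_injective
      simp only [map_add, map_mul, map_pow, map_zero, ValuationSubring.subtype_apply]
      field_simp at hF'
      linear_combination hF'
    · apply V.subtype_injective
      simp only [map_add, map_mul, map_pow, map_zero, map_neg, map_ofNat,
        ValuationSubring.subtype_apply]
      field_simp at hG'
      linear_combination hG'

end Place


section Place

variable {K : Type*} [Field K] {V : ValuationSubring K}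

open IsLocalRing

/-- Case where `W` dominates `L`, normalised to `W = 1` and `L = η` infinitesimal. The cubic term of
the first relation excludes infinite `s`, a combination divisible by `η` forces `s` to be of order
`η`, and the lowest order terms in `u = s / η` are then incompatible. -/
theorem place_contradiction_of_large_W [CharZero (ResidueField V)] {nu c C η : V} {s : K}
    {m : ℕ} (hm : m ≠ 0) (hη0 : η ≠ 0) (hη : residue V η = 0)
    (hc : residue V c = 0) (hC : residue V C = 0)
    (hF : reducedRel (nu : K) m (c * η ^ 2) (C * η ^ 2) η s (-(c * η ^ 2)) 1 = 0)
    (hG : reducedRelDeriv (nu : K) m (c * η ^ 2) (C * η ^ 2) η s (-(c * η ^ 2)) 1 = 0) :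
    False := by
  have hηK : (η : K) ≠ 0 := fun h => hη0 (Subtype.ext h)
  have hmk : (m : ResidueField V) ≠ 0 := by exact_mod_cast hm
  by_cases hs : s ∈ V
  · lift s to V using hs
    have hF' : reducedRel nu m (c * η ^ 2) (C * η ^ 2) η s (-(c * η ^ 2)) 1 = 0 := by
      apply V.subtype_injective
      rw [map_reducedRel]
      simpa only [map_mul, map_pow, map_neg, map_one, map_zero, map_natCast,
        ValuationSubring.subtype_apply] using hF
    have hG' : reducedRelDeriv nu m (c * η ^ 2) (C * η ^ 2) η s (-(c * η ^ 2)) 1 = 0 := by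
      apply V.subtype_injective
      rw [map_reducedRelDeriv]
      simpa only [map_mul, map_pow, map_neg, map_one, map_zero, map_natCast,
        ValuationSubring.subtype_apply] using hG
    obtain ⟨j₀, hj₀⟩ : ∃ j₀ : V, j₀ = -12 * C * c * η ^ 2 + C * c * η ^ 2 * nu + 18 * C + C * m
      - 81 * c - 30 * c * m + 5 * c * m * nu - 5 * c * m ^ 2 + 18 * c * nu + 54 * c * η ^ 2
      - 12 * c * η ^ 2 * nu + 54 * c ^ 2 * η ^ 2 + 30 * c ^ 2 * η ^ 2 * m
      - 5 * c ^ 2 * η ^ 2 * m * nu - 42 * c ^ 2 * η ^ 2 * nu + 5 * c ^ 2 * η ^ 2 * nu ^ 2 + 81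
      - 12 * m := ⟨_, rfl⟩
    obtain ⟨j₁, hj₁⟩ : ∃ j₁ : V, j₁ = -9 * C * c * η ^ 2 - 3 * C * c * η ^ 2 * m
      - 2 * C * c * η ^ 2 * nu - 5 * C * m + 27 * C * η ^ 2 + 2 * C ^ 2 * η ^ 2 + 21 * c * m
      - c * m * nu + c * m ^ 2 - 15 * c * η ^ 2 * m - 24 * c * η ^ 2 * nu
      + 21 * c ^ 2 * η ^ 2 * m - c ^ 2 * η ^ 2 * m * nu + c ^ 2 * η ^ 2 * m ^ 2 - 39 * m
      + 108 * η ^ 2 := ⟨_, rfl⟩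
    obtain ⟨j₂, hj₂⟩ : ∃ j₂ : V, j₂ = -18 * C * η ^ 2 + 81 * c * η ^ 2 + 24 * c * η ^ 2 * m
      - 18 * c * η ^ 2 * nu - 81 * η ^ 2 + 6 * m := ⟨_, rfl⟩
    -- The second relation minus three times the first is divisible by `η`; the quotient is a
    -- quadratic form in `s` and `η` whose coefficient `j₂` has residue `6 m`.
    have hJ : j₂ * s ^ 2 + j₁ * η * s + j₀ * η ^ 2 = 0 := by
      apply mul_left_cancel₀ hη0
      rw [hj₀, hj₁, hj₂]
      simp only [reducedRel] at hF'
      simp only [reducedRelDeriv] at hG'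
      linear_combination hG' - 3 * hF'
    have hj₂ρ : residue V j₂ = 6 * m := by
      simp only [hj₂, hη, map_add, map_sub, map_mul, map_pow, map_ofNat, map_natCast, map_neg]
      ring
    have hsρ : residue V s = 0 := by
      have := congrArg (residue V) hJ
      simpa [hη, hj₂ρ, hmk] using this
    by_cases hu : (s : K) * (η : K)⁻¹ ∈ V
    · obtain ⟨u, hu⟩ : ∃ u : V, (u : K) = s * (η : K)⁻¹ := ⟨⟨_, hu⟩, rfl⟩
      obtain rfl : s = u * η := by
        apply Subtype.val_injective
        simp only [MulMemClass.coe_mul, hu]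
        field_simp
      have h1 : residue V (j₂ * u ^ 2 + j₁ * u + j₀) = 0 := by
        have : j₂ * u ^ 2 + j₁ * u + j₀ = 0 := by
          apply mul_left_cancel₀ (pow_ne_zero 2 hη0)
          linear_combination hJ
        rw [this, map_zero]
      have hj₁ρ : residue V j₁ = -39 * m := by
        simp only [hj₁, hη, hc, hC, map_add, map_sub, map_mul, map_pow, map_ofNat,
          map_natCast, map_neg]
        ring
      have hj₀ρ : residue V j₀ = 81 - 12 * m := by
        simp only [hj₀, hη, hc, hC, map_add, map_sub, map_mul, map_pow, map_ofNat, map_natCast,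
          map_neg]
        ring
      simp only [map_add, map_mul, map_pow, hj₂ρ, hj₁ρ, hj₀ρ] at h1
      have h2 : (1 + residue V u) * (3 * m - m ^ 2) = 0 := by
        obtain ⟨q, hq⟩ : ∃ q : V, reducedRel nu m (c * η ^ 2) (C * η ^ 2) η (u * η)
            (-(c * η ^ 2)) 1 = η * ((1 + u) * (3 * m - m ^ 2) + η * q) := by
          refine ⟨-6 * C * η + 27 * c * η + 15 * c * η * m - 2 * c * η * m * nu - 6 * c * η * nu
            + 6 * c ^ 2 * η ^ 3 * nu - c ^ 2 * η ^ 3 * nu ^ 2 - 27 * η +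
            (C * c * η ^ 3 * nu + C * η * m + 3 * c * η * m - c * η * m * nu - c * η * m ^ 2
            + 6 * c * η ^ 3 * nu - c ^ 2 * η ^ 3 * m * nu + 6 * η * m) * u +
            (6 * C * η ^ 3 - 27 * c * η ^ 3 - 9 * c * η ^ 3 * m + 6 * c * η ^ 3 * nu - 3 * η * m
            + 27 * η ^ 3) * u ^ 2 + (-3 * c * η ^ 3 * m - 3 * η * m) * u ^ 3, ?_⟩
          simp only [reducedRel]
          ring
        rw [hq] at hF'
        have h3 := congrArg (residue V)
          ((mul_eq_zero.mp hF').resolve_left hη0)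
        simpa [hη, map_ofNat] using h3
      -- The lowest order part of the first relation is `(1 + u) m (3 - m)`. It gives `u = -1`
      -- unless `m = 3`, where it vanishes identically and the terms of order `η ^ 3` supply a cubic
      -- equation for `u` instead.
      by_cases hm3 : m = 3
      · subst hm3
        have h3 : residue V u ^ 3 + residue V u ^ 2 - 2 * residue V u + 3 = 0 := by
          obtain ⟨q, hq⟩ : ∃ q : V, q = -27 + 18 * u - 9 * u ^ 2 - 9 * u ^ 3
              + (-6 * C + 72 * c - 12 * c * nu + c ^ 2 * η ^ 2 * (6 * nu - nu ^ 2))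
              + (C * c * η ^ 2 * nu + 3 * C - 3 * c * nu + 6 * c * η ^ 2 * nu
              - 3 * c ^ 2 * η ^ 2 * nu) * u
              + (6 * C * η ^ 2 - 54 * c * η ^ 2 + 6 * c * η ^ 2 * nu + 27 * η ^ 2) * u ^ 2
              - 9 * c * η ^ 2 * u ^ 3 := ⟨_, rfl⟩
          have hq0 : q = 0 := by
            apply mul_left_cancel₀ (pow_ne_zero 3 hη0)
            rw [hq]
            simp only [reducedRel] at hF'
            push_cast at hF'
            linear_combination hF'
          have h4 := congrArg (residue V) hq
          simp only [hq0, hη, hc, hC, map_add, map_sub, map_mul, map_pow, map_ofNat,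
            map_neg, map_zero] at h4
          have h5 : (9 : ResidueField V) * (residue V u ^ 3 + residue V u ^ 2 - 2 * residue V u
              + 3) = 0 := by linear_combination h4
          simpa using h5
        push_cast at h1
        generalize residue V u = x at h1 h3
        have h4 : 177 * x - 63 = 0 := by linear_combination 4 * h3 - (2 * x + 15) / 9 * h1
        have h5 : x = 21 / 59 := by linear_combination h4 / 177
        rw [h5] at h1
        norm_num at h1
      · have hm3' : (3 - m : ResidueField V) ≠ 0 := by
          intro h
          apply hm3
          have : (m : ResidueField V) = (3 : ℕ) := by push_cast; linear_combination -h
          exact_mod_cast this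
        have h3 : residue V u = -1 := by
          have : (1 + residue V u) * (m * (3 - m)) = 0 := by linear_combination h2
          have := (mul_eq_zero.mp this).resolve_right (mul_ne_zero hmk hm3')
          linear_combination this
        rw [h3] at h1
        have h4 : ((33 * m + 81 : ℕ) : ResidueField V) = 0 := by
          push_cast
          linear_combination h1
        have h5 : 33 * m + 81 = 0 := by exact_mod_cast h4
        omega
    · obtain ⟨σ, hσu, hσ, hσ0⟩ := exists_coe_eq_inv hu
      have hs0 : s ≠ 0 := by
        rintro rfl
        exact hu (by simp)
      have hsK : (s : K) ≠ 0 := fun h => hs0 (Subtype.ext h)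
      have hση : η = σ * s := by
        apply Subtype.val_injective
        simp only [MulMemClass.coe_mul, hσu]
        field_simp
      have h1 : j₂ + j₁ * σ + j₀ * σ ^ 2 = 0 := by
        apply mul_left_cancel₀ (pow_ne_zero 2 hs0)
        rw [mul_zero, ← hJ]
        generalize j₀ = a at *
        generalize j₁ = b at *
        generalize j₂ = d at *
        rw [hση]
        ring
      have h2 := congrArg (residue V) h1
      simp [hσ, hj₂ρ, hmk] at h2
  · obtain ⟨τ, hτs, hτ, hτ0⟩ := exists_coe_eq_inv hs
    have hsτ : s = (τ : K)⁻¹ := by rw [hτs, inv_inv]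
    have hτK : (τ : K) ≠ 0 := fun h => hτ0 (Subtype.ext h)
    subst hsτ
    -- For infinite `s`, divide the first relation by `s ^ 3`: its leading coefficient has the
    -- nonzero residue `-3 m`.
    obtain ⟨q, hq⟩ : ∃ q : V, -3 * (c * η ^ 2 + 1) * m + τ * q = 0 := by
      refine ⟨6 * C * η ^ 3 - 27 * c * η ^ 3 - 9 * c * η ^ 3 * m + 6 * c * η ^ 3 * nu
        - 3 * η * m + 27 * η ^ 3 + (C * c * η ^ 4 * nu + C * η ^ 2 * m + 3 * c * η ^ 2 * m
        - c * η ^ 2 * m * nu - c * η ^ 2 * m ^ 2 + 6 * c * η ^ 4 * nu - c ^ 2 * η ^ 4 * m * nu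
        + 6 * η ^ 2 * m + 3 * m - m ^ 2) * τ + (-6 * C * η ^ 3 + 27 * c * η ^ 3
        + 15 * c * η ^ 3 * m - 2 * c * η ^ 3 * m * nu - 6 * c * η ^ 3 * nu
        + 6 * c ^ 2 * η ^ 5 * nu - c ^ 2 * η ^ 5 * nu ^ 2 + 3 * η * m - η * m ^ 2
        - 27 * η ^ 3) * τ ^ 2, ?_⟩
      apply V.subtype_injective
      simp only [map_add, map_sub, map_mul, map_pow, map_ofNat, map_natCast, map_neg, map_one,
        map_zero, ValuationSubring.subtype_apply]
      simp only [reducedRel] at hF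
      field_simp at hF
      linear_combination hF
    have h1 := congrArg (residue V) hq
    simp only [map_add, map_mul, map_neg, map_pow, map_ofNat, map_natCast, map_one, map_zero, hη,
      hτ, hc] at h1
    have h2 : ((3 * m : ℕ) : ResidueField V) = 0 := by
      push_cast
      linear_combination -h1
    have h3 : 3 * m = 0 := by exact_mod_cast h2
    omega

/-- On a place of a field where the constants are finite, the reduced curvature is finite. -/
theorem mem_of_reducedRel (i : ℝ →+* V) {nu c C : ℝ} {m : ℕ} {L s B W : K}
    (hm0 : m = 0 → W = 0) (hm : m ≠ 0 → B * W = -(i c : K))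
    (hF : reducedRel (i nu : K) m (i c) (i C) L s B W = 0)
    (hG : reducedRelDeriv (i nu : K) m (i c) (i C) L s B W = 0)
    (hE : reducedRelDerivTwo (i nu : K) m (i c) (i C) L s B W = 0) : L ∈ V := by
  have : CharZero (ResidueField V) :=
    charZero_of_injective_ringHom ((residue V).comp i).injective
  by_contra hL
  -- Suppose `L` is infinite and rescale by `t = 1 / L`, so that `L` becomes one while `c` and `C`
  -- pick up the infinitesimal factor `t ^ 2`. The cases below are distinguished by which of `t B`,
  -- `t W` and `s` is infinite.
  obtain ⟨t, htL, ht, ht0⟩ := exists_coe_eq_inv hL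
  have hL0 : L ≠ 0 := fun h => hL (h ▸ V.zero_mem)
  have hsc : ∀ x : V, residue V (x * t ^ 2) = 0 := fun x => by simp [ht]
  have hF1 := reducedRel_smul (t : K) (i nu : K) m (i c) (i C) L s B W
  have hG1 := reducedRelDeriv_smul (t : K) (i nu : K) m (i c) (i C) L s B W
  have hE1 := reducedRelDerivTwo_smul (t : K) (i nu : K) m (i c) (i C) L s B W
  have htL1 : (t : K) * L = 1 := by rw [htL]; field_simp
  rw [hF, mul_zero, htL1] at hF1
  rw [hG, mul_zero, htL1] at hG1
  rw [hE, mul_zero, htL1] at hE1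
  have hcoe : ∀ x : V, (t : K) ^ 2 * x = ((x * t ^ 2 : V) : K) := fun x => by
    push_cast; ring
  rw [hcoe, hcoe] at hF1 hG1 hE1
  by_cases hb : (t : K) * B ∈ V
  · by_cases hw : (t : K) * W ∈ V
    · obtain ⟨b, hb⟩ : ∃ b : V, (b : K) = t * B := ⟨⟨_, hb⟩, rfl⟩
      obtain ⟨w, hw⟩ : ∃ w : V, (w : K) = t * W := ⟨⟨_, hw⟩, rfl⟩
      rw [← hb, ← hw] at hF1 hG1 hE1
      by_cases hs : s ∈ V
      · lift s to V using hs
        refine place_contradiction_of_bounded (hsc (i c)) (hsc (i C)) (b := b) (w := w)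
          (m := m) (nu := i nu) (s := s) ?_ ?_ ?_ ?_ ?_
        · by_cases hm' : m = 0
          · have : w = 0 := by
              apply Subtype.val_injective
              rw [hw, hm0 hm', mul_zero]
              rfl
            simp [this]
          · have : b * w = -(i c * t ^ 2) := by
              apply Subtype.val_injective
              simp only [MulMemClass.coe_mul, hb, hw, NegMemClass.coe_neg, SubmonoidClass.coe_pow]
              linear_combination (t : K) ^ 2 * hm hm'
            rw [this, map_neg, hsc, neg_zero]
        · intro hm'
          apply Subtype.val_injective
          rw [hw, hm0 hm', mul_zero]
          rfl
        · apply V.subtype_injective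
          rw [map_reducedRel]
          simpa using hF1
        · apply V.subtype_injective
          rw [map_reducedRelDeriv]
          simpa using hG1
        · apply V.subtype_injective
          rw [map_reducedRelDerivTwo]
          simpa using hE1
      · obtain ⟨τ, hτs, hτ, hτ0⟩ := exists_coe_eq_inv hs
        have hsτ : s = (τ : K)⁻¹ := by rw [hτs, inv_inv]
        rw [hsτ] at hF1 hG1
        exact place_contradiction_of_infinite_slope hτ0 hτ (hsc (i c)) (hsc (i C)) hF1 hG1
    · obtain ⟨η, hηw, hη, hη0⟩ := exists_coe_eq_inv hw
      have hW0 : W ≠ 0 := by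
        rintro rfl
        exact hw (by simp)
      have hm' : m ≠ 0 := fun h => hW0 (hm0 h)
      have hF2 := reducedRel_smul (η : K) (i nu : K) m ((i c * t ^ 2 : V) : K)
        ((i C * t ^ 2 : V) : K) 1 s (t * B) (t * W)
      have hG2 := reducedRelDeriv_smul (η : K) (i nu : K) m ((i c * t ^ 2 : V) : K)
        ((i C * t ^ 2 : V) : K) 1 s (t * B) (t * W)
      have htK : (t : K) ≠ 0 := fun h => ht0 (Subtype.ext h)
      have e1 : (η : K) * (t * W) = 1 := by rw [hηw]; field_simp
      have e2 : (η : K) * (t * B) = -(((i c * t ^ 2 : V) : K) * (η : K) ^ 2) := by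
        have : (i c : K) = -(B * W) := by rw [hm hm', neg_neg]
        push_cast
        rw [this]
        linear_combination (-(η : K) * t * B) * e1
      rw [hF1, mul_zero, e1, e2, mul_one, mul_comm ((η : K) ^ 2), mul_comm ((η : K) ^ 2)] at hF2
      rw [hG1, mul_zero, e1, e2, mul_one, mul_comm ((η : K) ^ 2), mul_comm ((η : K) ^ 2)] at hG2
      exact place_contradiction_of_large_W hm' hη0 hη (hsc (i c)) (hsc (i C)) hF2 hG2
  · obtain ⟨η, hηb, hη, hη0⟩ := exists_coe_eq_inv hb
    have hB0 : B ≠ 0 := by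
      rintro rfl
      exact hb (by simp)
    have hF2 := reducedRel_smul (η : K) (i nu : K) m ((i c * t ^ 2 : V) : K)
      ((i C * t ^ 2 : V) : K) 1 s (t * B) (t * W)
    have hG2 := reducedRelDeriv_smul (η : K) (i nu : K) m ((i c * t ^ 2 : V) : K)
      ((i C * t ^ 2 : V) : K) 1 s (t * B) (t * W)
    have htK : (t : K) ≠ 0 := fun h => ht0 (Subtype.ext h)
    have e1 : (η : K) * (t * B) = 1 := by rw [hηb]; field_simp
    rw [hF1, mul_zero, e1, mul_one, mul_comm ((η : K) ^ 2), mul_comm ((η : K) ^ 2)] at hF2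
    rw [hG1, mul_zero, e1, mul_one, mul_comm ((η : K) ^ 2), mul_comm ((η : K) ^ 2)] at hG2
    refine place_contradiction_of_large_B (m := m) hη0 hη (hsc (i c)) (hsc (i C)) (nu := i nu)
      (s := s) ?_ ?_
    -- For `m = 0` no relation `B W = -c` is available, but `W` enters the relation only with a
    -- factor `m`, so its value may be changed freely.
    · by_cases hm' : m = 0
      · subst hm'
        rw [← hF2]
        simp only [reducedRel]
        push_cast
        ring
      · have : (i c : K) = -(B * W) := by rw [hm hm', neg_neg]
        rw [← hF2]
        congr 1
        push_cast
        rw [this]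
        linear_combination ((η : K) * t * W) * e1
    · by_cases hm' : m = 0
      · subst hm'
        rw [← hG2]
        simp only [reducedRelDeriv]
        push_cast
        ring
      · have : (i c : K) = -(B * W) := by rw [hm hm', neg_neg]
        rw [← hG2]
        congr 1
        push_cast
        rw [this]
        linear_combination ((η : K) * t * W) * e1

end Place


/-! ### Finiteness of the values of `L` by passing to an ultrapower. -/

/-- A sequence of reals along an ultrafilter in which no value is repeated is transcendental. -/
theorem germ_eval_ne_zero {L : ℕ → ℝ} (hL : Function.Injective L) {p : Polynomial ℝ}
    (hp : p ≠ 0) :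
    ((fun n => p.eval (L n) : ℕ → ℝ) : Filter.Germ (Filter.hyperfilter ℕ : Filter ℕ) ℝ) ≠ 0 := by
  intro h
  have h1 : ∀ᶠ n in (Filter.hyperfilter ℕ : Filter ℕ), p.eval (L n) = 0 :=
    Filter.Germ.coe_eq.mp h
  have h2 : (L ⁻¹' {x | p.IsRoot x}).Finite :=
    (Polynomial.finite_setOfPred_isRoot hp).preimage hL.injOn
  exact Filter.notMem_hyperfilter_of_finite h2 h1

/-- The intersection of all valuation rings of `K` containing a subring is the integral closure of
that subring. Applied to the image of the reals this gives a monic equation, whose coefficients are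
lifted back along `κ`. -/
theorem exists_polynomial_of_mem_valuationSubring {K : Type*} [Field K] (κ : ℝ →+* K) (x : K)
    (hx : ∀ V : ValuationSubring K, (∀ r, κ r ∈ V) → x ∈ V) :
    ∃ q : Polynomial ℝ, q ≠ 0 ∧ Polynomial.eval₂ κ x q = 0 := by
  have hmem : x ∈ ⨅ V : {V : ValuationSubring K // (κ.range : Set K) ⊆ V.toSubring},
      V.1.toSubring := by
    rw [Subring.mem_iInf]
    rintro ⟨V, hV⟩
    exact hx V fun r => hV ⟨r, rfl⟩
  rw [iInf_valuationSubring_superset] at hmem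
  obtain ⟨p, hp, hpL⟩ : IsIntegral (Subring.closure (κ.range : Set K)) x := hmem
  let κ' : ℝ →+* Subring.closure (κ.range : Set K) :=
    κ.codRestrict _ (fun x => Subring.subset_closure ⟨x, rfl⟩)
  have hκ' : Function.Surjective κ' := fun x => by
    obtain ⟨r, hr⟩ := (Subring.closure_eq κ.range).le x.2
    exact ⟨r, Subtype.ext hr⟩
  obtain ⟨q, rfl⟩ := Polynomial.map_surjective κ' hκ' p
  refine ⟨q, ?_, ?_⟩
  · rintro rfl
    rw [Polynomial.map_zero] at hp
    exact Polynomial.Monic.ne_zero hp rfl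
  · rw [Polynomial.eval₂_map] at hpL
    exact hpL

theorem mem_valuationSubring_of_reducedRel_seq {K : Type*} [Field K] (ρ : (ℕ → ℝ) →+* K)
    {nu c C : ℝ} {m : ℕ} {L s B W : ℕ → ℝ}
    (hm0 : ∀ n, m = 0 → W n = 0) (hm : ∀ n, m ≠ 0 → B n * W n = -c)
    (hF : ∀ n, reducedRel nu m c C (L n) (s n) (B n) (W n) = 0)
    (hG : ∀ n, reducedRelDeriv nu m c C (L n) (s n) (B n) (W n) = 0)
    (hE : ∀ n, reducedRelDerivTwo nu m c C (L n) (s n) (B n) (W n) = 0)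
    (V : ValuationSubring K) (hV : ∀ r, (ρ.comp (Pi.constRingHom ℕ ℝ)) r ∈ V) : ρ L ∈ V := by
  have hm0' : m = 0 → ρ W = 0 := fun h => by
    rw [show W = 0 from funext fun n => hm0 n h, map_zero]
  have hm' : m ≠ 0 → ρ B * ρ W = -(ρ (Pi.constRingHom ℕ ℝ c)) := fun h => by
    rw [← map_mul, ← map_neg]
    exact congrArg ρ (funext fun n => hm n h)
  have hF' : reducedRel (Pi.constRingHom ℕ ℝ nu) m (Pi.constRingHom ℕ ℝ c)
      (Pi.constRingHom ℕ ℝ C) L s B W = 0 := by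
    funext n
    have := map_reducedRel (Pi.evalRingHom (fun _ => ℝ) n) (Pi.constRingHom ℕ ℝ nu) m
      (Pi.constRingHom ℕ ℝ c) (Pi.constRingHom ℕ ℝ C) L s B W
    rw [map_natCast] at this
    exact this.trans (hF n)
  have hG' : reducedRelDeriv (Pi.constRingHom ℕ ℝ nu) m (Pi.constRingHom ℕ ℝ c)
      (Pi.constRingHom ℕ ℝ C) L s B W = 0 := by
    funext n
    have := map_reducedRelDeriv (Pi.evalRingHom (fun _ => ℝ) n) (Pi.constRingHom ℕ ℝ nu) m
      (Pi.constRingHom ℕ ℝ c) (Pi.constRingHom ℕ ℝ C) L s B W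
    rw [map_natCast] at this
    exact this.trans (hG n)
  have hE' : reducedRelDerivTwo (Pi.constRingHom ℕ ℝ nu) m (Pi.constRingHom ℕ ℝ c)
      (Pi.constRingHom ℕ ℝ C) L s B W = 0 := by
    funext n
    have := map_reducedRelDerivTwo (Pi.evalRingHom (fun _ => ℝ) n) (Pi.constRingHom ℕ ℝ nu) m
      (Pi.constRingHom ℕ ℝ c) (Pi.constRingHom ℕ ℝ C) L s B W
    rw [map_natCast] at this
    exact this.trans (hE n)
  replace hF' := congrArg ρ hF'
  replace hG' := congrArg ρ hG'
  replace hE' := congrArg ρ hE'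
  rw [map_reducedRel, map_zero, map_natCast] at hF'
  rw [map_reducedRelDeriv, map_zero, map_natCast] at hG'
  rw [map_reducedRelDerivTwo, map_zero, map_natCast] at hE'
  exact mem_of_reducedRel ((ρ.comp (Pi.constRingHom ℕ ℝ)).codRestrict V.toSubring hV) hm0' hm'
    hF' hG' hE'

/-- An infinite set would contain an injective sequence. Its class in the ultrapower solves the
relations, hence lies in every valuation ring containing the reals and is algebraic over them; but
an injective sequence takes the finitely many roots of a polynomial only finitely often. -/
theorem finite_setOf_reducedRel (nu c C : ℝ) (m : ℕ) :
    {L : ℝ | ∃ s B W : ℝ, (m = 0 → W = 0) ∧ (m ≠ 0 → B * W = -c) ∧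
      reducedRel nu m c C L s B W = 0 ∧ reducedRelDeriv nu m c C L s B W = 0 ∧
      reducedRelDerivTwo nu m c C L s B W = 0}.Finite := by
  by_contra hinf
  let e := Set.Infinite.natEmbedding _ hinf
  have hL : Function.Injective fun n => (e n : ℝ) := Subtype.val_injective.comp e.injective
  choose s B W hm0 hm hF hG hE using fun n => (e n).2
  obtain ⟨q, hq, hqL⟩ := exists_polynomial_of_mem_valuationSubring _ _
    (mem_valuationSubring_of_reducedRel_seq
      (Filter.Germ.coeRingHom (Filter.hyperfilter ℕ : Filter ℕ)) hm0 hm hF hG hE)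
  refine germ_eval_ne_zero hL hq ?_
  rw [← Polynomial.hom_eval₂] at hqL
  have h2 : Polynomial.eval₂ (Pi.constRingHom ℕ ℝ) (fun n => (e n : ℝ)) q =
      fun n => q.eval (e n : ℝ) := by
    funext n
    exact Polynomial.hom_eval₂ q (Pi.constRingHom ℕ ℝ) (Pi.evalRingHom (fun _ => ℝ) n) _
  rw [h2] at hqL
  exact hqL


/-! ### Derivation of the reduced relations along the flow. -/

theorem eq_zero_of_hasDerivAt_of_forall_eq_zero {I : Set ℝ} (hI : IsOpen I) {f : ℝ → ℝ} {t d : ℝ}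
    (ht : t ∈ I) (hf : ∀ u ∈ I, f u = 0) (hd : HasDerivAt f d t) : d = 0 := by
  have : f =ᶠ[nhds t] fun _ => (0 : ℝ) := by
    filter_upwards [hI.mem_nhds ht] with u hu using hf u hu
  exact hd.unique ((hasDerivAt_const t (0 : ℝ)).congr_of_eventuallyEq this)

/-- At a point of nonzero derivative nearby values differ from the value at the point, whereas by
continuity they avoid the finitely many other values. -/
theorem not_finite_image_of_hasDerivAt_ne_zero {I : Set ℝ} (hI : IsOpen I) {f f' : ℝ → ℝ}
    (hne : I.Nonempty) (hf : ∀ t ∈ I, HasDerivAt f (f' t) t) (hf' : ∀ t ∈ I, f' t ≠ 0) :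
    ¬ (f '' I).Finite := by
  intro hfin
  obtain ⟨t, ht⟩ := hne
  have h1 : ∀ᶠ u in nhdsWithin t {t}ᶜ, f u ≠ f t := (hf t ht).eventually_ne (hf' t ht)
  have h2 : ∀ᶠ u in nhdsWithin t {t}ᶜ, f u ∈ f '' I :=
    nhdsWithin_le_nhds (Filter.mem_of_superset (hI.mem_nhds ht) fun u hu => ⟨u, hu, rfl⟩)
  have h3 : ((f '' I) \ {f t}).Finite := hfin.subset Set.sdiff_subset
  have h4 : ∀ᶠ u in nhdsWithin t {t}ᶜ, f u ∈ ((f '' I) \ {f t})ᶜ :=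
    nhdsWithin_le_nhds ((hf t ht).continuousAt (h3.isClosed.isOpen_compl.mem_nhds (by simp)))
  obtain ⟨u, hu1, hu2, hu3⟩ := (h1.and (h2.and h4)).exists
  exact hu3 ⟨hu2, hu1⟩

section Flow

theorem hasDerivAt_reducedRel (nu m c C : ℝ) {L s B W : ℝ → ℝ} {L' s' B' W' t : ℝ}
    (hL : HasDerivAt L L' t) (hs : HasDerivAt s s' t) (hB : HasDerivAt B B' t)
    (hW : HasDerivAt W W' t) :
    HasDerivAt (fun t => reducedRel nu m c C (L t) (s t) (B t) (W t))
      ((-12 * B t * L t * nu * s t + 6 * B t ^ 2 * nu - 1 * B t ^ 2 * nu ^ 2 - 6 * C + 6 * C * s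
      t ^ 2 + 12 * L t * W t * m * s t - 81 * L t ^ 2 + 81 * L t ^ 2 * s t ^ 2 + 3 * W t ^ 2 * m
      - 3 * W t ^ 2 * m * s t ^ 2 - 1 * W t ^ 2 * m ^ 2 + 27 * c + 15 * c * m - 2 * c * m * nu -
      9 * c * m * s t ^ 2 - 6 * c * nu + 6 * c * nu * s t ^ 2 - 27 * c * s t ^ 2) * L' + (-1 * B
      t * C * nu - 6 * B t * L t ^ 2 * nu + 1 * B t * c * m * nu + 12 * C * L t * s t + 1 * C *
      W t * m - 6 * L t * W t ^ 2 * m * s t - 18 * L t * c * m * s t + 12 * L t * c * nu * s t -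
      54 * L t * c * s t + 6 * L t ^ 2 * W t * m + 54 * L t ^ 3 * s t + 3 * W t * c * m - 1 * W
      t * c * m * nu - 9 * W t * c * m * s t ^ 2 - 1 * W t * c * m ^ 2 + 3 * W t ^ 3 * m - 9 * W
      t ^ 3 * m * s t ^ 2 - 1 * W t ^ 3 * m ^ 2) * s' + (12 * B t * L t * nu - 2 * B t * L t *
      nu ^ 2 - 1 * C * nu * s t - 6 * L t ^ 2 * nu * s t + 1 * c * m * nu * s t) * B' + (1 * C *
      m * s t + 6 * L t * W t * m - 6 * L t * W t * m * s t ^ 2 - 2 * L t * W t * m ^ 2 + 6 * L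
      t ^ 2 * m * s t + 9 * W t ^ 2 * m * s t - 9 * W t ^ 2 * m * s t ^ 3 - 3 * W t ^ 2 * m ^ 2
      * s t - 1 * c * m * nu * s t + 3 * c * m * s t - 3 * c * m * s t ^ 3 - 1 * c * m ^ 2 * s
      t) * W') t := by
  unfold reducedRel
  apply HasDerivAt.congr_deriv
  · repeat' first
      | exact hL | exact hs | exact hB | exact hW
      | exact hasDerivAt_const _ _
      | with_reducible apply HasDerivAt.fun_add
      | with_reducible apply HasDerivAt.fun_sub
      | with_reducible apply HasDerivAt.fun_mul
      | with_reducible apply HasDerivAt.fun_pow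
  · push_cast
    ring

theorem hasDerivAt_reducedRelDeriv (nu m c C : ℝ) {L s B W : ℝ → ℝ} {L' s' B' W' t : ℝ}
    (hL : HasDerivAt L L' t) (hs : HasDerivAt s s' t) (hB : HasDerivAt B B' t)
    (hW : HasDerivAt W W' t) :
    HasDerivAt (fun t => reducedRelDeriv nu m c C (L t) (s t) (B t) (W t))
      ((12 * B t * C - 1 * B t * C * nu - 162 * B t * L t ^ 2 + 36 * B t * L t ^ 2 * nu - 54 * B
      t * c - 30 * B t * c * m + 5 * B t * c * m * nu + 24 * B t * c * nu - 2 * B t * c * nu ^ 2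
      + 54 * C * L t * s t + 1 * C * W t * m - 42 * L t * W t ^ 2 * m * s t - 30 * L t * c * m *
      s t - 12 * L t * c * nu * s t - 36 * L t ^ 2 * W t * m + 432 * L t ^ 3 * s t + 15 * W t *
      c * m - 1 * W t * c * m * nu - 3 * W t * c * m * s t ^ 2 - 5 * W t * c * m ^ 2 + 9 * W t ^
      3 * m - 3 * W t ^ 3 * m * s t ^ 2 - 3 * W t ^ 3 * m ^ 2) * L' + (27 * C * L t ^ 2 - 2 * C
      * W t ^ 2 * m - 9 * C * c - 3 * C * c * m + 1 * C * c * nu + 2 * C ^ 2 - 6 * L t * W t * c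
      * m * s t - 6 * L t * W t ^ 3 * m * s t - 21 * L t ^ 2 * W t ^ 2 * m - 15 * L t ^ 2 * c *
      m - 6 * L t ^ 2 * c * nu + 108 * L t ^ 4 + 30 * W t ^ 2 * c * m - 4 * W t ^ 2 * c * m * nu
      - 27 * W t ^ 2 * c * m * s t ^ 2 - 2 * W t ^ 2 * c * m ^ 2 + 9 * W t ^ 4 * m - 27 * W t ^
      4 * m * s t ^ 2 - 3 * W t ^ 4 * m ^ 2 + 21 * c ^ 2 * m - 4 * c ^ 2 * m * nu + 1 * c ^ 2 *
      m ^ 2) * s' + (12 * C * L t - 1 * C * L t * nu - 54 * L t * c - 30 * L t * c * m + 5 * L t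
      * c * m * nu + 24 * L t * c * nu - 2 * L t * c * nu ^ 2 - 54 * L t ^ 3 + 12 * L t ^ 3 *
      nu) * B' + (1 * C * L t * m - 4 * C * W t * m * s t + 27 * L t * W t ^ 2 * m - 9 * L t * W
      t ^ 2 * m * s t ^ 2 - 9 * L t * W t ^ 2 * m ^ 2 + 15 * L t * c * m - 1 * L t * c * m * nu
      - 3 * L t * c * m * s t ^ 2 - 5 * L t * c * m ^ 2 - 42 * L t ^ 2 * W t * m * s t - 12 * L
      t ^ 3 * m - 8 * W t * c * m * nu * s t + 60 * W t * c * m * s t - 18 * W t * c * m * s t ^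
      3 - 4 * W t * c * m ^ 2 * s t + 36 * W t ^ 3 * m * s t - 36 * W t ^ 3 * m * s t ^ 3 - 12 *
      W t ^ 3 * m ^ 2 * s t) * W') t := by
  unfold reducedRelDeriv
  apply HasDerivAt.congr_deriv
  · repeat' first
      | exact hL | exact hs | exact hB | exact hW
      | exact hasDerivAt_const _ _
      | with_reducible apply HasDerivAt.fun_add
      | with_reducible apply HasDerivAt.fun_sub
      | with_reducible apply HasDerivAt.fun_mul
      | with_reducible apply HasDerivAt.fun_pow
  · push_cast
    ring


variable {I : Set ℝ} {nu c C : ℝ} {m : ℕ} {x DL L s B W : ℝ → ℝ}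

/-- The reduced relation together with its first two derivatives. -/
theorem reducedRel_derivatives (hI : IsOpen I)
    (hx : ∀ t ∈ I, x t ≠ 0)
    (hm0 : m = 0 → ∀ t ∈ I, W t = 0) (hm : m ≠ 0 → ∀ t ∈ I, B t * W t = -c)
    (hL : ∀ t ∈ I, HasDerivAt L (x t * DL t) t)
    (hs : ∀ t ∈ I, HasDerivAt s (x t * (L t + B t * s t)) t)
    (hB : ∀ t ∈ I, HasDerivAt B (x t * (B t ^ 2 + c)) t)
    (hW : m ≠ 0 → ∀ t ∈ I, HasDerivAt W (x t * (W t ^ 2 + c)) t)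
    (h1 : ∀ t ∈ I, 3 * (1 - s t ^ 2) * DL t = L t * ((6 - nu) * B t + m * W t) -
      s t * (6 * L t ^ 2 + C - m * (c + W t ^ 2)))
    (h2 : ∀ t ∈ I, (nu * B t - m * W t) * DL t = 9 * L t ^ 3 +
      (2 * C - (9 - 2 * nu + 2 * m) * c - m * (c + W t ^ 2)) * L t -
      m * (c + W t ^ 2) * W t * s t) :
    (∀ t ∈ I, reducedRel nu m c C (L t) (s t) (B t) (W t) = 0) ∧
    (∀ t ∈ I, reducedRelDeriv nu m c C (L t) (s t) (B t) (W t) = 0) ∧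
    (∀ t ∈ I, reducedRelDerivTwo nu m c C (L t) (s t) (B t) (W t) = 0) := by
  have hW' : ∀ t ∈ I, ∃ W' : ℝ, HasDerivAt W (x t * W') t ∧ (m ≠ 0 → W' = W t ^ 2 + c)
      ∧ (m = 0 → W' = 0) := by
    intro t ht
    by_cases h : m = 0
    · refine ⟨0, ?_, fun h' => absurd h h', fun _ => rfl⟩
      rw [mul_zero]
      refine (hasDerivAt_const t (0 : ℝ)).congr_of_eventuallyEq ?_
      filter_upwards [hI.mem_nhds ht] with u hu using hm0 h u hu
    · exact ⟨_, hW h t ht, fun _ => rfl, fun h' => absurd h' h⟩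
  -- Both `h1` and `h2` are linear in `DL`; cross-multiplying eliminates it. The relation `B W = -c`
  -- is used to bring the result into its normal form.
  have hF : ∀ t ∈ I, reducedRel nu m c C (L t) (s t) (B t) (W t) = 0 := by
    intro t ht
    have e1 := h1 t ht
    have e2 := h2 t ht
    by_cases h : m = 0
    · have e3 := hm0 h t ht
      subst h
      rw [e3] at e1 e2 ⊢
      simp only [reducedRel]
      push_cast at e1 e2 ⊢
      linear_combination -(nu * B t) * e1 + 3 * (1 - s t ^ 2) * e2
    · have e3 : c = -(B t * W t) := by linear_combination hm h t ht
      simp only [reducedRel]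
      rw [e3] at e1 e2 ⊢
      linear_combination -(nu * B t - m * W t) * e1 + 3 * (1 - s t ^ 2) * e2
  -- Modulo `B W = -c`, the coefficient of `DL` in the derivative of the first relation is a
  -- combination of the coefficients in `h1` and `h2`, so `DL` can be removed without multiplying by
  -- anything but the factor `x`.
  have hG : ∀ t ∈ I, reducedRelDeriv nu m c C (L t) (s t) (B t) (W t) = 0 := by
    intro t ht
    have e1 := h1 t ht
    have e2 := h2 t ht
    obtain ⟨W', hWt, hW1, hW0⟩ := hW' t ht
    have hd := hasDerivAt_reducedRel nu m c C (hL t ht) (hs t ht) (hB t ht) hWt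
    have hd0 := eq_zero_of_hasDerivAt_of_forall_eq_zero hI ht hF hd
    have hFt := hF t ht
    apply mul_left_cancel₀ (hx t ht)
    by_cases h : m = 0
    · have e3 := hm0 h t ht
      have e4 := hW0 h
      subst h
      rw [e4] at hd0
      rw [e3] at e1 e2 hFt hd0 ⊢
      simp only [reducedRel] at hFt
      simp only [reducedRelDeriv]
      push_cast at e1 e2 hd0 hFt ⊢
      linear_combination hd0 - 2 * B t * x t * hFt
        - x t * ((6 - nu) * B t - 12 * s t * L t) * e2
        + x t * (27 * L t ^ 2 + (2 * C - (9 - 2 * nu) * c)) * e1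
    · have e3 : c = -(B t * W t) := by linear_combination hm h t ht
      rw [hW1 h] at hd0
      simp only [reducedRel] at hFt
      simp only [reducedRelDeriv]
      clear hm0 hm hL hs hB hW h1 h2 hW' hF hd hWt hW1 hW0
      subst e3
      linear_combination hd0 - 2 * B t * x t * hFt
        - x t * ((6 - nu) * B t + m * W t - 12 * s t * L t) * e2
        + x t * (27 * L t ^ 2 + (2 * C - (9 - 2 * nu + 2 * m) * (-(B t * W t))
          - m * (-(B t * W t) + W t ^ 2))) * e1
  refine ⟨hF, hG, ?_⟩
  intro t ht
  have e2 := h2 t ht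
  obtain ⟨W', hWt, hW1, hW0⟩ := hW' t ht
  have hd := hasDerivAt_reducedRelDeriv nu m c C (hL t ht) (hs t ht) (hB t ht) hWt
  have hd0 := eq_zero_of_hasDerivAt_of_forall_eq_zero hI ht hG hd
  have hGt := hG t ht
  apply mul_left_cancel₀ (hx t ht)
  obtain ⟨gL, hgL⟩ : ∃ gL, gL = 12 * B t * C - 1 * B t * C * nu - 162 * B t * L t ^ 2 + 36 * B t * L t ^ 2 * nu - 54 * B
          t * c - 30 * B t * c * m + 5 * B t * c * m * nu + 24 * B t * c * nu - 2 * B t * c * nu ^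
          2 + 54 * C * L t * s t + 1 * C * W t * m - 42 * L t * W t ^ 2 * m * s t - 30 * L t * c *
          m * s t - 12 * L t * c * nu * s t - 36 * L t ^ 2 * W t * m + 432 * L t ^ 3 * s t + 15 *
          W t * c * m - 1 * W t * c * m * nu - 3 * W t * c * m * s t ^ 2 - 5 * W t * c * m ^ 2 + 9
          * W t ^ 3 * m - 3 * W t ^ 3 * m * s t ^ 2 - 3 * W t ^ 3 * m ^ 2 := ⟨_, rfl⟩
  -- This time the derivative is first multiplied by `nu B - m W`, the coefficient of `DL` in `h2`,
  -- after which `h2` removes `DL`.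
  have key : x t * reducedRelDerivTwo nu m c C (L t) (s t) (B t) (W t) = x t * 0 +
      (nu * B t - m * W t) * 0 := by
    by_cases h : m = 0
    · have e3 := hm0 h t ht
      have e4 := hW0 h
      subst h
      rw [e4] at hd0
      rw [e3] at e2 hGt hd0 hgL ⊢
      simp only [reducedRelDeriv] at hGt
      simp only [reducedRelDerivTwo]
      push_cast at e2 hd0 hGt hgL ⊢
      have e5 := congrArg (gL * ·) e2
      rw [hgL] at e5
      linear_combination nu * B t * hd0 - (36 * L t ^ 2 + B t * (nu * B t)) * x t * hGt
        - x t * e5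
    · have e3 : c = -(B t * W t) := by linear_combination hm h t ht
      rw [hW1 h] at hd0
      simp only [reducedRelDeriv] at hGt
      simp only [reducedRelDerivTwo]
      clear hm0 hm hL hs hB hW h1 h2 hW' hF hd hWt hW1 hW0 hG
      subst e3
      have e5 := congrArg (gL * ·) e2
      rw [hgL] at e5
      linear_combination (nu * B t - m * W t) * hd0
        - (36 * L t ^ 2 + B t * (nu * B t - m * W t)) * x t * hGt - x t * e5
  linear_combination key

end Flow

/-! ### The flow on a line with at most one exceptional point. -/

/-- The biharmonic equations along an integral curve of the gradient of the mean curvature are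
incompatible when the points `(λ_a, ω_a)` lie on a line `ω = α λ + β`, except for one point
`w (-α, 1)` of multiplicity `m`. Here `M` is the number of points on the line, and `S₁`, `S₂`,
`S₃` are the power sums of their first coordinates. -/
theorem line_flow_contradiction {I : Set ℝ} (hI : IsOpen I) (hne : I.Nonempty)
    {M c C : ℝ} {m : ℕ} {l y α β w S₁ S₂ S₃ : ℝ → ℝ}
    (hy0 : ∀ t ∈ I, y t ≠ 0)
    (hl : ∀ t ∈ I, HasDerivAt l (y t) t)
    (hα : ∀ t ∈ I, HasDerivAt α (α t * β t + l t * (1 + α t ^ 2)) t)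
    (hβ : ∀ t ∈ I, HasDerivAt β (β t ^ 2 + c + α t * β t * l t) t)
    (hw : ∀ t ∈ I, m ≠ 0 → HasDerivAt w (w t ^ 2 + c - α t * w t * l t) t)
    (hm0 : m = 0 → ∀ t ∈ I, w t = 0) (hm : m ≠ 0 → ∀ t ∈ I, β t * w t = -c)
    (hS₁ : ∀ t ∈ I, HasDerivAt S₁ (α t * S₂ t + β t * S₁ t - l t * (α t * S₁ t + β t * M)) t)
    (hS₂ : ∀ t ∈ I, HasDerivAt S₂
      (2 * (α t * S₃ t + β t * S₂ t - l t * (α t * S₂ t + β t * S₁ t))) t)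
    (hE₁ : ∀ t ∈ I, S₁ t + m * (-(α t * w t)) = -3 * l t)
    (hE₂ : ∀ t ∈ I, S₂ t + m * (α t * w t) ^ 2 = 3 * l t ^ 2 + C)
    (hy : ∀ t ∈ I, HasDerivAt y ((α t * S₁ t + β t * M + m * w t) * y t +
      l t * (4 * l t ^ 2 + C - (M + m + 1) * c)) t) : False := by
  have hw' : ∀ t ∈ I, ∃ w', HasDerivAt w w' t ∧ (m ≠ 0 → w' = w t ^ 2 + c - α t * w t * l t) ∧
      (m = 0 → w' = 0) := by
    intro t ht
    by_cases h : m = 0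
    · refine ⟨0, ?_, fun h' => absurd h h', fun _ => rfl⟩
      refine (hasDerivAt_const t (0 : ℝ)).congr_of_eventuallyEq ?_
      filter_upwards [hI.mem_nhds ht] with u hu using hm0 h u hu
    · exact ⟨_, hw t ht h, fun _ => rfl, fun h' => absurd h' h⟩
  -- `e₁` and `e₂` are the derivatives of the two power sum identities `hE₁` and `hE₂`, simplified
  -- by `β w = -c`.
  have e₁ : ∀ t ∈ I, α t * S₂ t + β t * S₁ t - l t * (α t * S₁ t + β t * M)
      - m * w t * (α t * w t + l t) + 3 * y t = 0 := by
    intro t ht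
    obtain ⟨w', hwt, hw1, hw0⟩ := hw' t ht
    have := eq_zero_of_hasDerivAt_of_forall_eq_zero hI ht
      (f := fun t => S₁ t + m * (-(α t * w t)) - -3 * l t)
      (fun u hu => sub_eq_zero.mpr (hE₁ u hu))
      (((hS₁ t ht).add ((((hα t ht).mul hwt).neg).const_mul _)).sub ((hl t ht).const_mul _))
    by_cases h : m = 0
    · subst h
      push_cast at this ⊢
      linear_combination this
    · rw [hw1 h] at this
      linear_combination this + m * α t * hm h t ht
  have e₂ : ∀ t ∈ I, α t * S₃ t + β t * S₂ t - l t * (α t * S₂ t + β t * S₁ t)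
      + m * w t * (α t * w t) * (α t * w t + l t) - 3 * l t * y t = 0 := by
    intro t ht
    obtain ⟨w', hwt, hw1, hw0⟩ := hw' t ht
    have := eq_zero_of_hasDerivAt_of_forall_eq_zero hI ht
      (f := fun t => S₂ t + m * (α t * w t) ^ 2 - (3 * l t ^ 2 + C))
      (fun u hu => sub_eq_zero.mpr (hE₂ u hu))
      (((hS₂ t ht).add ((((hα t ht).mul hwt).pow 2).const_mul _)).sub
        ((((hl t ht).pow 2).const_mul _).add_const _))
    simp only [Pi.mul_apply] at this
    by_cases h : m = 0
    · subst h
      push_cast at this ⊢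
      linear_combination this / 2
    · rw [hw1 h] at this
      push_cast at this
      linear_combination this / 2 - m * α t ^ 2 * w t * hm h t ht
  -- Eliminating `S₁` and `S₂` from `e₁` expresses `y` through `l`, `α`, `β` and `w`.
  have e₃ : ∀ t ∈ I, 3 * y t = -(α t * (6 * l t ^ 2 + C - m * c) - (M + 3) * l t * β t
      - m * (α t * w t + l t) * (w t * (1 + α t ^ 2))) := by
    intro t ht
    by_cases h : m = 0
    · have h1 := e₁ t ht
      have h2 := hE₁ t ht
      have h3 := hE₂ t ht
      subst h
      push_cast at *
      linear_combination h1 + (α t * l t - β t) * h2 - α t * h3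
    · linear_combination e₁ t ht + (α t * l t - β t) * hE₁ t ht - α t * hE₂ t ht
        - m * α t * hm h t ht
  -- The derivative of `e₁` contains the third power sum through the derivative of `S₂`; `e₂`
  -- removes it. Together with `e₃` this gives two equations for `y` in the four remaining unknowns.
  have e₄ : ∀ t ∈ I, -3 * y t * ((3 - M) * β t - m * (w t * (1 + α t ^ 2)))
      + 3 * m * w t * (α t * w t + l t) * (β t - w t * (1 + α t ^ 2))
      + 3 * l t * (9 * l t ^ 2 + (2 * C - (2 * (M + m + 1) + 1) * c)) = 0 := by
    intro t ht
    obtain ⟨w', hwt, hw1, hw0⟩ := hw' t ht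
    have := eq_zero_of_hasDerivAt_of_forall_eq_zero hI ht
      (f := fun t => α t * S₂ t + β t * S₁ t - l t * (α t * S₁ t + β t * M)
        - m * w t * (α t * w t + l t) + 3 * y t) e₁
      ((((((hα t ht).mul (hS₂ t ht)).add ((hβ t ht).mul (hS₁ t ht))).sub
        ((hl t ht).mul (((hα t ht).mul (hS₁ t ht)).add ((hβ t ht).mul_const M)))).sub
        ((hwt.const_mul (m : ℝ)).mul (((hα t ht).mul hwt).add (hl t ht)))).add
        ((hy t ht).const_mul 3))
    simp only [Pi.mul_apply, Pi.add_apply] at this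
    have hs1 : S₁ t = -3 * l t + m * (α t * w t) := by linear_combination hE₁ t ht
    have hs2 : S₂ t = 3 * l t ^ 2 + C - m * (α t * w t) ^ 2 := by linear_combination hE₂ t ht
    have h2 := e₂ t ht
    have h3 := e₃ t ht
    rw [hs1, hs2] at h2 this
    by_cases h : m = 0
    · have e3 := hm0 h t ht
      have e4 := hw0 h
      subst h
      rw [e4, e3] at this
      rw [e3] at h2 h3 ⊢
      push_cast at *
      linear_combination 3 / 2 * this - 3 * α t * h2 - 3 * β t * h3
    · have e3 : c = -(β t * w t) := by linear_combination hm h t ht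
      rw [hw1 h] at this
      clear hm0 hm hα hl hw hβ hS₁ hS₂ hE₁ hE₂ hy hw' e₁ e₂ e₃ hwt hw1 hw0
      subst e3
      linear_combination 3 / 2 * this - 3 * α t * h2 - 3 * β t * h3
  have hpos : ∀ t, 0 < 1 + α t ^ 2 := fun t => by positivity
  -- `x` is the cosine of the angle of inclination of the line. Then `s = α x` is the sine, `B = β
  -- x` the signed distance of the line from the origin, and `W = w / x` the signed distance of the
  -- exceptional point, which lies on the normal to the line through the origin. In these variables
  -- the system is the one treated by `reducedRel_derivatives`, with `nu = 3 - M`.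
  obtain ⟨x, hx⟩ : ∃ x : ℝ → ℝ, x = fun t => (Real.sqrt (1 + α t ^ 2))⁻¹ := ⟨_, rfl⟩
  have hx0 : ∀ t, x t ≠ 0 := fun t => by
    rw [hx]
    exact inv_ne_zero (Real.sqrt_ne_zero'.mpr (hpos t))
  have hx2 : ∀ t, x t ^ 2 * (1 + α t ^ 2) = 1 := fun t => by
    rw [hx]
    simp only [inv_pow, Real.sq_sqrt (hpos t).le]
    exact inv_mul_cancel₀ (hpos t).ne'
  have hxd : ∀ t ∈ I, HasDerivAt x (-(x t ^ 3 * α t *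
      (α t * β t + l t * (1 + α t ^ 2)))) t := by
    intro t ht
    have h1 := ((((hα t ht).fun_pow 2).const_add 1).sqrt (hpos t).ne').fun_inv
      (Real.sqrt_ne_zero'.mpr (hpos t))
    rw [hx]
    refine h1.congr_deriv ?_
    have := Real.sqrt_ne_zero'.mpr (hpos t)
    field_simp
    push_cast
    ring
  have hW0 : m = 0 → ∀ t ∈ I, w t / x t = 0 := fun h t ht => by rw [hm0 h t ht, zero_div]
  have hBW : m ≠ 0 → ∀ t ∈ I, β t * x t * (w t / x t) = -c := fun h t ht => by
    rw [← hm h t ht]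
    field_simp [hx0 t]
  have hL' : ∀ t ∈ I, HasDerivAt l (x t * (y t / x t)) t := fun t ht => by
    refine (hl t ht).congr_deriv ?_
    field_simp [hx0 t]
  have hs' : ∀ t ∈ I, HasDerivAt (fun t => α t * x t)
      (x t * (l t + β t * x t * (α t * x t))) t := fun t ht => by
    refine ((hα t ht).mul (hxd t ht)).congr_deriv ?_
    linear_combination (-x t * α t ^ 2 * l t - x t * α t * β t) * hx2 t
  have hB' : ∀ t ∈ I, HasDerivAt (fun t => β t * x t) (x t * ((β t * x t) ^ 2 + c)) t :=
      fun t ht => by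
    refine ((hβ t ht).mul (hxd t ht)).congr_deriv ?_
    linear_combination (-x t * α t * β t * l t - x t * β t ^ 2) * hx2 t
  have hW' : m ≠ 0 → ∀ t ∈ I, HasDerivAt (fun t => w t / x t) (x t * ((w t / x t) ^ 2 + c)) t :=
      fun h t ht => by
    refine ((hw t ht h).fun_div (hxd t ht) (hx0 t)).congr_deriv ?_
    have h1 := hm h t ht
    have h2 := hx0 t
    field_simp
    linear_combination (w t * α t * l t - c) * hx2 t + α t ^ 2 * x t ^ 2 * h1
  have h₁ : ∀ t ∈ I, 3 * (1 - (α t * x t) ^ 2) * (y t / x t) =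
      l t * ((6 - (3 - M)) * (β t * x t) + m * (w t / x t)) -
      α t * x t * (6 * l t ^ 2 + C - m * (c + (w t / x t) ^ 2)) := fun t ht => by
    have h2 := hx0 t
    field_simp
    linear_combination x t ^ 2 * e₃ t ht
      - (3 * y t - l t * m * w t - α t * m * w t ^ 2) * hx2 t
  have h₂ : ∀ t ∈ I, ((3 - M) * (β t * x t) - m * (w t / x t)) * (y t / x t) = 9 * l t ^ 3 +
      (2 * C - (9 - 2 * (3 - M) + 2 * m) * c - m * (c + (w t / x t) ^ 2)) * l t -
      m * (c + (w t / x t) ^ 2) * (w t / x t) * (α t * x t) := fun t ht => by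
    have h2 := hx0 t
    have h3 : m * (β t * w t + c) = 0 := by
      by_cases h : m = 0
      · rw [h, Nat.cast_zero, zero_mul]
      · rw [hm h t ht, neg_add_cancel, mul_zero]
    field_simp
    linear_combination -x t ^ 2 / 3 * e₄ t ht + x t ^ 2 * (l t + α t * w t) * h3
      + (m * w t * y t - m * w t ^ 2 * l t - m * w t ^ 3 * α t) * hx2 t
  obtain ⟨hF, hG, hE⟩ := reducedRel_derivatives hI (fun t _ => hx0 t) hW0 hBW hL' hs' hB' hW' h₁ h₂
  refine not_finite_image_of_hasDerivAt_ne_zero hI hne hl hy0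
    ((finite_setOf_reducedRel (3 - M) c C m).subset ?_)
  rintro _ ⟨t, ht, rfl⟩
  exact ⟨_, _, _, fun h => hW0 h t ht, fun h => hBW h t ht, hF t ht, hG t ht, hE t ht⟩


/-! ### Configurations of at most five points in the plane. -/

section Configuration

variable {ι : Type*} {p w : ι → ℝ} {c : ℝ} {Z : ι → ι → ι → Prop}

theorem exists_line {i j k : ι} (hij : p i ≠ p j)
    (h : (p i - p k) * (w j - w k) = (p j - p k) * (w i - w k)) :
    ∃ α β, w i = α * p i + β ∧ w j = α * p j + β ∧ w k = α * p k + β := by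
  have : p i - p j ≠ 0 := sub_ne_zero.mpr hij
  refine ⟨(w i - w j) / (p i - p j), w i - (w i - w j) / (p i - p j) * p i, by ring, ?_, ?_⟩
  · field_simp; ring
  · field_simp; linear_combination -h

theorem mem_line {a b x : ι} {α β : ℝ} (hab : p a ≠ p b) (ha : w a = α * p a + β)
    (hb : w b = α * p b + β)
    (h : (p x - p b) * (w a - w b) = (p a - p b) * (w x - w b)) : w x = α * p x + β := by
  have : p a - p b ≠ 0 := sub_ne_zero.mpr hab
  apply mul_left_cancel₀ this
  rw [ha, hb] at h
  linear_combination -h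

/-- Five points, three of which lie on a line that contains neither of the two others, do not
occur. -/
theorem five_points_contradiction (hp : Function.Injective p)
    (hZ₁ : ∀ a b d, Z a b d → Z b a d) (hZ₂ : ∀ a b d, Z a b d → Z a d b)
    (h₁ : ∀ a b d, a ≠ b → a ≠ d → b ≠ d → ¬ Z a b d →
      (p a - p d) * (w b - w d) = (p b - p d) * (w a - w d))
    (h₂ : ∀ a b, a ≠ b → (∀ d, d ≠ a → d ≠ b → Z a b d) → c + p a * p b + w a * w b = 0)
    (h₃ : ∀ a b e, a ≠ b → a ≠ e → b ≠ e → (∀ d, d ≠ a → d ≠ b → d ≠ e → Z a b d) →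
      c + p a * p b + w a * w b = 0 → Z a b e)
    {i j k u v : ι} (hij : i ≠ j) (hik : i ≠ k) (hjk : j ≠ k) (huv : u ≠ v)
    (huniv : ∀ x, x = i ∨ x = j ∨ x = k ∨ x = u ∨ x = v) {α β : ℝ}
    (hi : w i = α * p i + β) (hj : w j = α * p j + β) (hk : w k = α * p k + β)
    (hu : w u ≠ α * p u + β) (hv : w v ≠ α * p v + β)
    (hZj : Z u v j) (hZk : Z u v k) : False := by
  have hne : ∀ {a x}, w a = α * p a + β → w x ≠ α * p x + β → x ≠ a := by
    rintro a x ha hx rfl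
    exact hx ha
  -- A point off the line cannot be collinear with two distinct points on it, so the contrapositive
  -- of `h₁` supplies `Z`.
  have hZ : ∀ {x a b}, w x ≠ α * p x + β → w a = α * p a + β → w b = α * p b + β → a ≠ b →
      Z x a b := by
    intro x a b hx ha hb hab
    by_contra hn
    exact hx (mem_line (hp.ne hab) ha hb (h₁ x a b (hne ha hx) (hne hb hx) hab hn))
  have hZvu : ∀ {x}, Z u v x → Z v u x := fun h => hZ₁ _ _ _ h
  have Kuj : c + p u * p j + w u * w j = 0 := by
    refine h₂ u j (hne hj hu) fun d hd hd' => ?_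
    obtain rfl | rfl | rfl | rfl | rfl := huniv d
    · exact hZ hu hj hi hd'.symm
    · exact absurd rfl hd'
    · exact hZ hu hj hk hd'.symm
    · exact absurd rfl hd
    · exact hZ₂ _ _ _ hZj
  have Kuk : c + p u * p k + w u * w k = 0 := by
    refine h₂ u k (hne hk hu) fun d hd hd' => ?_
    obtain rfl | rfl | rfl | rfl | rfl := huniv d
    · exact hZ hu hk hi hd'.symm
    · exact hZ hu hk hj hd'.symm
    · exact absurd rfl hd'
    · exact absurd rfl hd
    · exact hZ₂ _ _ _ hZk
  have Kvj : c + p v * p j + w v * w j = 0 := by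
    refine h₂ v j (hne hj hv) fun d hd hd' => ?_
    obtain rfl | rfl | rfl | rfl | rfl := huniv d
    · exact hZ hv hj hi hd'.symm
    · exact absurd rfl hd'
    · exact hZ hv hj hk hd'.symm
    · exact hZ₂ _ _ _ (hZvu hZj)
    · exact absurd rfl hd
  have Kvk : c + p v * p k + w v * w k = 0 := by
    refine h₂ v k (hne hk hv) fun d hd hd' => ?_
    obtain rfl | rfl | rfl | rfl | rfl := huniv d
    · exact hZ hv hk hi hd'.symm
    · exact hZ hv hk hj hd'.symm
    · exact absurd rfl hd'
    · exact hZ₂ _ _ _ (hZvu hZk)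
    · exact absurd rfl hd
  have hpjk : p j - p k ≠ 0 := sub_ne_zero.mpr (hp.ne hjk)
  -- Subtracting the relations of `u` with `j` and with `k` shows that `u` is orthogonal to the
  -- direction of the line; the same holds for `v`. Comparing `u` with `v` then gives `β = 0` and `c
  -- = 0`.
  have hwu : p u + α * w u = 0 := by
    apply mul_left_cancel₀ hpjk
    linear_combination Kuj - Kuk - w u * hj + w u * hk
  have hwv : p v + α * w v = 0 := by
    apply mul_left_cancel₀ hpjk
    linear_combination Kvj - Kvk - w v * hj + w v * hk
  have hβ : β = 0 := by
    have h0 : w u - w v ≠ 0 := by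
      intro h
      apply hp.ne huv
      linear_combination hwu - hwv - α * h
    apply mul_left_cancel₀ h0
    linear_combination Kuj - Kvj - (w u - w v) * hj - p j * (hwu - hwv)
  have hc : c = 0 := by linear_combination Kuj - w u * hj - p j * hwu - w u * hβ
  have Kui : c + p u * p i + w u * w i = 0 := by
    linear_combination hc + p i * hwu + w u * hi + w u * hβ
  -- The triple `u`, `v`, `i` is the only one not covered by the assumptions. The relation for the
  -- pair `u`, `i` already holds for reasons of orthogonality, and `h₃` recovers the missing `Z`
  -- from it.
  have hZi : Z u i v := by
    refine h₃ u i v (hne hi hu) huv (hne hi hv).symm (fun d hd hd' hd'' => ?_) Kui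
    obtain rfl | rfl | rfl | rfl | rfl := huniv d
    · exact absurd rfl hd'
    · exact hZ hu hi hj hd'.symm
    · exact hZ hu hi hk hd'.symm
    · exact absurd rfl hd
    · exact absurd rfl hd''
  have Kuv : c + p u * p v + w u * w v = 0 := by
    refine h₂ u v huv fun d hd hd' => ?_
    obtain rfl | rfl | rfl | rfl | rfl := huniv d
    · exact hZ₂ _ _ _ hZi
    · exact hZj
    · exact hZk
    · exact absurd rfl hd
    · exact absurd rfl hd'
  -- Now `u` and `v` are orthogonal to each other and both orthogonal to the line, so one of them is
  -- the origin, which lies on the line because `β = 0`.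
  have h0 : w u * w v = 0 := by
    have : 0 < 1 + α ^ 2 := by positivity
    apply mul_left_cancel₀ this.ne'
    linear_combination Kuv - hc - p v * hwu + α * w u * hwv
  rcases mul_eq_zero.mp h0 with h | h
  · apply hu
    linear_combination h - α * hwu + α ^ 2 * h - hβ
  · apply hv
    linear_combination h - α * hwv + α ^ 2 * h - hβ

/-- For at most five points in the plane, either all of them are collinear, or all but one are,
and then the exceptional one is in a special position. -/
theorem planar_configuration [Fintype ι] (hcard : Fintype.card ι ≤ 5)
    (hp : Function.Injective p)
    (hZ₁ : ∀ a b d, Z a b d → Z b a d) (hZ₂ : ∀ a b d, Z a b d → Z a d b)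
    (h₁ : ∀ a b d, a ≠ b → a ≠ d → b ≠ d → ¬ Z a b d →
      (p a - p d) * (w b - w d) = (p b - p d) * (w a - w d))
    (h₂ : ∀ a b, a ≠ b → (∀ d, d ≠ a → d ≠ b → Z a b d) → c + p a * p b + w a * w b = 0)
    (h₃ : ∀ a b e, a ≠ b → a ≠ e → b ≠ e → (∀ d, d ≠ a → d ≠ b → d ≠ e → Z a b d) →
      c + p a * p b + w a * w b = 0 → Z a b e) :
    (∀ a b d, (p a - p d) * (w b - w d) = (p b - p d) * (w a - w d)) ∨
    ∃ o, (∀ a b d, a ≠ o → b ≠ o → d ≠ o →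
      (p a - p d) * (w b - w d) = (p b - p d) * (w a - w d)) ∧
      ∀ b, b ≠ o → c + p o * p b + w o * w b = 0 := by
  classical
  rcases isEmpty_or_nonempty ι with hι | ⟨⟨e⟩⟩
  · exact Or.inl fun a => isEmptyElim a
  have hline : ∀ {s : Set ι} {α β : ℝ}, (∀ x ∈ s, w x = α * p x + β) → ∀ a ∈ s, ∀ b ∈ s, ∀ d ∈ s,
      (p a - p d) * (w b - w d) = (p b - p d) * (w a - w d) := by
    intro s α β h a ha b hb d hd
    rw [h a ha, h b hb, h d hd]
    ring
  by_cases hP : ∃ o, ∀ a b d, a ≠ o → b ≠ o → d ≠ o →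
      (p a - p d) * (w b - w d) = (p b - p d) * (w a - w d)
  · obtain ⟨o, ho⟩ := hP
    by_cases hall : ∀ a b d, (p a - p d) * (w b - w d) = (p b - p d) * (w a - w d)
    · exact Or.inl hall
    · refine Or.inr ⟨o, ho, fun b hb => h₂ o b hb.symm fun d hd hd' => ?_⟩
      by_contra hn
      apply hall
      have hbd := hp.ne hd'.symm
      -- The degenerate triple `b`, `d`, `b` merely produces the line through `b` and `d`; if `Z o b
      -- d` failed, `o` would lie on it as well.
      obtain ⟨α, β, hα⟩ := exists_line hbd ((by ring_nf :
        (p b - p b) * (w d - w b) = (p d - p b) * (w b - w b)))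
      have hx : ∀ x, w x = α * p x + β := by
        intro x
        by_cases hx : x = o
        · rw [hx]
          exact mem_line hbd hα.1 hα.2.1 (h₁ o b d hb.symm hd.symm hd'.symm hn)
        · exact mem_line hbd hα.1 hα.2.1 (ho x b d hx hb hd)
      intro a b d
      exact hline (s := Set.univ) (fun x _ => hx x) a trivial b trivial d trivial
  · exfalso
    push Not at hP
    by_cases hcol : ∃ i j k, i ≠ j ∧ i ≠ k ∧ j ≠ k ∧
        (p i - p k) * (w j - w k) = (p j - p k) * (w i - w k)
    · obtain ⟨i, j, k, hij, hik, hjk, h⟩ := hcol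
      obtain ⟨α, β, hi, hj, hk⟩ := exists_line (hp.ne hij) h
      have hoff : ∀ o, ∃ x, x ≠ o ∧ w x ≠ α * p x + β := by
        intro o
        by_contra! hn
        obtain ⟨a, b, d, ha, hb, hd, hne⟩ := hP o
        exact hne (hline (s := {o}ᶜ) hn a ha b hb d hd)
      obtain ⟨u, -, hu⟩ := hoff i
      obtain ⟨v, hvu, hv⟩ := hoff u
      have hne : ∀ {a x}, w a = α * p a + β → w x ≠ α * p x + β → x ≠ a := by
        rintro a x ha hx rfl
        exact hx ha
      have huniv : ∀ x, x = i ∨ x = j ∨ x = k ∨ x = u ∨ x = v := by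
        have hc5 : ({i, j, k, u, v} : Finset ι).card = 5 := by
          rw [Finset.card_insert_of_notMem, Finset.card_insert_of_notMem,
            Finset.card_insert_of_notMem, Finset.card_insert_of_notMem, Finset.card_singleton]
          · simpa using hvu.symm
          · simpa using ⟨(hne hk hu).symm, (hne hk hv).symm⟩
          · simpa using ⟨hjk, (hne hj hu).symm, (hne hj hv).symm⟩
          · simpa using ⟨hij, hik, (hne hi hu).symm, (hne hi hv).symm⟩
        have := Finset.eq_univ_of_card _ (le_antisymm (Finset.card_le_univ _)
          (hc5.symm ▸ hcard))
        intro x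
        have hx := this ▸ Finset.mem_univ x
        simpa using hx
      -- The line through `u` and `v` meets the line of `i`, `j`, `k` in at most one point, so `Z u
      -- v` can fail for at most one of these three. Relabelling, `five_points_contradiction`
      -- applies.
      have hone : ∀ {a b}, a ≠ b → w a = α * p a + β → w b = α * p b + β → ¬ Z u v a →
          Z u v b := by
        intro a b hab ha hb hna
        by_contra hnb
        have e1 := h₁ u v a hvu.symm (hne ha hu) (hne ha hv) hna
        have e2 := h₁ u v b hvu.symm (hne hb hu) (hne hb hv) hnb
        obtain ⟨α', β', hu', hv', ha'⟩ := exists_line (hp.ne hvu.symm) e1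
        have hb' := mem_line (x := b) (hp.ne hvu.symm) hu' hv' (by linear_combination e2)
        apply hu
        refine mem_line (x := u) (hp.ne hab) ha hb ?_
        rw [hu', ha', hb']
        ring
      by_cases hZi : Z u v i
      · by_cases hZj : Z u v j
        · exact five_points_contradiction (i := k) (j := i) (k := j) hp hZ₁ hZ₂ h₁ h₂ h₃ hik.symm
            hjk.symm hij hvu.symm (fun x => by have := huniv x; tauto) hk hi hj hu hv hZi hZj
        · exact five_points_contradiction (i := j) (j := i) (k := k) hp hZ₁ hZ₂ h₁ h₂ h₃ hij.symm
            hjk hik hvu.symm (fun x => by have := huniv x; tauto) hj hi hk hu hv hZi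
            (hone hjk hj hk hZj)
      · exact five_points_contradiction (i := i) (j := j) (k := k) hp hZ₁ hZ₂ h₁ h₂ h₃ hij
          hik hjk hvu.symm huniv hi hj hk hu hv (hone hij hi hj hZi) (hone hik hi hk hZi)
    -- If no three points are collinear, `Z` holds for all triples of distinct points and every pair
    -- satisfies its relation. Comparing `e` with a noncollinear triple places `e` at the origin and
    -- gives `c = 0`, leaving three nonzero pairwise orthogonal vectors in the plane.
    · push Not at hcol
      have hZ : ∀ a b d, a ≠ b → a ≠ d → b ≠ d → Z a b d := fun a b d hab had hbd => by
        by_contra hn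
        exact hcol a b d hab had hbd (h₁ a b d hab had hbd hn)
      have hK : ∀ a b, a ≠ b → c + p a * p b + w a * w b = 0 := fun a b hab =>
        h₂ a b hab fun d hd hd' => hZ a b d hab hd.symm hd'.symm
      obtain ⟨a, b, d, ha, hb, hd, hne⟩ := hP e
      have hab : a ≠ b := by rintro rfl; exact hne rfl
      have had : a ≠ d := by rintro rfl; exact hne (by ring)
      have hbd : b ≠ d := by rintro rfl; exact hne (by ring)
      have e1 := hK e a ha.symm
      have e2 := hK e b hb.symm
      have e3 := hK e d hd.symm
      have e4 := hK a b hab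
      have e5 := hK a d had
      have e6 := hK b d hbd
      have hδ := sub_ne_zero.mpr hne
      have hpe : p e = 0 := by
        apply mul_left_cancel₀ hδ
        linear_combination (w b - w d) * (e1 - e3) - (w a - w d) * (e2 - e3)
      have hwe : w e = 0 := by
        apply mul_left_cancel₀ hδ
        linear_combination (p a - p d) * (e2 - e3) - (p b - p d) * (e1 - e3)
      have hc : c = 0 := by linear_combination e1 - p a * hpe - w a * hwe
      have ha0 : p a ≠ 0 := hpe ▸ hp.ne ha
      have hb0 : p b ≠ 0 := hpe ▸ hp.ne hb
      have hd0 : p d ≠ 0 := hpe ▸ hp.ne hd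
      have : (p a ^ 2 + w a ^ 2) * (p b * p d) = 0 := by
        subst hc
        linear_combination w a ^ 2 * e6 + p a * p d * e4 - w a * w b * e5
      have h0 : 0 < p a ^ 2 + w a ^ 2 := by positivity
      exact mul_ne_zero h0.ne' (mul_ne_zero hb0 hd0) this

end Configuration

/-! ### The system of ordinary differential equations for the principal curvatures. -/

/-- A finite cover of a nonempty open set by relatively closed sets contains a nonempty open
subset in one of its members. -/
theorem exists_open_forall_of_finite_cover {X κ : Type*} [TopologicalSpace X] (s : Finset κ)
    {P : κ → X → Prop} {I : Set X} (hI : IsOpen I) (hne : I.Nonempty)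
    (hP : ∀ k ∈ s, ∀ t ∈ I, ¬ P k t → ∀ᶠ u in nhds t, ¬ P k u)
    (hcover : ∀ t ∈ I, ∃ k ∈ s, P k t) :
    ∃ k ∈ s, ∃ J ⊆ I, IsOpen J ∧ J.Nonempty ∧ ∀ t ∈ J, P k t := by
  classical
  induction s using Finset.induction_on generalizing I with
  | empty =>
    obtain ⟨t, ht⟩ := hne
    obtain ⟨k, hk, -⟩ := hcover t ht
    simp at hk
  | insert k s hk ih =>
    by_cases hall : ∀ t ∈ I, P k t
    · exact ⟨k, Finset.mem_insert_self k s, I, subset_rfl, hI, hne, hall⟩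
    · push Not at hall
      obtain ⟨t, ht, hn⟩ := hall
      obtain ⟨U, hU, hUo, htU⟩ := eventually_nhds_iff.mp
        (hP k (Finset.mem_insert_self k s) t ht hn)
      obtain ⟨k', hk', J, hJ, h⟩ := ih (I := U ∩ I) (hUo.inter hI) ⟨t, htU, ht⟩
        (fun k' hk' u hu => hP k' (Finset.mem_insert_of_mem hk') u hu.2) (fun u hu => by
          obtain ⟨k', hk', h⟩ := hcover u hu.2
          rcases Finset.mem_insert.mp hk' with rfl | hk'
          · exact absurd h (hU u hu.1)
          · exact ⟨k', hk', h⟩)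
      exact ⟨k', Finset.mem_insert_of_mem hk', J, hJ.trans Set.inter_subset_right, h⟩

section Curve

variable {ι : Type*} {I : Set ℝ} {c C n : ℝ} {mult : ι → ℕ} {l y : ℝ → ℝ} {p w : ι → ℝ → ℝ}

/-- Slope and intercept of the moving line are read off from two of its points, and the equations of
motion of the points give those of `α` and `β` required by `line_flow_contradiction`. The absence of
an exceptional point is encoded by `m = 0` and `v = 0`. -/
theorem curve_contradiction_of_line [DecidableEq ι] (hI : IsOpen I) (hne : I.Nonempty)
    (hl : ∀ t ∈ I, HasDerivAt l (y t) t) (hy0 : ∀ t ∈ I, y t ≠ 0)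
    (hp : ∀ t ∈ I, ∀ a, HasDerivAt (p a) (w a t * (p a t - l t)) t)
    (hw : ∀ t ∈ I, ∀ a, HasDerivAt (w a) (w a t ^ 2 + l t * p a t + c) t)
    (hinj : ∀ t ∈ I, Function.Injective fun a => p a t)
    (s : Finset ι) (m : ℕ) (v : ℝ → ℝ) {a b : ι} (ha : a ∈ s) (hb : b ∈ s) (hab : a ≠ b)
    (hdet : ∀ t ∈ I, ∀ x ∈ s, (p x t - p b t) * (w a t - w b t) =
      (p a t - p b t) * (w x t - w b t))
    (hm0 : m = 0 → v = 0) (hm : m ≠ 0 → ∃ o, v = w o ∧ ∀ t ∈ I, ∀ x ∈ s,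
      c + p o t * p x t + w o t * w x t = 0)
    (hE₁ : ∀ t ∈ I, ∑ x ∈ s, mult x * p x t +
      m * (-((w a t - w b t) / (p a t - p b t) * v t)) = -3 * l t)
    (hE₂ : ∀ t ∈ I, ∑ x ∈ s, mult x * p x t ^ 2 +
      m * ((w a t - w b t) / (p a t - p b t) * v t) ^ 2 = 3 * l t ^ 2 + C)
    (hy : ∀ t ∈ I, HasDerivAt y ((∑ x ∈ s, mult x * w x t + m * v t) * y t +
      l t * (4 * l t ^ 2 + C - (∑ x ∈ s, (mult x : ℝ) + m + 1) * c)) t) : False := by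
  have hΔ : ∀ t ∈ I, p a t - p b t ≠ 0 := fun t ht => sub_ne_zero.mpr ((hinj t ht).ne hab)
  obtain ⟨α, hαdef⟩ : ∃ α : ℝ → ℝ, α = fun t => (w a t - w b t) / (p a t - p b t) := ⟨_, rfl⟩
  have hα' : ∀ t, (w a t - w b t) / (p a t - p b t) = α t := fun t => by rw [hαdef]
  simp only [hα'] at hE₁ hE₂
  obtain ⟨β, hβdef⟩ : ∃ β : ℝ → ℝ, β = fun t => w a t - α t * p a t := ⟨_, rfl⟩
  have hαt : ∀ t ∈ I, α t * (p a t - p b t) = w a t - w b t := fun t ht => by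
    rw [← hα', div_mul_cancel₀ _ (hΔ t ht)]
  have hβt : ∀ t, β t = w a t - α t * p a t := fun t => by rw [hβdef]
  have hx : ∀ t ∈ I, ∀ x ∈ s, w x t = α t * p x t + β t := by
    intro t ht x hx
    rw [hβt]
    apply mul_left_cancel₀ (hΔ t ht)
    linear_combination -hdet t ht x hx + (p a t - p x t) * hαt t ht
  have hα : ∀ t ∈ I, HasDerivAt α (α t * β t + l t * (1 + α t ^ 2)) t := by
    intro t ht
    rw [hαdef]
    refine (((hw t ht a).fun_sub (hw t ht b)).fun_div ((hp t ht a).fun_sub (hp t ht b))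
      (hΔ t ht)).congr_deriv ?_
    beta_reduce
    rw [hα', hx t ht a ha, hx t ht b hb]
    have := hΔ t ht
    field_simp
    ring
  have hβ : ∀ t ∈ I, HasDerivAt β (β t ^ 2 + c + α t * β t * l t) t := by
    intro t ht
    rw [hβdef]
    refine ((hw t ht a).fun_sub ((hα t ht).fun_mul (hp t ht a))).congr_deriv ?_
    beta_reduce
    rw [← hβt, hx t ht a ha]
    ring
  have hpx : ∀ t ∈ I, ∀ x ∈ s, HasDerivAt (p x) ((α t * p x t + β t) * (p x t - l t)) t := by
    intro t ht x hxs
    rw [← hx t ht x hxs]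
    exact hp t ht x
  have hmv : m ≠ 0 → ∀ t ∈ I, β t * v t = -c := by
    intro h t ht
    obtain ⟨o, rfl, ho⟩ := hm h
    have h1 := ho t ht a ha
    have h2 := ho t ht b hb
    rw [hβt]
    -- The relations of the exceptional point with two points of the line differ by this
    -- orthogonality, which puts the point at `v (-α, 1)`; what remains of either relation is `β v =
    -- -c`.
    have h3 : p o t + α t * w o t = 0 := by
      apply mul_left_cancel₀ (hΔ t ht)
      linear_combination h1 - h2 + w o t * hαt t ht
    linear_combination h1 - p a t * h3
  refine line_flow_contradiction hI hne (M := ∑ x ∈ s, (mult x : ℝ)) (c := c) (C := C) (m := m)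
    (α := α) (β := β) (w := v) (S₁ := fun t => ∑ x ∈ s, mult x * p x t)
    (S₂ := fun t => ∑ x ∈ s, mult x * p x t ^ 2) (S₃ := fun t => ∑ x ∈ s, mult x * p x t ^ 3)
    hy0 hl hα hβ ?_ (fun h t _ => by rw [hm0 h]; rfl) hmv ?_ ?_ hE₁ hE₂ ?_
  · intro t ht h
    obtain ⟨o, rfl, ho⟩ := hm h
    refine (hw t ht o).congr_deriv ?_
    have h1 := ho t ht a ha
    have h2 := ho t ht b hb
    have h3 : p o t + α t * w o t = 0 := by
      apply mul_left_cancel₀ (hΔ t ht)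
      linear_combination h1 - h2 + w o t * hαt t ht
    linear_combination l t * h3
  · intro t ht
    refine (HasDerivAt.fun_sum fun x hxs => (hpx t ht x hxs).const_mul (mult x : ℝ)).congr_deriv ?_
    simp only [Finset.mul_sum, ← Finset.sum_add_distrib, ← Finset.sum_sub_distrib]
    exact Finset.sum_congr rfl fun x _ => by ring
  · intro t ht
    refine (HasDerivAt.fun_sum fun x hxs =>
      ((hpx t ht x hxs).fun_pow 2).const_mul (mult x : ℝ)).congr_deriv ?_
    simp only [Finset.mul_sum, ← Finset.sum_add_distrib, ← Finset.sum_sub_distrib]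
    exact Finset.sum_congr rfl fun x _ => by push_cast; ring
  · intro t ht
    refine (hy t ht).congr_deriv ?_
    have : ∑ x ∈ s, mult x * w x t =
        α t * ∑ x ∈ s, mult x * p x t + β t * ∑ x ∈ s, (mult x : ℝ) := by
      simp only [Finset.mul_sum, ← Finset.sum_add_distrib]
      exact Finset.sum_congr rfl fun x hxs => by rw [hx t ht x hxs]; ring
    rw [this]

/-- With a single further eigenvalue the two power sums give `(9 - 3 M) l ^ 2 = M C`. As `l` is not
constant, `M = 3`, `C = 0` and `p = -l`; then `y = 2 w l`, and differentiating this yields `l ^ 2 =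
c`, which is impossible for the same reason. -/
theorem curve_contradiction_of_one (hI : IsOpen I) (hne : I.Nonempty)
    (hl : ∀ t ∈ I, HasDerivAt l (y t) t) (hy0 : ∀ t ∈ I, y t ≠ 0) (hl0 : ∀ t ∈ I, l t ≠ 0)
    {M : ℝ} (hM : M ≠ 0) {p w : ℝ → ℝ}
    (hp : ∀ t ∈ I, HasDerivAt p (w t * (p t - l t)) t)
    (hw : ∀ t ∈ I, HasDerivAt w (w t ^ 2 + l t * p t + c) t)
    (hE₁ : ∀ t ∈ I, M * p t = -3 * l t) (hE₂ : ∀ t ∈ I, M * p t ^ 2 = 3 * l t ^ 2 + C)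
    (hy : ∀ t ∈ I, HasDerivAt y (M * w t * y t + l t * (4 * l t ^ 2 + C - (M + 1) * c)) t) :
    False := by
  have e₁ : ∀ t ∈ I, M * (w t * (p t - l t)) + 3 * y t = 0 := fun t ht => by
    have := eq_zero_of_hasDerivAt_of_forall_eq_zero hI ht (f := fun t => M * p t - -3 * l t)
      (fun u hu => sub_eq_zero.mpr (hE₁ u hu))
      (((hp t ht).const_mul M).fun_sub ((hl t ht).const_mul (-3)))
    linear_combination this
  have hM3 : M = 3 := by
    obtain ⟨t, ht⟩ := hne
    have := eq_zero_of_hasDerivAt_of_forall_eq_zero hI ht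
      (f := fun t => (9 - 3 * M) * l t ^ 2 - M * C)
      (fun u hu => by linear_combination M * hE₂ u hu - (M * p u - 3 * l u) * hE₁ u hu)
      ((((hl t ht).fun_pow 2).const_mul (9 - 3 * M)).sub_const (M * C))
    have h2 : (9 - 3 * M) * (l t * y t) = 0 := by
      push_cast at this
      linear_combination this / 2
    have h3 := (mul_eq_zero.mp h2).resolve_right (mul_ne_zero (hl0 t ht) (hy0 t ht))
    linear_combination -h3 / 3
  subst hM3
  have hpl : ∀ t ∈ I, p t = -l t := fun t ht => by linear_combination hE₁ t ht / 3
  have hC : C = 0 := by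
    obtain ⟨t, ht⟩ := hne
    have := hE₂ t ht
    rw [hpl t ht] at this
    linear_combination -this
  have e₂ : ∀ t ∈ I, y t = 2 * w t * l t := fun t ht => by
    have := e₁ t ht
    rw [hpl t ht] at this
    linear_combination this / 3
  have e₃ : ∀ t ∈ I, 6 * (c - l t ^ 2) = 0 := fun t ht => by
    have := eq_zero_of_hasDerivAt_of_forall_eq_zero hI ht (f := fun t => y t - 2 * w t * l t)
      (fun u hu => sub_eq_zero.mpr (e₂ u hu))
      ((hy t ht).fun_sub (((hw t ht).const_mul 2).fun_mul (hl t ht)))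
    rw [hpl t ht, e₂ t ht, hC] at this
    apply mul_left_cancel₀ (hl0 t ht)
    linear_combination -this
  obtain ⟨t, ht⟩ := hne
  have := eq_zero_of_hasDerivAt_of_forall_eq_zero hI ht e₃
    ((((hl t ht).fun_pow 2).const_sub c).const_mul 6)
  have h2 : l t * y t = 0 := by
    push_cast at this
    linear_combination -this / 12
  exact mul_ne_zero (hl0 t ht) (hy0 t ht) h2

/-- The system of ordinary differential equations satisfied by the principal curvatures along an
integral curve of the gradient of the mean curvature has no solution. -/
theorem curve_contradiction [Fintype ι] (hcard : Fintype.card ι ≤ 5) (hI : IsOpen I)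
    (hne : I.Nonempty) (hmult : ∀ a, mult a ≠ 0) (hn : ∑ a, (mult a : ℝ) + 1 = n)
    (hl : ∀ t ∈ I, HasDerivAt l (y t) t) (hy0 : ∀ t ∈ I, y t ≠ 0) (hl0 : ∀ t ∈ I, l t ≠ 0)
    (hp : ∀ t ∈ I, ∀ a, HasDerivAt (p a) (w a t * (p a t - l t)) t)
    (hw : ∀ t ∈ I, ∀ a, HasDerivAt (w a) (w a t ^ 2 + l t * p a t + c) t)
    (hinj : ∀ t ∈ I, Function.Injective fun a => p a t)
    (hE₁ : ∀ t ∈ I, ∑ a, mult a * p a t = -3 * l t)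
    (hE₂ : ∀ t ∈ I, ∑ a, mult a * p a t ^ 2 = 3 * l t ^ 2 + C)
    (hy : ∀ t ∈ I, HasDerivAt y ((∑ a, mult a * w a t) * y t +
      l t * (4 * l t ^ 2 + C - n * c)) t)
    (Z : ℝ → ι → ι → ι → Prop)
    (hZ₁ : ∀ t ∈ I, ∀ a b d, Z t a b d → Z t b a d)
    (hZ₂ : ∀ t ∈ I, ∀ a b d, Z t a b d → Z t a d b)
    (h₁ : ∀ t ∈ I, ∀ a b d, a ≠ b → a ≠ d → b ≠ d → ¬ Z t a b d →
      (p a t - p d t) * (w b t - w d t) = (p b t - p d t) * (w a t - w d t))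
    (h₂ : ∀ t ∈ I, ∀ a b, a ≠ b → (∀ d, d ≠ a → d ≠ b → Z t a b d) →
      c + p a t * p b t + w a t * w b t = 0)
    (h₃ : ∀ t ∈ I, ∀ a b e, a ≠ b → a ≠ e → b ≠ e →
      (∀ d, d ≠ a → d ≠ b → d ≠ e → Z t a b d) →
      c + p a t * p b t + w a t * w b t = 0 → Z t a b e) : False := by
  classical
  have hpc : ∀ t ∈ I, ∀ a, ContinuousAt (p a) t := fun t ht a => (hp t ht a).continuousAt
  have hwc : ∀ t ∈ I, ∀ a, ContinuousAt (w a) t := fun t ht a => (hw t ht a).continuousAt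
  -- `none` stands for all points being collinear, `some o` for the exceptional point `o`. Each
  -- condition is an equality of continuous functions, so one of these finitely many closed
  -- conditions holds on a nonempty open set of times.
  let Q : Option ι → ℝ → Prop := fun k t => k.elim
    (∀ a b d, (p a t - p d t) * (w b t - w d t) = (p b t - p d t) * (w a t - w d t))
    (fun o => (∀ a b d, a ≠ o → b ≠ o → d ≠ o →
      (p a t - p d t) * (w b t - w d t) = (p b t - p d t) * (w a t - w d t)) ∧
      ∀ b, b ≠ o → c + p o t * p b t + w o t * w b t = 0)
  have hdetc : ∀ a b d, ∀ t ∈ I, ¬ ((p a t - p d t) * (w b t - w d t) =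
      (p b t - p d t) * (w a t - w d t)) → ∀ᶠ u in nhds t,
      ¬ ((p a u - p d u) * (w b u - w d u) = (p b u - p d u) * (w a u - w d u)) := by
    intro a b d t ht h
    filter_upwards [((((hpc t ht a).fun_sub (hpc t ht d)).fun_mul
      ((hwc t ht b).fun_sub (hwc t ht d))).fun_sub (((hpc t ht b).fun_sub (hpc t ht d)).fun_mul
      ((hwc t ht a).fun_sub (hwc t ht d)))).eventually_ne (sub_ne_zero.mpr h)] with u hu
    exact sub_ne_zero.mp hu
  have hQc : ∀ k ∈ (Finset.univ : Finset (Option ι)), ∀ t ∈ I, ¬ Q k t →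
      ∀ᶠ u in nhds t, ¬ Q k u := by
    intro k _ t ht hQ
    rcases k with _ | o
    · simp only [Q, Option.elim_none] at hQ ⊢
      push Not at hQ
      obtain ⟨a, b, d, h⟩ := hQ
      filter_upwards [hdetc a b d t ht h] with u hu hn using hu (hn a b d)
    · simp only [Q, Option.elim_some] at hQ ⊢
      rw [not_and_or] at hQ
      rcases hQ with hQ | hQ
      · push Not at hQ
        obtain ⟨a, b, d, ha, hb, hd, h⟩ := hQ
        filter_upwards [hdetc a b d t ht h] with u hu hn using hu (hn.1 a b d ha hb hd)
      · push Not at hQ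
        obtain ⟨b, hb, h⟩ := hQ
        have : ContinuousAt (fun u => c + p o u * p b u + w o u * w b u) t :=
          (continuousAt_const.add ((hpc t ht o).mul (hpc t ht b))).add
            ((hwc t ht o).mul (hwc t ht b))
        filter_upwards [this.eventually_ne h] with u hu hn using hu (hn.2 b hb)
  have hcover : ∀ t ∈ I, ∃ k ∈ (Finset.univ : Finset (Option ι)), Q k t := by
    intro t ht
    rcases planar_configuration hcard (hinj t ht) (hZ₁ t ht) (hZ₂ t ht) (h₁ t ht) (h₂ t ht)
      (h₃ t ht) with h | ⟨o, h⟩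
    · exact ⟨none, Finset.mem_univ _, h⟩
    · exact ⟨some o, Finset.mem_univ _, h⟩
  obtain ⟨k, -, J, hJI, hJo, hJne, hJ⟩ := exists_open_forall_of_finite_cover
    (Finset.univ : Finset (Option ι)) (P := Q) hI hne hQc hcover
  have hall : ¬ ∀ t ∈ J, Q none t := by
    intro hJ
    -- A line through two points is needed for `curve_contradiction_of_line`; no points at all would
    -- give `l = 0`, and a single point is treated separately.
    rcases subsingleton_or_nontrivial ι with hs | hs
    · rcases isEmpty_or_nonempty ι with he | ⟨⟨o⟩⟩
      · obtain ⟨t, ht⟩ := hne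
        have := hE₁ t ht
        rw [Finset.univ_eq_empty, Finset.sum_empty] at this
        exact hl0 t ht (by linear_combination this / 3)
      · have : Unique ι := ⟨⟨o⟩, fun x => Subsingleton.elim x o⟩
        simp only [Fintype.sum_unique] at hn hE₁ hE₂ hy
        subst hn
        exact curve_contradiction_of_one hI hne hl hy0 hl0
          (Nat.cast_ne_zero.mpr (hmult default)) (fun t ht => hp t ht default)
          (fun t ht => hw t ht default) hE₁ hE₂ hy
    · obtain ⟨a, b, hab⟩ := exists_pair_ne ι
      refine curve_contradiction_of_line (C := C) (mult := mult) hJo hJne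
        (fun t ht => hl t (hJI ht)) (fun t ht => hy0 t (hJI ht)) (fun t ht => hp t (hJI ht))
        (fun t ht => hw t (hJI ht)) (fun t ht => hinj t (hJI ht)) Finset.univ 0 0
        (Finset.mem_univ a) (Finset.mem_univ b) hab (fun t ht x _ => hJ t ht x a b)
        (fun _ => rfl) (fun h => absurd rfl h) (fun t ht => ?_) (fun t ht => ?_) (fun t ht => ?_)
      · simpa using hE₁ t (hJI ht)
      · simpa using hE₂ t (hJI ht)
      · simpa [hn] using hy t (hJI ht)
  rcases k with _ | o
  · exact hall hJ
  by_cases hex : ∃ a b, a ≠ b ∧ a ≠ o ∧ b ≠ o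
  · obtain ⟨a, b, hab, hao, hbo⟩ := hex
    have hsum : ∀ f : ι → ℝ, ∑ x, f x = ∑ x ∈ Finset.univ.erase o, f x + f o := fun f =>
      (Finset.sum_erase_add _ _ (Finset.mem_univ o)).symm
    have hline : ∀ t ∈ J, p o t = -((w a t - w b t) / (p a t - p b t) * w o t) := by
      intro t ht
      have h1 := (hJ t ht).2 a hao
      have h2 := (hJ t ht).2 b hbo
      have : p a t - p b t ≠ 0 := sub_ne_zero.mpr ((hinj t (hJI ht)).ne hab)
      field_simp
      linear_combination h1 - h2
    refine curve_contradiction_of_line (C := C) (mult := mult) hJo hJne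
      (fun t ht => hl t (hJI ht)) (fun t ht => hy0 t (hJI ht)) (fun t ht => hp t (hJI ht))
      (fun t ht => hw t (hJI ht)) (fun t ht => hinj t (hJI ht)) (Finset.univ.erase o) (mult o) (w o)
      (Finset.mem_erase.mpr ⟨hao, Finset.mem_univ a⟩)
      (Finset.mem_erase.mpr ⟨hbo, Finset.mem_univ b⟩) hab
      (fun t ht x hx => ?_)
      (fun h => absurd h (hmult o)) (fun _ => ⟨o, rfl, fun t ht x hx => ?_⟩)
      (fun t ht => ?_) (fun t ht => ?_) (fun t ht => ?_)
    · exact ((hJ t ht).1 x a b (Finset.ne_of_mem_erase hx) hao hbo)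
    · exact (hJ t ht).2 x (Finset.ne_of_mem_erase hx)
    · rw [← hline t ht, ← hsum fun x => mult x * p x t]
      exact hE₁ t (hJI ht)
    · rw [← neg_sq, ← hline t ht, ← hsum fun x => mult x * p x t ^ 2]
      exact hE₂ t (hJI ht)
    · rw [← hsum fun x => mult x * w x t, ← hsum fun x => (mult x : ℝ), hn]
      exact hy t (hJI ht)
  -- With at most one point besides `o` there are no three distinct points, so the collinear case
  -- applies.
  · push Not at hex
    refine hall fun t ht a b d => ?_
    by_cases hab : a = b
    · subst hab; ring
    by_cases had : a = d
    · subst had; ring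
    by_cases hbd : b = d
    · subst hbd; ring
    exfalso
    by_cases hao : a = o
    · have h1 := hex b d hbd (hao ▸ Ne.symm hab)
      exact had (hao.trans h1.symm)
    · exact hbd ((hex a b hab hao).trans (hex a d had hao).symm)

end Curve

/-! ### Covariant derivatives, traces and metrics on an open set of a vector space. -/

section Connection

variable {E : Type*} [NormedAddCommGroup E] [NormedSpace ℝ E]
variable {F : Type*} [NormedAddCommGroup F] [NormedSpace ℝ F]

theorem differentiableAt_of_smooth {f : E → F} {x : E} (hf : ContDiffAt ℝ ∞ f x) :
    DifferentiableAt ℝ f x :=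
  hf.differentiableAt (by simp)

theorem contDiffAt_fderiv_apply {f : E → F} {x : E} (hf : ContDiffAt ℝ ∞ f x) (u : E) :
    ContDiffAt ℝ ∞ (fun y => fderiv ℝ f y u) x :=
  (hf.fderiv_right (m := ∞) (by simp)).clm_apply contDiffAt_const

theorem fderiv_fderiv_comm {f : E → F} {x : E} (hf : ContDiffAt ℝ ∞ f x) (u v : E) :
    fderiv ℝ (fun y => fderiv ℝ f y u) x v = fderiv ℝ (fun y => fderiv ℝ f y v) x u := by
  have h1 : DifferentiableAt ℝ (fderiv ℝ f) x :=
    differentiableAt_of_smooth (hf.fderiv_right (m := ∞) (by simp))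
  have h2 := hf.isSymmSndFDerivAt
    (by rw [minSmoothness_of_isRCLikeNormedField]; exact WithTop.coe_le_coe.mpr le_top)
  rw [fderiv_clm_apply h1 (differentiableAt_const _), fderiv_clm_apply h1 (differentiableAt_const _)]
  simpa using h2.eq v u

/-- The covariant derivative of a vector field in a constant direction. -/
noncomputable def covVec (Γ : E → E →L[ℝ] E →L[ℝ] E) (u : E) (Z : E → E) (x : E) : E :=
  fderiv ℝ Z x u + Γ x u (Z x)

/-- The covariant derivative of a field of endomorphisms in a constant direction. -/
noncomputable def covEnd (Γ : E → E →L[ℝ] E →L[ℝ] E) (u : E) (B : E → E →L[ℝ] E) (x : E) :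
    E →L[ℝ] E :=
  fderiv ℝ B x u + Γ x u * B x - B x * Γ x u

variable {Γ : E → E →L[ℝ] E →L[ℝ] E} {u v w : E} {Z Y : E → E} {B D : E → E →L[ℝ] E} {f : E → ℝ}
  {x : E}

theorem contDiffAt_covVec (hΓ : ContDiffAt ℝ ∞ Γ x) (hZ : ContDiffAt ℝ ∞ Z x) :
    ContDiffAt ℝ ∞ (covVec Γ u Z) x :=
  (contDiffAt_fderiv_apply hZ u).add ((hΓ.clm_apply contDiffAt_const).clm_apply hZ)

theorem contDiffAt_covEnd (hΓ : ContDiffAt ℝ ∞ Γ x) (hB : ContDiffAt ℝ ∞ B x) :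
    ContDiffAt ℝ ∞ (covEnd Γ u B) x :=
  ((contDiffAt_fderiv_apply hB u).add ((hΓ.clm_apply contDiffAt_const).clm_comp hB)).sub
    (hB.clm_comp (hΓ.clm_apply contDiffAt_const))

theorem covVec_smul (hf : DifferentiableAt ℝ f x) (hZ : DifferentiableAt ℝ Z x) :
    covVec Γ u (fun y => f y • Z y) x = fderiv ℝ f x u • Z x + f x • covVec Γ u Z x := by
  simp only [covVec, fderiv_fun_smul hf hZ, add_apply,
    smul_apply, ContinuousLinearMap.smulRight_apply, map_smul, smul_add]
  abel

theorem covVec_apply (hB : DifferentiableAt ℝ B x) (hZ : DifferentiableAt ℝ Z x) :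
    covVec Γ u (fun y => B y (Z y)) x = covEnd Γ u B x (Z x) + B x (covVec Γ u Z x) := by
  simp only [covVec, covEnd, fderiv_clm_apply hB hZ, add_apply,
    sub_apply, ContinuousLinearMap.coe_comp, Function.comp_apply,
    ContinuousLinearMap.flip_apply, mul_apply_eq_comp, map_add]
  abel

theorem covVec_apply_const (hB : DifferentiableAt ℝ B x) (w : E) :
    covVec Γ u (fun y => B y w) x = covEnd Γ u B x w + B x (Γ x u w) := by
  rw [covVec_apply hB (differentiableAt_const w)]
  simp [covVec]

theorem covEnd_mul (hB : DifferentiableAt ℝ B x) (hD : DifferentiableAt ℝ D x) :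
    covEnd Γ u (fun y => B y * D y) x = covEnd Γ u B x * D x + B x * covEnd Γ u D x := by
  have : fderiv ℝ (fun y => B y * D y) x u = fderiv ℝ B x u * D x + B x * fderiv ℝ D x u := by
    rw [fderiv_fun_mul' hB hD]
    simp only [add_apply, smul_apply, smul_eq_mul,
      op_smul_eq_mul]
    abel
  simp only [covEnd, this]
  noncomm_ring

theorem covEnd_smul (hf : DifferentiableAt ℝ f x) (hB : DifferentiableAt ℝ B x) :
    covEnd Γ u (fun y => f y • B y) x = fderiv ℝ f x u • B x + f x • covEnd Γ u B x := by
  simp only [covEnd, fderiv_fun_smul hf hB, add_apply,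
    smul_apply, ContinuousLinearMap.smulRight_apply, smul_sub, smul_add,
    mul_smul_comm, smul_mul_assoc]
  abel

theorem covEnd_add (hB : DifferentiableAt ℝ B x) (hD : DifferentiableAt ℝ D x) :
    covEnd Γ u (fun y => B y + D y) x = covEnd Γ u B x + covEnd Γ u D x := by
  simp only [covEnd, fderiv_fun_add hB hD, add_apply, mul_add, add_mul]
  abel

theorem covEnd_congr (h : B =ᶠ[nhds x] D) : covEnd Γ u B x = covEnd Γ u D x := by
  simp only [covEnd, h.fderiv_eq, h.eq_of_nhds]

theorem covVec_congr (h : Z =ᶠ[nhds x] Y) : covVec Γ u Z x = covVec Γ u Y x := by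
  simp only [covVec, h.fderiv_eq, h.eq_of_nhds]

/-- The curvature of the connection, as an endomorphism. -/
noncomputable def curv (Γ : E → E →L[ℝ] E →L[ℝ] E) (v u : E) (x : E) : E →L[ℝ] E :=
  fderiv ℝ (fun y => Γ y u) x v - fderiv ℝ (fun y => Γ y v) x u + Γ x v * Γ x u - Γ x u * Γ x v

/-- The Ricci identity. The directions are constant vector fields, which commute, so no bracket term
appears. -/
theorem covVec_covVec_sub (hΓ : ContDiffAt ℝ ∞ Γ x) (hZ : ContDiffAt ℝ ∞ Z x) (v u : E) :
    covVec Γ v (covVec Γ u Z) x - covVec Γ u (covVec Γ v Z) x = curv Γ v u x (Z x) := by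
  have h : ∀ u v, covVec Γ v (covVec Γ u Z) x = fderiv ℝ (fun y => fderiv ℝ Z y u) x v +
      (fderiv ℝ (fun y => Γ y u) x v (Z x) + Γ x u (fderiv ℝ Z x v)) +
      (Γ x v (fderiv ℝ Z x u) + Γ x v (Γ x u (Z x))) := by
    intro u v
    have hΓu := hΓ.clm_apply (contDiffAt_const (c := u))
    have h1 : fderiv ℝ (covVec Γ u Z) x v = fderiv ℝ (fun y => fderiv ℝ Z y u) x v +
        (fderiv ℝ (fun y => Γ y u) x v (Z x) + Γ x u (fderiv ℝ Z x v)) := by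
      unfold covVec
      rw [fderiv_fun_add (differentiableAt_of_smooth (contDiffAt_fderiv_apply hZ u))
        (differentiableAt_of_smooth (hΓu.clm_apply hZ)),
        fderiv_clm_apply (differentiableAt_of_smooth hΓu) (differentiableAt_of_smooth hZ)]
      simp only [add_apply, ContinuousLinearMap.coe_comp, Function.comp_apply,
        ContinuousLinearMap.flip_apply]
      abel
    rw [covVec, h1]
    simp only [covVec, map_add]
  rw [h u v, h v u, fderiv_fderiv_comm hZ u v]
  simp only [curv, add_apply, sub_apply,
    mul_apply_eq_comp]
  abel

theorem covEnd_covEnd_sub (hΓ : ContDiffAt ℝ ∞ Γ x) (hB : ContDiffAt ℝ ∞ B x) (v u : E) :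
    covEnd Γ v (covEnd Γ u B) x - covEnd Γ u (covEnd Γ v B) x =
      curv Γ v u x * B x - B x * curv Γ v u x := by
  have hmul : ∀ {P Q : E → E →L[ℝ] E} (v : E), DifferentiableAt ℝ P x → DifferentiableAt ℝ Q x →
      fderiv ℝ (fun y => P y * Q y) x v = fderiv ℝ P x v * Q x + P x * fderiv ℝ Q x v := by
    intro P Q v hP hQ
    rw [fderiv_fun_mul' hP hQ]
    simp only [add_apply, smul_apply, smul_eq_mul,
      op_smul_eq_mul]
    abel
  have h : ∀ u v, fderiv ℝ (covEnd Γ u B) x v = fderiv ℝ (fun y => fderiv ℝ B y u) x v +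
      (fderiv ℝ (fun y => Γ y u) x v * B x + Γ x u * (fderiv ℝ B x v)) -
      (fderiv ℝ B x v * Γ x u + B x * fderiv ℝ (fun y => Γ y u) x v) := by
    intro u v
    have hΓu := hΓ.clm_apply (contDiffAt_const (c := u))
    unfold covEnd
    have d1 := differentiableAt_of_smooth (contDiffAt_fderiv_apply hB u)
    have d2 : DifferentiableAt ℝ (fun y => Γ y u * B y) x :=
      differentiableAt_of_smooth (hΓu.clm_comp hB)
    have d3 : DifferentiableAt ℝ (fun y => B y * Γ y u) x :=
      differentiableAt_of_smooth (hB.clm_comp hΓu)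
    rw [fderiv_fun_sub (d1.fun_add d2) d3, fderiv_fun_add d1 d2]
    simp only [add_apply, sub_apply]
    rw [hmul v (differentiableAt_of_smooth hΓu) (differentiableAt_of_smooth hB),
      hmul v (differentiableAt_of_smooth hB) (differentiableAt_of_smooth hΓu)]
  have h' : ∀ u v, covEnd Γ v (covEnd Γ u B) x = fderiv ℝ (covEnd Γ u B) x v +
      Γ x v * covEnd Γ u B x - covEnd Γ u B x * Γ x v := fun _ _ => rfl
  rw [h' u v, h' v u, h u v, h v u, fderiv_fderiv_comm hB u v]
  simp only [curv, covEnd]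
  noncomm_ring

end Connection

section Trace

variable {E : Type*} [NormedAddCommGroup E] [NormedSpace ℝ E] [FiniteDimensional ℝ E]
  {Γ : E → E →L[ℝ] E →L[ℝ] E} {u : E} {B : E → E →L[ℝ] E} {x : E}

variable (E) in
/-- The trace of a continuous endomorphism. -/
noncomputable def opTrace : (E →L[ℝ] E) →L[ℝ] ℝ :=
  LinearMap.toContinuousLinearMap ((LinearMap.trace ℝ E).comp (ContinuousLinearMap.coeLM ℝ))

theorem opTrace_apply (B : E →L[ℝ] E) : opTrace E B = LinearMap.trace ℝ E B := rfl

theorem opTrace_mul_comm (B D : E →L[ℝ] E) : opTrace E (B * D) = opTrace E (D * B) := by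
  simp only [opTrace_apply]
  exact LinearMap.trace_mul_comm ℝ _ _

/-- The connection enters the covariant derivative of an endomorphism through a commutator, which
has trace zero. -/
theorem fderiv_opTrace (hB : DifferentiableAt ℝ B x) :
    fderiv ℝ (fun y => opTrace E (B y)) x u = opTrace E (covEnd Γ u B x) := by
  have h : fderiv ℝ (fun y => opTrace E (B y)) x = (opTrace E).comp (fderiv ℝ B x) :=
    ((opTrace E).hasFDerivAt.comp x hB.hasFDerivAt).fderiv
  rw [h]
  simp only [covEnd, map_add, map_sub, ContinuousLinearMap.comp_apply]
  rw [opTrace_mul_comm (B x)]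
  ring

end Trace


section Metric

variable {E : Type*} [NormedAddCommGroup E] [NormedSpace ℝ E]
  {U : Set E} {g : E → E →L[ℝ] E →L[ℝ] ℝ} {Γ : E → E →L[ℝ] E →L[ℝ] E}

/-- A Riemannian metric on an open set together with its Levi-Civita connection. -/
structure LeviCivita (U : Set E) (g : E → E →L[ℝ] E →L[ℝ] ℝ) (Γ : E → E →L[ℝ] E →L[ℝ] E) :
    Prop where
  isOpen : IsOpen U
  g_smooth : ∀ x ∈ U, ContDiffAt ℝ ∞ g x
  Γ_smooth : ∀ x ∈ U, ContDiffAt ℝ ∞ Γ x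
  g_symm : ∀ x ∈ U, ∀ u v, g x u v = g x v u
  g_pos : ∀ x ∈ U, ∀ u, u ≠ 0 → 0 < g x u u
  Γ_symm : ∀ x ∈ U, ∀ u v, Γ x u v = Γ x v u
  compat : ∀ x ∈ U, ∀ u v w, fderiv ℝ g x u v w = g x (Γ x u v) w + g x v (Γ x u w)

namespace LeviCivita

variable (hg : LeviCivita U g Γ) {x : E} (hx : x ∈ U)

include hg hx

theorem eq_of_forall {u v : E} (h : ∀ w, g x u w = g x v w) : u = v := by
  by_contra hne
  have h1 := hg.g_pos x hx (u - v) (sub_ne_zero.mpr hne)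
  have h2 : g x (u - v) (u - v) = 0 := by
    rw [map_sub (g x), sub_apply, h, sub_self]
  exact h1.ne' h2

theorem eq_zero_of_self {u : E} (h : g x u u = 0) : u = 0 := by
  by_contra hne
  exact (hg.g_pos x hx u hne).ne' h

theorem fderiv_metric {Y Z : E → E} (hY : DifferentiableAt ℝ Y x) (hZ : DifferentiableAt ℝ Z x)
    (u : E) : fderiv ℝ (fun y => g y (Y y) (Z y)) x u =
      g x (covVec Γ u Y x) (Z x) + g x (Y x) (covVec Γ u Z x) := by
  have h1 := differentiableAt_of_smooth (hg.g_smooth x hx)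
  rw [fderiv_clm_apply (h1.clm_apply hY) hZ, fderiv_clm_apply h1 hY]
  simp only [add_apply, ContinuousLinearMap.coe_comp, Function.comp_apply,
    ContinuousLinearMap.flip_apply, covVec, map_add, hg.compat x hx]
  ring

theorem covEnd_selfAdj {B : E → E →L[ℝ] E} (hB : ContDiffAt ℝ ∞ B x)
    (h : ∀ y ∈ U, ∀ v w, g y (B y v) w = g y v (B y w)) (u v w : E) :
    g x (covEnd Γ u B x v) w = g x v (covEnd Γ u B x w) := by
  have hBd := differentiableAt_of_smooth hB
  have h1 : (fun y => g y (B y v) w) =ᶠ[nhds x] fun y => g y v (B y w) := by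
    filter_upwards [hg.isOpen.mem_nhds hx] with y hy using h y hy v w
  have h2 := congrArg (fun L : E →L[ℝ] ℝ => L u) h1.fderiv_eq
  have hBv : ∀ v, DifferentiableAt ℝ (fun y => B y v) x := fun v =>
    hBd.clm_apply (differentiableAt_const v)
  beta_reduce at h2
  rw [hg.fderiv_metric hx (hBv v) (differentiableAt_const w),
    hg.fderiv_metric hx (differentiableAt_const v) (hBv w), covVec_apply_const hBd,
    covVec_apply_const hBd] at h2
  have h3 : ∀ z : E, covVec Γ u (fun _ => z) x = Γ x u z := fun z => by simp [covVec]
  rw [h3, h3, map_add, map_add, add_apply, h x hx, h x hx] at h2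
  linear_combination h2

/-- Both sides are the Hessian of `f`, which is symmetric because the connection is torsion-free. -/
theorem grad_symm {f : E → ℝ} {N : E → E} (hf : ContDiffAt ℝ ∞ f x) (hN : ContDiffAt ℝ ∞ N x)
    (h : ∀ y ∈ U, ∀ u, fderiv ℝ f y u = g y (N y) u) (u v : E) :
    g x (covVec Γ u N x) v = g x (covVec Γ v N x) u := by
  have key : ∀ u v, fderiv ℝ (fun y => fderiv ℝ f y v) x u =
      g x (covVec Γ u N x) v + g x (N x) (Γ x u v) := by
    intro u v
    have h1 : (fun y => fderiv ℝ f y v) =ᶠ[nhds x] fun y => g y (N y) v := by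
      filter_upwards [hg.isOpen.mem_nhds hx] with y hy using h y hy v
    rw [h1.fderiv_eq, hg.fderiv_metric hx (differentiableAt_of_smooth hN)
      (differentiableAt_const v)]
    simp [covVec]
  have h1 := key u v
  rw [fderiv_fderiv_comm hf, key v u, hg.Γ_symm x hx v u] at h1
  linear_combination -h1

end LeviCivita

end Metric

/-! ### Biharmonic and spectral charts; the unit gradient field is geodesic. -/

section Biharmonic

variable {E : Type*} [NormedAddCommGroup E] [NormedSpace ℝ E] [FiniteDimensional ℝ E]

/-- The equations satisfied by a biharmonic hypersurface of constant scalar curvature in a space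
of constant curvature `c`, in a chart: `A` is the Weingarten operator, and `N` is the gradient of
`l = -trace A / 2`. -/
structure BiharmonicChart (U : Set E) (c C : ℝ) (g : E → E →L[ℝ] E →L[ℝ] ℝ)
    (Γ : E → E →L[ℝ] E →L[ℝ] E) (A : E → E →L[ℝ] E) (l : E → ℝ) (N : E → E) : Prop
    extends LeviCivita U g Γ where
  A_smooth : ∀ x ∈ U, ContDiffAt ℝ ∞ A x
  N_smooth : ∀ x ∈ U, ContDiffAt ℝ ∞ N x
  l_smooth : ∀ x ∈ U, ContDiffAt ℝ ∞ l x
  A_symm : ∀ x ∈ U, ∀ u v, g x (A x u) v = g x u (A x v)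
  codazzi : ∀ x ∈ U, ∀ u v, covEnd Γ u A x v = covEnd Γ v A x u
  gauss : ∀ x ∈ U, ∀ v u w, curv Γ v u x w = c • (g x u w • v - g x v w • u) +
    g x (A x u) w • A x v - g x (A x v) w • A x u
  trace_A : ∀ x ∈ U, opTrace E (A x) = -2 * l x
  trace_A_sq : ∀ x ∈ U, opTrace E (A x * A x) = 4 * l x ^ 2 + C
  grad : ∀ x ∈ U, ∀ u, fderiv ℝ l x u = g x (N x) u
  A_grad : ∀ x ∈ U, A x (N x) = l x • N x
  lap : ∀ x ∈ U, opTrace E (fderiv ℝ N x + (Γ x).flip (N x)) =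
    l x * (4 * l x ^ 2 + C - Module.finrank ℝ E * c)

/-- A biharmonic chart on which the eigenvalues `lam a` of `A` and the orthogonal projections `P a`
to its eigenspaces are smooth, and the gradient of `l` is `y` times the unit vector field `T`. -/
structure SpectralChart {ι : Type*} [Fintype ι] [DecidableEq ι] (U : Set E) (c C : ℝ)
    (g : E → E →L[ℝ] E →L[ℝ] ℝ) (Γ : E → E →L[ℝ] E →L[ℝ] E) (A : E → E →L[ℝ] E) (l : E → ℝ)
    (N : E → E) (lam : Option ι → E → ℝ) (P : Option ι → E → E →L[ℝ] E) (mult : ι → ℕ)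
    (T : E → E) (y : E → ℝ) : Prop
    extends BiharmonicChart U c C g Γ A l N where
  lam_smooth : ∀ x ∈ U, ∀ a, ContDiffAt ℝ ∞ (lam a) x
  P_smooth : ∀ x ∈ U, ∀ a, ContDiffAt ℝ ∞ (P a) x
  sum_P : ∀ x ∈ U, ∑ a, P a x = 1
  P_mul : ∀ x ∈ U, ∀ a b, P a x * P b x = if a = b then P a x else 0
  A_mul_P : ∀ x ∈ U, ∀ a, A x * P a x = lam a x • P a x
  P_ne : ∀ x ∈ U, ∀ a, P a x ≠ 0
  lam_inj : ∀ x ∈ U, Function.Injective fun a => lam a x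
  trace_P : ∀ x ∈ U, ∀ a, opTrace E (P (some a) x) = mult a
  mult_ne : ∀ a, mult a ≠ 0
  lam_none : ∀ x ∈ U, lam none x = l x
  l_ne : ∀ x ∈ U, l x ≠ 0
  T_smooth : ∀ x ∈ U, ContDiffAt ℝ ∞ T x
  y_smooth : ∀ x ∈ U, ContDiffAt ℝ ∞ y x
  y_pos : ∀ x ∈ U, 0 < y x
  N_eq : ∀ x ∈ U, N x = y x • T x
  T_unit : ∀ x ∈ U, g x (T x) (T x) = 1

namespace SpectralChart

variable {ι : Type*} [Fintype ι] [DecidableEq ι] {U : Set E} {c C : ℝ}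
  {g : E → E →L[ℝ] E →L[ℝ] ℝ} {Γ : E → E →L[ℝ] E →L[ℝ] E} {A : E → E →L[ℝ] E} {l : E → ℝ}
  {N : E → E} {lam : Option ι → E → ℝ} {P : Option ι → E → E →L[ℝ] E} {mult : ι → ℕ}
  {T : E → E} {y : E → ℝ}
  (hS : SpectralChart U c C g Γ A l N lam P mult T y) {x : E} (hx : x ∈ U)

include hS hx

theorem P_self (a : Option ι) (u : E) : P a x (P a x u) = P a x u := by
  have := congrArg (fun L => L u) (hS.P_mul x hx a a)
  simpa using this

theorem P_of_ne {a b : Option ι} (hab : a ≠ b) (u : E) : P a x (P b x u) = 0 := by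
  have := congrArg (fun L => L u) (hS.P_mul x hx a b)
  simpa [hab] using this

theorem A_P (a : Option ι) (u : E) : A x (P a x u) = lam a x • P a x u :=
  congrArg (fun L => L u) (hS.A_mul_P x hx a)

theorem sum_P_apply (u : E) : ∑ a, P a x u = u := by
  have := congrArg (fun L => L u) (hS.sum_P x hx)
  simpa [sum_apply] using this

theorem P_A (a : Option ι) (u : E) : P a x (A x u) = lam a x • P a x u := by
  conv_lhs => rw [← hS.sum_P_apply hx u]
  simp only [map_sum, hS.A_P hx, map_smul]
  rw [Finset.sum_eq_single a (fun b _ hb => by rw [hS.P_of_ne hx hb.symm, smul_zero])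
    (fun h => absurd (Finset.mem_univ a) h), hS.P_self hx]

theorem P_orth {a b : Option ι} (hab : a ≠ b) (u v : E) : g x (P a x u) (P b x v) = 0 := by
  have h := hS.A_symm x hx (P a x u) (P b x v)
  rw [hS.A_P hx, hS.A_P hx, map_smul, map_smul, smul_apply, smul_eq_mul, smul_eq_mul] at h
  have h2 : lam a x - lam b x ≠ 0 := sub_ne_zero.mpr ((hS.lam_inj x hx).ne hab)
  apply mul_left_cancel₀ h2
  linear_combination h

theorem P_symm (a : Option ι) (u v : E) : g x (P a x u) v = g x u (P a x v) := by
  have h1 : ∀ u v, g x (P a x u) v = g x (P a x u) (P a x v) := by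
    intro u v
    conv_lhs => rw [← hS.sum_P_apply hx v]
    rw [map_sum]
    exact Finset.sum_eq_single a (fun b _ hb => hS.P_orth hx hb.symm u v)
      (fun h => absurd (Finset.mem_univ a) h)
  rw [h1, hS.g_symm x hx, ← h1, hS.g_symm x hx]

theorem fderiv_l (u : E) : fderiv ℝ l x u = y x * g x (T x) u := by
  rw [hS.grad x hx, hS.N_eq x hx, map_smul, smul_apply, smul_eq_mul]

theorem A_T : A x (T x) = l x • T x := by
  have h := hS.A_grad x hx
  rw [hS.N_eq x hx, map_smul, smul_comm] at h
  exact smul_right_injective E (hS.y_pos x hx).ne' h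

theorem P_some_T (a : ι) : P (some a) x (T x) = 0 := by
  have h := hS.P_A hx (some a) (T x)
  rw [hS.A_T hx, map_smul, ← hS.lam_none x hx, ← sub_eq_zero, ← sub_smul] at h
  exact (smul_eq_zero.mp h).resolve_left
    (sub_ne_zero.mpr ((hS.lam_inj x hx).ne (Option.some_ne_none a).symm))

theorem P_none_T : P none x (T x) = T x := by
  have h := hS.sum_P_apply hx (T x)
  rw [Fintype.sum_option] at h
  simpa [hS.P_some_T hx] using h

theorem covVec_T_T (u : E) : g x (covVec Γ u T x) (T x) = 0 := by
  have hT := differentiableAt_of_smooth (hS.T_smooth x hx)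
  have h1 : (fun y => g y (T y) (T y)) =ᶠ[nhds x] fun _ => (1 : ℝ) := by
    filter_upwards [hS.isOpen.mem_nhds hx] with y hy using hS.T_unit y hy
  have h2 := congrArg (fun L : E →L[ℝ] ℝ => L u) h1.fderiv_eq
  beta_reduce at h2
  rw [hS.toLeviCivita.fderiv_metric hx hT hT, hS.g_symm x hx (T x)] at h2
  simp only [fderiv_fun_const, Pi.zero_apply, zero_apply] at h2
  linarith

theorem covEnd_A_T (u : E) : covEnd Γ u A x (T x) =
    fderiv ℝ l x u • T x + l x • covVec Γ u T x - A x (covVec Γ u T x) := by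
  have hT := differentiableAt_of_smooth (hS.T_smooth x hx)
  have hA := differentiableAt_of_smooth (hS.A_smooth x hx)
  have hl := differentiableAt_of_smooth (hS.l_smooth x hx)
  have h1 : (fun y => A y (T y)) =ᶠ[nhds x] fun y => l y • T y := by
    filter_upwards [hS.isOpen.mem_nhds hx] with y hy using hS.A_T hy
  have h2 := covVec_congr (Γ := Γ) (u := u) h1
  rw [covVec_apply hA hT, covVec_smul hl hT] at h2
  rw [← h2, add_sub_cancel_right]

/-- Differentiate `B Q = f Q` and multiply by `Q` from the left: the terms with the derivative of
`Q` cancel because `Q B = f Q`. It is applied to the Weingarten operator and to `negGrad`. -/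
theorem P_covEnd_P {B Q : E → E →L[ℝ] E} {f : E → ℝ} (hB : ContDiffAt ℝ ∞ B x)
    (hQ : ContDiffAt ℝ ∞ Q x) (hf : ContDiffAt ℝ ∞ f x)
    (hQQ : Q x * Q x = Q x)
    (h : ∀ y ∈ U, B y * Q y = f y • Q y) (h' : Q x * B x = f x • Q x) (u : E) :
    Q x * covEnd Γ u B x * Q x = fderiv ℝ f x u • Q x := by
  have h1 : (fun y => B y * Q y) =ᶠ[nhds x] fun y => f y • Q y := by
    filter_upwards [hS.isOpen.mem_nhds hx] with y hy using h y hy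
  have h2 := covEnd_congr (Γ := Γ) (u := u) h1
  rw [covEnd_mul (differentiableAt_of_smooth hB) (differentiableAt_of_smooth hQ),
    covEnd_smul (differentiableAt_of_smooth hf) (differentiableAt_of_smooth hQ)] at h2
  have h3 := congrArg (fun L => Q x * L) h2
  beta_reduce at h3
  rw [mul_add, mul_add, ← mul_assoc (Q x) (B x), h', mul_smul_comm, mul_smul_comm, hQQ,
    smul_mul_assoc] at h3
  rw [mul_assoc]
  exact add_right_cancel h3

theorem A_covEnd (a : Option ι) (u v : E) :
    P a x (covEnd Γ u A x (P a x v)) = fderiv ℝ (lam a) x u • P a x v :=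
  congrArg (fun L => L v) (hS.P_covEnd_P hx (hS.A_smooth x hx) (hS.P_smooth x hx a)
    (hS.lam_smooth x hx a) (by simp [hS.P_mul x hx]) (fun y hy => hS.A_mul_P y hy a)
    (ContinuousLinearMap.ext fun v => hS.P_A hx a v) u)

theorem A_covEnd_symm (u v w : E) : g x (covEnd Γ u A x v) w = g x v (covEnd Γ u A x w) :=
  hS.toLeviCivita.covEnd_selfAdj hx (hS.A_smooth x hx) hS.A_symm u v w

theorem fderiv_lam_none : fderiv ℝ (lam none) x = fderiv ℝ l x := by
  have h1 : lam none =ᶠ[nhds x] l := by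
    filter_upwards [hS.isOpen.mem_nhds hx] with y hy using hS.lam_none y hy
  exact h1.fderiv_eq

/-- The eigenvalue `l` is simple. For an `l`-eigenvector `X` orthogonal to `T`, the number `⟨(∇_T A)
X, X⟩` equals `y |X| ^ 2`, since the derivative of the eigenvalue along `T` is `y`. By Codazzi it is
also `⟨(∇_X A) T, X⟩`, which vanishes. -/
theorem P_none (u : E) : P none x u = g x (T x) u • T x := by
  obtain ⟨X, hX⟩ : ∃ X, X = P none x u - g x (T x) u • T x := ⟨_, rfl⟩
  have hXP : P none x X = X := by
    rw [hX, map_sub, map_smul, hS.P_self hx, hS.P_none_T hx]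
  have hXT : g x (T x) X = 0 := by
    rw [hX, map_sub, map_smul, hS.T_unit x hx, ← hS.P_symm hx, hS.P_none_T hx, smul_eq_mul,
      mul_one, sub_self]
  have h1 : g x (covEnd Γ (T x) A x X) X = y x * g x X X := by
    have h := hS.A_covEnd hx none (T x) X
    rw [hXP, hS.fderiv_lam_none hx, hS.fderiv_l hx, hS.T_unit x hx, mul_one] at h
    calc g x (covEnd Γ (T x) A x X) X = g x (covEnd Γ (T x) A x X) (P none x X) := by rw [hXP]
      _ = g x (P none x (covEnd Γ (T x) A x X)) X := (hS.P_symm hx _ _ _).symm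
      _ = _ := by rw [h, map_smul, smul_apply, smul_eq_mul]
  have h2 : g x (covEnd Γ (T x) A x X) X = 0 := by
    rw [hS.codazzi x hx, hS.covEnd_A_T hx, hS.fderiv_l hx, hXT]
    have hAX : A x X = l x • X := by
      rw [← hXP, hS.A_P hx, hS.lam_none x hx]
    simp only [map_add, map_sub, map_smul, add_apply, sub_apply, smul_apply, smul_eq_mul,
      hS.A_symm x hx, hAX, hXT]
    ring
  have h3 : g x X X = 0 := by
    rw [h2] at h1
    exact (mul_eq_zero.mp h1.symm).resolve_left (hS.y_pos x hx).ne'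
  have h4 := hS.toLeviCivita.eq_zero_of_self hx h3
  rw [hX, sub_eq_zero] at h4
  exact h4

/-- The integral curves of `T` are geodesics: pairing Codazzi with `T` shows that `∇_T T` is an
`l`-eigenvector, hence a multiple of `T`, and it is orthogonal to `T`. -/
theorem covVec_T_self : covVec Γ (T x) T x = 0 := by
  obtain ⟨D, hD⟩ : ∃ D, D = covVec Γ (T x) T x := ⟨_, rfl⟩
  have h1 : A x D = l x • D := by
    refine hS.toLeviCivita.eq_of_forall hx fun v => ?_
    have e1 : g x (covEnd Γ v A x (T x)) (T x) = y x * g x (T x) v := by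
      rw [hS.covEnd_A_T hx, hS.fderiv_l hx]
      simp only [map_add, map_sub, map_smul, add_apply, sub_apply, smul_apply, smul_eq_mul,
        hS.A_symm x hx, hS.A_T hx, hS.covVec_T_T hx, hS.T_unit x hx]
      ring
    rw [hS.codazzi x hx, hS.A_covEnd_symm hx, hS.covEnd_A_T hx, hS.fderiv_l hx, hS.T_unit x hx,
      ← hD] at e1
    simp only [map_add, map_sub, map_smul, smul_eq_mul, hS.g_symm x hx v, add_apply, sub_apply,
      smul_apply] at e1
    simp only [map_smul, smul_apply, smul_eq_mul]
    linear_combination -e1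
  have h2 : ∀ a, P (some a) x D = 0 := by
    intro a
    have h := hS.P_A hx (some a) D
    rw [h1, map_smul, ← hS.lam_none x hx, ← sub_eq_zero, ← sub_smul] at h
    exact (smul_eq_zero.mp h).resolve_left
      (sub_ne_zero.mpr ((hS.lam_inj x hx).ne (Option.some_ne_none a).symm))
  have h3 := hS.sum_P_apply hx D
  rw [Fintype.sum_option] at h3
  simp only [h2, Finset.sum_const_zero, add_zero, hS.P_none hx] at h3
  rw [← hD, ← h3, hS.g_symm x hx, hD, hS.covVec_T_T hx, zero_smul]

end SpectralChart

end Biharmonic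


/-! ### The endomorphism `-∇T` and the equations along `T`. -/

section Biharmonic

variable {E : Type*} [NormedAddCommGroup E] [NormedSpace ℝ E]

/-- The endomorphism `u ↦ -∇_u T`. -/
noncomputable def negGrad (Γ : E → E →L[ℝ] E →L[ℝ] E) (T : E → E) (x : E) : E →L[ℝ] E :=
  -(fderiv ℝ T x + (Γ x).flip (T x))

/-- The derivative of `f` along the vector field `T`. -/
noncomputable def along (T : E → E) (f : E → ℝ) (x : E) : ℝ := fderiv ℝ f x (T x)

/-- The eigenvalue of `negGrad` belonging to the eigenvalue `lam` of the Weingarten operator. -/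
noncomputable def gradEigenvalue (T : E → E) (l lam : E → ℝ) (x : E) : ℝ :=
  along T lam x / (lam x - l x)

theorem negGrad_apply {Γ : E → E →L[ℝ] E →L[ℝ] E} {T : E → E} (x u : E) :
    negGrad Γ T x u = -covVec Γ u T x := by
  simp [negGrad, covVec]

theorem contDiffAt_along {T : E → E} {f : E → ℝ} {x : E} (hT : ContDiffAt ℝ ∞ T x)
    (hf : ContDiffAt ℝ ∞ f x) : ContDiffAt ℝ ∞ (along T f) x :=
  (hf.fderiv_right (m := ∞) (by simp)).clm_apply hT

variable [FiniteDimensional ℝ E]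

namespace SpectralChart

variable {ι : Type*} [Fintype ι] [DecidableEq ι] {U : Set E} {c C : ℝ}
  {g : E → E →L[ℝ] E →L[ℝ] ℝ} {Γ : E → E →L[ℝ] E →L[ℝ] E} {A : E → E →L[ℝ] E} {l : E → ℝ}
  {N : E → E} {lam : Option ι → E → ℝ} {P : Option ι → E → E →L[ℝ] E} {mult : ι → ℕ}
  {T : E → E} {y : E → ℝ}
  (hS : SpectralChart U c C g Γ A l N lam P mult T y) {x : E} (hx : x ∈ U)

include hS hx

theorem negGrad_smooth : ContDiffAt ℝ ∞ (negGrad Γ T) x := by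
  have h1 := (hS.T_smooth x hx).fderiv_right (m := ∞) (by simp)
  have h2 : ContDiffAt ℝ ∞ (fun y => (Γ y).flip) x :=
    (ContinuousLinearMap.flipₗᵢ ℝ E E E).contDiff.contDiffAt.comp x (hS.Γ_smooth x hx)
  exact (h1.add (h2.clm_apply (hS.T_smooth x hx))).neg

theorem lam_sub_ne (a : ι) : lam (some a) x - l x ≠ 0 := by
  rw [← hS.lam_none x hx]
  exact sub_ne_zero.mpr ((hS.lam_inj x hx).ne (Option.some_ne_none a))

theorem gradEigenvalue_smooth (a : ι) : ContDiffAt ℝ ∞ (gradEigenvalue T l (lam (some a))) x :=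
  (contDiffAt_along (hS.T_smooth x hx) (hS.lam_smooth x hx _)).div
    ((hS.lam_smooth x hx _).sub (hS.l_smooth x hx)) (hS.lam_sub_ne hx a)

theorem along_lam (a : ι) : along T (lam (some a)) x =
    gradEigenvalue T l (lam (some a)) x * (lam (some a) x - l x) :=
  (div_mul_cancel₀ _ (hS.lam_sub_ne hx a)).symm

theorem negGrad_T : negGrad Γ T x (T x) = 0 := by
  rw [negGrad_apply, hS.covVec_T_self hx, neg_zero]

/-- The gradient of such an `f` is `along T f • T`; this is the symmetry of its Hessian. -/
theorem along_grad {f : E → ℝ} (hf : ∀ y ∈ U, ContDiffAt ℝ ∞ f y)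
    (h : ∀ y ∈ U, ∀ u, fderiv ℝ f y u = along T f y * g y (T y) u) (u v : E) :
    fderiv ℝ (along T f) x u * g x (T x) v + along T f x * g x (covVec Γ u T x) v =
      fderiv ℝ (along T f) x v * g x (T x) u + along T f x * g x (covVec Γ v T x) u := by
  have hs := contDiffAt_along (hS.T_smooth x hx) (hf x hx)
  have h1 := hS.toLeviCivita.grad_symm hx (hf x hx) (hs.smul (hS.T_smooth x hx))
    (fun y hy u => by
      change _ = g y (along T f y • T y) u
      rw [h y hy, map_smul, smul_apply, smul_eq_mul]) u v
  have h2 : ∀ u, covVec Γ u (along T f • T) x =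
      fderiv ℝ (along T f) x u • T x + along T f x • covVec Γ u T x := fun u =>
    covVec_smul (differentiableAt_of_smooth hs) (differentiableAt_of_smooth (hS.T_smooth x hx))
  rw [h2, h2] at h1
  simpa using h1

/-- Functions that only vary in the direction of `T` have the same property for their derivative
along `T`. -/
theorem fderiv_along {f : E → ℝ} (hf : ∀ y ∈ U, ContDiffAt ℝ ∞ f y)
    (h : ∀ y ∈ U, ∀ u, fderiv ℝ f y u = along T f y * g y (T y) u) (u : E) :
    fderiv ℝ (along T f) x u = along T (along T f) x * g x (T x) u := by
  have h1 := hS.along_grad hx hf h u (T x)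
  rw [hS.T_unit x hx, hS.covVec_T_T hx, hS.covVec_T_self hx, map_zero, zero_apply] at h1
  rw [along]
  linear_combination h1

theorem along_l : along T l x = y x := by
  rw [along, hS.fderiv_l hx, hS.T_unit x hx, mul_one]

theorem fderiv_l_along (u : E) : fderiv ℝ l x u = along T l x * g x (T x) u := by
  rw [hS.along_l hx, hS.fderiv_l hx]

theorem along_congr {f h : E → ℝ} (hfh : ∀ z ∈ U, f z = h z) : along T f x = along T h x := by
  have h1 : f =ᶠ[nhds x] h := by
    filter_upwards [hS.isOpen.mem_nhds hx] with z hz using hfh z hz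
  rw [along, along, h1.fderiv_eq]

theorem fderiv_congr {f h : E → ℝ} (hfh : ∀ z ∈ U, f z = h z) : fderiv ℝ f x = fderiv ℝ h x := by
  have h1 : f =ᶠ[nhds x] h := by
    filter_upwards [hS.isOpen.mem_nhds hx] with z hz using hfh z hz
  exact h1.fderiv_eq

theorem fderiv_y (u : E) : fderiv ℝ y x u = along T y x * g x (T x) u := by
  have h1 := hS.fderiv_along hx hS.l_smooth (fun z hz u => hS.fderiv_l_along hz u) u
  rw [hS.fderiv_congr hx fun z hz => hS.along_l hz,
    hS.along_congr hx fun z hz => hS.along_l hz] at h1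
  exact h1

/-- The gradient of `l` is `y T`, and `y` itself varies only along `T`, so the symmetry of the
Hessian of `l` reduces to that of `∇T`. -/
theorem negGrad_symm (u v : E) : g x (negGrad Γ T x u) v = g x u (negGrad Γ T x v) := by
  have h1 := hS.along_grad hx hS.l_smooth (fun z hz u => hS.fderiv_l_along hz u) u v
  have h2 : ∀ u, fderiv ℝ (along T l) x u = along T y x * g x (T x) u := fun u => by
    rw [hS.fderiv_congr hx fun z hz => hS.along_l hz, hS.fderiv_y hx]
  rw [h2, h2, hS.along_l hx] at h1
  rw [hS.g_symm x hx u, negGrad_apply, negGrad_apply, map_neg, map_neg, neg_apply, neg_apply,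
    neg_inj]
  apply mul_left_cancel₀ (hS.y_pos x hx).ne'
  linear_combination h1

theorem covEnd_T_A (u : E) : covEnd Γ (T x) A x u =
    A x (negGrad Γ T x u) - l x • negGrad Γ T x u + (y x * g x (T x) u) • T x := by
  rw [hS.codazzi x hx, hS.covEnd_A_T hx, hS.fderiv_l hx, negGrad_apply]
  simp only [map_neg, smul_neg]
  abel

theorem T_P_some (a : ι) (u : E) : g x (T x) (P (some a) x u) = 0 := by
  rw [← hS.P_symm hx, hS.P_some_T hx, map_zero, zero_apply]

theorem negGrad_P_none (u : E) : negGrad Γ T x (P none x u) = 0 := by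
  rw [hS.P_none hx, map_smul, hS.negGrad_T hx, smul_zero]

/-- By Codazzi, `⟨(∇_T A) X, Y⟩` is `λ_b - l` times `⟨-∇_X T, Y⟩`. Symmetry in the two arguments
makes the same component carry the factor `λ_a - l`, and the eigenvalues differ. -/
theorem P_negGrad_P {a b : Option ι} (hab : a ≠ b) (u : E) :
    P b x (negGrad Γ T x (P a x u)) = 0 := by
  refine hS.toLeviCivita.eq_of_forall hx fun v => ?_
  rw [map_zero, zero_apply, hS.P_symm hx]
  rcases a with _ | a
  · rw [hS.negGrad_P_none hx, map_zero, zero_apply]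
  rcases b with _ | b
  · rw [hS.negGrad_symm hx, hS.negGrad_P_none hx, map_zero]
  have key : ∀ (a b : ι) (u v : E), g x (covEnd Γ (T x) A x (P (some a) x u)) (P (some b) x v) =
      (lam (some b) x - l x) * g x (negGrad Γ T x (P (some a) x u)) (P (some b) x v) := by
    intro a b u v
    rw [hS.covEnd_T_A hx]
    simp only [map_add, map_sub, map_smul, add_apply, sub_apply, smul_apply, smul_eq_mul,
      hS.A_symm x hx, hS.A_P hx, hS.T_P_some hx]
    ring
  have h1 := key a b u v
  rw [hS.A_covEnd_symm hx, hS.g_symm x hx, key b a v u, hS.negGrad_symm hx,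
    hS.g_symm x hx (P (some b) x v)] at h1
  apply mul_left_cancel₀ (sub_ne_zero.mpr ((hS.lam_inj x hx).ne hab))
  linear_combination h1

theorem negGrad_P_eq (a : Option ι) (u : E) :
    negGrad Γ T x (P a x u) = P a x (negGrad Γ T x (P a x u)) := by
  conv_lhs => rw [← hS.sum_P_apply hx (negGrad Γ T x (P a x u))]
  exact Finset.sum_eq_single a (fun b _ hb => hS.P_negGrad_P hx hb.symm u)
    (fun h => absurd (Finset.mem_univ a) h)

theorem P_negGrad (a : Option ι) (u : E) :
    P a x (negGrad Γ T x u) = negGrad Γ T x (P a x u) := by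
  conv_lhs => rw [← hS.sum_P_apply hx u]
  rw [map_sum, map_sum, hS.negGrad_P_eq hx a u]
  exact Finset.sum_eq_single a (fun b _ hb => hS.P_negGrad_P hx hb u)
    (fun h => absurd (Finset.mem_univ a) h)

/-- On the eigenspace of `λ_a` the compression of `∇_T A` is the scalar `T λ_a`, while Codazzi makes
it `λ_a - l` times `-∇T`. -/
theorem negGrad_P_some (a : ι) (u : E) : negGrad Γ T x (P (some a) x u) =
    gradEigenvalue T l (lam (some a)) x • P (some a) x u := by
  have h := hS.A_covEnd hx (some a) (T x) u
  rw [hS.covEnd_T_A hx, map_add, map_sub, map_smul, map_smul, hS.P_some_T hx, smul_zero, add_zero,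
    hS.P_A hx, ← hS.negGrad_P_eq hx, ← sub_smul] at h
  apply smul_right_injective E (hS.lam_sub_ne hx a)
  beta_reduce
  rw [h, smul_smul, mul_comm, ← hS.along_lam hx, along]

theorem negGrad_eq_sum : negGrad Γ T x =
    ∑ a, gradEigenvalue T l (lam (some a)) x • P (some a) x := by
  ext u
  conv_lhs => rw [← hS.sum_P_apply hx u]
  rw [Fintype.sum_option, map_add, hS.negGrad_P_none hx, zero_add, map_sum, sum_apply]
  exact Finset.sum_congr rfl fun a _ => by rw [hS.negGrad_P_some hx]; rfl

/-- A Codazzi equation for `-∇T`, with a defect: the Ricci identity for `T` contributes the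
curvature term. -/
theorem covEnd_negGrad (v u : E) : covEnd Γ v (negGrad Γ T) x u =
    covEnd Γ u (negGrad Γ T) x v - curv Γ v u x (T x) := by
  have hW := differentiableAt_of_smooth (hS.negGrad_smooth hx)
  have h : ∀ v u, covEnd Γ v (negGrad Γ T) x u =
      -covVec Γ v (covVec Γ u T) x + covVec Γ (Γ x v u) T x := by
    intro v u
    have h1 := covVec_apply_const (Γ := Γ) (u := v) hW u
    have h2 : (fun z => negGrad Γ T z u) = fun z => -covVec Γ u T z :=
      funext fun z => negGrad_apply z u
    have h3 : ∀ Z : E → E, covVec Γ v (fun z => -Z z) x = -covVec Γ v Z x := fun Z => by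
      simp only [covVec, fderiv_fun_neg, neg_apply, map_neg, ← neg_add]
    rw [h2, h3, negGrad_apply] at h1
    rw [h1]
    abel
  rw [h, h, ← covVec_covVec_sub (hS.Γ_smooth x hx) (hS.T_smooth x hx), hS.Γ_symm x hx v u]
  abel

theorem covEnd_negGrad_T (u : E) : covEnd Γ u (negGrad Γ T) x (T x) =
    negGrad Γ T x (negGrad Γ T x u) := by
  have h1 : (fun z => negGrad Γ T z (T z)) =ᶠ[nhds x] fun _ => (0 : E) := by
    filter_upwards [hS.isOpen.mem_nhds hx] with z hz using hS.negGrad_T hz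
  have h2 := covVec_congr (Γ := Γ) (u := u) h1
  rw [covVec_apply (differentiableAt_of_smooth (hS.negGrad_smooth hx))
    (differentiableAt_of_smooth (hS.T_smooth x hx))] at h2
  have h3 : covVec Γ u (fun _ => (0 : E)) x = 0 := by simp [covVec]
  rw [h3] at h2
  rw [negGrad_apply x u, map_neg, eq_neg_iff_add_eq_zero, h2]

/-- The Riccati equation of a geodesic field. Exchanging the directions in `∇(-∇T)` produces the
square of `-∇T` and `-R(T, X) T`, and the Gauss equation evaluates the latter as `(c + l λ_a) X`. -/
theorem along_gradEigenvalue (a : ι) : along T (gradEigenvalue T l (lam (some a))) x =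
    gradEigenvalue T l (lam (some a)) x ^ 2 + l x * lam (some a) x + c := by
  obtain ⟨u, hu⟩ : ∃ u, P (some a) x u ≠ 0 := by
    by_contra! h
    exact hS.P_ne x hx (some a) (ContinuousLinearMap.ext h)
  have h1 := congrArg (fun L => L u) (hS.P_covEnd_P hx (hS.negGrad_smooth hx)
    (hS.P_smooth x hx (some a)) (hS.gradEigenvalue_smooth hx a) (by simp [hS.P_mul x hx])
    (fun z hz => ContinuousLinearMap.ext fun v => hS.negGrad_P_some hz a v)
    (ContinuousLinearMap.ext fun v => (hS.P_negGrad hx (some a) v).trans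
      (hS.negGrad_P_some hx a v)) (T x))
  simp only [mul_apply_eq_comp, smul_apply] at h1
  rw [hS.covEnd_negGrad hx, hS.covEnd_negGrad_T hx, hS.gauss x hx] at h1
  simp only [hS.negGrad_P_some hx, map_smul, hS.T_P_some hx, hS.T_unit x hx, hS.A_T hx, hS.A_P hx,
    hS.g_symm x hx (P (some a) x u) (T x), map_sub, hS.P_self hx,
    smul_apply, smul_eq_mul, mul_zero, zero_smul, zero_sub, smul_smul, map_neg, smul_neg,
    sub_zero, add_zero, zero_add, one_smul, mul_one, zero_mul] at h1
  apply smul_left_injective ℝ hu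
  beta_reduce
  rw [along, ← h1]
  module

/-! ### Traces -/

theorem trace_P_none : opTrace E (P none x) = 1 := by
  have : P none x = (g x (T x)).smulRight (T x) :=
    ContinuousLinearMap.ext fun u => hS.P_none hx u
  rw [this, opTrace_apply]
  exact (LinearMap.trace_smulRight _ _).trans (hS.T_unit x hx)

theorem finrank_eq : ∑ a, (mult a : ℝ) + 1 = Module.finrank ℝ E := by
  have h := congrArg (opTrace E) (hS.sum_P x hx)
  rw [Fintype.sum_option, map_add, hS.trace_P_none hx, map_sum] at h
  simp only [hS.trace_P x hx] at h
  rw [opTrace_apply] at h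
  have h2 : LinearMap.trace ℝ E ((1 : E →L[ℝ] E) : E →ₗ[ℝ] E) = Module.finrank ℝ E :=
    LinearMap.trace_one ℝ E
  rw [h2] at h
  linarith

theorem A_eq_sum : A x = ∑ a, lam a x • P a x := by
  rw [← mul_one (A x), ← hS.sum_P x hx, Finset.mul_sum]
  exact Finset.sum_congr rfl fun a _ => hS.A_mul_P x hx a

theorem sum_lam : ∑ a, mult a * lam (some a) x = -3 * l x := by
  have h := hS.trace_A x hx
  rw [hS.A_eq_sum hx, Fintype.sum_option, map_add, map_smul, hS.trace_P_none hx, map_sum] at h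
  simp only [map_smul, hS.trace_P x hx, smul_eq_mul, hS.lam_none x hx] at h
  rw [Finset.sum_congr rfl fun a _ => mul_comm (mult a : ℝ) _]
  linarith

theorem sum_lam_sq : ∑ a, mult a * lam (some a) x ^ 2 = 3 * l x ^ 2 + C := by
  have h := hS.trace_A_sq x hx
  have h1 : A x * A x = ∑ a, lam a x ^ 2 • P a x := by
    have h2 : A x * A x = A x * ∑ a, lam a x • P a x := by rw [← hS.A_eq_sum hx]
    rw [h2, Finset.mul_sum]
    exact Finset.sum_congr rfl fun a _ => by
      rw [mul_smul_comm, hS.A_mul_P x hx, smul_smul, sq]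
  rw [h1, Fintype.sum_option, map_add, map_smul, hS.trace_P_none hx, map_sum] at h
  simp only [map_smul, hS.trace_P x hx, smul_eq_mul, hS.lam_none x hx] at h
  rw [Finset.sum_congr rfl fun a _ => mul_comm (mult a : ℝ) _]
  linarith

/-- The Laplacian of `l` is the trace of `∇(y T)`, namely the derivative of `y` along `T` minus `y`
times the trace of `-∇T`. -/
theorem along_y : along T y x = (∑ a, mult a * gradEigenvalue T l (lam (some a)) x) * y x +
    l x * (4 * l x ^ 2 + C - Module.finrank ℝ E * c) := by
  have hy := differentiableAt_of_smooth (hS.y_smooth x hx)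
  have hT := differentiableAt_of_smooth (hS.T_smooth x hx)
  have h1 : fderiv ℝ N x + (Γ x).flip (N x) =
      along T y x • P none x - y x • negGrad Γ T x := by
    ext u
    have h2 : N =ᶠ[nhds x] fun z => y z • T z := by
      filter_upwards [hS.isOpen.mem_nhds hx] with z hz using hS.N_eq z hz
    change covVec Γ u N x = _
    rw [covVec_congr h2, covVec_smul hy hT, hS.fderiv_y hx, sub_apply, smul_apply, smul_apply,
      hS.P_none hx, negGrad_apply, smul_neg, sub_neg_eq_add, smul_smul]
  have h3 := hS.lap x hx
  rw [h1, map_sub, map_smul, map_smul, hS.trace_P_none hx, hS.negGrad_eq_sum hx, map_sum] at h3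
  simp only [map_smul, hS.trace_P x hx, smul_eq_mul] at h3
  rw [Finset.sum_congr rfl fun a _ => mul_comm (mult a : ℝ) _]
  linarith

end SpectralChart

end Biharmonic


/-! ### Power sums, and functions varying only along `T`. -/

section PowerSums

variable {ι : Type*} [Fintype ι] {z p : ι → ℝ}

theorem sum_mul_eval_eq_zero {n : ℕ} (h : ∀ j < n, ∑ a, z a * p a ^ j = 0) {q : Polynomial ℝ}
    (hq : q.natDegree < n) : ∑ a, z a * q.eval (p a) = 0 := by
  simp only [Polynomial.eval_eq_sum_range' hq, Finset.mul_sum]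
  rw [Finset.sum_comm]
  refine Finset.sum_eq_zero fun j hj => ?_
  have := congrArg (q.coeff j * ·) (h j (Finset.mem_range.mp hj))
  beta_reduce at this
  rw [mul_zero, Finset.mul_sum] at this
  rw [← this]
  exact Finset.sum_congr rfl fun a _ => by ring

/-- All nodes are roots of one monic polynomial of degree `Fintype.card ι`, and powers can be
reduced modulo it. The nodes need not be distinct, which matters because the `ω_a` may coincide. -/
theorem power_sums_eq_zero {n : ℕ} (hn : Fintype.card ι ≤ n) (h : ∀ j < n, ∑ a, z a * p a ^ j = 0)
    (j : ℕ) : ∑ a, z a * p a ^ j = 0 := by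
  rcases isEmpty_or_nonempty ι with hι | hι
  · simp
  let q : Polynomial ℝ := ∏ a, (Polynomial.X - Polynomial.C (p a))
  have hq : q.Monic := Polynomial.monic_prod_of_monic _ _ fun a _ => Polynomial.monic_X_sub_C _
  have hdeg : q.natDegree = Fintype.card ι := by
    simp only [q]
    rw [Polynomial.natDegree_prod_of_monic _ _ fun a _ => Polynomial.monic_X_sub_C _]
    simp
  have hroot : ∀ a, q.eval (p a) = 0 := fun a => by
    simp only [q, Polynomial.eval_prod]
    exact Finset.prod_eq_zero (Finset.mem_univ a) (by simp)
  have hne : q ≠ 1 := fun h1 => by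
    rw [h1, Polynomial.natDegree_one] at hdeg
    exact Fintype.card_ne_zero hdeg.symm
  have hr := Polynomial.natDegree_modByMonic_lt (Polynomial.X ^ j : Polynomial ℝ) hq hne
  rw [hdeg] at hr
  have h1 := sum_mul_eval_eq_zero h (hr.trans_le hn)
  rw [← h1]
  refine Finset.sum_congr rfl fun a _ => ?_
  have h2 := congrArg (Polynomial.eval (p a))
    (Polynomial.modByMonic_add_div (Polynomial.X ^ j : Polynomial ℝ) q)
  rw [Polynomial.eval_add, Polynomial.eval_mul, hroot, zero_mul, add_zero, Polynomial.eval_pow,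
    Polynomial.eval_X] at h2
  rw [h2]

/-- Evaluate against the polynomial that vanishes at every node except `p a`. -/
theorem eq_zero_of_power_sums (hp : Function.Injective p) (h : ∀ j, ∑ a, z a * p a ^ j = 0)
    (a : ι) : z a = 0 := by
  classical
  let q : Polynomial ℝ := ∏ b ∈ Finset.univ.erase a, (Polynomial.X - Polynomial.C (p b))
  have h1 := sum_mul_eval_eq_zero (n := q.natDegree + 1) (fun j _ => h j) (Nat.lt_succ_self _)
  have hroot : ∀ b, b ≠ a → q.eval (p b) = 0 := fun b hb => by
    simp only [q, Polynomial.eval_prod]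
    exact Finset.prod_eq_zero (Finset.mem_erase.mpr ⟨hb, Finset.mem_univ b⟩) (by simp)
  rw [Finset.sum_eq_single a (fun b _ hb => by rw [hroot b hb, mul_zero])
    (fun h => absurd (Finset.mem_univ a) h)] at h1
  refine (mul_eq_zero.mp h1).resolve_right ?_
  simp only [q, Polynomial.eval_prod, Finset.prod_ne_zero_iff]
  intro b hb
  simpa [sub_eq_zero] using hp.ne (Finset.ne_of_mem_erase hb).symm

end PowerSums

section Radial

variable {E : Type*} [NormedAddCommGroup E] [NormedSpace ℝ E] {U : Set E}
  {g : E → E →L[ℝ] E →L[ℝ] ℝ} {T : E → E} {f h : E → ℝ}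

/-- A smooth function whose derivatives orthogonal to `T` vanish. -/
structure Radial (U : Set E) (g : E → E →L[ℝ] E →L[ℝ] ℝ) (T : E → E) (f : E → ℝ) : Prop where
  smooth : ∀ x ∈ U, ContDiffAt ℝ ∞ f x
  fderiv_eq : ∀ x ∈ U, ∀ u, g x (T x) u = 0 → fderiv ℝ f x u = 0

namespace Radial

theorem const (a : ℝ) : Radial U g T fun _ => a :=
  ⟨fun _ _ => contDiffAt_const, fun x _ u _ => by simp⟩

theorem add (hf : Radial U g T f) (hh : Radial U g T h) : Radial U g T fun x => f x + h x :=
  ⟨fun x hx => (hf.smooth x hx).add (hh.smooth x hx), fun x hx u hu => by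
    rw [fderiv_fun_add (differentiableAt_of_smooth (hf.smooth x hx))
      (differentiableAt_of_smooth (hh.smooth x hx)), add_apply, hf.fderiv_eq x hx u hu,
      hh.fderiv_eq x hx u hu, add_zero]⟩

theorem mul (hf : Radial U g T f) (hh : Radial U g T h) : Radial U g T fun x => f x * h x :=
  ⟨fun x hx => (hf.smooth x hx).mul (hh.smooth x hx), fun x hx u hu => by
    rw [fderiv_fun_mul (differentiableAt_of_smooth (hf.smooth x hx))
      (differentiableAt_of_smooth (hh.smooth x hx)), add_apply, smul_apply, smul_apply,
      hf.fderiv_eq x hx u hu, hh.fderiv_eq x hx u hu, smul_zero, smul_zero, add_zero]⟩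

theorem sub (hf : Radial U g T f) (hh : Radial U g T h) : Radial U g T fun x => f x - h x := by
  have := hf.add ((const (-1)).mul hh)
  simpa only [neg_mul, one_mul, ← sub_eq_add_neg] using this

theorem inv (hf : Radial U g T f) (h0 : ∀ x ∈ U, f x ≠ 0) : Radial U g T fun x => (f x)⁻¹ :=
  ⟨fun x hx => (hf.smooth x hx).inv (h0 x hx), fun x hx u hu => by
    have h1 : fderiv ℝ (fun x => (f x)⁻¹) x = _ := ((hasDerivAt_inv (h0 x hx)).comp_hasFDerivAt x
      (differentiableAt_of_smooth (hf.smooth x hx)).hasFDerivAt).fderiv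
    rw [h1, smul_apply, hf.fderiv_eq x hx u hu, smul_zero]⟩

theorem congr (hU : IsOpen U) (hf : Radial U g T f) (hfh : ∀ x ∈ U, f x = h x) :
    Radial U g T h := by
  have h1 : ∀ x ∈ U, h =ᶠ[nhds x] f := fun x hx => by
    filter_upwards [hU.mem_nhds hx] with z hz using (hfh z hz).symm
  exact ⟨fun x hx => (hf.smooth x hx).congr_of_eventuallyEq (h1 x hx), fun x hx u hu => by
    rw [(h1 x hx).fderiv_eq, hf.fderiv_eq x hx u hu]⟩

/-- A radial function can be divided by a radial function without zeros. -/
theorem of_mul (hU : IsOpen U) (hf : Radial U g T f) (h0 : ∀ x ∈ U, f x ≠ 0)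
    (hfh : Radial U g T fun x => f x * h x) : Radial U g T h :=
  ((hf.inv h0).mul hfh).congr hU fun x hx => by
    rw [← mul_assoc, inv_mul_cancel₀ (h0 x hx), one_mul]

end Radial

end Radial

/-! ### The principal curvatures vary only along `T`. -/

section Biharmonic

variable {E : Type*} [NormedAddCommGroup E] [NormedSpace ℝ E]

/-- The sum of `mult a * p a ^ j * w a ^ k`. -/
noncomputable def moment {ι : Type*} [Fintype ι] (mult : ι → ℕ) (p w : ι → E → ℝ) (j k : ℕ)
    (x : E) : ℝ :=
  ∑ a, mult a * (p a x ^ j * w a x ^ k)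

theorem contDiffAt_moment {ι : Type*} [Fintype ι] {mult : ι → ℕ} {p w : ι → E → ℝ} {x : E}
    (hp : ∀ a, ContDiffAt ℝ ∞ (p a) x) (hw : ∀ a, ContDiffAt ℝ ∞ (w a) x) (j k : ℕ) :
    ContDiffAt ℝ ∞ (moment mult p w j k) x :=
  ContDiffAt.sum fun a _ => contDiffAt_const.mul (((hp a).pow j).mul ((hw a).pow k))

theorem fderiv_moment {ι : Type*} [Fintype ι] {mult : ι → ℕ} {p w : ι → E → ℝ} {x : E}
    (hp : ∀ a, ContDiffAt ℝ ∞ (p a) x) (hw : ∀ a, ContDiffAt ℝ ∞ (w a) x) (j k : ℕ) (u : E) :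
    fderiv ℝ (moment mult p w j k) x u = ∑ a, mult a *
      (j * p a x ^ (j - 1) * w a x ^ k * fderiv ℝ (p a) x u +
        k * p a x ^ j * w a x ^ (k - 1) * fderiv ℝ (w a) x u) := by
  have h1 : HasFDerivAt (moment mult p w j k) _ x := HasFDerivAt.fun_sum fun a _ =>
    (((differentiableAt_of_smooth (hp a)).hasFDerivAt.pow j).fun_mul
      ((differentiableAt_of_smooth (hw a)).hasFDerivAt.pow k)).const_mul (mult a : ℝ)
  rw [h1.fderiv, sum_apply]
  refine Finset.sum_congr rfl fun a _ => ?_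
  simp only [smul_apply, add_apply, smul_eq_mul, nsmul_eq_mul]
  ring

variable [FiniteDimensional ℝ E]

namespace SpectralChart

variable {ι : Type*} [Fintype ι] [DecidableEq ι] {U : Set E} {c C : ℝ}
  {g : E → E →L[ℝ] E →L[ℝ] ℝ} {Γ : E → E →L[ℝ] E →L[ℝ] E} {A : E → E →L[ℝ] E} {l : E → ℝ}
  {N : E → E} {lam : Option ι → E → ℝ} {P : Option ι → E → E →L[ℝ] E} {mult : ι → ℕ}
  {T : E → E} {y : E → ℝ}
  (hS : SpectralChart U c C g Γ A l N lam P mult T y) {x : E}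

include hS

theorem radial_fderiv {f : E → ℝ} (hf : Radial U g T f) (hx : x ∈ U) (u : E) :
    fderiv ℝ f x u = along T f x * g x (T x) u := by
  have h := hf.fderiv_eq x hx (u - g x (T x) u • T x) (by
    rw [map_sub, map_smul, hS.T_unit x hx, smul_eq_mul, mul_one, sub_self])
  rw [map_sub, map_smul, smul_eq_mul] at h
  rw [along]
  linear_combination h

theorem radial_along {f : E → ℝ} (hf : Radial U g T f) : Radial U g T (along T f) :=
  ⟨fun x hx => contDiffAt_along (hS.T_smooth x hx) (hf.smooth x hx), fun x hx u hu => by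
    rw [hS.fderiv_along hx hf.smooth (fun z hz u => hS.radial_fderiv hf hz u) u, hu, mul_zero]⟩

theorem radial_l : Radial U g T l :=
  ⟨hS.l_smooth, fun x hx u hu => by rw [hS.fderiv_l hx, hu, mul_zero]⟩

theorem radial_y : Radial U g T y :=
  (hS.radial_along hS.radial_l).congr hS.isOpen fun _ hx => hS.along_l hx

/-- The truncated exponents `j - 1` and `k - 1` are harmless, since they occur only with the factor
`j` or `k`. -/
theorem along_moment (hx : x ∈ U) (j k : ℕ) :
    along T (moment mult (fun a => lam (some a)) (fun a => gradEigenvalue T l (lam (some a))) j k)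
      x = (j + k) * moment mult (fun a => lam (some a))
        (fun a => gradEigenvalue T l (lam (some a))) j (k + 1) x
      - j * (l x * moment mult (fun a => lam (some a))
        (fun a => gradEigenvalue T l (lam (some a))) (j - 1) (k + 1) x)
      + k * (l x * moment mult (fun a => lam (some a))
        (fun a => gradEigenvalue T l (lam (some a))) (j + 1) (k - 1) x)
      + k * (c * moment mult (fun a => lam (some a))
        (fun a => gradEigenvalue T l (lam (some a))) j (k - 1) x) := by
  rw [along, fderiv_moment (fun a => hS.lam_smooth x hx _) (fun a => hS.gradEigenvalue_smooth hx a)]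
  simp only [moment, Finset.mul_sum, ← Finset.sum_add_distrib, ← Finset.sum_sub_distrib]
  refine Finset.sum_congr rfl fun a _ => ?_
  have h1 := hS.along_lam hx a
  have h2 := hS.along_gradEigenvalue hx a
  rw [along] at h1 h2
  rw [h1, h2]
  rcases j with _ | j <;> rcases k with _ | k <;> simp only [Nat.add_sub_cancel, Nat.cast_zero,
    Nat.cast_add, Nat.cast_one] <;> ring

/-- The eigenvalues of the Weingarten operator are constant in the directions orthogonal to the
gradient of the mean curvature. -/
theorem radial_lam (hcard : Fintype.card ι ≤ 5) (a : ι) : Radial U g T (lam (some a)) := by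
  obtain ⟨μ, hμ⟩ : ∃ μ : ℕ → ℕ → E → ℝ, μ = moment mult (fun a => lam (some a))
    (fun a => gradEigenvalue T l (lam (some a))) := ⟨_, rfl⟩
  have hal : ∀ x ∈ U, ∀ j k, along T (μ j k) x = (j + k) * μ j (k + 1) x
      - j * (l x * μ (j - 1) (k + 1) x) + k * (l x * μ (j + 1) (k - 1) x)
      + k * (c * μ j (k - 1) x) := by
    intro x hx j k
    rw [hμ]
    exact hS.along_moment hx j k
  have hU := hS.isOpen
  have rl := hS.radial_l
  have ry := hS.radial_y
  have rc : ∀ r : ℝ, Radial U g T fun _ => r := fun r => Radial.const r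
  have r00 : Radial U g T (μ 0 0) := (rc (∑ a, (mult a : ℝ))).congr hU fun x _ => by
    simp [hμ, moment]
  have r10 : Radial U g T (μ 1 0) := ((rc (-3)).mul rl).congr hU fun x hx => by
    rw [← hS.sum_lam hx]
    simp [hμ, moment]
  have r20 : Radial U g T (μ 2 0) := (((rc 3).mul (rl.mul rl)).add (rc C)).congr hU fun x hx => by
    rw [← sq, ← hS.sum_lam_sq hx]
    simp [hμ, moment]
  -- The second order equation for `l` is solved for the trace of `-∇T`.
  have r01 : Radial U g T (μ 0 1) := by
    refine Radial.of_mul hU ry (fun x hx => (hS.y_pos x hx).ne')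
      (((hS.radial_along ry).sub (rl.mul (((rc 4).mul (rl.mul rl)).add
        (rc (C - Module.finrank ℝ E * c))))).congr hU fun x hx => ?_)
    rw [hS.along_y hx]
    simp only [hμ, moment, pow_zero, one_mul, pow_one]
    ring
  have ral : ∀ {j k}, Radial U g T (μ j k) → Radial U g T (along T (μ j k)) := fun h =>
    hS.radial_along h
  -- From here on each moment is obtained by differentiating a known one along `T` and solving for
  -- the only unknown term. The chain reaches the fifth power sum of the `ω_a`, enough for five
  -- values.
  have r02 : Radial U g T (μ 0 2) :=
    (((ral r01).sub (rl.mul r10)).sub ((rc c).mul r00)).congr hU fun x hx => by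
      rw [hal x hx]; push_cast; ring
  have r11 : Radial U g T (μ 1 1) :=
    ((ral r10).add (rl.mul r01)).congr hU fun x hx => by
      rw [hal x hx]; push_cast; ring
  have r12 : Radial U g T (μ 1 2) :=
    ((rc (1 / 2)).mul ((((ral r11).add (rl.mul r02)).sub (rl.mul r20)).sub
      ((rc c).mul r10))).congr hU fun x hx => by
        rw [hal x hx]; push_cast; ring
  have r03 : Radial U g T (μ 0 3) :=
    (((rc (1 / 2)).mul (ral r02)).sub ((rl.mul r11).add ((rc c).mul r01))).congr hU
      fun x hx => by rw [hal x hx]; push_cast; ring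
  have r21 : Radial U g T (μ 2 1) :=
    (((rc (1 / 2)).mul (ral r20)).add (rl.mul r11)).congr hU
      fun x hx => by rw [hal x hx]; push_cast; ring
  have r13 : Radial U g T (μ 1 3) :=
    ((rc (1 / 3)).mul (((ral r12).add (rl.mul r03)).sub ((rc 2).mul ((rl.mul r21).add
      ((rc c).mul r11))))).congr hU fun x hx => by rw [hal x hx]; push_cast; ring
  have r04 : Radial U g T (μ 0 4) :=
    (((rc (1 / 3)).mul (ral r03)).sub ((rl.mul r12).add ((rc c).mul r02))).congr hU
      fun x hx => by rw [hal x hx]; push_cast; ring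
  have r05 : Radial U g T (μ 0 5) :=
    (((rc (1 / 4)).mul (ral r04)).sub ((rl.mul r13).add ((rc c).mul r03))).congr hU
      fun x hx => by rw [hal x hx]; push_cast; ring
  have hsm : ∀ j k, ∀ x ∈ U, ContDiffAt ℝ ∞ (μ j k) x := fun j k x hx => by
    rw [hμ]
    exact contDiffAt_moment (fun a => hS.lam_smooth x hx _)
      (fun a => hS.gradEigenvalue_smooth hx a) j k
  have hfd : ∀ x ∈ U, ∀ j k u, fderiv ℝ (μ j k) x u = ∑ a, mult a *
      (j * lam (some a) x ^ (j - 1) * gradEigenvalue T l (lam (some a)) x ^ k *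
        fderiv ℝ (lam (some a)) x u +
        k * lam (some a) x ^ j * gradEigenvalue T l (lam (some a)) x ^ (k - 1) *
        fderiv ℝ (gradEigenvalue T l (lam (some a))) x u) := by
    intro x hx j k u
    rw [hμ]
    exact fderiv_moment (fun a => hS.lam_smooth x hx _)
      (fun a => hS.gradEigenvalue_smooth hx a) j k u
  have r0 : ∀ k, Radial U g T (μ 0 k) := by
    intro k
    refine ⟨hsm 0 k, fun x hx u hu => ?_⟩
    -- The first five power sums being radial says that the weighted differentials of the `ω_a`
    -- annihilate the powers below the fifth; with at most five nodes they annihilate all powers.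
    have key : ∀ j, ∑ a, (mult a * fderiv ℝ (gradEigenvalue T l (lam (some a))) x u) *
        gradEigenvalue T l (lam (some a)) x ^ j = 0 := by
      refine power_sums_eq_zero hcard fun j hj => ?_
      have hr : Radial U g T (μ 0 (j + 1)) := by
        interval_cases j
        exacts [r01, r02, r03, r04, r05]
      have h1 := hr.fderiv_eq x hx u hu
      rw [hfd x hx] at h1
      have h2 : ((j + 1 : ℕ) : ℝ) ≠ 0 := by positivity
      apply mul_left_cancel₀ h2
      rw [mul_zero, ← h1, Finset.mul_sum]
      exact Finset.sum_congr rfl fun a _ => by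
        simp only [Nat.cast_zero, Nat.add_sub_cancel, pow_zero]; ring
    rw [hfd x hx]
    have h1 := key (k - 1)
    rw [← mul_zero (k : ℝ), ← h1, Finset.mul_sum]
    exact Finset.sum_congr rfl fun a _ => by simp only [Nat.cast_zero, pow_zero]; ring
  have hall : ∀ j, ∀ k, Radial U g T (μ j k) ∧ Radial U g T (μ (j + 1) k) := by
    -- The derivative of `μ j (k + 1)` contains `μ (j + 1) k` with the nonvanishing factor `(k + 1)
    -- l`, so radiality propagates to one more power of the eigenvalues. In the end the pure power
    -- sums of the distinct `λ_a` determine their differentials.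
    have hstep : ∀ j, (∀ k, Radial U g T (μ (j - 1) k)) → (∀ k, Radial U g T (μ j k)) →
        ∀ k, Radial U g T (μ (j + 1) k) := by
      intro j h1 h2 k
      refine Radial.of_mul hU rl hS.l_ne (Radial.of_mul hU (rc (k + 1))
        (fun _ _ => by positivity) (Radial.congr hU
        ((((ral (h2 (k + 1))).sub ((rc (j + (k + 1))).mul (h2 (k + 2)))).add
          ((rc j).mul (rl.mul (h1 (k + 2))))).sub ((rc ((k + 1) * c)).mul (h2 k)))
        fun x hx => ?_))
      rw [hal x hx]
      simp only [Nat.add_sub_cancel]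
      push_cast
      ring
    intro j
    induction j with
    | zero => exact fun k => ⟨r0 k, hstep 0 r0 r0 k⟩
    | succ j ih => exact fun k => ⟨(ih k).2, hstep (j + 1) (fun k => (ih k).1)
        (fun k => (ih k).2) k⟩
  refine ⟨fun x hx => hS.lam_smooth x hx _, fun x hx u hu => ?_⟩
  have hinj : Function.Injective fun a => lam (some a) x :=
    (hS.lam_inj x hx).comp (Option.some_injective ι)
  have h1 := eq_zero_of_power_sums (z := fun a => mult a * fderiv ℝ (lam (some a)) x u) hinj
    (fun j => ?_) a
  · exact (mul_eq_zero.mp h1).resolve_left (Nat.cast_ne_zero.mpr (hS.mult_ne a))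
  · have h1 := (hall j 0).2.fderiv_eq x hx u hu
    rw [hfd x hx] at h1
    have h2 : ((j + 1 : ℕ) : ℝ) ≠ 0 := by positivity
    apply mul_left_cancel₀ h2
    rw [mul_zero, ← h1, Finset.mul_sum]
    exact Finset.sum_congr rfl fun a _ => by
      simp only [Nat.cast_zero, Nat.add_sub_cancel, pow_zero]; ring

end SpectralChart

end Biharmonic


/-! ### Second derivatives of the Weingarten operator and the Gauss equation between eigenspaces. -/

section SecondDerivative

variable {E : Type*} [NormedAddCommGroup E] [NormedSpace ℝ E]

/-- The second covariant derivative of a field of endomorphisms. -/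
noncomputable def covEnd2 (Γ : E → E →L[ℝ] E →L[ℝ] E) (v u : E) (B : E → E →L[ℝ] E) (x : E) :
    E →L[ℝ] E :=
  covEnd Γ v (covEnd Γ u B) x - covEnd Γ (Γ x v u) B x

variable {Γ : E → E →L[ℝ] E →L[ℝ] E} {U : Set E} {B D : E → E →L[ℝ] E} {f : E → ℝ} {x : E}

theorem covEnd2_mul (hU : IsOpen U) (hx : x ∈ U) (hΓ : ContDiffAt ℝ ∞ Γ x)
    (hB : ∀ y ∈ U, ContDiffAt ℝ ∞ B y) (hD : ∀ y ∈ U, ContDiffAt ℝ ∞ D y) (u : E) :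
    covEnd2 Γ u u (fun y => B y * D y) x = covEnd2 Γ u u B x * D x +
      (2 : ℝ) • (covEnd Γ u B x * covEnd Γ u D x) + B x * covEnd2 Γ u u D x := by
  have hBd := fun y hy => differentiableAt_of_smooth (hB y hy)
  have hDd := fun y hy => differentiableAt_of_smooth (hD y hy)
  have h1 : covEnd Γ u (fun y => B y * D y) =ᶠ[nhds x]
      fun y => covEnd Γ u B y * D y + B y * covEnd Γ u D y := by
    filter_upwards [hU.mem_nhds hx] with y hy using covEnd_mul (hBd y hy) (hDd y hy)
  have hB1 := differentiableAt_of_smooth (contDiffAt_covEnd (u := u) hΓ (hB x hx))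
  have hD1 := differentiableAt_of_smooth (contDiffAt_covEnd (u := u) hΓ (hD x hx))
  rw [covEnd2, covEnd2, covEnd2, covEnd_congr h1, covEnd_add (hB1.fun_mul (hDd x hx))
    ((hBd x hx).fun_mul hD1), covEnd_mul hB1 (hDd x hx), covEnd_mul (hBd x hx) hD1,
    covEnd_mul (hBd x hx) (hDd x hx), two_smul]
  noncomm_ring

theorem covEnd2_smul (hU : IsOpen U) (hx : x ∈ U) (hΓ : ContDiffAt ℝ ∞ Γ x)
    (hf : ∀ y ∈ U, ContDiffAt ℝ ∞ f y) (hD : ∀ y ∈ U, ContDiffAt ℝ ∞ D y) (u : E) :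
    covEnd2 Γ u u (fun y => f y • D y) x =
      (fderiv ℝ (fun y => fderiv ℝ f y u) x u - fderiv ℝ f x (Γ x u u)) • D x +
      (2 * fderiv ℝ f x u) • covEnd Γ u D x + f x • covEnd2 Γ u u D x := by
  have hfd := fun y hy => differentiableAt_of_smooth (hf y hy)
  have hDd := fun y hy => differentiableAt_of_smooth (hD y hy)
  have h1 : covEnd Γ u (fun y => f y • D y) =ᶠ[nhds x]
      fun y => fderiv ℝ f y u • D y + f y • covEnd Γ u D y := by
    filter_upwards [hU.mem_nhds hx] with y hy using covEnd_smul (hfd y hy) (hDd y hy)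
  have hf1 := differentiableAt_of_smooth (contDiffAt_fderiv_apply (hf x hx) u)
  have hD1 := differentiableAt_of_smooth (contDiffAt_covEnd (u := u) hΓ (hD x hx))
  rw [covEnd2, covEnd2, covEnd_congr h1, covEnd_add (hf1.fun_smul (hDd x hx))
    ((hfd x hx).fun_smul hD1), covEnd_smul hf1 (hDd x hx), covEnd_smul (hfd x hx) hD1,
    covEnd_smul (hfd x hx) (hDd x hx)]
  module

theorem covEnd2_sub_swap (hΓ : ContDiffAt ℝ ∞ Γ x) (hΓs : ∀ u v, Γ x u v = Γ x v u)
    (hB : ContDiffAt ℝ ∞ B x) (v u : E) : covEnd2 Γ v u B x - covEnd2 Γ u v B x =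
      curv Γ v u x * B x - B x * curv Γ v u x := by
  rw [covEnd2, covEnd2, hΓs u v, sub_sub_sub_cancel_right, covEnd_covEnd_sub hΓ hB]

theorem covEnd2_codazzi (hU : IsOpen U) (hx : x ∈ U) (hΓ : ContDiffAt ℝ ∞ Γ x)
    (hB : ContDiffAt ℝ ∞ B x)
    (h : ∀ y ∈ U, ∀ u v, covEnd Γ u B y v = covEnd Γ v B y u) (v u w : E) :
    covEnd2 Γ v u B x w = covEnd2 Γ v w B x u := by
  have h1 : (fun y => covEnd Γ u B y w) =ᶠ[nhds x] fun y => covEnd Γ w B y u := by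
    filter_upwards [hU.mem_nhds hx] with y hy using h y hy u w
  have h2 := covVec_congr (Γ := Γ) (u := v) h1
  rw [covVec_apply_const (differentiableAt_of_smooth (contDiffAt_covEnd hΓ hB)),
    covVec_apply_const (differentiableAt_of_smooth (contDiffAt_covEnd hΓ hB)), h x hx u,
    h x hx w] at h2
  rw [covEnd2, covEnd2, sub_apply, sub_apply, sub_eq_sub_iff_add_eq_add, add_comm _ (covEnd Γ (Γ x v u) B x w)]
  rw [add_comm (covEnd Γ v (covEnd Γ u B) x w)] at h2
  rw [add_comm, h2, add_comm]

end SecondDerivative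

section Biharmonic

variable {E : Type*} [NormedAddCommGroup E] [NormedSpace ℝ E]

theorem LeviCivita.covEnd2_selfAdj {U : Set E} {g : E → E →L[ℝ] E →L[ℝ] ℝ}
    {Γ : E → E →L[ℝ] E →L[ℝ] E} (hg : LeviCivita U g Γ) {B : E → E →L[ℝ] E} {x : E} (hx : x ∈ U)
    (hB : ∀ y ∈ U, ContDiffAt ℝ ∞ B y)
    (h : ∀ y ∈ U, ∀ v w, g y (B y v) w = g y v (B y w)) (v u a b : E) :
    g x (covEnd2 Γ v u B x a) b = g x a (covEnd2 Γ v u B x b) := by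
  rw [covEnd2, sub_apply, sub_apply, map_sub, map_sub, sub_apply,
    hg.covEnd_selfAdj hx (hB x hx) h, hg.covEnd_selfAdj hx
    (contDiffAt_covEnd (hg.Γ_smooth x hx) (hB x hx))
    fun y hy => hg.covEnd_selfAdj hy (hB y hy) h u]

/-- The relation `⟨(∇_X A) Y, Z⟩ = 0` between three eigenspaces of `A`. -/
def Decoupled {ι : Type*} (g : E → E →L[ℝ] E →L[ℝ] ℝ) (Γ : E → E →L[ℝ] E →L[ℝ] E)
    (A : E → E →L[ℝ] E) (P : Option ι → E → E →L[ℝ] E) (x : E) (a b d : ι) : Prop :=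
  ∀ u v w, g x (covEnd Γ (P (some a) x u) A x (P (some b) x v)) (P (some d) x w) = 0

variable [FiniteDimensional ℝ E]

namespace SpectralChart

variable {ι : Type*} [Fintype ι] [DecidableEq ι] {U : Set E} {c C : ℝ}
  {g : E → E →L[ℝ] E →L[ℝ] ℝ} {Γ : E → E →L[ℝ] E →L[ℝ] E} {A : E → E →L[ℝ] E} {l : E → ℝ}
  {N : E → E} {lam : Option ι → E → ℝ} {P : Option ι → E → E →L[ℝ] E} {mult : ι → ℕ}
  {T : E → E} {y : E → ℝ}
  (hS : SpectralChart U c C g Γ A l N lam P mult T y) {x : E} (hx : x ∈ U)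

include hS hx

theorem P_some_orth {a b : ι} (hab : a ≠ b) (u v : E) :
    g x (P (some a) x u) (P (some b) x v) = 0 :=
  hS.P_orth hx (fun h => hab (Option.some_injective ι h)) u v

theorem lam_some_sub_ne {a b : ι} (hab : a ≠ b) : lam (some a) x - lam (some b) x ≠ 0 :=
  sub_ne_zero.mpr ((hS.lam_inj x hx).ne fun h => hab (Option.some_injective ι h))

theorem fderiv_lam_P (hr : ∀ a, Radial U g T (lam (some a))) (a b : ι) (u : E) :
    fderiv ℝ (lam (some a)) x (P (some b) x u) = 0 :=
  (hr a).fderiv_eq x hx _ (hS.T_P_some hx b u)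

theorem A_negGrad {z : E} (hz : z ∈ U) : A z * negGrad Γ T z = negGrad Γ T z * A z := by
  rw [hS.negGrad_eq_sum hz, Finset.mul_sum, Finset.sum_mul]
  refine Finset.sum_congr rfl fun a _ => ?_
  rw [mul_smul_comm, smul_mul_assoc, hS.A_mul_P z hz]
  congr 1
  ext u
  exact (hS.P_A hz (some a) u).symm

/-- The curvature defect `R(X, Y) T` vanishes when `X` and `Y` are orthogonal to `T`, because `T` is
an eigenvector of `A`. -/
theorem covEnd_negGrad_swap (a b : ι) (u v : E) :
    covEnd Γ (P (some a) x u) (negGrad Γ T) x (P (some b) x v) =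
      covEnd Γ (P (some b) x v) (negGrad Γ T) x (P (some a) x u) := by
  rw [hS.covEnd_negGrad hx, hS.gauss x hx, hS.g_symm x hx _ (T x), hS.g_symm x hx _ (T x),
    hS.T_P_some hx, hS.T_P_some hx, hS.A_P hx, hS.A_P hx]
  simp only [map_smul, smul_apply, hS.g_symm x hx _ (T x), hS.T_P_some hx]
  simp

/-- Obtained by differentiating the commutation of `A` with `-∇T`. -/
theorem covEnd_A_negGrad (a b d : ι) (u v w : E) :
    (gradEigenvalue T l (lam (some b)) x - gradEigenvalue T l (lam (some d)) x) *
      g x (covEnd Γ (P (some a) x u) A x (P (some b) x v)) (P (some d) x w) =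
    (lam (some b) x - lam (some d) x) *
      g x (covEnd Γ (P (some a) x u) (negGrad Γ T) x (P (some b) x v)) (P (some d) x w) := by
  have hA := differentiableAt_of_smooth (hS.A_smooth x hx)
  have hW := differentiableAt_of_smooth (hS.negGrad_smooth hx)
  have h1 : (fun z => A z * negGrad Γ T z) =ᶠ[nhds x] fun z => negGrad Γ T z * A z := by
    filter_upwards [hS.isOpen.mem_nhds hx] with z hz using hS.A_negGrad hx hz
  have h2 := covEnd_congr (Γ := Γ) (u := P (some a) x u) h1
  rw [covEnd_mul hA hW, covEnd_mul hW hA] at h2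
  have h3 := congrArg (fun L : E →L[ℝ] E => g x (L (P (some b) x v)) (P (some d) x w)) h2
  simp only [add_apply, mul_apply_eq_comp, hS.negGrad_P_some hx, hS.A_P hx, map_smul, map_add,
    smul_apply, smul_eq_mul, hS.A_symm x hx, hS.negGrad_symm hx] at h3
  linear_combination h3

/-- Both `∇A` and `∇(-∇T)` are symmetric in the first two arguments here. The previous
proportionality, read with `a` and `b` exchanged, must have the same ratio as soon as the component
of `∇A` is not zero, and equality of the ratios is collinearity. -/
theorem covEnd_A_collinear {a b d : ι} {u v w : E}
    (h : g x (covEnd Γ (P (some a) x u) A x (P (some b) x v)) (P (some d) x w) ≠ 0) :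
    (lam (some a) x - lam (some d) x) *
      (gradEigenvalue T l (lam (some b)) x - gradEigenvalue T l (lam (some d)) x) =
    (lam (some b) x - lam (some d) x) *
      (gradEigenvalue T l (lam (some a)) x - gradEigenvalue T l (lam (some d)) x) := by
  have h1 := hS.covEnd_A_negGrad hx a b d u v w
  have h2 := hS.covEnd_A_negGrad hx b a d v u w
  rw [hS.codazzi x hx, hS.covEnd_negGrad_swap hx] at h2
  apply mul_right_cancel₀ h
  linear_combination (lam (some a) x - lam (some d) x) * h1 -
    (lam (some b) x - lam (some d) x) * h2

theorem P_covEnd_A_right (hr : ∀ a, Radial U g T (lam (some a))) (a b : ι) (u v : E) :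
    P (some b) x (covEnd Γ (P (some a) x u) A x (P (some b) x v)) = 0 := by
  rw [hS.A_covEnd hx, hS.fderiv_lam_P hx hr, zero_smul]

theorem P_covEnd_A_left (hr : ∀ a, Radial U g T (lam (some a))) (a b : ι) (u v : E) :
    P (some a) x (covEnd Γ (P (some a) x u) A x (P (some b) x v)) = 0 := by
  rw [hS.codazzi x hx, hS.P_covEnd_A_right hx hr]

theorem P_none_covEnd_A {a b : ι} (hab : a ≠ b) (u v : E) :
    P none x (covEnd Γ (P (some a) x u) A x (P (some b) x v)) = 0 := by
  rw [hS.P_none hx, hS.g_symm x hx, hS.A_covEnd_symm hx, hS.covEnd_A_T hx, hS.fderiv_l hx,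
    hS.T_P_some hx]
  have h1 : covVec Γ (P (some a) x u) T x =
      -(gradEigenvalue T l (lam (some a)) x • P (some a) x u) := by
    rw [← hS.negGrad_P_some hx, negGrad_apply, neg_neg]
  rw [h1, map_neg, map_smul, hS.A_P hx]
  simp [hS.P_some_orth hx hab.symm]

/-- The components in the eigenspaces of `a` and `b` vanish because the eigenvalues are constant in
these directions, and the component along `T` because `∇_X T` stays in the eigenspace of `X`. -/
theorem covEnd_A_eq_sum (hr : ∀ a, Radial U g T (lam (some a))) {a b : ι} (hab : a ≠ b) (u v : E) :
    covEnd Γ (P (some a) x u) A x (P (some b) x v) = ∑ d ∈ {d | d ≠ a ∧ d ≠ b},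
      P (some d) x (covEnd Γ (P (some a) x u) A x (P (some b) x v)) := by
  conv_lhs => rw [← hS.sum_P_apply hx (covEnd Γ (P (some a) x u) A x (P (some b) x v))]
  rw [Fintype.sum_option, hS.P_none_covEnd_A hx hab, zero_add, Finset.sum_filter]
  refine Finset.sum_congr rfl fun d _ => ?_
  by_cases h1 : d = a
  · rw [h1, hS.P_covEnd_A_left hx hr]; simp
  by_cases h2 : d = b
  · rw [h2, hS.P_covEnd_A_right hx hr]; simp
  rw [if_pos ⟨h1, h2⟩]

/-- The gradient of a radial function is a multiple of `T`, so its Hessian on vectors orthogonal to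
`T` is that multiple times `∇T`. -/
theorem hess_lam (hr : ∀ a, Radial U g T (lam (some a))) (a b : ι) (u : E) :
    fderiv ℝ (fun z => fderiv ℝ (lam (some b)) z (P (some a) x u)) x (P (some a) x u) -
      fderiv ℝ (lam (some b)) x (Γ x (P (some a) x u) (P (some a) x u)) =
    -(gradEigenvalue T l (lam (some b)) x * (lam (some b) x - l x) *
      gradEigenvalue T l (lam (some a)) x * g x (P (some a) x u) (P (some a) x u)) := by
  obtain ⟨X, hX⟩ : ∃ X, X = P (some a) x u := ⟨_, rfl⟩
  have hTX : g x (T x) X = 0 := by rw [hX, hS.T_P_some hx]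
  have hXX := hS.negGrad_P_some hx a u
  rw [← hX] at hXX ⊢
  have h1 : (fun z => fderiv ℝ (lam (some b)) z X) =ᶠ[nhds x]
      fun z => g z (along T (lam (some b)) z • T z) X := by
    filter_upwards [hS.isOpen.mem_nhds hx] with z hz
    rw [hS.radial_fderiv (hr b) hz, map_smul, smul_apply, smul_eq_mul]
  have hs := differentiableAt_of_smooth
    (contDiffAt_along (hS.T_smooth x hx) (hS.lam_smooth x hx (some b)))
  have hT := differentiableAt_of_smooth (hS.T_smooth x hx)
  rw [h1.fderiv_eq, hS.toLeviCivita.fderiv_metric hx (hs.fun_smul hT) (differentiableAt_const X),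
    covVec_smul hs hT, (hS.radial_along (hr b)).fderiv_eq x hx X hTX, zero_smul, zero_add,
    hS.radial_fderiv (hr b) hx (Γ x X X)]
  have h2 : covVec Γ X (fun _ => X) x = Γ x X X := by simp [covVec]
  have h3 : covVec Γ X T x = -(gradEigenvalue T l (lam (some a)) x • X) := by
    rw [← hXX, negGrad_apply, neg_neg]
  rw [h2, h3, ← hS.along_lam hx]
  simp only [map_smul, map_neg, smul_apply, neg_apply, smul_eq_mul]
  ring

/-- First order perturbation theory: differentiate `A P_b = λ_b P_b` and project to another
eigenspace. -/
theorem P_covEnd_P_mixed (hr : ∀ a, Radial U g T (lam (some a))) {a b d : ι} (hbd : d ≠ b)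
    (u v : E) :
    P (some d) x (covEnd Γ (P (some a) x u) (P (some b)) x (P (some b) x v)) =
      -((lam (some d) x - lam (some b) x)⁻¹ •
        P (some d) x (covEnd Γ (P (some a) x u) A x (P (some b) x v))) := by
  have hA := differentiableAt_of_smooth (hS.A_smooth x hx)
  have hP := differentiableAt_of_smooth (hS.P_smooth x hx (some b))
  have hl := differentiableAt_of_smooth (hS.lam_smooth x hx (some b))
  have h1 : (fun z => A z * P (some b) z) =ᶠ[nhds x] fun z => lam (some b) z • P (some b) z := by
    filter_upwards [hS.isOpen.mem_nhds hx] with z hz using hS.A_mul_P z hz _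
  have h2 := covEnd_congr (Γ := Γ) (u := P (some a) x u) h1
  rw [covEnd_mul hA hP, covEnd_smul hl hP, hS.fderiv_lam_P hx hr, zero_smul, zero_add] at h2
  have h3 := congrArg (fun L : E →L[ℝ] E => P (some d) x (L (P (some b) x v))) h2
  simp only [add_apply, mul_apply_eq_comp, map_add, smul_apply, map_smul, hS.P_A hx,
    hS.P_self hx] at h3
  apply smul_right_injective E (hS.lam_some_sub_ne hx hbd)
  beta_reduce
  rw [smul_neg, smul_smul, mul_inv_cancel₀ (hS.lam_some_sub_ne hx hbd), one_smul, sub_smul,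
    ← h3]
  abel

/-- Second order perturbation theory: differentiate `A P_b = λ_b P_b` twice in the direction `X` and
pair with `Y`. The second derivatives of `P_b` cancel, and the mixed term is evaluated by
`P_covEnd_P_mixed`. -/
theorem second_derivative (hr : ∀ a, Radial U g T (lam (some a))) {a b : ι} (hab : a ≠ b)
    {X Y S : E} (u v : E) (hX : X = P (some a) x u) (hY : Y = P (some b) x v)
    (hSd : S = covEnd Γ X A x Y) :
    g x (covEnd2 Γ X X A x Y) Y = -(gradEigenvalue T l (lam (some b)) x *
      (lam (some b) x - l x) * gradEigenvalue T l (lam (some a)) x * g x X X) * g x Y Y +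
      2 * ∑ d ∈ {d | d ≠ a ∧ d ≠ b}, (lam (some d) x - lam (some b) x)⁻¹ *
        g x (P (some d) x S) (P (some d) x S) := by
  have hPY : P (some b) x Y = Y := by rw [hY, hS.P_self hx]
  have hAY : A x Y = lam (some b) x • Y := by rw [hY, hS.A_P hx]
  have h1 : (fun z => A z * P (some b) z) =ᶠ[nhds x] fun z => lam (some b) z • P (some b) z := by
    filter_upwards [hS.isOpen.mem_nhds hx] with z hz using hS.A_mul_P z hz _
  have h2 : covEnd2 Γ X X (fun z => A z * P (some b) z) x =
      covEnd2 Γ X X (fun z => lam (some b) z • P (some b) z) x := by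
    have h3 : covEnd Γ X (fun z => A z * P (some b) z) =ᶠ[nhds x]
        covEnd Γ X fun z => lam (some b) z • P (some b) z :=
      h1.eventuallyEq_nhds.mono fun z hz => covEnd_congr hz
    rw [covEnd2, covEnd2, covEnd_congr h3, covEnd_congr h1]
  rw [covEnd2_mul hS.isOpen hx (hS.Γ_smooth x hx) hS.A_smooth fun z hz => hS.P_smooth z hz _,
    covEnd2_smul hS.isOpen hx (hS.Γ_smooth x hx) (fun z hz => hS.lam_smooth z hz _)
      fun z hz => hS.P_smooth z hz _] at h2
  have h4 := hS.hess_lam hx hr a b u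
  rw [← hX] at h4
  have h5 : fderiv ℝ (lam (some b)) x X = 0 := by rw [hX, hS.fderiv_lam_P hx hr]
  rw [h4, h5, mul_zero, zero_smul, add_zero] at h2
  have h6 := congrArg (fun L : E →L[ℝ] E => g x (L Y) Y) h2
  simp only [add_apply, smul_apply, mul_apply_eq_comp, map_add, map_smul, hPY, smul_eq_mul,
    hS.A_symm x hx, hAY, hS.A_covEnd_symm hx, ← hSd] at h6
  have h7 : g x (covEnd Γ X (P (some b)) x Y) S = -∑ d ∈ {d | d ≠ a ∧ d ≠ b},
      (lam (some d) x - lam (some b) x)⁻¹ * g x (P (some d) x S) (P (some d) x S) := by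
    have h8 := hS.covEnd_A_eq_sum hx hr hab u v
    rw [← hX, ← hY, ← hSd] at h8
    conv_lhs => rw [h8]
    rw [map_sum, ← Finset.sum_neg_distrib]
    refine Finset.sum_congr rfl fun d hd => ?_
    have h9 := hS.P_covEnd_P_mixed hx hr (a := a) (Finset.mem_filter.mp hd).2.2 u v
    rw [← hX, ← hY, ← hSd] at h9
    conv_lhs => rw [← hS.P_self hx, ← hS.P_symm hx, h9]
    simp
  rw [h7] at h6
  linear_combination h6

/-- The component of the Gauss equation in the planes spanned by two principal directions. -/
theorem sectional (hr : ∀ a, Radial U g T (lam (some a))) {a b : ι} (hab : a ≠ b)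
    {X Y S : E} (u v : E) (hX : X = P (some a) x u) (hY : Y = P (some b) x v)
    (hSd : S = covEnd Γ X A x Y) :
    (c + lam (some a) x * lam (some b) x + gradEigenvalue T l (lam (some a)) x *
      gradEigenvalue T l (lam (some b)) x) * (g x X X * g x Y Y) =
      2 * ∑ d ∈ {d | d ≠ a ∧ d ≠ b}, ((lam (some a) x - lam (some d) x) *
        (lam (some b) x - lam (some d) x))⁻¹ * g x (P (some d) x S) (P (some d) x S) := by
  -- Codazzi turns `∇²_{X,X} A` on `Y, Y` and `∇²_{Y,Y} A` on `X, X` into mixed second derivatives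
  -- with the same arguments. Their difference is the commutator of `A` with the curvature, hence
  -- known by the Gauss equation.
  have hc2 := covEnd2_codazzi hS.isOpen hx (hS.Γ_smooth x hx) (hS.A_smooth x hx) hS.codazzi
  have q1 := hS.second_derivative hx hr hab u v hX hY hSd
  have q2 := hS.second_derivative hx hr hab.symm v u hY hX (hSd.trans (hS.codazzi x hx _ _))
  rw [hc2] at q1 q2
  rw [hS.toLeviCivita.covEnd2_selfAdj hx hS.A_smooth hS.A_symm, hS.g_symm x hx] at q2
  have hXY : g x X Y = 0 := by rw [hX, hY, hS.P_some_orth hx hab]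
  have hAX : A x X = lam (some a) x • X := by rw [hX, hS.A_P hx]
  have hAY : A x Y = lam (some b) x • Y := by rw [hY, hS.A_P hx]
  have h1 := congrArg (fun L : E →L[ℝ] E => g x (L X) Y) (covEnd2_sub_swap (hS.Γ_smooth x hx)
    (hS.Γ_symm x hx) (hS.A_smooth x hx) X Y)
  have hR : g x (curv Γ X Y x X) Y =
      -(c + lam (some a) x * lam (some b) x) * (g x X X * g x Y Y) := by
    rw [hS.gauss x hx]
    simp only [map_add, map_sub, map_smul, add_apply, sub_apply, smul_apply, smul_eq_mul, hAX,
      hAY, hXY, hS.g_symm x hx Y X]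
    ring
  simp only [sub_apply, mul_apply_eq_comp, map_sub, hS.A_symm x hx, hAX, hAY, map_smul,
    smul_apply, smul_eq_mul, hR, q1, q2] at h1
  have hfilter : Finset.filter (fun d => d ≠ b ∧ d ≠ a) Finset.univ =
      Finset.filter (fun d => d ≠ a ∧ d ≠ b) Finset.univ :=
    Finset.filter_congr fun d _ => and_comm
  rw [hfilter] at h1
  -- Partial fractions: the common factor `λ_a - λ_b` splits off and is cancelled at the end.
  have hsum : ∑ d ∈ {d | d ≠ a ∧ d ≠ b}, (lam (some d) x - lam (some b) x)⁻¹ *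
        g x (P (some d) x S) (P (some d) x S) -
      ∑ d ∈ {d | d ≠ a ∧ d ≠ b}, (lam (some d) x - lam (some a) x)⁻¹ *
        g x (P (some d) x S) (P (some d) x S) =
      -(lam (some a) x - lam (some b) x) * ∑ d ∈ {d | d ≠ a ∧ d ≠ b},
        ((lam (some a) x - lam (some d) x) * (lam (some b) x - lam (some d) x))⁻¹ *
        g x (P (some d) x S) (P (some d) x S) := by
    rw [← Finset.sum_sub_distrib, Finset.mul_sum]
    refine Finset.sum_congr rfl fun d hd => ?_
    have hd := (Finset.mem_filter.mp hd).2
    have n1 := hS.lam_some_sub_ne hx hd.1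
    have n2 := hS.lam_some_sub_ne hx hd.2
    have n3 := hS.lam_some_sub_ne hx hd.1.symm
    have n4 := hS.lam_some_sub_ne hx hd.2.symm
    field_simp
    ring
  apply mul_left_cancel₀ (hS.lam_some_sub_ne hx hab)
  linear_combination h1 - 2 * hsum

theorem decoupled_swap {a b d : ι} (h : Decoupled g Γ A P x a b d) :
    Decoupled g Γ A P x b a d := fun u v w => by
  rw [hS.codazzi x hx, h v u w]

theorem decoupled_rotate {a b d : ι} (h : Decoupled g Γ A P x a b d) :
    Decoupled g Γ A P x a d b := fun u v w => by
  rw [hS.A_covEnd_symm hx, hS.g_symm x hx, h u w v]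

theorem P_eq_zero_of_decoupled {a b d : ι} (h : Decoupled g Γ A P x a b d) (u v : E) :
    P (some d) x (covEnd Γ (P (some a) x u) A x (P (some b) x v)) = 0 := by
  refine hS.toLeviCivita.eq_of_forall hx fun w => ?_
  rw [hS.P_symm hx, h, map_zero, zero_apply]

theorem exists_P_ne (a : ι) : ∃ u, 0 < g x (P (some a) x u) (P (some a) x u) := by
  obtain ⟨u, hu⟩ : ∃ u, P (some a) x u ≠ 0 := by
    by_contra! h
    exact hS.P_ne x hx (some a) (ContinuousLinearMap.ext h)
  exact ⟨u, hS.g_pos x hx _ hu⟩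

theorem sectional_eq_zero (hr : ∀ a, Radial U g T (lam (some a))) {a b : ι} (hab : a ≠ b)
    (h : ∀ d, d ≠ a → d ≠ b → Decoupled g Γ A P x a b d) :
    c + lam (some a) x * lam (some b) x + gradEigenvalue T l (lam (some a)) x *
      gradEigenvalue T l (lam (some b)) x = 0 := by
  obtain ⟨u, hu⟩ := hS.exists_P_ne hx a
  obtain ⟨v, hv⟩ := hS.exists_P_ne hx b
  have h1 := hS.sectional hx hr hab u v rfl rfl rfl
  rw [Finset.sum_eq_zero fun d hd => ?_, mul_zero] at h1
  · exact (mul_eq_zero.mp h1).resolve_right (mul_pos hu hv).ne'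
  · have hd := (Finset.mem_filter.mp hd).2
    rw [hS.P_eq_zero_of_decoupled hx (h d hd.1 hd.2), map_zero, mul_zero]

/-- Only the term of `e` survives in `sectional`; it is a squared norm with a nonzero coefficient.
-/
theorem decoupled_of_sectional_eq_zero (hr : ∀ a, Radial U g T (lam (some a))) {a b e : ι}
    (hab : a ≠ b) (hae : a ≠ e) (hbe : b ≠ e)
    (h : ∀ d, d ≠ a → d ≠ b → d ≠ e → Decoupled g Γ A P x a b d)
    (hK : c + lam (some a) x * lam (some b) x + gradEigenvalue T l (lam (some a)) x *
      gradEigenvalue T l (lam (some b)) x = 0) : Decoupled g Γ A P x a b e := fun u v w => by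
  have h1 := hS.sectional hx hr hab u v rfl rfl rfl
  rw [hK, zero_mul, Finset.sum_eq_single_of_mem e
    (Finset.mem_filter.mpr ⟨Finset.mem_univ e, hae.symm, hbe.symm⟩) fun d hd hde => by
      have hd := (Finset.mem_filter.mp hd).2
      rw [hS.P_eq_zero_of_decoupled hx (h d hd.1 hd.2 hde), map_zero, mul_zero]] at h1
  have h2 := (mul_eq_zero.mp ((mul_eq_zero.mp h1.symm).resolve_left two_ne_zero)).resolve_left
    (inv_ne_zero (mul_ne_zero (hS.lam_some_sub_ne hx hae) (hS.lam_some_sub_ne hx hbe)))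
  rw [← hS.P_symm hx, hS.toLeviCivita.eq_zero_of_self hx h2, map_zero, zero_apply]

end SpectralChart

end Biharmonic


/-! ### Nonexistence of spectral charts. -/

section Biharmonic

variable {E : Type*} [NormedAddCommGroup E] [NormedSpace ℝ E] [FiniteDimensional ℝ E]

namespace SpectralChart

variable {ι : Type*} [Fintype ι] [DecidableEq ι] {U : Set E} {c C : ℝ}
  {g : E → E →L[ℝ] E →L[ℝ] ℝ} {Γ : E → E →L[ℝ] E →L[ℝ] E} {A : E → E →L[ℝ] E} {l : E → ℝ}
  {N : E → E} {lam : Option ι → E → ℝ} {P : Option ι → E → E →L[ℝ] E} {mult : ι → ℕ}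
  {T : E → E} {y : E → ℝ}
  (hS : SpectralChart U c C g Γ A l N lam P mult T y)

include hS

/-- There is no biharmonic chart on which the gradient of the mean curvature does not vanish and
the Weingarten operator has at most six distinct eigenvalues. -/
theorem eq_empty (hcard : Fintype.card ι ≤ 5) : U = ∅ := by
  by_contra hne
  obtain ⟨x₀, hx₀⟩ := Set.nonempty_iff_ne_empty.mpr hne
  have hr := hS.radial_lam hcard
  -- Along an integral curve of `T` the operator `along T` becomes the time derivative, and the
  -- identities in the chart become the hypotheses of `curve_contradiction`.
  obtain ⟨r, hr0, ε, hε, hflow⟩ :=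
    ((hS.T_smooth x₀ hx₀).of_le (by norm_cast) :
      ContDiffAt ℝ 1 T x₀).exists_forall_mem_closedBall_exists_eq_forall_mem_Ioo_hasDerivAt 0
  obtain ⟨γ, hγ0, hγ⟩ := hflow x₀ (Metric.mem_closedBall_self hr0.le)
  have hcont : ContinuousAt γ 0 :=
    (hγ 0 ⟨by linarith, by linarith⟩).continuousAt
  have hU : ∀ᶠ t in nhds (0 : ℝ), γ t ∈ U :=
    hcont.eventually_mem (by rw [hγ0]; exact hS.isOpen.mem_nhds hx₀)
  obtain ⟨I, hI, hIo, h0I⟩ := eventually_nhds_iff.mp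
    (hU.and (Ioo_mem_nhds (show (0 : ℝ) - ε < 0 by linarith) (show (0 : ℝ) < 0 + ε by linarith)))
  have hcomp : ∀ {f : E → ℝ}, (∀ x ∈ U, ContDiffAt ℝ ∞ f x) → ∀ t ∈ I,
      HasDerivAt (fun t => f (γ t)) (along T f (γ t)) t := fun {f} hf t ht =>
    (differentiableAt_of_smooth (hf _ (hI t ht).1)).hasFDerivAt.comp_hasDerivAt t
      (hγ t (hI t ht).2)
  refine curve_contradiction (mult := mult) (c := c) (C := C) (n := Module.finrank ℝ E)
    (l := fun t => l (γ t)) (y := fun t => y (γ t)) (p := fun a t => lam (some a) (γ t))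
    (w := fun a t => gradEigenvalue T l (lam (some a)) (γ t)) hcard hIo ⟨0, h0I⟩ hS.mult_ne
    (hS.finrank_eq hx₀) (fun t ht => ?_) (fun t ht => (hS.y_pos _ (hI t ht).1).ne')
    (fun t ht => hS.l_ne _ (hI t ht).1) (fun t ht a => ?_) (fun t ht a => ?_)
    (fun t ht => (hS.lam_inj _ (hI t ht).1).comp (Option.some_injective ι))
    (fun t ht => hS.sum_lam (hI t ht).1) (fun t ht => hS.sum_lam_sq (hI t ht).1) (fun t ht => ?_)
    (fun t => Decoupled g Γ A P (γ t)) (fun t ht a b d => hS.decoupled_swap (hI t ht).1)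
    (fun t ht a b d => hS.decoupled_rotate (hI t ht).1) (fun t ht a b d _ _ _ hZ => ?_)
    (fun t ht a b hab h => hS.sectional_eq_zero (hI t ht).1 hr hab h)
    (fun t ht a b e hab hae hbe h hK =>
      hS.decoupled_of_sectional_eq_zero (hI t ht).1 hr hab hae hbe h hK)
  · rw [← hS.along_l (hI t ht).1]
    exact hcomp hS.l_smooth t ht
  · rw [← hS.along_lam (hI t ht).1]
    exact hcomp (fun x hx => hS.lam_smooth x hx _) t ht
  · rw [← hS.along_gradEigenvalue (hI t ht).1]
    exact hcomp (fun x hx => hS.gradEigenvalue_smooth hx a) t ht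
  · rw [← hS.along_y (hI t ht).1]
    exact hcomp hS.y_smooth t ht
  · simp only [Decoupled, not_forall] at hZ
    obtain ⟨u, v, w, h⟩ := hZ
    linear_combination hS.covEnd_A_collinear (hI t ht).1 h

end SpectralChart

end Biharmonic


/-! ### Smooth eigenvalues of a diagonalisable family. -/

section SelfAdjoint

open Module.End

/-- The eigenspaces of an endomorphism which is self-adjoint with respect to a positive definite
bilinear form span. -/
theorem iSup_eigenspace_eq_top {V : Type*} [AddCommGroup V] [Module ℝ V] [FiniteDimensional ℝ V]
    (b : V →ₗ[ℝ] V →ₗ[ℝ] ℝ) (hsymm : ∀ u v, b u v = b v u) (hpos : ∀ u, u ≠ 0 → 0 < b u u)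
    (B : V →ₗ[ℝ] V) (hB : ∀ u v, b (B u) v = b u (B v)) : ⨆ s, eigenspace B s = ⊤ := by
  let core : InnerProductSpace.Core ℝ V :=
    { inner := fun u v => b u v
      conj_inner_symm := fun u v => hsymm v u
      re_inner_nonneg := fun u => by
        by_cases h : u = 0
        · simp [h]
        · exact (hpos u h).le
      add_left := fun u v w => by simp
      smul_left := fun u v r => by simp
      definite := fun u h => by
        by_contra hne
        exact (hpos u hne).ne' h }
  letI : NormedAddCommGroup V := core.toNormedAddCommGroup
  letI : InnerProductSpace ℝ V := InnerProductSpace.ofCore core.toCore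
  have hT : B.IsSymmetric := fun u v => hB u v
  exact Submodule.orthogonal_eq_bot_iff.mp hT.orthogonalComplement_iSup_eigenspaces_eq_bot

end SelfAdjoint

section FunctionalCalculus

open Polynomial

variable {E : Type*} [NormedAddCommGroup E] [NormedSpace ℝ E] {ι : Type*}

theorem aeval_apply_of_eigenvector {B : E →L[ℝ] E} {s : ℝ} {v : E} (h : B v = s • v) (p : ℝ[X]) :
    aeval B p v = p.eval s • v := by
  induction p using Polynomial.induction_on' with
  | add p q hp hq => rw [map_add, add_apply, hp, hq, eval_add, add_smul]
  | monomial n a =>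
    rw [aeval_monomial, eval_monomial, mul_smul, Algebra.algebraMap_eq_smul_one, smul_mul_assoc,
      one_mul, smul_apply]
    congr 1
    induction n with
    | zero => simp
    | succ n ih => rw [pow_succ, mul_apply_eq_comp, h, map_smul, ih, smul_smul, pow_succ, mul_comm]

theorem contDiff_aeval_nodal [Fintype ι] [DecidableEq ι] (s : Finset ι) :
    ContDiff ℝ ∞ fun q : (E →L[ℝ] E) × (ι → ℝ) => aeval q.1 (Lagrange.nodal s q.2) := by
  induction s using Finset.induction_on with
  | empty => simpa using contDiff_const
  | insert a s ha ih =>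
    have h1 : (fun q : (E →L[ℝ] E) × (ι → ℝ) => aeval q.1 (Lagrange.nodal (insert a s) q.2)) =
        fun q => (q.1 - q.2 a • (1 : E →L[ℝ] E)) * aeval q.1 (Lagrange.nodal s q.2) := by
      funext q
      rw [Lagrange.nodal_insert_eq_nodal ha, map_mul, map_sub, aeval_X, aeval_C,
        Algebra.algebraMap_eq_smul_one]
    rw [h1]
    exact (contDiff_fst.sub (((contDiff_apply ℝ ℝ a).comp contDiff_snd).smul
      contDiff_const)).clm_comp ih

theorem basis_eq_smul_nodal [DecidableEq ι] (s : Finset ι) (v : ι → ℝ) (i : ι) :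
    Lagrange.basis s v i =
      C (∏ j ∈ s.erase i, (v i - v j)⁻¹) * Lagrange.nodal (s.erase i) v := by
  rw [Lagrange.basis, map_prod, Lagrange.nodal, ← Finset.prod_mul_distrib]
  rfl

variable [FiniteDimensional ℝ E]

/-- The product over the eigenvalues annihilates `B`; a power of `X` pads it to degree exactly `q`,
so that the difference with another monic polynomial of degree `q` drops in degree. -/
theorem exists_monic_annihilator {B : E →L[ℝ] E}
    (h : ⨆ s, Module.End.eigenspace (B : E →ₗ[ℝ] E) s = ⊤) {q : ℕ}
    (hq : {s | Module.End.HasEigenvalue (B : E →ₗ[ℝ] E) s}.ncard ≤ q) :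
    ∃ p : ℝ[X], p.Monic ∧ p.natDegree = q ∧ aeval B p = 0 := by
  have hfin : {s | Module.End.HasEigenvalue (B : E →ₗ[ℝ] E) s}.Finite :=
    Module.End.finite_hasEigenvalue _
  rw [Set.ncard_eq_toFinset_card _ hfin] at hq
  refine ⟨Lagrange.nodal hfin.toFinset id * X ^ (q - hfin.toFinset.card),
    Lagrange.nodal_monic.mul (monic_X_pow _), ?_, ?_⟩
  · rw [Lagrange.nodal_monic.natDegree_mul (monic_X_pow _), Lagrange.natDegree_nodal,
      natDegree_X_pow]
    omega
  · have h0 : aeval B (Lagrange.nodal hfin.toFinset id) = 0 := by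
      ext v
      have hv : v ∈ ⨆ s, Module.End.eigenspace (B : E →ₗ[ℝ] E) s := h ▸ Submodule.mem_top
      induction hv using Submodule.iSup_induction' with
      | mem s v hv =>
        have hBv : B v = s • v := Module.End.mem_eigenspace_iff.mp hv
        rw [aeval_apply_of_eigenvector hBv]
        by_cases h0 : v = 0
        · simp [h0]
        · have hs : s ∈ hfin.toFinset := hfin.mem_toFinset.mpr
            (Module.End.hasEigenvalue_of_hasEigenvector ⟨hv, h0⟩)
          rw [show s = id s from rfl, Lagrange.eval_nodal_at_node hs, zero_smul, zero_apply]
      | zero => simp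
      | add v w _ _ hv hw => rw [map_add, hv, hw, map_add]
    rw [map_mul, h0, zero_mul]

/-- The eigenvalues of a diagonalizable endomorphism depend smoothly on it as long as their number
is maximal. -/
theorem exists_smooth_eigenvalues [Fintype ι] [DecidableEq ι] {U : Set E} (hU : IsOpen U)
    {A : E → E →L[ℝ] E} (hA : ∀ x ∈ U, ContDiffAt ℝ ∞ A x)
    (hdiag : ∀ x ∈ U, ⨆ s, Module.End.eigenspace (A x : E →ₗ[ℝ] E) s = ⊤)
    (hmax : ∀ x ∈ U, {s | Module.End.HasEigenvalue (A x : E →ₗ[ℝ] E) s}.ncard ≤ Fintype.card ι)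
    {x₀ : E} (hx₀ : x₀ ∈ U) {r : ι → ℝ} (hr : Function.Injective r)
    (hr' : ∀ a, Module.End.HasEigenvalue (A x₀ : E →ₗ[ℝ] E) (r a)) :
    ∃ μ : E → ι → ℝ, μ x₀ = r ∧ (∀ᶠ x in nhds x₀, ContDiffAt ℝ ∞ μ x) ∧
      ∀ᶠ x in nhds x₀, aeval (A x) (Lagrange.nodal Finset.univ (μ x)) = 0 := by
  choose v hv using fun a => (hr' a).exists_hasEigenvector
  have hAv : ∀ a, A x₀ (v a) = r a • v a := fun a => (hv a).apply_eq_smul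
  choose f hf using fun a => SeparatingDual.exists_eq_one (R := ℝ) (hv a).2
  have hprod : ∀ a, ∏ b ∈ Finset.univ.erase a, (r a - r b) ≠ 0 := fun a =>
    Finset.prod_ne_zero_iff.mpr fun b hb => sub_ne_zero.mpr (hr.ne (Finset.ne_of_mem_erase hb).symm)
  -- On polynomials in `A x₀` the functional `φ` reads off the Lagrange coefficients: it is dual to
  -- the nodal polynomials with one node removed, as `hφn` states.
  let φ : (E →L[ℝ] E) →L[ℝ] (ι → ℝ) := ContinuousLinearMap.pi fun a =>
    (∏ b ∈ Finset.univ.erase a, (r a - r b))⁻¹ • (f a).comp (ContinuousLinearMap.apply ℝ E (v a))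
  have hφ : ∀ B a, φ B a = (∏ b ∈ Finset.univ.erase a, (r a - r b))⁻¹ * f a (B (v a)) :=
    fun B a => rfl
  have hφp : ∀ (p : ℝ[X]) a, φ (aeval (A x₀) p) a =
      (∏ b ∈ Finset.univ.erase a, (r a - r b))⁻¹ * p.eval (r a) := fun p a => by
    rw [hφ, aeval_apply_of_eigenvector (hAv a), map_smul, hf, smul_eq_mul, mul_one]
  have hφn : ∀ a b, φ (aeval (A x₀) (Lagrange.nodal (Finset.univ.erase b) r)) a =
      if a = b then 1 else 0 := fun a b => by
    rw [hφp]
    split_ifs with hab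
    · rw [hab, Lagrange.eval_nodal, inv_mul_cancel₀ (hprod b)]
    · rw [Lagrange.eval_nodal_at_node (Finset.mem_erase.mpr ⟨hab, Finset.mem_univ a⟩), mul_zero]
  -- The eigenvalues near `x₀` are found by the inverse function theorem as the zeros `m` of `F (x,
  -- ·)`. At `(x₀, r)` the derivative of `F` in the second variable is minus the identity.
  let F : E × (ι → ℝ) → ι → ℝ := fun q => φ (aeval (A q.1) (Lagrange.nodal Finset.univ q.2))
  have hF : ∀ q : E × (ι → ℝ), q.1 ∈ U → ContDiffAt ℝ ∞ F q := fun q hq =>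
    φ.contDiff.contDiffAt.comp q ((contDiff_aeval_nodal Finset.univ).contDiffAt.comp q
      (((hA _ hq).comp q contDiffAt_fst).prodMk contDiffAt_snd))
  have hF0 : F (x₀, r) = 0 := funext fun a => by
    change φ (aeval (A x₀) (Lagrange.nodal Finset.univ r)) a = 0
    rw [hφp, Lagrange.eval_nodal_at_node (Finset.mem_univ a), mul_zero]
  have hFd := (differentiableAt_of_smooth (hF (x₀, r) hx₀)).hasFDerivAt
  have hFsingle : ∀ b, fderiv ℝ F (x₀, r) (0, Pi.single b 1) = -Pi.single b 1 := by
    intro b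
    have h1 : HasDerivAt (fun t : ℝ => ((x₀, r + t • Pi.single b 1) : E × (ι → ℝ)))
        (0, Pi.single b 1) 0 := by
      have := ((hasDerivAt_id (0 : ℝ)).smul_const (Pi.single b (1 : ℝ) : ι → ℝ)).const_add r
      rw [one_smul] at this
      exact (hasDerivAt_const (0 : ℝ) x₀).prodMk this
    have hFd' : HasFDerivAt F (fderiv ℝ F (x₀, r)) (x₀, r + (0 : ℝ) • Pi.single b 1) := by
      rwa [zero_smul, add_zero]
    have h2 := hFd'.comp_hasDerivAt (0 : ℝ) h1
    have h3 : (F ∘ fun t : ℝ => ((x₀, r + t • Pi.single b 1) : E × (ι → ℝ))) =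
        fun t => (-t) • (Pi.single b 1 : ι → ℝ) := by
      funext t a
      change φ (aeval (A x₀) (Lagrange.nodal Finset.univ (r + t • Pi.single b 1))) a = _
      have h4 : Lagrange.nodal Finset.univ (r + t • Pi.single b 1) =
          (X - C (r b)) * Lagrange.nodal (Finset.univ.erase b) r -
            C t * Lagrange.nodal (Finset.univ.erase b) r := by
        rw [Lagrange.nodal_eq_mul_nodal_erase (Finset.mem_univ b)]
        have h5 : Lagrange.nodal (Finset.univ.erase b) (r + t • Pi.single b 1) =
            Lagrange.nodal (Finset.univ.erase b) r := by
          rw [Lagrange.nodal, Lagrange.nodal]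
          refine Finset.prod_congr rfl fun d hd => ?_
          simp [Finset.ne_of_mem_erase hd]
        rw [h5]
        simp
        ring
      rw [h4, ← Lagrange.nodal_eq_mul_nodal_erase (Finset.mem_univ b), map_sub, map_sub,
        map_mul (aeval (A x₀)), aeval_C, Algebra.algebraMap_eq_smul_one, smul_mul_assoc, one_mul,
        map_smul, Pi.sub_apply, Pi.smul_apply, hφn, hφp,
        Lagrange.eval_nodal_at_node (Finset.mem_univ a)]
      simp only [Pi.single_apply, Pi.smul_apply, smul_eq_mul]
      split_ifs <;> simp
    rw [h3] at h2
    have h6 := ((hasDerivAt_id (0 : ℝ)).neg.smul_const (Pi.single b (1 : ℝ) : ι → ℝ))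
    have h7 := h2.unique h6
    rw [h7]
    simp
  have hFsnd : ∀ m : ι → ℝ, fderiv ℝ F (x₀, r) (0, m) = -m := by
    intro m
    have h1 : ((0, m) : E × (ι → ℝ)) = ∑ b, m b • ((0, Pi.single b 1) : E × (ι → ℝ)) := by
      refine Prod.ext ?_ ?_
      · simp [Prod.fst_sum]
      · simp only [Prod.snd_sum, Prod.smul_snd]
        exact pi_eq_sum_univ' m |>.trans (Finset.sum_congr rfl fun b _ => by
          congr 1)
    conv_lhs => rw [h1]
    rw [map_sum]
    simp only [map_smul, hFsingle]
    ext i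
    simp [Finset.sum_apply, Pi.single_apply]
  let G : E × (ι → ℝ) → E × (ι → ℝ) := fun q => (q.1, F q)
  have hG : ∀ q : E × (ι → ℝ), q.1 ∈ U → ContDiffAt ℝ ∞ G q := fun q hq =>
    contDiffAt_fst.prodMk (hF q hq)
  let L : E × (ι → ℝ) →L[ℝ] E × (ι → ℝ) :=
    (ContinuousLinearMap.fst ℝ E (ι → ℝ)).prod (fderiv ℝ F (x₀, r))
  -- Since `L (q₁, q₂) = (q₁, D q₁ - q₂)` for a linear map `D`, it is an involution.
  have hLL : Function.LeftInverse L L := fun q => by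
    have h2 : fderiv ℝ F (x₀, r) (q.1, fderiv ℝ F (x₀, r) q) = q.2 := by
      have e1 : ∀ q : E × (ι → ℝ), fderiv ℝ F (x₀, r) q = fderiv ℝ F (x₀, r) (q.1, 0) - q.2 :=
        fun q => by
          have : q = (q.1, 0) + (0, q.2) := by simp
          conv_lhs => rw [this]
          rw [map_add, hFsnd, sub_eq_add_neg]
      rw [e1, e1 q]
      simp
    exact Prod.ext rfl h2
  let e : (E × (ι → ℝ)) ≃L[ℝ] (E × (ι → ℝ)) := ContinuousLinearEquiv.equivOfInverse L L hLL hLL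
  have hGd : HasFDerivAt G (e : E × (ι → ℝ) →L[ℝ] E × (ι → ℝ)) (x₀, r) :=
    hasFDerivAt_fst.prodMk hFd
  let H := (hG (x₀, r) hx₀).toOpenPartialHomeomorph G hGd (by simp)
  have hHsrc : (x₀, r) ∈ H.source :=
    (hG (x₀, r) hx₀).mem_toOpenPartialHomeomorph_source hGd (by simp)
  have hHG : ∀ q, H q = G q := fun q => rfl
  have hH0 : H (x₀, r) = (x₀, 0) := by rw [hHG]; exact Prod.ext rfl hF0
  have hsymm0 : H.symm (x₀, 0) = (x₀, r) := by rw [← hH0, H.left_inv hHsrc]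
  have hcont : ContinuousAt (fun x : E => H.symm (x, 0)) x₀ := by
    have h1 : ContinuousAt H.symm (x₀, 0) :=
      H.continuousAt_symm (by rw [← hH0]; exact H.map_source hHsrc)
    exact ContinuousAt.comp (g := H.symm) (f := fun x : E => ((x, 0) : E × (ι → ℝ))) h1
      (continuousAt_id.prodMk continuousAt_const)
  have htgt : ∀ᶠ x in nhds x₀, ((x, 0) : E × (ι → ℝ)) ∈ H.target :=
    (continuousAt_id.prodMk continuousAt_const : ContinuousAt
      (fun x : E => ((x, 0) : E × (ι → ℝ))) x₀).eventually_mem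
      (H.open_target.mem_nhds (by rw [id, ← hH0]; exact H.map_source hHsrc))
  have hfst : ∀ᶠ x in nhds x₀, (H.symm (x, 0)).1 = x := by
    filter_upwards [htgt] with x hx
    exact congrArg Prod.fst (H.right_inv hx)
  have hFz : ∀ᶠ x in nhds x₀, F (x, (H.symm (x, 0)).2) = 0 := by
    filter_upwards [htgt, hfst] with x hx h1
    have h2 := congrArg Prod.snd (H.right_inv hx)
    change F (H.symm (x, 0)) = 0 at h2
    rwa [show H.symm (x, 0) = (x, (H.symm (x, 0)).2) from Prod.ext h1 rfl] at h2
  -- Smoothness of the local inverse is wanted at all nearby points, so the derivative must stay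
  -- invertible there.
  have hinv : ∀ᶠ q in nhds ((x₀, r) : E × (ι → ℝ)),
      ∃ e' : (E × (ι → ℝ)) ≃L[ℝ] (E × (ι → ℝ)), (e' : E × (ι → ℝ) →L[ℝ] E × (ι → ℝ)) =
        fderiv ℝ G q := by
    have h1 : ContinuousAt (fderiv ℝ G) (x₀, r) :=
      (hG (x₀, r) hx₀).continuousAt_fderiv (by simp)
    have h2 := h1.eventually_mem (s := Set.range ((↑) : ((E × (ι → ℝ)) ≃L[ℝ] (E × (ι → ℝ))) →
      (E × (ι → ℝ) →L[ℝ] E × (ι → ℝ)))) (by rw [hGd.fderiv]; exact e.nhds)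
    exact h2
  have hUev : ∀ᶠ x in nhds x₀, x ∈ U := hU.mem_nhds hx₀
  have hμ : ∀ᶠ x in nhds x₀, ContDiffAt ℝ ∞ (fun x => (H.symm (x, 0)).2) x := by
    have h1 := hcont.eventually (p := fun q => ∃ e' : (E × (ι → ℝ)) ≃L[ℝ] (E × (ι → ℝ)),
      (e' : E × (ι → ℝ) →L[ℝ] E × (ι → ℝ)) = fderiv ℝ G q) (by beta_reduce; rwa [hsymm0])
    filter_upwards [h1, htgt, hfst, hUev] with x ⟨e', he'⟩ hx hx1 hxU
    have h2 : ContDiffAt ℝ ∞ H.symm (x, 0) := by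
      have hGx := hG (H.symm (x, 0)) (by rwa [hx1])
      refine H.contDiffAt_symm hx (f₀' := e') ?_ hGx
      rw [he']
      exact (differentiableAt_of_smooth hGx).hasFDerivAt
    exact contDiffAt_snd.comp x (ContDiffAt.comp x (g := H.symm)
      (f := fun x : E => ((x, 0) : E × (ι → ℝ))) h2 (contDiffAt_id.prodMk contDiffAt_const))
  have hμ0 : (H.symm (x₀, 0)).2 = r := by rw [hsymm0]
  refine ⟨fun x => (H.symm (x, 0)).2, hμ0, hμ, ?_⟩
  have hμc : ContinuousAt (fun x => (H.symm (x, 0)).2) x₀ := continuousAt_snd.comp hcont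
  have hinj : ∀ᶠ x in nhds x₀, Function.Injective (H.symm (x, 0)).2 := by
    have : ∀ a b, a ≠ b → ∀ᶠ x in nhds x₀, (H.symm (x, 0)).2 a - (H.symm (x, 0)).2 b ≠ 0 :=
      fun a b hab => (((continuousAt_pi.mp hμc a).sub (continuousAt_pi.mp hμc b))).eventually_ne
        (by rw [Pi.sub_apply, hμ0]; exact sub_ne_zero.mpr (hr.ne hab))
    have h2 : ∀ᶠ x in nhds x₀, ∀ a b, a ≠ b →
        (H.symm (x, 0)).2 a - (H.symm (x, 0)).2 b ≠ 0 := by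
      simp only [Filter.eventually_all]
      exact fun a b hab => this a b hab
    filter_upwards [h2] with x hx a b hab
    by_contra hne
    exact hx a b hne (sub_eq_zero.mpr hab)
  -- `F = 0` only says that `φ` annihilates the nodal polynomial of `A x`. That polynomial and a
  -- monic annihilator of degree `Fintype.card ι` differ by a combination of nodal polynomials with
  -- one node removed; `φ` sees its coefficients through `M x`, which is invertible near `x₀`
  -- because `M x₀ = 1`. So the coefficients vanish.
  let M : E → Matrix ι ι ℝ := fun x => Matrix.of fun a b =>
    φ (aeval (A x) (Lagrange.nodal (Finset.univ.erase b) (H.symm (x, 0)).2)) a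
  have hM : ∀ᶠ x in nhds x₀, (M x).det ≠ 0 := by
    have hMc : ContinuousAt M x₀ := by
      refine continuousAt_pi.mpr fun a => continuousAt_pi.mpr fun b => ?_
      refine (continuous_apply a).continuousAt.comp (φ.continuous.continuousAt.comp ?_)
      exact ((contDiff_aeval_nodal (E := E) (Finset.univ.erase b)).continuous.continuousAt).comp
        (f := fun x => (A x, (H.symm (x, 0)).2)) ((hA x₀ hx₀).continuousAt.prodMk hμc)
    have hdet : ContinuousAt (fun x => (M x).det) x₀ :=
      (Continuous.matrix_det continuous_id).continuousAt.comp hMc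
    refine hdet.eventually_ne ?_
    have : M x₀ = 1 := by
      ext a b
      change φ (aeval (A x₀) (Lagrange.nodal (Finset.univ.erase b) (H.symm (x₀, 0)).2)) a = _
      rw [hμ0, hφn, Matrix.one_apply]
    rw [this, Matrix.det_one]
    exact one_ne_zero
  filter_upwards [hFz, hUev, hinj, hM] with x hFx hxU hxinj hMx
  obtain ⟨p, hp1, hp2, hp3⟩ := exists_monic_annihilator (hdiag x hxU) (hmax x hxU)
  obtain ⟨m, hm⟩ : ∃ m, m = (H.symm (x, 0)).2 := ⟨_, rfl⟩
  rw [← hm] at hFx hxinj ⊢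
  have hdeg : (Lagrange.nodal Finset.univ m - p).degree < (Finset.univ : Finset ι).card := by
    have h1 : (Lagrange.nodal Finset.univ m).degree = p.degree := by
      rw [Lagrange.degree_nodal, degree_eq_natDegree hp1.ne_zero, hp2]; rfl
    have h2 := degree_sub_lt h1 Lagrange.nodal_ne_zero
      (Lagrange.nodal_monic.leadingCoeff.trans hp1.leadingCoeff.symm)
    rwa [Lagrange.degree_nodal] at h2
  have h1 := Lagrange.eq_interpolate hxinj.injOn hdeg
  rw [Lagrange.interpolate_apply] at h1
  have h2 : aeval (A x) (Lagrange.nodal Finset.univ m) = ∑ b, (eval (m b)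
      (Lagrange.nodal Finset.univ m - p) * ∏ j ∈ Finset.univ.erase b, (m b - m j)⁻¹) •
      aeval (A x) (Lagrange.nodal (Finset.univ.erase b) m) := by
    have h3 := congrArg (aeval (A x)) h1
    rw [map_sub, hp3, sub_zero, map_sum] at h3
    rw [h3]
    refine Finset.sum_congr rfl fun b _ => ?_
    rw [basis_eq_smul_nodal, ← mul_assoc, ← C_mul, map_mul, aeval_C,
      Algebra.algebraMap_eq_smul_one, smul_mul_assoc, one_mul]
  have h4 : (M x).mulVec (fun b => eval (m b) (Lagrange.nodal Finset.univ m - p) *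
      ∏ j ∈ Finset.univ.erase b, (m b - m j)⁻¹) = 0 := by
    have h5 : F (x, m) = 0 := hFx
    simp only [F] at h5
    rw [h2, map_sum] at h5
    rw [← h5]
    ext a
    simp only [Matrix.mulVec, dotProduct, M, Matrix.of_apply, Finset.sum_apply, map_smul,
      Pi.smul_apply, smul_eq_mul, ← hm]
    exact Finset.sum_congr rfl fun b _ => mul_comm _ _
  have h6 := Matrix.eq_zero_of_mulVec_eq_zero hMx h4
  rw [h2]
  exact Finset.sum_eq_zero fun b _ => by rw [congrFun h6 b, Pi.zero_apply, zero_smul]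

end FunctionalCalculus


/-! ### Spectral projections, and the passage from biharmonic to spectral charts. -/

section SpectralProjections

open Polynomial

variable {E : Type*} [NormedAddCommGroup E] [NormedSpace ℝ E] {ι : Type*} [Fintype ι]
  [DecidableEq ι]

/-- The projection to the eigenspace of `B` for the eigenvalue `m a`, where `m` enumerates the
eigenvalues of `B`. -/
noncomputable def spectralProj (B : E →L[ℝ] E) (m : ι → ℝ) (a : ι) : E →L[ℝ] E :=
  aeval B (Lagrange.basis Finset.univ m a)

variable {B : E →L[ℝ] E} {m : ι → ℝ}

theorem spectralProj_eq (a : ι) : spectralProj B m a =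
    (∏ j ∈ Finset.univ.erase a, (m a - m j)⁻¹) •
      aeval B (Lagrange.nodal (Finset.univ.erase a) m) := by
  rw [spectralProj, basis_eq_smul_nodal, map_mul, aeval_C, Algebra.algebraMap_eq_smul_one,
    smul_mul_assoc, one_mul]

theorem sum_spectralProj [Nonempty ι] (hm : Function.Injective m) :
    ∑ a, spectralProj B m a = 1 := by
  simp only [spectralProj]
  rw [← map_sum, Lagrange.sum_basis hm.injOn Finset.univ_nonempty, map_one]

theorem mul_spectralProj (h : aeval B (Lagrange.nodal Finset.univ m) = 0) (a : ι) :
    B * spectralProj B m a = m a • spectralProj B m a := by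
  rw [Lagrange.nodal_eq_mul_nodal_erase (Finset.mem_univ a), map_mul, map_sub, aeval_X, aeval_C,
    Algebra.algebraMap_eq_smul_one, sub_mul, smul_mul_assoc, one_mul, sub_eq_zero] at h
  rw [spectralProj_eq, mul_smul_comm, h, smul_comm]

theorem aeval_mul_spectralProj (h : aeval B (Lagrange.nodal Finset.univ m) = 0) (p : ℝ[X]) (a : ι) :
    aeval B p * spectralProj B m a = p.eval (m a) • spectralProj B m a := by
  ext v
  have h1 : B (spectralProj B m a v) = m a • spectralProj B m a v :=
    congrArg (fun L => L v) (mul_spectralProj h a)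
  exact aeval_apply_of_eigenvector h1 p

theorem spectralProj_mul (hm : Function.Injective m)
    (h : aeval B (Lagrange.nodal Finset.univ m) = 0) (a b : ι) :
    spectralProj B m a * spectralProj B m b = if a = b then spectralProj B m a else 0 := by
  conv_lhs => rw [spectralProj, aeval_mul_spectralProj h]
  split_ifs with hab
  · rw [← hab, Lagrange.eval_basis_self hm.injOn (Finset.mem_univ a), one_smul]
  · rw [Lagrange.eval_basis_of_ne hab (Finset.mem_univ b), zero_smul]

theorem spectralProj_apply (hm : Function.Injective m) {v : E} {a : ι} (hv : B v = m a • v) :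
    spectralProj B m a v = v := by
  rw [spectralProj, aeval_apply_of_eigenvector hv,
    Lagrange.eval_basis_self hm.injOn (Finset.mem_univ a), one_smul]

theorem contDiffAt_spectralProj {A : E → E →L[ℝ] E} {μ : E → ι → ℝ} {x : E}
    (hA : ContDiffAt ℝ ∞ A x) (hμ : ContDiffAt ℝ ∞ μ x) (hinj : Function.Injective (μ x)) (a : ι) :
    ContDiffAt ℝ ∞ (fun x => spectralProj (A x) (μ x) a) x := by
  simp only [spectralProj_eq]
  have h1 := contDiffAt_pi.mp hμ
  exact (contDiffAt_prod fun b hb => ((h1 a).sub (h1 b)).inv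
    (sub_ne_zero.mpr (hinj.ne (Finset.ne_of_mem_erase hb).symm))).smul
    ((contDiff_aeval_nodal _).contDiffAt.comp x (hA.prodMk hμ))

variable [FiniteDimensional ℝ E]

/-- The trace of a projection is its rank. As an integer depending continuously on the point it will
be locally constant, which gives the multiplicities. -/
theorem opTrace_of_idempotent {Q : E →L[ℝ] E} (hQ : Q * Q = Q) :
    ∃ k : ℕ, opTrace E Q = k ∧ (Q ≠ 0 → k ≠ 0) := by
  have h1 : LinearMap.IsProj (LinearMap.range (Q : E →ₗ[ℝ] E)) (Q : E →ₗ[ℝ] E) := by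
    refine ⟨fun v => ⟨v, rfl⟩, ?_⟩
    rintro _ ⟨v, rfl⟩
    exact congrArg (fun L : E →L[ℝ] E => L v) hQ
  refine ⟨_, h1.trace, fun h0 hk => h0 ?_⟩
  rw [Submodule.finrank_eq_zero, LinearMap.range_eq_bot] at hk
  ext v
  exact congrArg (fun L : E →ₗ[ℝ] E => L v) hk

end SpectralProjections

section Biharmonic

variable {E : Type*} [NormedAddCommGroup E] [NormedSpace ℝ E] [FiniteDimensional ℝ E]

namespace BiharmonicChart

variable {U : Set E} {c C : ℝ} {g : E → E →L[ℝ] E →L[ℝ] ℝ} {Γ : E → E →L[ℝ] E →L[ℝ] E}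
  {A : E → E →L[ℝ] E} {l : E → ℝ} {N : E → E}

theorem mono (hB : BiharmonicChart U c C g Γ A l N) {V : Set E} (hV : IsOpen V) (hVU : V ⊆ U) :
    BiharmonicChart V c C g Γ A l N where
  isOpen := hV
  g_smooth x hx := hB.g_smooth x (hVU hx)
  Γ_smooth x hx := hB.Γ_smooth x (hVU hx)
  g_symm x hx := hB.g_symm x (hVU hx)
  g_pos x hx := hB.g_pos x (hVU hx)
  Γ_symm x hx := hB.Γ_symm x (hVU hx)
  compat x hx := hB.compat x (hVU hx)
  A_smooth x hx := hB.A_smooth x (hVU hx)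
  N_smooth x hx := hB.N_smooth x (hVU hx)
  l_smooth x hx := hB.l_smooth x (hVU hx)
  A_symm x hx := hB.A_symm x (hVU hx)
  codazzi x hx := hB.codazzi x (hVU hx)
  gauss x hx := hB.gauss x (hVU hx)
  trace_A x hx := hB.trace_A x (hVU hx)
  trace_A_sq x hx := hB.trace_A_sq x (hVU hx)
  grad x hx := hB.grad x (hVU hx)
  A_grad x hx := hB.A_grad x (hVU hx)
  lap x hx := hB.lap x (hVU hx)

theorem iSup_eigenspace (hB : BiharmonicChart U c C g Γ A l N) {x : E} (hx : x ∈ U) :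
    ⨆ s, Module.End.eigenspace (A x : E →ₗ[ℝ] E) s = ⊤ :=
  iSup_eigenspace_eq_top ((ContinuousLinearMap.coeLM ℝ).comp (g x : E →ₗ[ℝ] E →L[ℝ] ℝ))
    (hB.g_symm x hx) (hB.g_pos x hx) _ (hB.A_symm x hx)

/-- Near a point where the number of eigenvalues is maximal, the gradient of `l` vanishes. -/
theorem grad_eq_zero_of_max (hB : BiharmonicChart U c C g Γ A l N) {x₀ : E} (hx₀ : x₀ ∈ U)
    (hmax : ∀ x ∈ U, {s | Module.End.HasEigenvalue (A x : E →ₗ[ℝ] E) s}.ncard ≤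
      {s | Module.End.HasEigenvalue (A x₀ : E →ₗ[ℝ] E) s}.ncard)
    (hcard : {s | Module.End.HasEigenvalue (A x₀ : E →ₗ[ℝ] E) s}.ncard ≤ 6) (hl : l x₀ ≠ 0) :
    N x₀ = 0 := by
  classical
  by_contra hN
  have hfin : {s | Module.End.HasEigenvalue (A x₀ : E →ₗ[ℝ] E) s}.Finite :=
    Module.End.finite_hasEigenvalue _
  rw [Set.ncard_eq_toFinset_card _ hfin] at hmax hcard
  let κ := hfin.toFinset
  have hκ : ∀ s, s ∈ κ ↔ Module.End.HasEigenvalue (A x₀ : E →ₗ[ℝ] E) s :=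
    fun s => hfin.mem_toFinset
  have hlκ : l x₀ ∈ κ := (hκ _).mpr (Module.End.hasEigenvalue_of_hasEigenvector
    ⟨Module.End.mem_eigenspace_iff.mpr (hB.A_grad x₀ hx₀), hN⟩)
  let o : κ := ⟨l x₀, hlκ⟩
  haveI : Nonempty κ := ⟨o⟩
  obtain ⟨μ, hμ0, hμs, hμz⟩ := exists_smooth_eigenvalues hB.isOpen hB.A_smooth
    (fun x hx => hB.iSup_eigenspace hx) (by simpa using hmax) hx₀
    (r := ((↑) : κ → ℝ)) Subtype.val_injective fun a => (hκ _).mp a.2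
  have hμc : ∀ a, ContinuousAt (fun x => μ x a) x₀ := fun a =>
    (contDiffAt_pi.mp hμs.self_of_nhds a).continuousAt
  have hμinj : ∀ᶠ x in nhds x₀, Function.Injective (μ x) := by
    have h2 : ∀ᶠ x in nhds x₀, ∀ a b, a ≠ b → μ x a - μ x b ≠ 0 := by
      simp only [Filter.eventually_all]
      exact fun a b hab => ((hμc a).sub (hμc b)).eventually_ne (by
        rw [Pi.sub_apply, hμ0]; exact sub_ne_zero.mpr (Subtype.val_injective.ne hab))
    filter_upwards [h2] with x hx a b hab
    by_contra hne
    exact hx a b hne (sub_eq_zero.mpr hab)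
  have hPs := fun a => contDiffAt_spectralProj (hB.A_smooth x₀ hx₀) hμs.self_of_nhds
    hμinj.self_of_nhds a
  have hP0 : ∀ a, spectralProj (A x₀) (μ x₀) a ≠ 0 := by
    intro a ha
    obtain ⟨v, hv⟩ := ((hκ _).mp a.2).exists_hasEigenvector
    have h1 := spectralProj_apply (B := A x₀) (m := μ x₀) hμinj.self_of_nhds (v := v) (a := a)
      (by rw [hμ0]; exact hv.apply_eq_smul)
    rw [ha, zero_apply] at h1
    exact hv.2 h1.symm
  have hPne : ∀ᶠ x in nhds x₀, ∀ a, spectralProj (A x) (μ x) a ≠ 0 := by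
    simp only [Filter.eventually_all]
    exact fun a => (hPs a).continuousAt.eventually_ne (hP0 a)
  choose k hk1 hk2 using fun a => opTrace_of_idempotent
    (Q := spectralProj (A x₀) (μ x₀) a) (by
      simpa using spectralProj_mul hμinj.self_of_nhds hμz.self_of_nhds a a)
  have hktr : ∀ᶠ x in nhds x₀, ∀ a, opTrace E (spectralProj (A x) (μ x) a) = k a := by
    have h1 : ∀ᶠ x in nhds x₀, ∀ a, |opTrace E (spectralProj (A x) (μ x) a) - k a| < 1 := by
      simp only [Filter.eventually_all]
      intro a
      have h2 : ContinuousAt (fun x => |opTrace E (spectralProj (A x) (μ x) a) - k a|) x₀ :=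
        (((opTrace E).continuous.continuousAt.comp (hPs a).continuousAt).sub
          continuousAt_const).abs
      exact h2.eventually_lt continuousAt_const (by simp [hk1])
    filter_upwards [h1, hμinj, hμz] with x hx hxi hxz a
    obtain ⟨j, hj, -⟩ := opTrace_of_idempotent (Q := spectralProj (A x) (μ x) a) (by
      simpa using spectralProj_mul hxi hxz a a)
    have h2 := hx a
    rw [hj] at h2 ⊢
    have h3 : |(j : ℤ) - k a| < 1 := by exact_mod_cast h2
    have h4 := Int.abs_lt_one_iff.mp h3
    have h5 : (j : ℤ) = k a := by omega
    exact_mod_cast h5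
  have hNne : ∀ᶠ x in nhds x₀, N x ≠ 0 := (hB.N_smooth x₀ hx₀).continuousAt.eventually_ne hN
  have hlne : ∀ᶠ x in nhds x₀, l x ≠ 0 := (hB.l_smooth x₀ hx₀).continuousAt.eventually_ne hl
  have hUev : ∀ᶠ x in nhds x₀, x ∈ U := hB.isOpen.mem_nhds hx₀
  -- The gradient is an eigenvector for `l x`, so `l x` is one of the `μ x a`; near `x₀` continuity
  -- leaves only the index `o`.
  have hlμ : ∀ᶠ x in nhds x₀, μ x o = l x := by
    have h1 : ∀ᶠ x in nhds x₀, ∀ a, a ≠ o → l x - μ x a ≠ 0 := by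
      simp only [Filter.eventually_all]
      exact fun a ha => ((hB.l_smooth x₀ hx₀).continuousAt.sub (hμc a)).eventually_ne (by
        rw [Pi.sub_apply, hμ0]; exact sub_ne_zero.mpr fun h => ha (Subtype.ext h.symm))
    filter_upwards [h1, hμz, hNne, hUev] with x hx hxz hxN hxU
    have h2 := congrArg (fun L => L (N x)) hxz
    beta_reduce at h2
    rw [aeval_apply_of_eigenvector (hB.A_grad x hxU), zero_apply, smul_eq_zero,
      Lagrange.eval_nodal] at h2
    obtain ⟨a, -, ha⟩ := Finset.prod_eq_zero_iff.mp (h2.resolve_right hxN)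
    by_cases hao : a = o
    · rw [← hao]; linarith
    · exact absurd ha (hx a hao)
  obtain ⟨V, hV, hVo, hx₀V⟩ := eventually_nhds_iff.mp
    (hμs.and (hμz.and (hμinj.and (hPne.and (hktr.and (hNne.and (hlne.and (hlμ.and hUev))))))))
  let e : Option {a : κ // a ≠ o} ≃ κ := Equiv.optionSubtypeNe o
  have hgN : ∀ x ∈ V, 0 < g x (N x) (N x) := fun x hx =>
    hB.g_pos x (hV x hx).2.2.2.2.2.2.2.2 _ (hV x hx).2.2.2.2.2.1
  have hBV := hB.mono hVo fun x hx => (hV x hx).2.2.2.2.2.2.2.2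
  have hgs : ∀ x ∈ V, ContDiffAt ℝ ∞ (fun x => Real.sqrt (g x (N x) (N x))) x := fun x hx =>
    (((hBV.g_smooth x hx).clm_apply (hBV.N_smooth x hx)).clm_apply (hBV.N_smooth x hx)).sqrt
      (hgN x hx).ne'
  have hSC : SpectralChart V c C g Γ A l N (fun a x => μ x (e a))
      (fun a x => spectralProj (A x) (μ x) (e a)) (fun a => k (e (some a)))
      (fun x => (Real.sqrt (g x (N x) (N x)))⁻¹ • N x)
      (fun x => Real.sqrt (g x (N x) (N x))) :=
    { hBV with
      lam_smooth := fun x hx a => contDiffAt_pi.mp (hV x hx).1 _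
      P_smooth := fun x hx a => contDiffAt_spectralProj (hBV.A_smooth x hx) (hV x hx).1
        (hV x hx).2.2.1 _
      sum_P := fun x hx => by
        rw [e.sum_comp fun a => spectralProj (A x) (μ x) a, sum_spectralProj (hV x hx).2.2.1]
      P_mul := fun x hx a b => by
        rw [spectralProj_mul (hV x hx).2.2.1 (hV x hx).2.1]
        simp only [e.apply_eq_iff_eq]
      A_mul_P := fun x hx a => mul_spectralProj (hV x hx).2.1 _
      P_ne := fun x hx a => (hV x hx).2.2.2.1 _
      lam_inj := fun x hx => (hV x hx).2.2.1.comp e.injective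
      trace_P := fun x hx a => (hV x hx).2.2.2.2.1 _
      mult_ne := fun a => hk2 _ (hP0 _)
      lam_none := fun x hx => (hV x hx).2.2.2.2.2.2.2.1
      l_ne := fun x hx => (hV x hx).2.2.2.2.2.2.1
      T_smooth := fun x hx => ((hgs x hx).inv (Real.sqrt_pos.mpr (hgN x hx)).ne').smul
        (hBV.N_smooth x hx)
      y_smooth := hgs
      y_pos := fun x hx => Real.sqrt_pos.mpr (hgN x hx)
      N_eq := fun x hx => by
        rw [smul_smul, mul_inv_cancel₀ (Real.sqrt_pos.mpr (hgN x hx)).ne', one_smul]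
      T_unit := fun x hx => by
        have h1 := (Real.sqrt_pos.mpr (hgN x hx)).ne'
        have h2 := Real.mul_self_sqrt (hgN x hx).le
        simp only [map_smul, smul_apply, smul_eq_mul]
        field_simp
        rw [sq, h2] }
  have hcard' : Fintype.card {a : κ // a ≠ o} ≤ 5 := by
    have h1 := Fintype.card_congr e
    rw [Fintype.card_option, Fintype.card_coe] at h1
    change κ.card ≤ 6 at hcard
    omega
  have := hSC.eq_empty hcard'
  rw [this] at hx₀V
  exact hx₀V

/-- In a biharmonic chart on which the Weingarten operator has at most six eigenvalues, the mean
curvature is locally constant. -/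
theorem fderiv_eq_zero (hB : BiharmonicChart U c C g Γ A l N)
    (hcard : ∀ x ∈ U, {s | Module.End.HasEigenvalue (A x : E →ₗ[ℝ] E) s}.ncard ≤ 6)
    {x : E} (hx : x ∈ U) : fderiv ℝ l x = 0 := by
  by_contra hne
  have hN : ∀ z ∈ U, N z = 0 → fderiv ℝ l z = 0 := fun z hz h => by
    ext u
    rw [hB.grad z hz, h, map_zero, zero_apply]
  have hU : IsOpen (U ∩ {z | N z ≠ 0}) := isOpen_iff_mem_nhds.mpr fun z hz =>
    Filter.inter_mem (hB.isOpen.mem_nhds hz.1)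
      ((hB.N_smooth z hz.1).continuousAt.eventually_ne hz.2)
  have hxN : N x ≠ 0 := fun h => hne (hN x hx h)
  -- If `l` vanished wherever its gradient does not, it would vanish near `x`, and so would its
  -- derivative.
  obtain ⟨x₁, hx₁, hl₁⟩ : ∃ x₁ ∈ U ∩ {z | N z ≠ 0}, l x₁ ≠ 0 := by
    by_contra! h
    have h1 : l =ᶠ[nhds x] fun _ => 0 := by
      filter_upwards [hU.mem_nhds ⟨hx, hxN⟩] with z hz using h z hz
    apply hne
    rw [h1.fderiv_eq]
    simp
  let V := (U ∩ {z | N z ≠ 0}) ∩ {z | l z ≠ 0}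
  have hV : IsOpen V := isOpen_iff_mem_nhds.mpr fun z hz =>
    Filter.inter_mem (hU.mem_nhds hz.1)
      ((hB.l_smooth z hz.1.1).continuousAt.eventually_ne hz.2)
  let f : E → ℕ := fun z => {s | Module.End.HasEigenvalue (A z : E →ₗ[ℝ] E) s}.ncard
  have hbdd : BddAbove (f '' V) := ⟨6, by
    rintro _ ⟨z, hz, rfl⟩
    exact hcard z hz.1.1⟩
  -- The number of eigenvalues is bounded by six, so its supremum on `V` is attained.
  obtain ⟨x₀, hx₀, hmax⟩ := Nat.sSup_mem (s := f '' V) ⟨_, x₁, ⟨hx₁, hl₁⟩, rfl⟩ hbdd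
  refine hx₀.1.2 ((hB.mono hV fun z hz => hz.1.1).grad_eq_zero_of_max hx₀ (fun z hz => ?_)
    (hcard x₀ hx₀.1.1) hx₀.2)
  change f z ≤ f x₀
  rw [hmax]
  exact le_csSup hbdd ⟨z, hz, rfl⟩

end BiharmonicChart

end Biharmonic


/-! ### Metrics, Christoffel symbols and curvature in coordinates. -/

section Coordinates

variable {m : ℕ}

theorem coord_eq_sum (u : Coord m) : u = ∑ i, u i • (EuclideanSpace.single i (1 : ℝ) : Coord m) := by
  ext j
  simp [Finset.sum_apply, Pi.single_apply]

theorem coord_induction {p : Coord m → Prop} (hs : ∀ i, p (EuclideanSpace.single i 1))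
    (h0 : p 0) (hadd : ∀ u v, p u → p v → p (u + v)) (hsmul : ∀ (a : ℝ) u, p u → p (a • u))
    (u : Coord m) : p u := by
  rw [coord_eq_sum u]
  exact Finset.sum_induction _ p hadd h0 fun i _ => hsmul _ _ (hs i)

/-- The bilinear form with a given matrix. -/
noncomputable def coordBilin (G : Matrix (Fin m) (Fin m) ℝ) : Coord m →L[ℝ] Coord m →L[ℝ] ℝ :=
  ∑ i, ∑ j, G i j • (EuclideanSpace.proj (𝕜 := ℝ) i : Coord m →L[ℝ] ℝ).smulRight
    (EuclideanSpace.proj (𝕜 := ℝ) j : Coord m →L[ℝ] ℝ)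

/-- The bilinear map with given structure coefficients. -/
noncomputable def coordMul (S : Fin m → Fin m → Fin m → ℝ) : Coord m →L[ℝ] Coord m →L[ℝ] Coord m :=
  ∑ k, ∑ i, ∑ j, S k i j • (EuclideanSpace.proj (𝕜 := ℝ) i : Coord m →L[ℝ] ℝ).smulRight
    ((EuclideanSpace.proj (𝕜 := ℝ) j : Coord m →L[ℝ] ℝ).smulRight
      (EuclideanSpace.single k (1 : ℝ) : Coord m))

/-- The endomorphism with a given matrix. -/
noncomputable def coordEnd (B : Matrix (Fin m) (Fin m) ℝ) : Coord m →L[ℝ] Coord m :=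
  ∑ i, ∑ j, B i j • (EuclideanSpace.proj (𝕜 := ℝ) j : Coord m →L[ℝ] ℝ).smulRight
    (EuclideanSpace.single i (1 : ℝ) : Coord m)

theorem coordBilin_apply (G : Matrix (Fin m) (Fin m) ℝ) (u v : Coord m) :
    coordBilin G u v = ∑ i, ∑ j, G i j * u i * v j := by
  simp [coordBilin, sum_apply, mul_assoc]

theorem coordBilin_single (G : Matrix (Fin m) (Fin m) ℝ) (i j : Fin m) :
    coordBilin G (EuclideanSpace.single i 1) (EuclideanSpace.single j 1) = G i j := by
  simp [coordBilin_apply]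

theorem coordMul_apply (S : Fin m → Fin m → Fin m → ℝ) (u v : Coord m) (k : Fin m) :
    coordMul S u v k = ∑ i, ∑ j, S k i j * u i * v j := by
  simp [coordMul, sum_apply, Finset.sum_apply, Pi.single_apply, mul_assoc]

theorem coordMul_single (S : Fin m → Fin m → Fin m → ℝ) (i j k : Fin m) :
    coordMul S (EuclideanSpace.single i 1) (EuclideanSpace.single j 1) k = S k i j := by
  simp [coordMul_apply]

theorem coordEnd_apply (B : Matrix (Fin m) (Fin m) ℝ) (u : Coord m) (i : Fin m) :
    coordEnd B u i = ∑ j, B i j * u j := by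
  simp [coordEnd, sum_apply, Finset.sum_apply, Pi.single_apply]

theorem contDiffAt_smul_const {X F : Type*} [NormedAddCommGroup X] [NormedSpace ℝ X]
    [NormedAddCommGroup F] [NormedSpace ℝ F] {f : X → ℝ} {x : X} (hf : ContDiffAt ℝ ∞ f x) (v : F) :
    ContDiffAt ℝ ∞ (fun y => f y • v) x :=
  hf.smul contDiffAt_const

theorem contDiffAt_det {X : Type*} [NormedAddCommGroup X] [NormedSpace ℝ X]
    {G : X → Matrix (Fin m) (Fin m) ℝ} {x : X} (hG : ∀ i j, ContDiffAt ℝ ∞ (fun y => G y i j) x) :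
    ContDiffAt ℝ ∞ (fun y => (G y).det) x := by
  simp only [Matrix.det_apply]
  exact ContDiffAt.sum fun σ _ => (contDiffAt_prod fun i _ => hG _ _).const_smul _

/-- Cramer's rule expresses the entries of the inverse as quotients of determinants. -/
theorem contDiffAt_matrix_inv {X : Type*} [NormedAddCommGroup X] [NormedSpace ℝ X]
    {G : X → Matrix (Fin m) (Fin m) ℝ} {x : X} (hG : ∀ i j, ContDiffAt ℝ ∞ (fun y => G y i j) x)
    (hdet : (G x).det ≠ 0) (i j : Fin m) : ContDiffAt ℝ ∞ (fun y => (G y)⁻¹ i j) x := by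
  have h1 : (fun y => (G y)⁻¹ i j) = fun y => (G y).det⁻¹ *
      ((G y).updateRow j (Pi.single i 1)).det := by
    funext y
    rw [Matrix.inv_def, Ring.inverse_eq_inv', Matrix.smul_apply, Matrix.adjugate_apply, smul_eq_mul]
  rw [h1]
  refine ((contDiffAt_det hG).inv hdet).mul (contDiffAt_det fun a b => ?_)
  by_cases ha : a = j
  · subst ha
    simpa using contDiffAt_const
  · simpa [Matrix.updateRow_ne ha] using hG a b

/-- A smooth family of positive definite symmetric matrices. -/
structure IsMetricOn (U : Set (Coord m)) (G : MetricField m) : Prop where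
  isOpen : IsOpen U
  smooth : ∀ x ∈ U, ∀ i j, ContDiffAt ℝ ∞ (fun y => G y i j) x
  symm : ∀ x ∈ U, ∀ i j, G x i j = G x j i
  pos : ∀ x ∈ U, ∀ u, u ≠ 0 → 0 < coordBilin (G x) u u

namespace IsMetricOn

variable {U : Set (Coord m)} {G : MetricField m} (hG : IsMetricOn U G) {x : Coord m} (hx : x ∈ U)

include hG hx

theorem det_ne : (G x).det ≠ 0 := by
  intro h
  obtain ⟨v, hv, hGv⟩ := Matrix.exists_mulVec_eq_zero_iff.mpr h
  have h1 := hG.pos x hx (WithLp.toLp 2 v) (fun h0 => hv (by simpa using h0))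
  rw [coordBilin_apply] at h1
  have h2 : ∀ i, ∑ j, G x i j * v j = 0 := fun i => congrFun hGv i
  have h3 : ∑ i, ∑ j, G x i j * v i * v j = 0 := Finset.sum_eq_zero fun i _ => by
    rw [← mul_zero (v i), ← h2 i, Finset.mul_sum]
    exact Finset.sum_congr rfl fun j _ => by ring
  exact h1.ne' h3

theorem inv_mul (i j : Fin m) : ∑ k, (G x)⁻¹ i k * G x k j = if i = j then 1 else 0 := by
  rw [← Matrix.mul_apply, Matrix.nonsing_inv_mul _ (isUnit_iff_ne_zero.mpr (hG.det_ne hx)),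
    Matrix.one_apply]

theorem mul_inv (i j : Fin m) : ∑ k, G x i k * (G x)⁻¹ k j = if i = j then 1 else 0 := by
  rw [← Matrix.mul_apply, Matrix.mul_nonsing_inv _ (isUnit_iff_ne_zero.mpr (hG.det_ne hx)),
    Matrix.one_apply]

theorem contDiffAt_pd (i j k : Fin m) : ContDiffAt ℝ ∞ (pd i fun y => G y j k) x :=
  contDiffAt_fderiv_apply (hG.smooth x hx j k) _

theorem contDiffAt_christoffel (k i j : Fin m) : ContDiffAt ℝ ∞ (christoffel G k i j) x :=
  contDiffAt_const.mul (ContDiffAt.sum fun l _ =>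
    (contDiffAt_matrix_inv (hG.smooth x hx) (hG.det_ne hx) k l).mul
      (((hG.contDiffAt_pd hx i j l).add (hG.contDiffAt_pd hx j i l)).sub
        (hG.contDiffAt_pd hx l i j)))

theorem pd_symm (k i j : Fin m) : pd k (fun y => G y i j) x = pd k (fun y => G y j i) x := by
  have h1 : (fun y => G y i j) =ᶠ[nhds x] fun y => G y j i := by
    filter_upwards [hG.isOpen.mem_nhds hx] with y hy using hG.symm y hy i j
  rw [pd, pd, h1.fderiv_eq]

theorem lower_christoffel (i j l : Fin m) : ∑ k, christoffel G k i j x * G x k l =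
    1 / 2 * (pd i (fun y => G y j l) x + pd j (fun y => G y i l) x -
      pd l (fun y => G y i j) x) := by
  simp only [christoffel, mul_assoc, Finset.sum_mul, ← Finset.mul_sum]
  congr 1
  rw [Finset.sum_comm]
  rw [Finset.sum_eq_single l (fun s _ hs => ?_) (fun h => absurd (Finset.mem_univ l) h)]
  · rw [Finset.sum_congr rfl fun k _ => show _ = (pd i (fun y => G y j l) x +
      pd j (fun y => G y i l) x - pd l (fun y => G y i j) x) * (G x l k * (G x)⁻¹ k l) by
        rw [hG.symm x hx k l]; ring, ← Finset.mul_sum, hG.mul_inv hx, if_pos rfl, mul_one]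
  · rw [Finset.sum_congr rfl fun k _ => show _ = (pd i (fun y => G y j s) x +
      pd j (fun y => G y i s) x - pd s (fun y => G y i j) x) * (G x l k * (G x)⁻¹ k s) by
        rw [hG.symm x hx k l]; ring, ← Finset.mul_sum, hG.mul_inv hx, if_neg (Ne.symm hs),
        mul_zero]

omit hx in
theorem leviCivita : LeviCivita U (fun x => coordBilin (G x))
    (fun x => coordMul fun k i j => christoffel G k i j x) where
  isOpen := hG.isOpen
  g_smooth x hx := ContDiffAt.sum fun i _ => ContDiffAt.sum fun j _ =>
    contDiffAt_smul_const (hG.smooth x hx i j) _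
  Γ_smooth x hx := ContDiffAt.sum fun k _ => ContDiffAt.sum fun i _ => ContDiffAt.sum fun j _ =>
    contDiffAt_smul_const (hG.contDiffAt_christoffel hx k i j) _
  g_symm x hx u v := by
    rw [coordBilin_apply, coordBilin_apply, Finset.sum_comm]
    refine Finset.sum_congr rfl fun i _ => Finset.sum_congr rfl fun j _ => ?_
    rw [hG.symm x hx]
    ring
  g_pos := hG.pos
  Γ_symm x hx u v := by
    ext k
    rw [coordMul_apply, coordMul_apply, Finset.sum_comm]
    refine Finset.sum_congr rfl fun i _ => Finset.sum_congr rfl fun j _ => ?_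
    have h1 : christoffel G k j i x = christoffel G k i j x := by
      simp only [christoffel]
      congr 1
      refine Finset.sum_congr rfl fun l _ => ?_
      rw [hG.pd_symm hx l i j]
      ring
    rw [h1]
    ring
  compat x hx u v w := by
    have hs : ContDiffAt ℝ ∞ (fun x => coordBilin (G x)) x :=
      ContDiffAt.sum fun i _ => ContDiffAt.sum fun j _ =>
        contDiffAt_smul_const (hG.smooth x hx i j) _
    have hd := differentiableAt_of_smooth hs
    induction u using coord_induction with
    | h0 => simp
    | hadd u u' hu hu' => simp only [map_add, add_apply, hu, hu']; ring
    | hsmul a u hu => simp only [map_smul, smul_apply, hu, smul_add]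
    | hs s =>
    induction v using coord_induction with
    | h0 => simp
    | hadd u u' hu hu' => simp only [map_add, add_apply, hu, hu']; ring
    | hsmul a u hu => simp only [map_smul, smul_apply, hu, smul_add]
    | hs i =>
    induction w using coord_induction with
    | h0 => simp
    | hadd u u' hu hu' => simp only [map_add, hu, hu']; ring
    | hsmul a u hu => simp only [map_smul, hu, smul_add]
    | hs j =>
    have h1 : fderiv ℝ (fun x => coordBilin (G x)) x (EuclideanSpace.single s 1)
        (EuclideanSpace.single i 1) (EuclideanSpace.single j 1) = pd s (fun y => G y i j) x := by
      have h2 : (fun y => G y i j) = fun y => coordBilin (G y) (EuclideanSpace.single i 1)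
        (EuclideanSpace.single j 1) := funext fun y => (coordBilin_single _ i j).symm
      rw [pd, h2, fderiv_clm_apply (hd.clm_apply (differentiableAt_const _))
        (differentiableAt_const _), fderiv_clm_apply hd (differentiableAt_const _)]
      simp
    have h3 : ∀ i j, coordBilin (G x) (coordMul (fun k i j => christoffel G k i j x)
        (EuclideanSpace.single s 1) (EuclideanSpace.single i 1)) (EuclideanSpace.single j 1) =
        ∑ k, christoffel G k s i x * G x k j := by
      intro i j
      rw [coordBilin_apply]
      refine Finset.sum_congr rfl fun k _ => ?_
      rw [Finset.sum_eq_single j (fun l _ hl => by simp [hl])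
        (fun h => absurd (Finset.mem_univ j) h), coordMul_single]
      simp [mul_comm]
    have h4 : ∀ u v, coordBilin (G x) u v = coordBilin (G x) v u := by
      intro u v
      rw [coordBilin_apply, coordBilin_apply, Finset.sum_comm]
      refine Finset.sum_congr rfl fun i _ => Finset.sum_congr rfl fun j _ => ?_
      rw [hG.symm x hx]
      ring
    rw [h1, h3, h4, h3, hG.lower_christoffel hx, hG.lower_christoffel hx, hG.pd_symm hx s j i]
    ring

end IsMetricOn

theorem curv_apply {E : Type*} [NormedAddCommGroup E] [NormedSpace ℝ E]
    {Γ : E → E →L[ℝ] E →L[ℝ] E} {x : E} (hΓ : ContDiffAt ℝ ∞ Γ x) (v u w : E) :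
    curv Γ v u x w = fderiv ℝ Γ x v u w - fderiv ℝ Γ x u v w + Γ x v (Γ x u w) -
      Γ x u (Γ x v w) := by
  have hd := differentiableAt_of_smooth hΓ
  rw [curv, fderiv_clm_apply hd (differentiableAt_const _),
    fderiv_clm_apply hd (differentiableAt_const _)]
  simp

theorem curvatureOp_eq {U : Set (Coord m)} {G : MetricField m} (hG : IsMetricOn U G)
    {x : Coord m} (hx : x ∈ U) (X Y Z : Coord m) (l : Fin m) :
    curvatureOp G x X Y Z l =
      curv (fun x => coordMul fun k i j => christoffel G k i j x) X Y x Z l := by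
  have hΓ := hG.leviCivita.Γ_smooth x hx
  have hd := differentiableAt_of_smooth hΓ
  have h1 : ∀ i j k, curv (fun x => coordMul fun k i j => christoffel G k i j x)
      (EuclideanSpace.single i 1) (EuclideanSpace.single j 1) x (EuclideanSpace.single k 1) l =
      curvature G l i j k x := by
    intro i j k
    have h2 : ∀ i j, fderiv ℝ (fun x => coordMul fun k i j => christoffel G k i j x) x
        (EuclideanSpace.single i 1) (EuclideanSpace.single j 1) (EuclideanSpace.single k 1) l =
        pd i (christoffel G l j k) x := by
      intro i j
      have h3 : christoffel G l j k = fun y => EuclideanSpace.proj (𝕜 := ℝ) l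
          (coordMul (fun k i j => christoffel G k i j y) (EuclideanSpace.single j 1)
            (EuclideanSpace.single k 1)) := funext fun y =>
            (coordMul_single (fun k i j => christoffel G k i j y) j k l).symm
      have h4 : DifferentiableAt ℝ (fun y => coordMul (fun k i j => christoffel G k i j y)
        (EuclideanSpace.single j 1) (EuclideanSpace.single k 1)) x :=
        (hd.clm_apply (differentiableAt_const _)).clm_apply (differentiableAt_const _)
      have h5 := ((EuclideanSpace.proj (𝕜 := ℝ) l :
        Coord m →L[ℝ] ℝ).hasFDerivAt.comp x h4.hasFDerivAt).fderiv
      rw [pd, h3]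
      refine Eq.trans ?_ (congrArg (fun L : Coord m →L[ℝ] ℝ =>
        L (EuclideanSpace.single i 1)) h5.symm)
      rw [fderiv_clm_apply (hd.clm_apply (differentiableAt_const _))
        (differentiableAt_const _), fderiv_clm_apply hd (differentiableAt_const _)]
      simp
    have h6 : ∀ i j, coordMul (fun k i j => christoffel G k i j x) (EuclideanSpace.single i 1)
        (coordMul (fun k i j => christoffel G k i j x) (EuclideanSpace.single j 1)
          (EuclideanSpace.single k 1)) l = ∑ s, christoffel G l i s x * christoffel G s j k x := by
      intro i j
      rw [coordMul_apply, Finset.sum_eq_single i (fun s _ hs => by simp [hs])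
        (fun h => absurd (Finset.mem_univ i) h)]
      refine Finset.sum_congr rfl fun s _ => ?_
      rw [coordMul_single]
      simp
    rw [curv_apply hΓ, curvature, Finset.sum_sub_distrib, ← h6, ← h6, ← h2, ← h2]
    simp only [PiLp.add_apply, PiLp.sub_apply]
    ring
  obtain ⟨Γ, hΓdef⟩ : ∃ Γ : Coord m → Coord m →L[ℝ] Coord m →L[ℝ] Coord m,
    Γ = fun x => coordMul fun k i j => christoffel G k i j x := ⟨_, rfl⟩
  rw [← hΓdef] at hΓ h1 ⊢
  have hX : ∀ X Y Z : Coord m, curv Γ X Y x Z =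
      ∑ i, X i • curv Γ (EuclideanSpace.single i 1) Y x Z := by
    intro X Y Z
    simp only [curv_apply hΓ]
    conv_lhs => rw [coord_eq_sum X]
    simp only [map_sum, map_smul, sum_apply, smul_apply, smul_sub, smul_add,
      Finset.sum_sub_distrib, Finset.sum_add_distrib]
  have hY : ∀ X Y Z : Coord m, curv Γ X Y x Z =
      ∑ i, Y i • curv Γ X (EuclideanSpace.single i 1) x Z := by
    intro X Y Z
    simp only [curv_apply hΓ]
    conv_lhs => rw [coord_eq_sum Y]
    simp only [map_sum, map_smul, sum_apply, smul_apply, smul_sub, smul_add,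
      Finset.sum_sub_distrib, Finset.sum_add_distrib]
  have hZ : ∀ X Y Z : Coord m, curv Γ X Y x Z =
      ∑ i, Z i • curv Γ X Y x (EuclideanSpace.single i 1) := by
    intro X Y Z
    conv_lhs => rw [coord_eq_sum Z]
    simp only [map_sum, map_smul]
  rw [hX, curvatureOp]
  simp only [WithLp.ofLp_sum, Finset.sum_apply, PiLp.smul_apply, smul_eq_mul]
  refine Finset.sum_congr rfl fun i _ => ?_
  rw [hY]
  simp only [WithLp.ofLp_sum, Finset.sum_apply, PiLp.smul_apply, smul_eq_mul, Finset.mul_sum]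
  refine Finset.sum_congr rfl fun j _ => ?_
  rw [hZ]
  simp only [WithLp.ofLp_sum, Finset.sum_apply, PiLp.smul_apply, smul_eq_mul, Finset.mul_sum, h1]
  exact Finset.sum_congr rfl fun k _ => by ring

end Coordinates


/-! ### The curvature tensor of a metric of constant sectional curvature. -/

section ConstantCurvature

/-- Polarisation of `sec` in the outer arguments, with pair symmetry, gives `R x y y w = 0`;
polarisation in `y` makes `R` antisymmetric in the middle arguments, and then the Bianchi identity
reads `3 R = 0`. Additivity is all the linearity that is needed. -/
theorem curvature_tensor_eq_zero {E : Type*} [AddCommGroup E] {R : E → E → E → E → ℝ}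
    (add₁ : ∀ x x' y z w, R (x + x') y z w = R x y z w + R x' y z w)
    (add₂ : ∀ x y y' z w, R x (y + y') z w = R x y z w + R x y' z w)
    (add₃ : ∀ x y z z' w, R x y (z + z') w = R x y z w + R x y z' w)
    (add₄ : ∀ x y z w w', R x y z (w + w') = R x y z w + R x y z w')
    (anti₁ : ∀ x y z w, R x y z w = -R y x z w) (anti₂ : ∀ x y z w, R x y z w = -R x y w z)
    (bianchi : ∀ x y z w, R x y z w + R y z x w + R z x y w = 0)
    (sec : ∀ x y, R x y y x = 0) (x y z w : E) : R x y z w = 0 := by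
  have pair : ∀ x y z w, R x y z w = R z w x y := by
    intro x y z w
    have b1 := bianchi x y z w
    have b2 := bianchi y z w x
    have b3 := bianchi z w x y
    have b4 := bianchi w x y z
    have a1 := anti₂ x y w z
    have a2 := anti₂ y z x w
    have a3 := anti₂ z w y x
    have a4 := anti₂ w x z y
    have a5 := anti₂ z x y w
    have a6 := anti₂ w y z x
    have a7 := anti₁ w y z x
    have a8 := anti₁ y w z x
    have a9 := anti₁ z x w y
    have a10 := anti₁ x z y w
    have a11 := anti₁ x z w y
    have a12 := anti₁ y w x z
    have a13 := anti₂ x z w y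
    have a14 := anti₂ y w x z
    linarith
  have h1 : ∀ x y w, R x y y w = 0 := by
    intro x y w
    have h := sec (x + w) y
    rw [add₁, add₄, add₄, sec, sec] at h
    have h2 := pair w y y x
    have h3 := anti₁ y x w y
    have h4 := anti₂ x y w y
    linarith
  have h2 : ∀ x y z w, R x y z w = -R x z y w := by
    intro x y z w
    have h := h1 x (y + z) w
    rw [add₂, add₃, add₃, h1, h1] at h
    linarith
  have h3 := bianchi x y z w
  have h4 := h2 y z x w
  have h5 := anti₁ y x z w
  have h6 := anti₁ z x y w
  have h7 := h2 x z y w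
  linarith

variable {E : Type*} [NormedAddCommGroup E] [NormedSpace ℝ E]
  {U : Set E} {g : E → E →L[ℝ] E →L[ℝ] ℝ} {Γ : E → E →L[ℝ] E →L[ℝ] E}

theorem curv_swap (v u : E) (x : E) : curv Γ v u x = -curv Γ u v x := by
  simp only [curv]
  abel

namespace LeviCivita

variable (hg : LeviCivita U g Γ) {x : E} (hx : x ∈ U)

include hg hx

theorem covVec_const (u z : E) : covVec Γ u (fun _ => z) x = Γ x u z := by simp [covVec]

/-- For a constant field `z`, the second derivatives of `g z z` commute. By compatibility with the
metric their commutator is twice the asserted quantity. -/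
theorem curv_self (v u z : E) : g x (curv Γ v u x z) z = 0 := by
  have hz : ∀ u, ∀ y ∈ U, ContDiffAt ℝ ∞ (covVec Γ u fun _ => z) y := fun u y hy =>
    contDiffAt_covVec (hg.Γ_smooth y hy) contDiffAt_const
  have h1 : ∀ u, (fun y => fderiv ℝ (fun y => g y z z) y u) =ᶠ[nhds x]
      fun y => 2 * g y (covVec Γ u (fun _ => z) y) z := by
    intro u
    filter_upwards [hg.isOpen.mem_nhds hx] with y hy
    rw [hg.fderiv_metric hy (differentiableAt_const z) (differentiableAt_const z),
      hg.g_symm y hy z]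
    ring
  have hgs : ContDiffAt ℝ ∞ (fun y => g y z z) x :=
    ((hg.g_smooth x hx).clm_apply contDiffAt_const).clm_apply contDiffAt_const
  have hd : ∀ u, DifferentiableAt ℝ (fun y => g y (covVec Γ u (fun _ => z) y) z) x := fun u =>
    differentiableAt_of_smooth (((hg.g_smooth x hx).clm_apply (hz u x hx)).clm_apply
      contDiffAt_const)
  have h2 : ∀ u v, fderiv ℝ (fun y => fderiv ℝ (fun y => g y z z) y u) x v =
      2 * (g x (covVec Γ v (covVec Γ u fun _ => z) x) z +
        g x (covVec Γ u (fun _ => z) x) (covVec Γ v (fun _ => z) x)) := by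
    intro u v
    rw [(h1 u).fderiv_eq, fderiv_const_mul (hd u), smul_apply, smul_eq_mul,
      hg.fderiv_metric hx (differentiableAt_of_smooth (hz u x hx)) (differentiableAt_const z)]
  have h3 := fderiv_fderiv_comm hgs u v
  rw [h2, h2, hg.g_symm x hx (covVec Γ v _ x) (covVec Γ u _ x)] at h3
  have h4 := covVec_covVec_sub (Γ := Γ) (Z := fun _ => z) (hg.Γ_smooth x hx) contDiffAt_const v u
  rw [← h4, map_sub, sub_apply]
  linarith

theorem curv_antisymm (v u z w : E) : g x (curv Γ v u x z) w = -g x (curv Γ v u x w) z := by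
  have h := hg.curv_self hx v u (z + w)
  simp only [map_add, add_apply, hg.curv_self hx] at h
  linarith

theorem bianchi (u v w : E) :
    curv Γ u v x w + curv Γ v w x u + curv Γ w u x v = 0 := by
  have h1 : ∀ u v w, fderiv ℝ Γ x u v w = fderiv ℝ Γ x u w v := by
    intro u v w
    have hd := differentiableAt_of_smooth (hg.Γ_smooth x hx)
    have h2 : (fun y => Γ y v w) =ᶠ[nhds x] fun y => Γ y w v := by
      filter_upwards [hg.isOpen.mem_nhds hx] with y hy using hg.Γ_symm y hy v w
    have h3 := congrArg (fun L : E →L[ℝ] E => L u) h2.fderiv_eq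
    beta_reduce at h3
    rw [fderiv_clm_apply (hd.clm_apply (differentiableAt_const _)) (differentiableAt_const _),
      fderiv_clm_apply (hd.clm_apply (differentiableAt_const _)) (differentiableAt_const _),
      fderiv_clm_apply hd (differentiableAt_const _),
      fderiv_clm_apply hd (differentiableAt_const _)] at h3
    simpa using h3
  simp only [curv_apply (hg.Γ_smooth x hx)]
  rw [h1 v u w, h1 w v u, h1 u w v, hg.Γ_symm x hx w v, hg.Γ_symm x hx u w, hg.Γ_symm x hx v u]
  abel

/-- The curvature tensor of a metric of constant sectional curvature. -/
theorem curv_of_sectional {c : ℝ}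
    (hsec : ∀ X Y, g x (curv Γ X Y x Y) X = c * (g x X X * g x Y Y - g x X Y ^ 2)) (X Y Z : E) :
    curv Γ X Y x Z = c • (g x Y Z • X - g x X Z • Y) := by
  refine hg.eq_of_forall hx fun W => ?_
  have hc := fun v u w => curv_apply (hg.Γ_smooth x hx) v u w
  have h := curvature_tensor_eq_zero (E := E) (R := fun X Y Z W => g x (curv Γ X Y x Z) W -
    c * (g x Y Z * g x X W - g x X Z * g x Y W)) ?_ ?_ ?_ ?_ ?_ ?_ ?_ ?_ X Y Z W
  · simp only [map_smul, map_sub, smul_apply, sub_apply, smul_eq_mul]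
    linarith
  · intro x x' y z w
    simp only [hc, map_add, map_sub, add_apply, sub_apply]
    ring
  · intro x x' y z w
    simp only [hc, map_add, map_sub, add_apply, sub_apply]
    ring
  · intro x x' y z w
    simp only [map_add, add_apply]
    ring
  · intro x x' y z w
    simp only [map_add]
    ring
  · intro a b z w
    rw [curv_swap a b, neg_apply, map_neg, neg_apply]
    ring
  · intro a b z w
    rw [hg.curv_antisymm hx]
    ring
  · intro a b d w
    have h1 := congrArg (fun v => g x v w) (hg.bianchi hx a b d)
    simp only [map_add, add_apply, map_zero, zero_apply] at h1
    rw [hg.g_symm x hx b a, hg.g_symm x hx d a, hg.g_symm x hx d b]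
    linear_combination h1
  · intro a b
    rw [hsec, hg.g_symm x hx b a]
    ring

end LeviCivita

end ConstantCurvature

/-! ### Vector fields along maps, isometric immersions and the hypersurface equations. -/

section AlongMap

variable {E E' : Type*} [NormedAddCommGroup E] [NormedSpace ℝ E] [NormedAddCommGroup E']
  [NormedSpace ℝ E']

/-- The covariant derivative in the direction `u` of a vector field `W` along `F`. -/
noncomputable def covAlong (Γ' : E' → E' →L[ℝ] E' →L[ℝ] E') (F : E → E') (u : E) (W : E → E')
    (x : E) : E' :=
  fderiv ℝ W x u + Γ' (F x) (fderiv ℝ F x u) (W x)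

variable {U : Set E} {g : E → E →L[ℝ] E →L[ℝ] ℝ} {Γ : E → E →L[ℝ] E →L[ℝ] E}
  {U' : Set E'} {h : E' → E' →L[ℝ] E' →L[ℝ] ℝ} {Γ' : E' → E' →L[ℝ] E' →L[ℝ] E'} {F : E → E'}
  {x : E}

theorem covAlong_congr {u : E} {V W : E → E'} (hVW : V =ᶠ[nhds x] W) :
    covAlong Γ' F u V x = covAlong Γ' F u W x := by
  rw [covAlong, covAlong, hVW.fderiv_eq, hVW.eq_of_nhds]

theorem covAlong_add {u : E} {V W : E → E'} (hV : DifferentiableAt ℝ V x)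
    (hW : DifferentiableAt ℝ W x) :
    covAlong Γ' F u (fun y => V y + W y) x = covAlong Γ' F u V x + covAlong Γ' F u W x := by
  simp only [covAlong, fderiv_fun_add hV hW, add_apply, map_add]
  abel

theorem covAlong_sub {u : E} {V W : E → E'} (hV : DifferentiableAt ℝ V x)
    (hW : DifferentiableAt ℝ W x) :
    covAlong Γ' F u (fun y => V y - W y) x = covAlong Γ' F u V x - covAlong Γ' F u W x := by
  simp only [covAlong, fderiv_fun_sub hV hW, sub_apply, map_sub]
  abel

theorem covAlong_smul {u : E} {f : E → ℝ} {W : E → E'} (hf : DifferentiableAt ℝ f x)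
    (hW : DifferentiableAt ℝ W x) :
    covAlong Γ' F u (fun y => f y • W y) x = fderiv ℝ f x u • W x + f x • covAlong Γ' F u W x := by
  simp only [covAlong, fderiv_fun_smul hf hW, add_apply, smul_apply,
    ContinuousLinearMap.smulRight_apply, map_smul, smul_add]
  abel

theorem contDiffAt_covAlong {u : E} {W : E → E'} (hF : ContDiffAt ℝ ∞ F x)
    (hΓ : ContDiffAt ℝ ∞ Γ' (F x)) (hW : ContDiffAt ℝ ∞ W x) :
    ContDiffAt ℝ ∞ (covAlong Γ' F u W) x :=
  (contDiffAt_fderiv_apply hW u).add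
    (((hΓ.comp x hF).clm_apply (contDiffAt_fderiv_apply hF u)).clm_apply hW)

theorem covAlong_covAlong_sub (hF : ContDiffAt ℝ ∞ F x) (hΓ : ContDiffAt ℝ ∞ Γ' (F x))
    {W : E → E'} (hW : ContDiffAt ℝ ∞ W x) (v u : E) :
    covAlong Γ' F v (covAlong Γ' F u W) x - covAlong Γ' F u (covAlong Γ' F v W) x =
      curv Γ' (fderiv ℝ F x v) (fderiv ℝ F x u) (F x) (W x) := by
  have key : ∀ u v, covAlong Γ' F v (covAlong Γ' F u W) x =
      fderiv ℝ (fun y => fderiv ℝ W y u) x v +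
      (fderiv ℝ Γ' (F x) (fderiv ℝ F x v) (fderiv ℝ F x u) (W x) +
        Γ' (F x) (fderiv ℝ (fun y => fderiv ℝ F y u) x v) (W x) +
        Γ' (F x) (fderiv ℝ F x u) (fderiv ℝ W x v)) +
      (Γ' (F x) (fderiv ℝ F x v) (fderiv ℝ W x u) +
        Γ' (F x) (fderiv ℝ F x v) (Γ' (F x) (fderiv ℝ F x u) (W x))) := by
    intro u v
    have d1 := differentiableAt_of_smooth (hΓ.comp x hF)
    have d2 := differentiableAt_of_smooth (contDiffAt_fderiv_apply hF u)
    have d3 := differentiableAt_of_smooth (contDiffAt_fderiv_apply hW u)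
    have d4 := differentiableAt_of_smooth hW
    have e1 : fderiv ℝ (Γ' ∘ F) x v = fderiv ℝ Γ' (F x) (fderiv ℝ F x v) := by
      rw [fderiv_comp x (differentiableAt_of_smooth hΓ) (differentiableAt_of_smooth hF)]
      rfl
    have e2 : fderiv ℝ (covAlong Γ' F u W) x v = fderiv ℝ (fun y => fderiv ℝ W y u +
        (Γ' ∘ F) y (fderiv ℝ F y u) (W y)) x v := rfl
    rw [covAlong, e2, fderiv_fun_add d3 ((d1.clm_apply d2).clm_apply d4),
      fderiv_clm_apply (d1.clm_apply d2) d4, fderiv_clm_apply d1 d2]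
    simp only [add_apply, ContinuousLinearMap.coe_comp, Function.comp_apply,
      ContinuousLinearMap.flip_apply, e1, covAlong, map_add]
    abel
  rw [key, key, fderiv_fderiv_comm hW u v, fderiv_fderiv_comm hF u v, curv_apply hΓ]
  abel

/-- An isometric immersion between coordinate domains with Riemannian metrics. -/
structure IsometricChart (U : Set E) (g : E → E →L[ℝ] E →L[ℝ] ℝ) (Γ : E → E →L[ℝ] E →L[ℝ] E)
    (U' : Set E') (h : E' → E' →L[ℝ] E' →L[ℝ] ℝ) (Γ' : E' → E' →L[ℝ] E' →L[ℝ] E') (F : E → E') :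
    Prop where
  src : LeviCivita U g Γ
  tgt : LeviCivita U' h Γ'
  mapsTo : ∀ x ∈ U, F x ∈ U'
  F_smooth : ∀ x ∈ U, ContDiffAt ℝ ∞ F x
  isometric : ∀ x ∈ U, ∀ u v, h (F x) (fderiv ℝ F x u) (fderiv ℝ F x v) = g x u v

namespace IsometricChart

variable (hI : IsometricChart U g Γ U' h Γ' F) (hx : x ∈ U)

include hI hx

theorem Γ'_smooth : ContDiffAt ℝ ∞ Γ' (F x) := hI.tgt.Γ_smooth _ (hI.mapsTo x hx)

theorem dF_smooth {Z : E → E} (hZ : ContDiffAt ℝ ∞ Z x) :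
    ContDiffAt ℝ ∞ (fun y => fderiv ℝ F y (Z y)) x :=
  ((hI.F_smooth x hx).fderiv_right (m := ∞) (by simp)).clm_apply hZ

theorem fderiv_metric {V W : E → E'} (hV : DifferentiableAt ℝ V x) (hW : DifferentiableAt ℝ W x)
    (u : E) : fderiv ℝ (fun y => h (F y) (V y) (W y)) x u =
      h (F x) (covAlong Γ' F u V x) (W x) + h (F x) (V x) (covAlong Γ' F u W x) := by
  have hF := differentiableAt_of_smooth (hI.F_smooth x hx)
  have hh := differentiableAt_of_smooth (hI.tgt.g_smooth _ (hI.mapsTo x hx))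
  have d1 : DifferentiableAt ℝ (h ∘ F) x := hh.comp x hF
  have e1 : fderiv ℝ (h ∘ F) x u = fderiv ℝ h (F x) (fderiv ℝ F x u) := by
    rw [fderiv_comp x hh hF]
    rfl
  have e2 : fderiv ℝ (fun y => h (F y) (V y) (W y)) x u =
    fderiv ℝ (fun y => (h ∘ F) y (V y) (W y)) x u := rfl
  rw [e2, fderiv_clm_apply (d1.clm_apply hV) hW, fderiv_clm_apply d1 hV]
  simp only [add_apply, ContinuousLinearMap.coe_comp, Function.comp_apply,
    ContinuousLinearMap.flip_apply, e1, covAlong, map_add,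
    hI.tgt.compat _ (hI.mapsTo x hx)]
  ring

theorem covAlong_dF_symm (u v : E) : covAlong Γ' F u (fun y => fderiv ℝ F y v) x =
    covAlong Γ' F v (fun y => fderiv ℝ F y u) x := by
  rw [covAlong, covAlong, fderiv_fderiv_comm (hI.F_smooth x hx),
    hI.tgt.Γ_symm _ (hI.mapsTo x hx)]

theorem covAlong_dF {Z : E → E} (hZ : DifferentiableAt ℝ Z x) (u : E) :
    covAlong Γ' F u (fun y => fderiv ℝ F y (Z y)) x =
      fderiv ℝ F x (fderiv ℝ Z x u) + covAlong Γ' F u (fun y => fderiv ℝ F y (Z x)) x := by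
  have hF := differentiableAt_of_smooth ((hI.F_smooth x hx).fderiv_right (m := ∞) (by simp))
  rw [covAlong, covAlong, fderiv_clm_apply hF hZ, fderiv_clm_apply hF (differentiableAt_const _)]
  simp only [add_apply, ContinuousLinearMap.coe_comp, Function.comp_apply,
    ContinuousLinearMap.flip_apply, fderiv_fun_const, Pi.zero_apply, zero_apply, map_zero]
  abel

/-- The Koszul argument: both sides are symmetric in `u`, `v` and have the same sums under metric
differentiation, so the cyclic combination determines them. -/
theorem tangential (u v w : E) :
    h (F x) (covAlong Γ' F u (fun y => fderiv ℝ F y v) x) (fderiv ℝ F x w) =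
      g x (Γ x u v) w := by
  have hF : ∀ v, DifferentiableAt ℝ (fun y => fderiv ℝ F y v) x := fun v =>
    differentiableAt_of_smooth (contDiffAt_fderiv_apply (hI.F_smooth x hx) v)
  have key : ∀ u v w, h (F x) (covAlong Γ' F u (fun y => fderiv ℝ F y v) x) (fderiv ℝ F x w) +
      h (F x) (covAlong Γ' F u (fun y => fderiv ℝ F y w) x) (fderiv ℝ F x v) =
      g x (Γ x u v) w + g x (Γ x u w) v := by
    intro u v w
    have h1 : (fun y => h (F y) (fderiv ℝ F y v) (fderiv ℝ F y w)) =ᶠ[nhds x]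
        fun y => g y v w := by
      filter_upwards [hI.src.isOpen.mem_nhds hx] with y hy using hI.isometric y hy v w
    have h2 := congrArg (fun L : E →L[ℝ] ℝ => L u) h1.fderiv_eq
    beta_reduce at h2
    rw [hI.fderiv_metric hx (hF v) (hF w), hI.src.fderiv_metric hx (differentiableAt_const v)
      (differentiableAt_const w), hI.src.covVec_const hx, hI.src.covVec_const hx,
      hI.tgt.g_symm _ (hI.mapsTo x hx) (fderiv ℝ F x v), hI.src.g_symm x hx v] at h2
    exact h2
  have k1 := key u v w
  have k2 := key v w u
  have k3 := key w u v
  rw [hI.covAlong_dF_symm hx v u, hI.src.Γ_symm x hx v u] at k2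
  rw [hI.covAlong_dF_symm hx w u, hI.covAlong_dF_symm hx w v, hI.src.Γ_symm x hx w u,
    hI.src.Γ_symm x hx w v] at k3
  linarith

end IsometricChart

end AlongMap


section Hypersurface

variable {E E' : Type*} [NormedAddCommGroup E] [NormedSpace ℝ E] [NormedAddCommGroup E']
  [NormedSpace ℝ E']

/-- A hypersurface in a coordinate domain with a unit normal field `ξ` and Weingarten operator
`A`. -/
structure HypersurfaceChart (U : Set E) (g : E → E →L[ℝ] E →L[ℝ] ℝ)
    (Γ : E → E →L[ℝ] E →L[ℝ] E) (U' : Set E') (h : E' → E' →L[ℝ] E' →L[ℝ] ℝ)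
    (Γ' : E' → E' →L[ℝ] E' →L[ℝ] E') (F ξ : E → E') (A : E → E →L[ℝ] E) : Prop
    extends IsometricChart U g Γ U' h Γ' F where
  finrank : Module.finrank ℝ E' = Module.finrank ℝ E + 1
  ξ_smooth : ∀ x ∈ U, ContDiffAt ℝ ∞ ξ x
  unit : ∀ x ∈ U, h (F x) (ξ x) (ξ x) = 1
  normal : ∀ x ∈ U, ∀ u, h (F x) (fderiv ℝ F x u) (ξ x) = 0
  A_smooth : ∀ x ∈ U, ContDiffAt ℝ ∞ A x
  shape : ∀ x ∈ U, ∀ u v, g x (A x u) v =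
    h (F x) (covAlong Γ' F u (fun y => fderiv ℝ F y v) x) (ξ x)

namespace HypersurfaceChart

variable {U : Set E} {g : E → E →L[ℝ] E →L[ℝ] ℝ} {Γ : E → E →L[ℝ] E →L[ℝ] E}
  {U' : Set E'} {h : E' → E' →L[ℝ] E' →L[ℝ] ℝ} {Γ' : E' → E' →L[ℝ] E' →L[ℝ] E'} {F ξ : E → E'}
  {A : E → E →L[ℝ] E} {x : E}
  (hH : HypersurfaceChart U g Γ U' h Γ' F ξ A) (hx : x ∈ U)

include hH hx

theorem tgt_symm (X Y : E') : h (F x) X Y = h (F x) Y X :=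
  hH.tgt.g_symm _ (hH.mapsTo x hx) X Y

theorem A_symm (u v : E) : g x (A x u) v = g x u (A x v) := by
  rw [hH.src.g_symm x hx u, hH.shape x hx, hH.shape x hx, hH.covAlong_dF_symm hx]

/-- The tangent space of the ambient manifold is spanned by the tangent space of the hypersurface
and the normal vector. -/
theorem exists_decomposition [FiniteDimensional ℝ E] [FiniteDimensional ℝ E'] (X : E') :
    ∃ (u : E) (t : ℝ), X = fderiv ℝ F x u + t • ξ x := by
  let L : E × ℝ →ₗ[ℝ] E' := (fderiv ℝ F x : E →ₗ[ℝ] E').coprod (LinearMap.toSpanSingleton ℝ E' (ξ x))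
  have hL : ∀ q, L q = fderiv ℝ F x q.1 + q.2 • ξ x := fun q => rfl
  have hinj : Function.Injective L := by
    refine (injective_iff_map_eq_zero L).mpr fun q hq => ?_
    rw [hL] at hq
    have h1 := congrArg (fun Y => h (F x) Y (ξ x)) hq
    simp only [map_add, map_smul, add_apply, smul_apply, hH.normal x hx, hH.unit x hx, map_zero,
      zero_apply, smul_eq_mul, mul_one, zero_add] at h1
    rw [h1, zero_smul, add_zero] at hq
    have h2 := hH.isometric x hx q.1 q.1
    rw [hq, map_zero] at h2
    exact Prod.ext (hH.src.eq_zero_of_self hx h2.symm) h1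
  have hdim : Module.finrank ℝ (E × ℝ) = Module.finrank ℝ E' := by
    rw [Module.finrank_prod, Module.finrank_self, hH.finrank]
  obtain ⟨q, hq⟩ := (LinearMap.injective_iff_surjective_of_finrank_eq_finrank hdim).mp hinj X
  exact ⟨q.1, q.2, by rw [← hq, hL]⟩

theorem eq_of_components [FiniteDimensional ℝ E] [FiniteDimensional ℝ E'] {X Y : E'}
    (h1 : ∀ u, h (F x) X (fderiv ℝ F x u) = h (F x) Y (fderiv ℝ F x u))
    (h2 : h (F x) X (ξ x) = h (F x) Y (ξ x)) : X = Y := by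
  refine hH.tgt.eq_of_forall (hH.mapsTo x hx) fun Z => ?_
  obtain ⟨u, t, rfl⟩ := hH.exists_decomposition hx Z
  rw [map_add, map_add, map_smul, map_smul, h1, h2]

theorem components {u u' : E} {t t' : ℝ}
    (heq : fderiv ℝ F x u + t • ξ x = fderiv ℝ F x u' + t' • ξ x) : u = u' ∧ t = t' := by
  constructor
  · refine hH.src.eq_of_forall hx fun w => ?_
    have h1 := congrArg (fun X => h (F x) (fderiv ℝ F x w) X) heq
    simp only [map_add, map_smul, hH.normal x hx, smul_eq_mul, mul_zero, add_zero,
      hH.isometric x hx] at h1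
    rw [hH.src.g_symm x hx, h1, hH.src.g_symm x hx]
  · have h1 := congrArg (fun X => h (F x) X (ξ x)) heq
    simpa [hH.normal x hx, hH.unit x hx] using h1

variable [FiniteDimensional ℝ E] [FiniteDimensional ℝ E']

/-- The Gauss formula. -/
theorem covAlong_tangent {Z : E → E} (hZ : DifferentiableAt ℝ Z x) (u : E) :
    covAlong Γ' F u (fun y => fderiv ℝ F y (Z y)) x =
      fderiv ℝ F x (covVec Γ u Z x) + g x (A x u) (Z x) • ξ x := by
  have h1 : ∀ v, covAlong Γ' F u (fun y => fderiv ℝ F y v) x =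
      fderiv ℝ F x (Γ x u v) + g x (A x u) v • ξ x := by
    intro v
    refine hH.eq_of_components hx (fun w => ?_) ?_
    · rw [hH.tangential hx, map_add, add_apply, hH.isometric x hx, map_smul, smul_apply,
        hH.tgt_symm hx (ξ x), hH.normal x hx, smul_zero, add_zero]
    · rw [← hH.shape x hx, map_add, add_apply, hH.normal x hx, map_smul, smul_apply,
        hH.unit x hx, smul_eq_mul, mul_one, zero_add]
  rw [hH.covAlong_dF hx hZ, h1, covVec, map_add, add_assoc]

/-- The Weingarten formula. -/
theorem covAlong_normal (u : E) : covAlong Γ' F u ξ x = -fderiv ℝ F x (A x u) := by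
  have hξ := differentiableAt_of_smooth (hH.ξ_smooth x hx)
  refine hH.eq_of_components hx (fun w => ?_) ?_
  · have h1 : (fun y => h (F y) (fderiv ℝ F y w) (ξ y)) =ᶠ[nhds x] fun _ => 0 := by
      filter_upwards [hH.src.isOpen.mem_nhds hx] with y hy using hH.normal y hy w
    have h2 := congrArg (fun L : E →L[ℝ] ℝ => L u) h1.fderiv_eq
    beta_reduce at h2
    rw [hH.fderiv_metric hx (differentiableAt_of_smooth (hH.dF_smooth hx contDiffAt_const)) hξ,
      ← hH.shape x hx] at h2
    simp only [fderiv_fun_const, Pi.zero_apply, zero_apply] at h2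
    rw [map_neg, neg_apply, hH.isometric x hx, hH.tgt_symm hx]
    linarith
  · have h1 : (fun y => h (F y) (ξ y) (ξ y)) =ᶠ[nhds x] fun _ => 1 := by
      filter_upwards [hH.src.isOpen.mem_nhds hx] with y hy using hH.unit y hy
    have h2 := congrArg (fun L : E →L[ℝ] ℝ => L u) h1.fderiv_eq
    beta_reduce at h2
    rw [hH.fderiv_metric hx hξ hξ, hH.tgt_symm hx (ξ x)] at h2
    simp only [fderiv_fun_const, Pi.zero_apply, zero_apply] at h2
    rw [map_neg, neg_apply, hH.normal x hx]
    linarith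

/-- Differentiate the Gauss formula once more, using the Weingarten formula for the normal part, and
antisymmetrise. The tangential component is the Gauss equation and the normal component the Codazzi
equation. -/
theorem curvature_equation (u v w : E) :
    curv Γ' (fderiv ℝ F x u) (fderiv ℝ F x v) (F x) (fderiv ℝ F x w) =
      fderiv ℝ F x (curv Γ u v x w - g x (A x v) w • A x u + g x (A x u) w • A x v) +
      (g x (covEnd Γ u A x v - covEnd Γ v A x u) w) • ξ x := by
  have hξ := differentiableAt_of_smooth (hH.ξ_smooth x hx)
  have hA := differentiableAt_of_smooth (hH.A_smooth x hx)
  have key : ∀ u v, covAlong Γ' F u (covAlong Γ' F v fun y => fderiv ℝ F y w) x =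
      fderiv ℝ F x (covVec Γ u (covVec Γ v fun _ => w) x - g x (A x v) w • A x u) +
      (g x (A x u) (Γ x v w) + g x (covEnd Γ u A x v + A x (Γ x u v)) w +
        g x (A x v) (Γ x u w)) • ξ x := by
    intro u v
    have hc : ContDiffAt ℝ ∞ (covVec Γ v fun _ => w) x :=
      contDiffAt_covVec (hH.src.Γ_smooth x hx) contDiffAt_const
    have hg : DifferentiableAt ℝ (fun y => g y (A y v) w) x :=
      differentiableAt_of_smooth (((hH.src.g_smooth x hx).clm_apply
        ((hH.A_smooth x hx).clm_apply contDiffAt_const)).clm_apply contDiffAt_const)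
    have h1 : (covAlong Γ' F v fun y => fderiv ℝ F y w) =ᶠ[nhds x] fun y =>
        fderiv ℝ F y (covVec Γ v (fun _ => w) y) + g y (A y v) w • ξ y := by
      filter_upwards [hH.src.isOpen.mem_nhds hx] with y hy
        using hH.covAlong_tangent hy (differentiableAt_const w) v
    rw [covAlong_congr h1, covAlong_add (differentiableAt_of_smooth (hH.dF_smooth hx hc))
      (hg.fun_smul hξ), covAlong_smul hg hξ, hH.covAlong_tangent hx
      (differentiableAt_of_smooth hc), hH.covAlong_normal hx, hH.src.fderiv_metric hx
      (hA.clm_apply (differentiableAt_const v)) (differentiableAt_const w),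
      covVec_apply_const hA, hH.src.covVec_const hx, hH.src.covVec_const hx]
    simp only [map_sub, map_smul, smul_neg]
    module
  rw [← covAlong_covAlong_sub (hH.F_smooth x hx) (hH.Γ'_smooth hx)
    (hH.dF_smooth hx contDiffAt_const), key, key]
  have h2 := covVec_covVec_sub (Γ := Γ) (Z := fun _ => w) (hH.src.Γ_smooth x hx)
    contDiffAt_const u v
  rw [← h2, hH.src.Γ_symm x hx v u]
  simp only [map_sub, map_add, map_smul, sub_apply, add_apply]
  module

theorem gauss_codazzi {c : ℝ} (hc : ∀ X Y Z, curv Γ' X Y (F x) Z =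
    c • (h (F x) Y Z • X - h (F x) X Z • Y)) (u v w : E) :
    curv Γ u v x w = c • (g x v w • u - g x u w • v) + g x (A x v) w • A x u -
      g x (A x u) w • A x v ∧ g x (covEnd Γ u A x v - covEnd Γ v A x u) w = 0 := by
  have h1 := hH.curvature_equation hx u v w
  rw [hc, hH.isometric x hx, hH.isometric x hx] at h1
  have h2 := hH.components hx (u := c • (g x v w • u - g x u w • v)) (t := 0) (by
    rw [← h1]; simp only [map_smul, map_sub, zero_smul, add_zero])
  refine ⟨?_, h2.2.symm⟩
  rw [h2.1]
  abel

theorem codazzi {c : ℝ} (hc : ∀ X Y Z, curv Γ' X Y (F x) Z =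
    c • (h (F x) Y Z • X - h (F x) X Z • Y)) (u v : E) :
    covEnd Γ u A x v = covEnd Γ v A x u :=
  hH.src.eq_of_forall hx fun w => by
    have h1 := (hH.gauss_codazzi hx hc u v w).2
    rw [map_sub, sub_apply] at h1
    linarith

/-- The second covariant derivative of a multiple of the normal field. -/
theorem covAlong_covAlong_normal {f : E → ℝ} (hf : ∀ y ∈ U, ContDiffAt ℝ ∞ f y) (u v : E) :
    covAlong Γ' F u (covAlong Γ' F v fun y => f y • ξ y) x -
      covAlong Γ' F (Γ x u v) (fun y => f y • ξ y) x =
    fderiv ℝ F x (-(fderiv ℝ f x v • A x u + fderiv ℝ f x u • A x v +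
      f x • covEnd Γ u A x v)) +
      (fderiv ℝ (fun y => fderiv ℝ f y v) x u - fderiv ℝ f x (Γ x u v) -
        f x * g x (A x u) (A x v)) • ξ x := by
  have hξ := fun y hy => differentiableAt_of_smooth (hH.ξ_smooth y hy)
  have hA := differentiableAt_of_smooth (hH.A_smooth x hx)
  have hfd := fun y hy => differentiableAt_of_smooth (hf y hy)
  have hfv := differentiableAt_of_smooth (contDiffAt_fderiv_apply (hf x hx) v)
  have hAv : DifferentiableAt ℝ (fun y => f y • A y v) x :=
    (hfd x hx).fun_smul (hA.clm_apply (differentiableAt_const v))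
  have h0 : ∀ y ∈ U, ∀ v, covAlong Γ' F v (fun y => f y • ξ y) y =
      fderiv ℝ f y v • ξ y - fderiv ℝ F y (f y • A y v) := by
    intro y hy v
    rw [covAlong_smul (hfd y hy) (hξ y hy), hH.covAlong_normal hy, map_smul, smul_neg,
      sub_eq_add_neg]
  have h1 : (covAlong Γ' F v fun y => f y • ξ y) =ᶠ[nhds x] fun y =>
      fderiv ℝ f y v • ξ y - fderiv ℝ F y (f y • A y v) := by
    filter_upwards [hH.src.isOpen.mem_nhds hx] with y hy using h0 y hy v
  have hdA : DifferentiableAt ℝ (fun y => fderiv ℝ F y (f y • A y v)) x :=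
    differentiableAt_of_smooth (hH.dF_smooth hx ((hf x hx).smul
      ((hH.A_smooth x hx).clm_apply contDiffAt_const)))
  rw [covAlong_congr h1, covAlong_sub (hfv.fun_smul (hξ x hx)) hdA, covAlong_smul hfv (hξ x hx),
    hH.covAlong_normal hx, hH.covAlong_tangent hx hAv, covVec_smul (hfd x hx)
      (hA.clm_apply (differentiableAt_const v)), covVec_apply_const hA, h0 x hx]
  simp only [map_add, map_smul, map_neg, smul_add, smul_neg, smul_eq_mul]
  module

end HypersurfaceChart

end Hypersurface


/-! ### Hypersurfaces given by components; traces and gradients. -/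

section CoordinateHypersurface

/-- The Levi-Civita connection of a metric in coordinates. -/
noncomputable def conn {m : ℕ} (G : MetricField m) (x : Coord m) :
    Coord m →L[ℝ] Coord m →L[ℝ] Coord m :=
  coordMul fun k i j => christoffel G k i j x

/-- A metric in coordinates as a bilinear form. -/
noncomputable def metr {m : ℕ} (G : MetricField m) (x : Coord m) :
    Coord m →L[ℝ] Coord m →L[ℝ] ℝ :=
  coordBilin (G x)

variable {m k : ℕ}

theorem IsMetricOn.leviCivita' {U : Set (Coord m)} {G : MetricField m} (hG : IsMetricOn U G) :
    LeviCivita U (metr G) (conn G) :=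
  hG.leviCivita

theorem innerAt_eq (G : MetricField m) (x u v : Coord m) : innerAt G x u v = metr G x u v :=
  (coordBilin_apply _ _ _).symm

theorem opTrace_eq_sum (L : Coord m →L[ℝ] Coord m) :
    opTrace (Coord m) L = ∑ i, L (EuclideanSpace.single i 1) i := by
  rw [opTrace_apply, LinearMap.trace_eq_matrix_trace ℝ (EuclideanSpace.basisFun (Fin m) ℝ).toBasis,
    Matrix.trace]
  refine Finset.sum_congr rfl fun i _ => ?_
  rw [Matrix.diag_apply, LinearMap.toMatrix_apply]
  simp

theorem opTrace_coordEnd (B : Matrix (Fin m) (Fin m) ℝ) :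
    opTrace (Coord m) (coordEnd B) = B.trace := by
  rw [opTrace_eq_sum, Matrix.trace]
  refine Finset.sum_congr rfl fun i _ => ?_
  rw [coordEnd_apply]
  simp

theorem contDiffAt_coordEnd {B : Coord m → Matrix (Fin m) (Fin m) ℝ} {x : Coord m}
    (hB : ∀ i j, ContDiffAt ℝ ∞ (fun y => B y i j) x) :
    ContDiffAt ℝ ∞ (fun y => coordEnd (B y)) x :=
  ContDiffAt.sum fun i _ => ContDiffAt.sum fun j _ => contDiffAt_smul_const (hB i j) _

/-- The trace of a bilinear map with respect to the metric. -/
noncomputable def metricTrace {F : Type*} [AddCommGroup F] [Module ℝ F] (G : MetricField m)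
    (x : Coord m) (b : Coord m → Coord m → F) : F :=
  ∑ i, ∑ j, (G x)⁻¹ i j • b (EuclideanSpace.single i 1) (EuclideanSpace.single j 1)

section MetricTrace

variable {F : Type*} [AddCommGroup F] [Module ℝ F] {G : MetricField m} {x : Coord m}

theorem metricTrace_add (b b' : Coord m → Coord m → F) :
    metricTrace G x (fun u v => b u v + b' u v) = metricTrace G x b + metricTrace G x b' := by
  simp only [metricTrace, smul_add, Finset.sum_add_distrib]

theorem metricTrace_sub (b b' : Coord m → Coord m → F) :
    metricTrace G x (fun u v => b u v - b' u v) = metricTrace G x b - metricTrace G x b' := by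
  simp only [metricTrace, smul_sub, Finset.sum_sub_distrib]

theorem metricTrace_map {F' : Type*} [AddCommGroup F'] [Module ℝ F'] (L : F →ₗ[ℝ] F')
    (b : Coord m → Coord m → F) :
    metricTrace G x (fun u v => L (b u v)) = L (metricTrace G x b) := by
  simp only [metricTrace, map_sum, map_smul]

theorem metricTrace_smul (a : ℝ) (b : Coord m → Coord m → F) :
    metricTrace G x (fun u v => a • b u v) = a • metricTrace G x b :=
  metricTrace_map (LinearMap.lsmul ℝ F a) b

theorem metricTrace_smul_const (b : Coord m → Coord m → ℝ) (v₀ : F) :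
    metricTrace G x (fun u v => b u v • v₀) = metricTrace G x b • v₀ :=
  metricTrace_map (LinearMap.toSpanSingleton ℝ F v₀) b

theorem metricTrace_metr {U : Set (Coord m)} (hG : IsMetricOn U G) (hx : x ∈ U)
    (L : Coord m →L[ℝ] Coord m) :
    metricTrace G x (fun u v => metr G x (L u) v) = opTrace (Coord m) L := by
  rw [opTrace_eq_sum, metricTrace]
  refine Finset.sum_congr rfl fun i _ => ?_
  have h1 : ∀ j, metr G x (L (EuclideanSpace.single i 1)) (EuclideanSpace.single j 1) =
      ∑ k, L (EuclideanSpace.single i 1) k * G x k j := by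
    intro j
    rw [metr, coordBilin_apply]
    refine Finset.sum_congr rfl fun k _ => ?_
    simp [mul_comm]
  simp only [h1, smul_eq_mul, Finset.mul_sum]
  rw [Finset.sum_comm]
  have h2 : ∀ k, ∑ j, (G x)⁻¹ i j * (L (EuclideanSpace.single i 1) k * G x k j) =
      L (EuclideanSpace.single i 1) k * if i = k then 1 else 0 := by
    intro k
    rw [← hG.inv_mul hx i k, Finset.mul_sum]
    exact Finset.sum_congr rfl fun j _ => by rw [hG.symm x hx k j]; ring
  simp [h2]

theorem metricTrace_swap {U : Set (Coord m)} (hG : IsMetricOn U G) (hx : x ∈ U)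
    (b : Coord m → Coord m → F) :
    metricTrace G x (fun u v => b v u) = metricTrace G x b := by
  have h1 : ∀ i j, (G x)⁻¹ i j = (G x)⁻¹ j i := by
    have h2 : (G x).transpose = G x := Matrix.ext fun i j => hG.symm x hx j i
    intro i j
    conv_lhs => rw [← h2, ← Matrix.transpose_nonsing_inv, Matrix.transpose_apply]
  rw [metricTrace, Finset.sum_comm, metricTrace]
  exact Finset.sum_congr rfl fun i _ => Finset.sum_congr rfl fun j _ => by rw [h1]

/-- The gradient of a function in coordinates. -/
noncomputable def grad (G : MetricField m) (f : Coord m → ℝ) (x : Coord m) : Coord m :=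
  metricTrace G x fun u v => fderiv ℝ f x v • u

theorem metr_grad {U : Set (Coord m)} (hG : IsMetricOn U G) (hx : x ∈ U) (f : Coord m → ℝ)
    (w : Coord m) : metr G x (grad G f x) w = fderiv ℝ f x w := by
  have h2 : ∀ u, metr G x u w = metr G x w u := fun u => hG.leviCivita'.g_symm x hx u w
  -- The vector representing the differential exists by a dimension count. Pairing the coordinate
  -- gradient with `w` is then the trace of a rank one operator.
  obtain ⟨z, hz⟩ : ∃ z, ∀ v, fderiv ℝ f x v = metr G x z v := by
    have hinj : Function.Injective (fun z : Coord m => (metr G x z : Coord m →ₗ[ℝ] ℝ)) := by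
      intro z z' h
      exact hG.leviCivita'.eq_of_forall hx fun w => LinearMap.congr_fun h w
    let L : Coord m →ₗ[ℝ] Module.Dual ℝ (Coord m) :=
      (ContinuousLinearMap.coeLM ℝ).comp (metr G x : Coord m →ₗ[ℝ] Coord m →L[ℝ] ℝ)
    have hs := (LinearMap.injective_iff_surjective_of_finrank_eq_finrank
      (Subspace.dual_finrank_eq (K := ℝ) (V := Coord m)).symm (f := L)).mp hinj
    obtain ⟨z, hz⟩ := hs (fderiv ℝ f x : Coord m →ₗ[ℝ] ℝ)
    exact ⟨z, fun v => (LinearMap.congr_fun hz v).symm⟩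
  have h3 := metricTrace_map (G := G) (x := x) ((metr G x w : Coord m →ₗ[ℝ] ℝ))
    (fun u v => fderiv ℝ f x v • u)
  have h4 := metricTrace_metr hG hx ((metr G x w).smulRight z)
  rw [h2, grad]
  refine h3.symm.trans (Eq.trans ?_ (h4.trans ?_))
  · congr 1
    funext u v
    simp [hz, mul_comm]
  · rw [opTrace_apply]
    exact (LinearMap.trace_smulRight _ _).trans (by
      rw [hz w]; exact (h2 z).symm)

theorem contDiffAt_grad {U : Set (Coord m)} (hG : IsMetricOn U G) (hx : x ∈ U) {f : Coord m → ℝ}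
    (hf : ContDiffAt ℝ ∞ f x) : ContDiffAt ℝ ∞ (grad G f) x := by
  change ContDiffAt ℝ ∞ (fun y => ∑ i, ∑ j, (G y)⁻¹ i j •
    (fderiv ℝ f y (EuclideanSpace.single j 1) • (EuclideanSpace.single i 1 : Coord m))) x
  exact ContDiffAt.sum fun i _ => ContDiffAt.sum fun j _ =>
    (contDiffAt_matrix_inv (hG.smooth x hx) (hG.det_ne hx) i j).smul
      (contDiffAt_smul_const (contDiffAt_fderiv_apply hf _) _)

end MetricTrace

theorem dMap_eq {F : Coord m → Coord k} {x : Coord m} (hF : DifferentiableAt ℝ F x) (j : Fin m)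
    (a : Fin k) : dMap F j x a = fderiv ℝ F x (EuclideanSpace.single j 1) a := by
  have h1 := ((EuclideanSpace.proj (𝕜 := ℝ) a :
    Coord k →L[ℝ] ℝ).hasFDerivAt.comp x hF.hasFDerivAt).fderiv
  exact congrArg (fun L : Coord m →L[ℝ] ℝ => L (EuclideanSpace.single j 1)) h1

/-- The bridge between the component formulas of the definitions and the coordinate-free calculus of
`covAlong`. -/
theorem covDerivAlong_eq {H : MetricField k} {F : Coord m → Coord k} {x : Coord m}
    (hF : DifferentiableAt ℝ F x) {W : Coord m → Fin k → ℝ} {V : Coord m → Coord k}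
    (hV : DifferentiableAt ℝ V x) (hWV : ∀ᶠ y in nhds x, ∀ a, W y a = V y a) (i : Fin m)
    (a : Fin k) : covDerivAlong H F i W x a =
      covAlong (conn H) F (EuclideanSpace.single i 1) V x a := by
  have h1 : (fun y => W y a) =ᶠ[nhds x] fun y => V y a := hWV.mono fun y hy => hy a
  have h2 := dMap_eq hV i a
  rw [covDerivAlong, covAlong, pd, h1.fderiv_eq, PiLp.add_apply, ← h2, conn, coordMul_apply]
  simp only [dMap_eq hF, hWV.self_of_nhds]
  rfl

/-- A hypersurface in a coordinate domain of a Riemannian manifold, given by the components of the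
metrics, of the map and of the unit normal field. -/
structure CoordHypersurface {n : ℕ} (U : Set (Coord n)) (G : MetricField n)
    (U' : Set (Coord (n + 1))) (H : MetricField (n + 1)) (F ξ : Coord n → Coord (n + 1)) :
    Prop where
  src : IsMetricOn U G
  tgt : IsMetricOn U' H
  mapsTo : ∀ x ∈ U, F x ∈ U'
  F_smooth : ∀ x ∈ U, ContDiffAt ℝ ∞ F x
  ξ_smooth : ∀ x ∈ U, ContDiffAt ℝ ∞ ξ x
  isometric : ∀ x ∈ U, ∀ u v, metr H (F x) (fderiv ℝ F x u) (fderiv ℝ F x v) = metr G x u v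
  unit : ∀ x ∈ U, metr H (F x) (ξ x) (ξ x) = 1
  normal : ∀ x ∈ U, ∀ u, metr H (F x) (fderiv ℝ F x u) (ξ x) = 0

/-- The matrix of the Weingarten operator. -/
noncomputable def weingartenMatrix {n : ℕ} (G : MetricField n) (H : MetricField (n + 1))
    (F ξ : Coord n → Coord (n + 1)) (x : Coord n) : Matrix (Fin n) (Fin n) ℝ :=
  (G x)⁻¹ * Matrix.of fun i j => innerAt H (F x) (covDerivAlong H F i (dMap F j) x) (ξ x)

/-- The Weingarten operator. -/
noncomputable def weingarten {n : ℕ} (G : MetricField n) (H : MetricField (n + 1))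
    (F ξ : Coord n → Coord (n + 1)) (x : Coord n) : Coord n →L[ℝ] Coord n :=
  coordEnd (weingartenMatrix G H F ξ x)

namespace CoordHypersurface

variable {n : ℕ} {U : Set (Coord n)} {G : MetricField n} {U' : Set (Coord (n + 1))}
  {H : MetricField (n + 1)} {F ξ : Coord n → Coord (n + 1)}
  (hC : CoordHypersurface U G U' H F ξ) {x : Coord n} (hx : x ∈ U)

include hC

theorem isometricChart : IsometricChart U (metr G) (conn G) U' (metr H) (conn H) F :=
  ⟨hC.src.leviCivita', hC.tgt.leviCivita', hC.mapsTo, hC.F_smooth, hC.isometric⟩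

include hx

theorem covDerivAlong_dMap (i j : Fin n) (a : Fin (n + 1)) : covDerivAlong H F i (dMap F j) x a =
    covAlong (conn H) F (EuclideanSpace.single i 1)
      (fun y => fderiv ℝ F y (EuclideanSpace.single j 1)) x a := by
  refine covDerivAlong_eq (differentiableAt_of_smooth (hC.F_smooth x hx))
    (differentiableAt_of_smooth (contDiffAt_fderiv_apply (hC.F_smooth x hx) _)) ?_ i a
  filter_upwards [hC.src.isOpen.mem_nhds hx] with y hy a
    using dMap_eq (differentiableAt_of_smooth (hC.F_smooth y hy)) j a

theorem secondFund_eq (i j : Fin n) :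
    innerAt H (F x) (covDerivAlong H F i (dMap F j) x) (ξ x) =
      metr H (F x) (covAlong (conn H) F (EuclideanSpace.single i 1)
      (fun y => fderiv ℝ F y (EuclideanSpace.single j 1)) x) (ξ x) := by
  rw [← innerAt_eq]
  congr 1
  exact funext fun a => hC.covDerivAlong_dMap hx i j a

theorem weingarten_shape (u v : Coord n) : metr G x (weingarten G H F ξ x u) v =
    metr H (F x) (covAlong (conn H) F u (fun y => fderiv ℝ F y v) x) (ξ x) := by
  have hF := differentiableAt_of_smooth ((hC.F_smooth x hx).fderiv_right (m := ∞) (by simp))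
  have hcov : ∀ u v, covAlong (conn H) F u (fun y => fderiv ℝ F y v) x =
      fderiv ℝ (fderiv ℝ F) x u v + conn H (F x) (fderiv ℝ F x u) (fderiv ℝ F x v) := by
    intro u v
    rw [covAlong, fderiv_clm_apply hF (differentiableAt_const v)]
    simp
  rw [hcov]
  induction u using coord_induction with
  | h0 => simp
  | hadd u u' hu hu' => simp only [map_add, add_apply, hu, hu']; ring
  | hsmul a u hu => simp only [map_smul, smul_apply, smul_eq_mul, hu, map_add, add_apply]; ring
  | hs i =>
  induction v using coord_induction with
  | h0 => simp
  | hadd u u' hu hu' => simp only [map_add, add_apply, hu, hu']; ring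
  | hsmul a u hu => simp only [map_smul, smul_apply, smul_eq_mul, hu, map_add, add_apply]; ring
  | hs j =>
  rw [← hcov, hC.isometricChart.covAlong_dF_symm hx, ← hC.secondFund_eq hx, metr,
    coordBilin_apply]
  have h1 : ∀ k, weingarten G H F ξ x (EuclideanSpace.single i 1) k =
      weingartenMatrix G H F ξ x k i := by
    intro k
    rw [weingarten, coordEnd_apply]
    simp
  have h2 : ∑ k, G x j k * weingartenMatrix G H F ξ x k i =
      innerAt H (F x) (covDerivAlong H F j (dMap F i) x) (ξ x) := by
    rw [← Matrix.mul_apply, weingartenMatrix, ← Matrix.mul_assoc,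
      Matrix.mul_nonsing_inv _ (isUnit_iff_ne_zero.mpr (hC.src.det_ne hx)), Matrix.one_mul]
    rfl
  rw [← h2]
  refine Finset.sum_congr rfl fun k _ => ?_
  rw [Finset.sum_eq_single j (fun l _ hl => by simp [hl])
    (fun h => absurd (Finset.mem_univ j) h), h1, hC.src.symm x hx k j]
  simp

theorem weingarten_smooth : ContDiffAt ℝ ∞ (weingarten G H F ξ) x := by
  refine contDiffAt_coordEnd fun i j => ?_
  simp only [weingartenMatrix, Matrix.mul_apply]
  refine ContDiffAt.sum fun k _ => (contDiffAt_matrix_inv (hC.src.smooth x hx)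
    (hC.src.det_ne hx) i k).mul ?_
  have h1 : (fun y => Matrix.of (fun i j => innerAt H (F y) (covDerivAlong H F i (dMap F j) y)
      (ξ y)) k j) =ᶠ[nhds x] fun y => metr H (F y) (covAlong (conn H) F
        (EuclideanSpace.single k 1) (fun y => fderiv ℝ F y (EuclideanSpace.single j 1)) y)
        (ξ y) := by
    filter_upwards [hC.src.isOpen.mem_nhds hx] with y hy using hC.secondFund_eq hy k j
  refine ContDiffAt.congr_of_eventuallyEq ?_ h1
  exact ((((hC.tgt.leviCivita'.g_smooth _ (hC.mapsTo x hx)).comp x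
    (hC.F_smooth x hx)).clm_apply (contDiffAt_covAlong (hC.F_smooth x hx)
    (hC.tgt.leviCivita'.Γ_smooth _ (hC.mapsTo x hx))
    (contDiffAt_fderiv_apply (hC.F_smooth x hx) _))).clm_apply (hC.ξ_smooth x hx))

omit hx

theorem hypersurfaceChart : HypersurfaceChart U (metr G) (conn G) U' (metr H) (conn H) F ξ
    (weingarten G H F ξ) :=
  { hC.isometricChart with
    finrank := by simp
    ξ_smooth := hC.ξ_smooth
    unit := hC.unit
    normal := hC.normal
    A_smooth := fun x hx => hC.weingarten_smooth hx
    shape := fun x hx => hC.weingarten_shape hx }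

end CoordHypersurface

end CoordinateHypersurface


/-! ### Components of the biharmonic equation and the scalar curvature. -/

section CoordinateHypersurface

theorem conn_single {m : ℕ} (G : MetricField m) (x : Coord m) (i j : Fin m) :
    conn G x (EuclideanSpace.single i 1) (EuclideanSpace.single j 1) =
      ∑ l, christoffel G l i j x • (EuclideanSpace.single l 1 : Coord m) := by
  conv_lhs => rw [coord_eq_sum (conn G x _ _)]
  simp only [conn, coordMul_single]

theorem curvatureOp_eq' {m : ℕ} {U : Set (Coord m)} {G : MetricField m} (hG : IsMetricOn U G)
    {x : Coord m} (hx : x ∈ U) (X Y Z : Coord m) :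
    curvatureOp G x X Y Z = curv (conn G) X Y x Z :=
  funext fun l => curvatureOp_eq hG hx X Y Z l

theorem curvature_eq {m : ℕ} {U : Set (Coord m)} {G : MetricField m} (hG : IsMetricOn U G)
    {x : Coord m} (hx : x ∈ U) (l i j k : Fin m) :
    curvature G l i j k x = curv (conn G) (EuclideanSpace.single i 1) (EuclideanSpace.single j 1) x
      (EuclideanSpace.single k 1) l := by
  rw [← curvatureOp_eq' hG hx]
  simp [curvatureOp]

theorem curv_conn_of_sectional {m : ℕ} {U : Set (Coord m)} {G : MetricField m}
    (hG : IsMetricOn U G) {x : Coord m} (hx : x ∈ U) {c : ℝ}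
    (hsec : ∀ X Y : Fin m → ℝ, innerAt G x (curvatureOp G x X Y Y) X =
      c * (innerAt G x X X * innerAt G x Y Y - innerAt G x X Y ^ 2)) (X Y Z : Coord m) :
    curv (conn G) X Y x Z = c • (metr G x Y Z • X - metr G x X Z • Y) := by
  refine hG.leviCivita'.curv_of_sectional hx (fun X Y => ?_) X Y Z
  have h := hsec X Y
  rw [curvatureOp_eq' hG hx, innerAt_eq, innerAt_eq, innerAt_eq, innerAt_eq] at h
  exact h

theorem covAlong_sum_dir {E E' κ : Type*} [NormedAddCommGroup E] [NormedSpace ℝ E]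
    [NormedAddCommGroup E'] [NormedSpace ℝ E'] {Γ' : E' → E' →L[ℝ] E' →L[ℝ] E'} {F : E → E'}
    {W : E → E'} {x : E} (s : Finset κ) (a : κ → ℝ) (u : κ → E) :
    covAlong Γ' F (∑ i ∈ s, a i • u i) W x = ∑ i ∈ s, a i • covAlong Γ' F (u i) W x := by
  simp only [covAlong, map_sum, map_smul, sum_apply, smul_apply, smul_add, Finset.sum_add_distrib]

namespace CoordHypersurface

variable {n : ℕ} {U : Set (Coord n)} {G : MetricField n} {U' : Set (Coord (n + 1))}
  {H : MetricField (n + 1)} {F ξ : Coord n → Coord (n + 1)}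
  (hC : CoordHypersurface U G U' H F ξ) {x : Coord n} (hx : x ∈ U)

include hC hx

theorem trace_smooth : ContDiffAt ℝ ∞ (fun y => opTrace (Coord n) (weingarten G H F ξ y)) x :=
  (opTrace (Coord n)).contDiff.contDiffAt.comp x (hC.weingarten_smooth hx)

theorem normalMul_smooth : ContDiffAt ℝ ∞
    (fun y => opTrace (Coord n) (weingarten G H F ξ y) • ξ y) x :=
  (hC.trace_smooth hx).smul (hC.ξ_smooth x hx)

/-- By the Gauss formula the tangential parts cancel against the Christoffel terms of the source,
leaving the trace of the second fundamental form times the normal. -/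
theorem tension_eq (a : Fin (n + 1)) : tension G H F x a =
    (opTrace (Coord n) (weingarten G H F ξ x) • ξ x) a := by
  have h1 : ∀ i j, covDerivAlong H F i (dMap F j) x a -
      ∑ l, christoffel G l i j x * dMap F l x a = (metr G x (weingarten G H F ξ x
        (EuclideanSpace.single i 1)) (EuclideanSpace.single j 1) • ξ x) a := by
    intro i j
    have h2 := hC.hypersurfaceChart.covAlong_tangent hx
      (differentiableAt_const (EuclideanSpace.single j (1 : ℝ))) (EuclideanSpace.single i 1)
    rw [hC.src.leviCivita'.covVec_const hx] at h2
    have h3 : ∑ l, christoffel G l i j x * dMap F l x a = fderiv ℝ F x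
        (conn G x (EuclideanSpace.single i 1) (EuclideanSpace.single j 1)) a := by
      rw [conn_single, map_sum]
      simp only [map_smul, WithLp.ofLp_sum, Finset.sum_apply, PiLp.smul_apply, smul_eq_mul,
        dMap_eq (differentiableAt_of_smooth (hC.F_smooth x hx))]
    rw [hC.covDerivAlong_dMap hx, h2, h3, PiLp.add_apply, add_sub_cancel_left]
  have h4 := metricTrace_smul_const (G := G) (x := x)
    (fun u v => metr G x (weingarten G H F ξ x u) v) (ξ x)
  rw [metricTrace_metr hC.src hx] at h4
  rw [← h4, tension, metricTrace]
  simp only [h1, WithLp.ofLp_sum, Finset.sum_apply, PiLp.smul_apply, smul_eq_mul]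

theorem covDerivAlong_tension (i : Fin n) (a : Fin (n + 1)) :
    covDerivAlong H F i (tension G H F) x a = covAlong (conn H) F (EuclideanSpace.single i 1)
      (fun y => opTrace (Coord n) (weingarten G H F ξ y) • ξ y) x a := by
  refine covDerivAlong_eq (differentiableAt_of_smooth (hC.F_smooth x hx))
    (differentiableAt_of_smooth (hC.normalMul_smooth hx)) ?_ i a
  filter_upwards [hC.src.isOpen.mem_nhds hx] with y hy a using hC.tension_eq hy a

theorem bitension_eq (a : Fin (n + 1)) : bitension G H F x a =
    (metricTrace G x (fun u v => covAlong (conn H) F u (covAlong (conn H) F v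
        fun y => opTrace (Coord n) (weingarten G H F ξ y) • ξ y) x -
      covAlong (conn H) F (conn G x u v)
        (fun y => opTrace (Coord n) (weingarten G H F ξ y) • ξ y) x) -
    metricTrace G x (fun u v => curv (conn H) (fderiv ℝ F x u)
      (opTrace (Coord n) (weingarten G H F ξ x) • ξ x) (F x) (fderiv ℝ F x v))) a := by
  have h1 : ∀ i j, covDerivAlong H F i (covDerivAlong H F j (tension G H F)) x a =
      covAlong (conn H) F (EuclideanSpace.single i 1) (covAlong (conn H) F
        (EuclideanSpace.single j 1)
        fun y => opTrace (Coord n) (weingarten G H F ξ y) • ξ y) x a := by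
    intro i j
    refine covDerivAlong_eq (differentiableAt_of_smooth (hC.F_smooth x hx))
      (differentiableAt_of_smooth (contDiffAt_covAlong (hC.F_smooth x hx)
        (hC.isometricChart.Γ'_smooth hx) (hC.normalMul_smooth hx))) ?_ i a
    filter_upwards [hC.src.isOpen.mem_nhds hx] with y hy a using hC.covDerivAlong_tension hy j a
  have h2 : ∀ i j, ∑ l, christoffel G l i j x * covDerivAlong H F l (tension G H F) x a =
      covAlong (conn H) F (conn G x (EuclideanSpace.single i 1) (EuclideanSpace.single j 1))
        (fun y => opTrace (Coord n) (weingarten G H F ξ y) • ξ y) x a := by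
    intro i j
    rw [conn_single, covAlong_sum_dir]
    simp only [WithLp.ofLp_sum, Finset.sum_apply, PiLp.smul_apply, smul_eq_mul,
      hC.covDerivAlong_tension hx]
  have h3 : ∀ i, dMap F i x = (fderiv ℝ F x (EuclideanSpace.single i 1) : Coord (n + 1)) :=
    fun i => funext fun a => dMap_eq (differentiableAt_of_smooth (hC.F_smooth x hx)) i a
  have h4 : tension G H F x = (opTrace (Coord n) (weingarten G H F ξ x) • ξ x : Coord (n + 1)) :=
    funext fun a => hC.tension_eq hx a
  rw [bitension, roughLaplacian, PiLp.sub_apply]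
  simp only [metricTrace, h1, h2, h3, h4, curvatureOp_eq' hC.tgt (hC.mapsTo x hx),
    WithLp.ofLp_sum, Finset.sum_apply, PiLp.smul_apply, PiLp.sub_apply, smul_eq_mul]

theorem metr_covVec_grad {f : Coord n → ℝ} (hf : ∀ y ∈ U, ContDiffAt ℝ ∞ f y) (u v : Coord n) :
    metr G x (covVec (conn G) u (grad G f) x) v =
      fderiv ℝ (fun y => fderiv ℝ f y v) x u - fderiv ℝ f x (conn G x u v) := by
  have h1 : (fun y => fderiv ℝ f y v) =ᶠ[nhds x] fun y => metr G y (grad G f y) v := by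
    filter_upwards [hC.src.isOpen.mem_nhds hx] with y hy using (metr_grad hC.src hy f v).symm
  rw [h1.fderiv_eq, hC.src.leviCivita'.fderiv_metric hx
    (differentiableAt_of_smooth (contDiffAt_grad hC.src hx (hf x hx)))
    (differentiableAt_const v), hC.src.leviCivita'.covVec_const hx, metr_grad hC.src hx]
  ring

/-- The tangential and the normal part of the biharmonic equation. -/
theorem bitension_components {c : ℝ} (hc : ∀ y ∈ U', ∀ X Y Z, curv (conn H) X Y y Z =
    c • (metr H y Y Z • X - metr H y X Z • Y)) (hbi : bitension G H F x = 0) {A : _} {f : _}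
    (hA : A = weingarten G H F ξ) (hf : f = fun y => opTrace (Coord n) (A y)) :
    (2 : ℝ) • A x (grad G f x) + f x • grad G f x = 0 ∧
    opTrace (Coord n) (fderiv ℝ (grad G f) x + (conn G x).flip (grad G f x)) -
      f x * opTrace (Coord n) (A x * A x) + c * n * f x = 0 := by
  have hH := hC.hypersurfaceChart
  rw [← hA] at hH
  have hfs : ∀ y ∈ U, ContDiffAt ℝ ∞ f y := fun y hy => by
    rw [hf, hA]; exact hC.trace_smooth hy
  have hAs := hH.A_symm hx
  have hgs := hC.src.leviCivita'.g_symm x hx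
  have hcod := fun u v => hH.codazzi hx (hc _ (hC.mapsTo x hx)) u v
  have h0 : metricTrace G x (fun u v => covAlong (conn H) F u (covAlong (conn H) F v
        fun y => f y • ξ y) x - covAlong (conn H) F (conn G x u v) (fun y => f y • ξ y) x) -
      metricTrace G x (fun u v => curv (conn H) (fderiv ℝ F x u) (f x • ξ x) (F x)
        (fderiv ℝ F x v)) = 0 := by
    ext a
    rw [hf, hA, ← hC.bitension_eq hx, hbi]
    rfl
  have h1 : (fun u v => covAlong (conn H) F u (covAlong (conn H) F v fun y => f y • ξ y) x -
      covAlong (conn H) F (conn G x u v) (fun y => f y • ξ y) x) = fun u v =>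
      (fderiv ℝ F x : Coord n →ₗ[ℝ] Coord (n + 1)) (-(fderiv ℝ f x v • A x u +
        fderiv ℝ f x u • A x v + f x • covEnd (conn G) u A x v)) +
      (metr G x (covVec (conn G) u (grad G f) x) v -
        f x * metr G x ((A x * A x) u) v) • ξ x := by
    funext u v
    rw [hH.covAlong_covAlong_normal hx hfs, hC.metr_covVec_grad hx hfs, mul_apply_eq_comp,
      hAs (A x u) v]
    rfl
  -- In constant curvature this term is purely normal, because the normal field is orthogonal to the
  -- image of the differential.
  have h2 : (fun u v => curv (conn H) (fderiv ℝ F x u) (f x • ξ x) (F x) (fderiv ℝ F x v)) =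
      fun u v => (-(c * f x) * metr G x ((1 : Coord n →L[ℝ] Coord n) u) v) • ξ x := by
    funext u v
    rw [hc _ (hC.mapsTo x hx), map_smul, smul_apply, hH.tgt_symm hx (ξ x), hH.normal x hx,
      hH.isometric x hx, one_apply_eq_self]
    module
  have e1 : metricTrace G x (fun u v => fderiv ℝ f x v • A x u) = A x (grad G f x) := by
    rw [grad]
    refine Eq.trans ?_ (metricTrace_map (A x : Coord n →ₗ[ℝ] Coord n) _)
    congr 1
    funext u v
    exact (map_smul (A x) _ _).symm
  have e2 : metricTrace G x (fun u v => fderiv ℝ f x u • A x v) = A x (grad G f x) := by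
    rw [← e1, ← metricTrace_swap hC.src hx]
  -- The divergence of `A` is the gradient of its trace, by Codazzi and self-adjointness.
  have e3 : metricTrace G x (fun u v => covEnd (conn G) u A x v) = grad G f x := by
    refine hC.src.leviCivita'.eq_of_forall hx fun w => ?_
    rw [metr_grad hC.src hx, hgs]
    have e4 := metricTrace_map (G := G) (x := x) (metr G x w : Coord n →ₗ[ℝ] ℝ)
      (fun u v => covEnd (conn G) u A x v)
    refine e4.symm.trans ?_
    have e5 := metricTrace_metr hC.src hx (covEnd (conn G) w A x)
    rw [← fderiv_opTrace (differentiableAt_of_smooth (hH.A_smooth x hx)), ← hf] at e5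
    rw [← e5]
    congr 1
    funext u v
    change metr G x w _ = _
    rw [← hC.src.leviCivita'.covEnd_selfAdj hx (hH.A_smooth x hx)
      (fun y hy => hH.A_symm hy), hcod u w]
  rw [h1, h2, metricTrace_add, metricTrace_map, metricTrace_smul_const, metricTrace_smul_const,
    metricTrace_sub] at h0
  have e6 : metricTrace G x (fun u v => -(fderiv ℝ f x v • A x u + fderiv ℝ f x u • A x v +
      f x • covEnd (conn G) u A x v)) =
      -((2 : ℝ) • A x (grad G f x) + f x • grad G f x) := by
    have := metricTrace_smul (G := G) (x := x) (-1) (fun u v => fderiv ℝ f x v • A x u +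
      fderiv ℝ f x u • A x v + f x • covEnd (conn G) u A x v)
    simp only [neg_smul, one_smul] at this
    rw [this, metricTrace_add, metricTrace_add, metricTrace_smul, e1, e2, e3, two_smul]
  have e7 : metricTrace G x (fun u v => metr G x (covVec (conn G) u (grad G f) x) v) =
      opTrace (Coord n) (fderiv ℝ (grad G f) x + (conn G x).flip (grad G f x)) := by
    rw [← metricTrace_metr hC.src hx]
    rfl
  have e8 : metricTrace G x (fun u v => f x * metr G x ((A x * A x) u) v) =
      f x * opTrace (Coord n) (A x * A x) := by
    rw [← metricTrace_metr hC.src hx]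
    exact metricTrace_smul (f x) fun u v => metr G x ((A x * A x) u) v
  have e9 : metricTrace G x (fun u v => -(c * f x) * metr G x ((1 : Coord n →L[ℝ] Coord n) u) v) =
      -(c * f x) * n := by
    refine (metricTrace_smul (-(c * f x)) fun u v =>
      metr G x ((1 : Coord n →L[ℝ] Coord n) u) v).trans ?_
    rw [metricTrace_metr hC.src hx, opTrace_apply, smul_eq_mul]
    congr 1
    exact (LinearMap.trace_one ℝ (Coord n)).trans (by simp)
  rw [e6, e7, e8, e9] at h0
  have h3 := hH.components hx (u := -((2 : ℝ) • A x (grad G f x) + f x • grad G f x))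
    (t := opTrace (Coord n) (fderiv ℝ (grad G f) x + (conn G x).flip (grad G f x)) -
      f x * opTrace (Coord n) (A x * A x) + c * n * f x) (u' := 0) (t' := 0) (by
      rw [map_zero, zero_smul, add_zero, ← h0]
      change (fderiv ℝ F x) _ + _ = (fderiv ℝ F x) _ + _ - _
      module)
  exact ⟨neg_eq_zero.mp h3.1, h3.2⟩

/-- The Gauss equation traced twice. With constant scalar curvature it ties `trace (A ^ 2)` to
`(trace A) ^ 2`. -/
theorem scalarCurvature_eq {c : ℝ} (hc : ∀ y ∈ U', ∀ X Y Z, curv (conn H) X Y y Z =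
    c • (metr H y Y Z • X - metr H y X Z • Y)) {A : _} (hA : A = weingarten G H F ξ) :
    scalarCurvatureIn G x = n * (n - 1) * c + opTrace (Coord n) (A x) ^ 2 -
      opTrace (Coord n) (A x * A x) := by
  have hH := hC.hypersurfaceChart
  rw [← hA] at hH
  have hgauss := fun u v w => (hH.gauss_codazzi hx (hc _ (hC.mapsTo x hx)) u v w).1
  have h1 : ∀ u v : Coord n, ∑ i, curv (conn G) (EuclideanSpace.single i 1) u x v i =
      ((n - 1) * c) * metr G x ((1 : Coord n →L[ℝ] Coord n) u) v +
        opTrace (Coord n) (A x) * metr G x (A x u) v - metr G x ((A x * A x) u) v := by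
    intro u v
    have s1 : ∑ i, metr G x (EuclideanSpace.single i 1) v * u i = metr G x u v := by
      conv_rhs => rw [coord_eq_sum u]
      simp [map_sum, sum_apply, mul_comm]
    have s2 : ∑ i, metr G x (A x (EuclideanSpace.single i 1)) v * A x u i =
        metr G x (A x (A x u)) v := by
      conv_rhs => rw [coord_eq_sum (A x u)]
      simp [map_sum, sum_apply, mul_comm]
    simp only [hgauss, PiLp.add_apply, PiLp.sub_apply, PiLp.smul_apply, smul_eq_mul,
      Finset.sum_add_distrib, Finset.sum_sub_distrib, ← Finset.mul_sum, s1, s2,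
      ← opTrace_eq_sum, mul_apply_eq_comp, one_apply_eq_self]
    simp
    ring
  have h2 : scalarCurvatureIn G x = metricTrace G x fun u v =>
      ∑ i, curv (conn G) (EuclideanSpace.single i 1) u x v i := by
    simp only [scalarCurvatureIn, metricTrace, curvature_eq hC.src hx, smul_eq_mul]
  have h3 : opTrace (Coord n) 1 = n := by
    rw [opTrace_apply]
    exact (LinearMap.trace_one ℝ (Coord n)).trans (by simp)
  simp only [h2, h1]
  rw [metricTrace_sub, metricTrace_add, metricTrace_metr hC.src hx]
  have h4 := metricTrace_smul (G := G) (x := x) ((n - 1) * c) fun u v =>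
    metr G x ((1 : Coord n →L[ℝ] Coord n) u) v
  have h5 := metricTrace_smul (G := G) (x := x) (opTrace (Coord n) (A x)) fun u v =>
    metr G x (A x u) v
  rw [metricTrace_metr hC.src hx] at h4 h5
  simp only [smul_eq_mul] at h4 h5
  rw [h4, h5, h3]
  ring

omit hx in
theorem biharmonicChart {c R : ℝ} (hsec : ∀ y ∈ U', ∀ X Y : Fin (n + 1) → ℝ,
      innerAt H y (curvatureOp H y X Y Y) X =
        c * (innerAt H y X X * innerAt H y Y Y - innerAt H y X Y ^ 2))
    (hbi : ∀ x ∈ U, bitension G H F x = 0) (hR : ∀ x ∈ U, scalarCurvatureIn G x = R) :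
    BiharmonicChart U c (n * (n - 1) * c - R) (metr G) (conn G) (weingarten G H F ξ)
      (fun x => -(1 / 2) * opTrace (Coord n) (weingarten G H F ξ x))
      (fun x => (-(1 / 2) : ℝ) •
        grad G (fun y => opTrace (Coord n) (weingarten G H F ξ y)) x) := by
  have hc := fun y hy => curv_conn_of_sectional hC.tgt hy (hsec y hy)
  have hH := hC.hypersurfaceChart
  have hgs := fun x hx => contDiffAt_grad hC.src hx (hC.trace_smooth (x := x) hx)
  have hbc := fun x hx => hC.bitension_components hx hc (hbi x hx) rfl rfl
  have hsq : ∀ x ∈ U, opTrace (Coord n) (weingarten G H F ξ x * weingarten G H F ξ x) =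
      4 * (-(1 / 2) * opTrace (Coord n) (weingarten G H F ξ x)) ^ 2 +
        (n * (n - 1) * c - R) := fun x hx => by
    have h1 := hC.scalarCurvature_eq hx hc rfl
    rw [hR x hx] at h1
    linarith
  exact
  { hC.src.leviCivita' with
    A_smooth := hH.A_smooth
    N_smooth := fun x hx => (hgs x hx).const_smul _
    l_smooth := fun x hx => contDiffAt_const.mul (hC.trace_smooth hx)
    A_symm := fun x hx => hH.A_symm hx
    codazzi := fun x hx => hH.codazzi hx (hc _ (hC.mapsTo x hx))
    gauss := fun x hx v u w => (hH.gauss_codazzi hx (hc _ (hC.mapsTo x hx)) v u w).1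
    trace_A := fun x hx => by ring
    trace_A_sq := hsq
    grad := fun x hx u => by
      rw [fderiv_const_mul (differentiableAt_of_smooth (hC.trace_smooth hx)), map_smul,
        smul_apply, smul_apply, metr_grad hC.src hx]
    A_grad := fun x hx => by
      have h1 := (hbc x hx).1
      rw [map_smul]
      -- With `f = -2 l` and `N = -(1 / 2) grad f`, the tangential equation `2 A grad f + f grad f =
      -- 0` is `-4 (A N - l N) = 0`.
      apply smul_right_injective (Coord n) (show (-4 : ℝ) ≠ 0 by norm_num)
      beta_reduce
      rw [← sub_eq_zero, ← h1]
      module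
    lap := fun x hx => by
      have h1 := (hbc x hx).2
      have h2 := hsq x hx
      have h3 : fderiv ℝ (fun x => (-(1 / 2) : ℝ) •
          grad G (fun y => opTrace (Coord n) (weingarten G H F ξ y)) x) x =
          (-(1 / 2) : ℝ) • fderiv ℝ
            (grad G fun y => opTrace (Coord n) (weingarten G H F ξ y)) x :=
        fderiv_fun_const_smul (differentiableAt_of_smooth (hgs x hx)) _
      rw [h3, map_smul, ← smul_add, map_smul, finrank_euclideanSpace_fin, smul_eq_mul]
      rw [h2] at h1
      linear_combination -(1 / 2) * h1 }

end CoordHypersurface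

end CoordinateHypersurface


/-! ### From manifolds to coordinate hypersurfaces. -/

theorem IsMetricOn.mono {m : ℕ} {U V : Set (Coord m)} {G : MetricField m} (hG : IsMetricOn U G)
    (hV : IsOpen V) (hVU : V ⊆ U) : IsMetricOn V G where
  isOpen := hV
  smooth x hx := hG.smooth x (hVU hx)
  symm x hx := hG.symm x (hVU hx)
  pos x hx := hG.pos x (hVU hx)

section ManifoldCharts

set_option linter.unusedSectionVars false

variable {m : ℕ} {M : Type*} [TopologicalSpace M] [ChartedSpace (Coord m) M]
  [IsManifold (𝓡 m) ∞ M]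
  {k : ℕ} {N : Type*} [TopologicalSpace N] [ChartedSpace (Coord k) N] [IsManifold (𝓡 k) ∞ N]
  {d : ℕ} {Z : Type*} [TopologicalSpace Z] [ChartedSpace (Coord d) Z]

theorem contMDiffAt_tangentMap {f : M → N} {s : Set M} (hs : IsOpen s)
    (hf : ContMDiffOn (𝓡 m) (𝓡 k) ∞ f s) {V : Z → TangentBundle (𝓡 m) M} {z : Z}
    (hV : ContMDiffAt (𝓡 d) (𝓡 m).tangent ∞ V z) (hz : (V z).1 ∈ s) :
    ContMDiffAt (𝓡 d) (𝓡 k).tangent ∞ (fun z => tangentMap (𝓡 m) (𝓡 k) f (V z)) z := by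
  have h1 := hf.contMDiffOn_tangentMapWithin (m := ∞) (by simp) hs.uniqueMDiffOn
  have ho : IsOpen (Bundle.TotalSpace.proj ⁻¹' s : Set (TangentBundle (𝓡 m) M)) :=
    hs.preimage (FiberBundle.continuous_proj _ _)
  have h2 : ContMDiffAt (𝓡 m).tangent (𝓡 k).tangent ∞ (tangentMap (𝓡 m) (𝓡 k) f) (V z) := by
    refine (h1.contMDiffAt (ho.mem_nhds hz)).congr_of_eventuallyEq ?_
    filter_upwards [ho.mem_nhds hz] with p hp
    exact (tangentMapWithin_eq_tangentMap (hs.uniqueMDiffWithinAt hp)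
      ((hf.contMDiffAt (hs.mem_nhds hp)).mdifferentiableAt (by simp))).symm
  exact h2.comp z hV

theorem contDiffAt_snd {f : Coord d → TangentBundle (𝓡 m) (Coord m)} {x : Coord d}
    (hf : ContMDiffAt (𝓡 d) (𝓡 m).tangent ∞ f x) :
    ContDiffAt ℝ ∞ (fun y => ((f y).2 : Coord m)) x :=
  contMDiffAt_iff_contDiffAt.mp (contMDiff_snd_tangentBundle_modelSpace (Coord m) (𝓡 m)
    |>.contMDiffAt.comp x hf)

theorem contMDiffAt_inner (g : RiemMetric m M) {b : Z → M} {z : Z}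
    {v w : ∀ z, TangentSpace (𝓡 m) (b z)}
    (hv : ContMDiffAt (𝓡 d) (𝓡 m).tangent ∞ (fun z => (⟨b z, v z⟩ : TangentBundle (𝓡 m) M)) z)
    (hw : ContMDiffAt (𝓡 d) (𝓡 m).tangent ∞ (fun z => (⟨b z, w z⟩ : TangentBundle (𝓡 m) M)) z) :
    ContMDiffAt (𝓡 d) 𝓘(ℝ, ℝ) ∞ (fun z => g.inner (b z) (v z) (w z)) z := by
  have hb : ContMDiffAt (𝓡 d) (𝓡 m) ∞ b z := by
    have := hv
    rw [Bundle.contMDiffAt_totalSpace] at this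
    exact this.1
  have : ContMDiffAt (𝓡 d) ((𝓡 m).prod 𝓘(ℝ, ℝ)) ∞
      (fun z => Bundle.TotalSpace.mk' ℝ (E := Bundle.Trivial M ℝ) (b z)
        (g.inner (b z) (v z) (w z))) z := by
    apply ContMDiffAt.clm_bundle_apply₂ (F₁ := Coord m) (F₂ := Coord m)
    · exact g.contMDiff.contMDiffAt.comp z hb
    · exact hv
    · exact hw
  rw [Bundle.contMDiffAt_totalSpace] at this
  exact this.2

/-- The differential of the inverse of a chart, as a linear map of `ℝ^m`. -/
noncomputable def chartInv (e : OpenPartialHomeomorph M (Coord m)) (x : Coord m) :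
    Coord m →L[ℝ] Coord m :=
  mfderiv (𝓡 m) (𝓡 m) e.symm x

/-- The differential of a chart, as a linear map of `ℝ^m`. -/
noncomputable def chartDeriv (e : OpenPartialHomeomorph M (Coord m)) (p : M) :
    Coord m →L[ℝ] Coord m :=
  mfderiv (𝓡 m) (𝓡 m) e p

/-- A Riemannian metric on `M` as a bilinear form on `ℝ^m` depending on the point. -/
noncomputable def innerOn (g : RiemMetric m M) (p : M) : Coord m →L[ℝ] Coord m →L[ℝ] ℝ :=
  g.inner p

theorem innerOn_pos (g : RiemMetric m M) (p : M) {u : Coord m} (hu : u ≠ 0) :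
    0 < innerOn g p u u :=
  g.pos p u hu

theorem metr_metricIn (g : RiemMetric m M) (e : OpenPartialHomeomorph M (Coord m))
    (x u v : Coord m) : metr (metricIn g e) x u v =
      innerOn g (e.symm x) (chartInv e x u) (chartInv e x v) := by
  induction u using coord_induction with
  | h0 => simp
  | hadd u u' hu hu' => simp only [map_add, add_apply, hu, hu']
  | hsmul a u hu => simp only [map_smul, smul_apply, hu]
  | hs i =>
    induction v using coord_induction with
    | h0 => simp
    | hadd v v' hv hv' => simp only [map_add, hv, hv']
    | hsmul a v hv => simp only [map_smul, hv]
    | hs j => exact coordBilin_single _ _ _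

variable {e : OpenPartialHomeomorph M (Coord m)} (he : e ∈ smoothCharts m M)

include he

theorem contMDiffOn_symm_chart : ContMDiffOn (𝓡 m) (𝓡 m) ∞ e.symm e.target :=
  contMDiffOn_symm_of_mem_maximalAtlas he

theorem contMDiffOn_chart : ContMDiffOn (𝓡 m) (𝓡 m) ∞ e e.source :=
  contMDiffOn_of_mem_maximalAtlas he

theorem mdifferentiable_chart : e.MDifferentiable (𝓡 m) (𝓡 m) :=
  ⟨(contMDiffOn_chart he).mdifferentiableOn (by simp),
    (contMDiffOn_symm_chart he).mdifferentiableOn (by simp)⟩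

theorem chartDeriv_chartInv {x : Coord m} (hx : x ∈ e.target) (u : Coord m) :
    chartDeriv e (e.symm x) (chartInv e x u) = u :=
  DFunLike.congr_fun ((mdifferentiable_chart he).comp_symm_deriv hx) u

theorem chartInv_chartDeriv {p : M} (hp : p ∈ e.source) (u : Coord m) :
    chartInv e (e p) (chartDeriv e p u) = u :=
  DFunLike.congr_fun ((mdifferentiable_chart he).symm_comp_deriv hp) u

theorem isMetricOn_metricIn (g : RiemMetric m M) : IsMetricOn e.target (metricIn g e) where
  isOpen := e.open_target
  smooth x hx i j := by
    have h1 : ∀ i : Fin m, ContMDiffAt (𝓡 m) (𝓡 m).tangent ∞ (fun y =>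
        (⟨e.symm y, coordVec e i y⟩ : TangentBundle (𝓡 m) M)) x := by
      intro i
      refine contMDiffAt_tangentMap e.open_target (contMDiffOn_symm_chart he)
        (V := fun y => (⟨y, (EuclideanSpace.single i (1 : ℝ) : Coord m)⟩ :
          TangentBundle (𝓡 m) (Coord m))) ?_ hx
      rw [Bundle.contMDiffAt_totalSpace]
      refine ⟨contMDiffAt_id, ?_⟩
      simpa using contMDiffAt_const
    exact contMDiffAt_iff_contDiffAt.mp (contMDiffAt_inner g (h1 i) (h1 j))
  symm x _ i j := g.symm _ _ _
  pos x hx u hu := by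
    have h1 := metr_metricIn g e x u u
    refine lt_of_lt_of_eq (innerOn_pos g _ fun h0 => hu ?_) h1.symm
    rw [← chartDeriv_chartInv he hx u, h0, map_zero]

theorem metr_chartDeriv (g : RiemMetric m M) {p : M} (hp : p ∈ e.source) (u v : Coord m) :
    metr (metricIn g e) (e p) (chartDeriv e p u) (chartDeriv e p v) = innerOn g p u v := by
  rw [metr_metricIn, chartInv_chartDeriv he hp, chartInv_chartDeriv he hp, e.left_inv hp]

end ManifoldCharts

section MapInCharts

set_option linter.unusedSectionVars false

variable {m : ℕ} {M : Type*} [TopologicalSpace M] [ChartedSpace (Coord m) M]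
  [IsManifold (𝓡 m) ∞ M]
  {k : ℕ} {N : Type*} [TopologicalSpace N] [ChartedSpace (Coord k) N] [IsManifold (𝓡 k) ∞ N]

/-- The domain of the coordinate expression of a map. -/
def mapDomain (φ : M → N) (e : OpenPartialHomeomorph M (Coord m))
    (e' : OpenPartialHomeomorph N (Coord k)) : Set (Coord m) :=
  e.target ∩ e.symm ⁻¹' (φ ⁻¹' e'.source)

/-- The differential of a map between manifolds, as a linear map from `ℝ^m` to `ℝ^k`. -/
noncomputable def mapDeriv (φ : M → N) (p : M) : Coord m →L[ℝ] Coord k :=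
  mfderiv (𝓡 m) (𝓡 k) φ p

theorem mem_mapDomain {φ : M → N} {e : OpenPartialHomeomorph M (Coord m)}
    {e' : OpenPartialHomeomorph N (Coord k)} {p : M} (hp : p ∈ e.source) (hp' : φ p ∈ e'.source) :
    e p ∈ mapDomain φ e e' :=
  ⟨e.map_source hp, by simpa [e.left_inv hp] using hp'⟩

theorem isOpen_mapDomain {φ : M → N} (hφ : Continuous φ) (e : OpenPartialHomeomorph M (Coord m))
    (e' : OpenPartialHomeomorph N (Coord k)) : IsOpen (mapDomain φ e e') :=
  e.isOpen_inter_preimage_symm (e'.open_source.preimage hφ)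

variable {φ : M → N} {e : OpenPartialHomeomorph M (Coord m)} (he : e ∈ smoothCharts m M)
  {e' : OpenPartialHomeomorph N (Coord k)} (he' : e' ∈ smoothCharts k N)
  {x : Coord m}

include he he'

theorem contDiffAt_mapIn (hφ : ContMDiff (𝓡 m) (𝓡 k) ∞ φ) (hx : x ∈ mapDomain φ e e') :
    ContDiffAt ℝ ∞ (mapIn φ e e') x := by
  have h1 := (contMDiffOn_symm_chart he).contMDiffAt (e.open_target.mem_nhds hx.1)
  have h2 := (contMDiffOn_chart he').contMDiffAt (e'.open_source.mem_nhds hx.2)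
  exact contMDiffAt_iff_contDiffAt.mp (h2.comp x (hφ.contMDiffAt.comp x h1))

theorem fderiv_mapIn (hφ : ContMDiff (𝓡 m) (𝓡 k) ∞ φ) (hx : x ∈ mapDomain φ e e') (u : Coord m) :
    fderiv ℝ (mapIn φ e e') x u =
      chartDeriv e' (φ (e.symm x)) (mapDeriv φ (e.symm x) (chartInv e x u)) := by
  have h1 := ((contMDiffOn_symm_chart he).contMDiffAt
    (e.open_target.mem_nhds hx.1)).mdifferentiableAt (by simp)
  have h2 := ((contMDiffOn_chart he').contMDiffAt
    (e'.open_source.mem_nhds hx.2)).mdifferentiableAt (by simp)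
  have h3 : MDifferentiableAt (𝓡 m) (𝓡 k) φ (e.symm x) :=
    hφ.contMDiffAt.mdifferentiableAt (by simp)
  have h4 : mfderiv (𝓡 m) (𝓡 k) (e' ∘ (φ ∘ e.symm)) x = _ :=
    mfderiv_comp x h2 (h3.comp x h1)
  rw [mfderiv_comp x h3 h1, mfderiv_eq_fderiv] at h4
  exact DFunLike.congr_fun h4 u

theorem mapsTo_mapIn (hx : x ∈ mapDomain φ e e') : mapIn φ e e' x ∈ e'.target :=
  e'.map_source hx.2

variable {g : RiemMetric m M} {h : RiemMetric k N}

theorem isometric_mapIn (hφ : IsIsometricImmersion g h φ) (hx : x ∈ mapDomain φ e e')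
    (u v : Coord m) : metr (metricIn h e') (mapIn φ e e' x) (fderiv ℝ (mapIn φ e e') x u)
      (fderiv ℝ (mapIn φ e e') x v) = metr (metricIn g e) x u v := by
  rw [fderiv_mapIn he he' hφ.smooth hx, fderiv_mapIn he he' hφ.smooth hx, mapIn,
    metr_chartDeriv he' h hx.2, metr_metricIn]
  exact hφ.isometric _ _ _

/-- A vector field along a map, in charts. -/
noncomputable def fieldIn (ξ : ∀ p : M, TangentSpace (𝓡 k) (φ p))
    (e : OpenPartialHomeomorph M (Coord m)) (e' : OpenPartialHomeomorph N (Coord k))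
    (x : Coord m) : Coord k :=
  chartDeriv e' (φ (e.symm x)) (ξ (e.symm x))

variable {ξ : ∀ p : M, TangentSpace (𝓡 k) (φ p)}

theorem contDiffAt_fieldIn (hξ : IsUnitNormalField (m := m) h φ ξ) (hx : x ∈ mapDomain φ e e') :
    ContDiffAt ℝ ∞ (fieldIn ξ e e') x := by
  have h1 := (contMDiffOn_symm_chart he).contMDiffAt (e.open_target.mem_nhds hx.1)
  exact contDiffAt_snd (contMDiffAt_tangentMap e'.open_source (contMDiffOn_chart he')
    (hξ.smooth.contMDiffAt.comp x h1) hx.2)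

theorem unit_fieldIn (hξ : IsUnitNormalField (m := m) h φ ξ) (hx : x ∈ mapDomain φ e e') :
    metr (metricIn h e') (mapIn φ e e' x) (fieldIn ξ e e' x) (fieldIn ξ e e' x) = 1 := by
  exact (metr_chartDeriv he' h hx.2 _ _).trans (hξ.unit _)

theorem normal_fieldIn (hφ : IsIsometricImmersion g h φ) (hξ : IsUnitNormalField (m := m) h φ ξ)
    (hx : x ∈ mapDomain φ e e') (u : Coord m) :
    metr (metricIn h e') (mapIn φ e e' x) (fderiv ℝ (mapIn φ e e') x u) (fieldIn ξ e e' x) = 0 := by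
  rw [fderiv_mapIn he he' hφ.smooth hx]
  exact (metr_chartDeriv he' h hx.2 _ _).trans (hξ.normal _ _)

end MapInCharts

section HypersurfaceInCharts

variable {n : ℕ} {M : Type*} [TopologicalSpace M] [ChartedSpace (Coord n) M]
  [IsManifold (𝓡 n) ∞ M]
  {N : Type*} [TopologicalSpace N] [ChartedSpace (Coord (n + 1)) N] [IsManifold (𝓡 (n + 1)) ∞ N]
  {g : RiemMetric n M} {h : RiemMetric (n + 1) N} {φ : M → N}
  {ξ : ∀ p : M, TangentSpace (𝓡 (n + 1)) (φ p)}
  {e : OpenPartialHomeomorph M (Coord n)} {e' : OpenPartialHomeomorph N (Coord (n + 1))}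

theorem coordHypersurface (hφ : IsIsometricImmersion g h φ)
    (hξ : IsUnitNormalField (m := n) h φ ξ) (he : e ∈ smoothCharts n M)
    (he' : e' ∈ smoothCharts (n + 1) N) :
    CoordHypersurface (mapDomain φ e e') (metricIn g e) e'.target (metricIn h e') (mapIn φ e e')
      (fieldIn ξ e e') where
  src := (isMetricOn_metricIn he g).mono (isOpen_mapDomain hφ.smooth.continuous e e')
    fun _ hx => hx.1
  tgt := isMetricOn_metricIn he' h
  mapsTo _ hx := mapsTo_mapIn he he' hx
  F_smooth _ hx := contDiffAt_mapIn he he' hφ.smooth hx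
  ξ_smooth _ hx := contDiffAt_fieldIn he he' hξ hx
  isometric _ hx := isometric_mapIn he he' hφ hx
  unit _ hx := unit_fieldIn he he' hξ hx
  normal _ hx := normal_fieldIn he he' hφ hξ hx

theorem weingartenIn_symm {x : Coord n} (hx : x ∈ mapDomain φ e e') :
    weingartenIn g h φ ξ e e' (e.symm x) =
      weingartenMatrix (metricIn g e) (metricIn h e') (mapIn φ e e') (fieldIn ξ e e') x := by
  rw [weingartenIn, secondFundIn, e.right_inv hx.1]
  rfl

theorem biharmonicChart_of_hypersurface {c R : ℝ} (hc : HasConstantSectionalCurvature h c)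
    (hφ : IsIsometricImmersion g h φ) (hξ : IsUnitNormalField (m := n) h φ ξ)
    (hbi : IsBiharmonic g h φ)
    (hR : ∀ e ∈ smoothCharts n M, ∀ x ∈ e.target, scalarCurvatureIn (metricIn g e) x = R)
    (he : e ∈ smoothCharts n M) (he' : e' ∈ smoothCharts (n + 1) N) :
    BiharmonicChart (mapDomain φ e e') c (n * (n - 1) * c - R) (metr (metricIn g e))
      (conn (metricIn g e))
      (weingarten (metricIn g e) (metricIn h e') (mapIn φ e e') (fieldIn ξ e e'))
      (fun x => -(1 / 2) * opTrace (Coord n)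
        (weingarten (metricIn g e) (metricIn h e') (mapIn φ e e') (fieldIn ξ e e') x))
      (fun x => (-(1 / 2) : ℝ) • grad (metricIn g e) (fun y => opTrace (Coord n)
        (weingarten (metricIn g e) (metricIn h e') (mapIn φ e e') (fieldIn ξ e e') y)) x) := by
  refine (coordHypersurface hφ hξ he he').biharmonicChart (fun y hy => hc e' he' y hy)
    (fun x hx => ?_) fun x hx => hR e he x hx.1
  have h1 := hbi e he e' he' (e.symm x) (e.map_target hx.1) hx.2
  rwa [e.right_inv hx.1] at h1

theorem fderiv_trace_eq_zero {c : ℝ} (hc : HasConstantSectionalCurvature h c)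
    (hφ : IsIsometricImmersion g h φ) (hξ : IsUnitNormalField (m := n) h φ ξ)
    (hbi : IsBiharmonic g h φ) (hR : HasConstantScalarCurvature g)
    (hpc : AtMostPrincipalCurvatures 6 g h φ ξ)
    (he : e ∈ smoothCharts n M) (he' : e' ∈ smoothCharts (n + 1) N) {x : Coord n}
    (hx : x ∈ mapDomain φ e e') :
    DifferentiableAt ℝ (fun y => (weingartenIn g h φ ξ e e' (e.symm y)).trace) x ∧
    fderiv ℝ (fun y => (weingartenIn g h φ ξ e e' (e.symm y)).trace) x = 0 := by
  obtain ⟨R, hR⟩ := hR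
  have hB := biharmonicChart_of_hypersurface hc hφ hξ hbi hR he he'
  have hH := coordHypersurface hφ hξ he he'
  have hcard : ∀ y ∈ mapDomain φ e e', {s : ℝ | Module.End.HasEigenvalue
      (weingarten (metricIn g e) (metricIn h e') (mapIn φ e e') (fieldIn ξ e e') y :
        Coord n →ₗ[ℝ] Coord n) s}.ncard ≤ 6 := by
    intro y hy
    have h1 := hpc e he e' he' (e.symm y) (e.map_target hy.1) hy.2
    rw [weingartenIn_symm hy] at h1
    refine ENat.natCast_le_natCast.mp (le_trans (Set.ncard_le_encard _) (le_trans ?_ h1))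
    refine Set.encard_le_encard fun s hs => ?_
    obtain ⟨v, hv⟩ := Module.End.HasEigenvalue.exists_hasEigenvector hs
    refine ⟨fun i => v i, fun h0 => hv.2 (PiLp.ext fun i => congrFun h0 i), funext fun i => ?_⟩
    have h2 := congrArg (fun w : Coord n => w i) (Module.End.mem_eigenspace_iff.mp hv.1)
    simp only [weingarten] at h2
    refine Eq.trans ?_ h2
    exact (coordEnd_apply _ _ _).symm
  have h0 := hB.fderiv_eq_zero hcard hx
  have hev : (fun y => opTrace (Coord n) (weingarten (metricIn g e) (metricIn h e')
      (mapIn φ e e') (fieldIn ξ e e') y)) =ᶠ[nhds x]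
      fun y => (weingartenIn g h φ ξ e e' (e.symm y)).trace := by
    filter_upwards [hH.src.isOpen.mem_nhds hx] with y hy
    rw [weingartenIn_symm hy, weingarten, opTrace_coordEnd]
  have hd := differentiableAt_of_smooth (hH.trace_smooth hx)
  refine ⟨hd.congr_of_eventuallyEq hev.symm, ?_⟩
  rw [← hev.fderiv_eq]
  rw [fderiv_const_mul hd] at h0
  exact (smul_eq_zero.mp h0).resolve_left (by norm_num)

end HypersurfaceInCharts

/-! ### Independence of the charts and the global conclusion. -/

section ChangeOfCharts

section Composition

variable {E E' E'' : Type*} [NormedAddCommGroup E] [NormedSpace ℝ E] [NormedAddCommGroup E']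
  [NormedSpace ℝ E'] [NormedAddCommGroup E''] [NormedSpace ℝ E'']

/-- The second order chain rule: the Hessian of `F` is carried along by the derivative of `K`, and
the rest is the second derivative of `K` in the image directions. -/
theorem covAlong_comp {Γ : E'' → E'' →L[ℝ] E'' →L[ℝ] E''} {K : E' → E''} {F : E → E'} {x : E}
    (hF : ContDiffAt ℝ ∞ F x) (hK : ContDiffAt ℝ ∞ K (F x)) (u v : E) :
    covAlong Γ (K ∘ F) u (fun y => fderiv ℝ (K ∘ F) y v) x =
      fderiv ℝ K (F x) (fderiv ℝ (fderiv ℝ F) x u v) +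
        covAlong Γ K (fderiv ℝ F x u) (fun z => fderiv ℝ K z (fderiv ℝ F x v)) (F x) := by
  have hF' := differentiableAt_of_smooth (hF.fderiv_right (m := ∞) (by simp))
  have hK' := differentiableAt_of_smooth (hK.fderiv_right (m := ∞) (by simp))
  have hF1 : ∀ᶠ y in nhds x, ContDiffAt ℝ 1 F y := (hF.of_le (by simp)).eventually (by simp)
  have hK1 : ∀ᶠ y in nhds x, ContDiffAt ℝ 1 K (F y) :=
    hF.continuousAt.eventually ((hK.of_le (by simp)).eventually (by simp))
  have hev : (fun y => fderiv ℝ (K ∘ F) y v) =ᶠ[nhds x]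
      fun y => (fderiv ℝ K ∘ F) y (fderiv ℝ F y v) := by
    filter_upwards [hF1, hK1] with y h1 h2
    rw [fderiv_comp y (h2.differentiableAt (by simp)) (h1.differentiableAt (by simp))]
    rfl
  have hKF : DifferentiableAt ℝ (fderiv ℝ K ∘ F) x := hK'.comp x (differentiableAt_of_smooth hF)
  have e1 : fderiv ℝ (fderiv ℝ K ∘ F) x u = fderiv ℝ (fderiv ℝ K) (F x) (fderiv ℝ F x u) := by
    rw [fderiv_comp x hK' (differentiableAt_of_smooth hF)]
    rfl
  have e2 : ∀ w, fderiv ℝ (K ∘ F) x w = fderiv ℝ K (F x) (fderiv ℝ F x w) := fun w => by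
    rw [fderiv_comp x (differentiableAt_of_smooth hK) (differentiableAt_of_smooth hF)]
    rfl
  rw [covAlong, covAlong, hev.fderiv_eq, e2, e2,
    fderiv_clm_apply hKF (hF'.clm_apply (differentiableAt_const v)),
    fderiv_clm_apply hF' (differentiableAt_const v),
    fderiv_clm_apply hK' (differentiableAt_const _)]
  simp only [add_apply, ContinuousLinearMap.coe_comp, Function.comp_apply,
    ContinuousLinearMap.flip_apply, e1, fderiv_fun_const, Pi.zero_apply, zero_apply, map_zero]
  abel_nf

end Composition

section Isometry

set_option linter.unusedSectionVars false

variable {E : Type*} [NormedAddCommGroup E] [NormedSpace ℝ E] [FiniteDimensional ℝ E]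
  {U U' : Set E} {g h : E → E →L[ℝ] E →L[ℝ] ℝ} {Γ Γ' : E → E →L[ℝ] E →L[ℝ] E} {F : E → E} {x : E}
  (hI : IsometricChart U g Γ U' h Γ' F) (hx : x ∈ U)

include hI hx

namespace IsometricChart

theorem fderiv_injective : Function.Injective (fderiv ℝ F x) := by
  intro u v huv
  refine hI.src.eq_of_forall hx fun w => ?_
  rw [← hI.isometric x hx, huv, hI.isometric x hx]

theorem fderiv_surjective : Function.Surjective (fderiv ℝ F x) :=
  (LinearMap.injective_iff_surjective (f := (fderiv ℝ F x : E →ₗ[ℝ] E))).mp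
    (hI.fderiv_injective hx)

/-- Isometries preserve the connection. -/
theorem covAlong_dF_eq (u v : E) :
    covAlong Γ' F u (fun y => fderiv ℝ F y v) x = fderiv ℝ F x (Γ x u v) := by
  refine hI.tgt.eq_of_forall (hI.mapsTo x hx) fun w => ?_
  obtain ⟨w, rfl⟩ := hI.fderiv_surjective hx w
  rw [hI.tangential hx, hI.isometric x hx]

end IsometricChart

end Isometry

variable {E E' : Type*} [NormedAddCommGroup E] [NormedSpace ℝ E] [FiniteDimensional ℝ E]
  [NormedAddCommGroup E'] [NormedSpace ℝ E'] [FiniteDimensional ℝ E']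
  {U V : Set E} {g k : E → E →L[ℝ] E →L[ℝ] ℝ} {Γ Λ : E → E →L[ℝ] E →L[ℝ] E}
  {U' V' W : Set E'} {h l : E' → E' →L[ℝ] E' →L[ℝ] ℝ} {Γ' Λ' : E' → E' →L[ℝ] E' →L[ℝ] E'}
  {F ξ K ζ : E → E'} {A B : E → E →L[ℝ] E} {ψ : E → E} {ψ' : E' → E'} {x : E}

/-- The trace of the Weingarten operator does not depend on the charts. -/
theorem HypersurfaceChart.opTrace_eq {S : Set E} (hF : HypersurfaceChart U g Γ U' h Γ' F ξ A)
    (hK : HypersurfaceChart V k Λ V' l Λ' K ζ B) (hψ : IsometricChart S g Γ V k Λ ψ)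
    (hψ' : IsometricChart W h Γ' V' l Λ' ψ') (hx : x ∈ U) (hxS : x ∈ S) (hFx : F x ∈ W)
    (hcomp : K ∘ ψ =ᶠ[nhds x] ψ' ∘ F) (hζ : ζ (ψ x) = fderiv ℝ ψ' (F x) (ξ x)) :
    opTrace E (B (ψ x)) = opTrace E (A x) := by
  have hψx := hψ.mapsTo x hxS
  have sF := hF.F_smooth x hx
  have sK := hK.F_smooth _ hψx
  have sψ := hψ.F_smooth x hxS
  have sψ' := hψ'.F_smooth _ hFx
  have hcov : ∀ u v, covAlong Λ' (K ∘ ψ) u (fun y => fderiv ℝ (K ∘ ψ) y v) x =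
      covAlong Λ' (ψ' ∘ F) u (fun y => fderiv ℝ (ψ' ∘ F) y v) x := by
    intro u v
    have h1 : (fun y => fderiv ℝ (K ∘ ψ) y v) =ᶠ[nhds x] fun y => fderiv ℝ (ψ' ∘ F) y v := by
      filter_upwards [hcomp.fderiv (𝕜 := ℝ)] with y hy
      rw [hy]
    rw [covAlong_congr h1, covAlong, covAlong, hcomp.fderiv_eq, hcomp.eq_of_nhds]
  have hleft : ∀ u v, covAlong Λ' (ψ' ∘ F) u (fun y => fderiv ℝ (ψ' ∘ F) y v) x =
      fderiv ℝ ψ' (F x) (covAlong Γ' F u (fun y => fderiv ℝ F y v) x) := by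
    intro u v
    have hF' := differentiableAt_of_smooth (sF.fderiv_right (m := ∞) (by simp))
    rw [covAlong_comp sF sψ', hψ'.covAlong_dF_eq hFx, ← map_add, covAlong,
      fderiv_clm_apply hF' (differentiableAt_const v)]
    simp
  -- The two Weingarten operators are conjugate by the derivative of the transition map: `ψ'`
  -- preserves the connection, and the Hessian of `ψ` contributes only a tangential term, which the
  -- normal field does not see.
  have hcomm : ∀ u, B (ψ x) (fderiv ℝ ψ x u) = fderiv ℝ ψ x (A x u) := by
    intro u
    refine hψ.tgt.eq_of_forall hψx fun w => ?_
    obtain ⟨v, rfl⟩ := hψ.fderiv_surjective hxS w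
    have h1 := hcov u v
    rw [covAlong_comp sψ sK, hleft] at h1
    have h2 := congrArg (fun X => l (K (ψ x)) X (ζ (ψ x))) h1
    have h3 : K (ψ x) = ψ' (F x) := hcomp.eq_of_nhds
    simp only [map_add, add_apply] at h2
    rw [hK.normal _ hψx, zero_add, ← hK.shape _ hψx, h3, hζ, hψ'.isometric _ hFx,
      ← hF.shape x hx] at h2
    rw [h2, hψ.isometric x hxS]
  let L : E ≃ₗ[ℝ] E := LinearEquiv.ofInjectiveEndo (fderiv ℝ ψ x : E →ₗ[ℝ] E)
    (hψ.fderiv_injective hxS)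
  rw [opTrace_apply, opTrace_apply, ← LinearMap.trace_conj' (A x : E →ₗ[ℝ] E) L]
  congr 1
  refine LinearMap.ext fun w => ?_
  obtain ⟨u, rfl⟩ := L.surjective w
  rw [LinearEquiv.conj_apply_apply, L.symm_apply_apply]
  exact hcomm u

end ChangeOfCharts

section TraceInCharts

set_option linter.unusedSectionVars false

variable {m : ℕ} {M : Type*} [TopologicalSpace M] [ChartedSpace (Coord m) M]
  [IsManifold (𝓡 m) ∞ M]

theorem isIsometricImmersion_id (g : RiemMetric m M) : IsIsometricImmersion g g id where
  smooth := contMDiff_id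
  isometric p v w := by rw [mfderiv_id]; rfl

/-- A transition map is the coordinate expression of the identity, which is an isometric immersion
of the manifold into itself. -/
theorem isometricChart_transition (g : RiemMetric m M) {e e₁ : OpenPartialHomeomorph M (Coord m)}
    (he : e ∈ smoothCharts m M) (he₁ : e₁ ∈ smoothCharts m M) :
    IsometricChart (mapDomain id e e₁) (metr (metricIn g e)) (conn (metricIn g e)) e₁.target
      (metr (metricIn g e₁)) (conn (metricIn g e₁)) (mapIn id e e₁) where
  src := ((isMetricOn_metricIn he g).mono (isOpen_mapDomain continuous_id e e₁)
    fun _ hx => hx.1).leviCivita'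
  tgt := (isMetricOn_metricIn he₁ g).leviCivita'
  mapsTo _ hx := mapsTo_mapIn he he₁ hx
  F_smooth _ hx := contDiffAt_mapIn he he₁ contMDiff_id hx
  isometric _ hx := isometric_mapIn he he₁ (isIsometricImmersion_id g) hx

variable {n : ℕ} {M : Type*} [TopologicalSpace M] [ChartedSpace (Coord n) M]
  [IsManifold (𝓡 n) ∞ M]
  {N : Type*} [TopologicalSpace N] [ChartedSpace (Coord (n + 1)) N] [IsManifold (𝓡 (n + 1)) ∞ N]
  {g : RiemMetric n M} {h : RiemMetric (n + 1) N} {φ : M → N}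
  {ξ : ∀ p : M, TangentSpace (𝓡 (n + 1)) (φ p)}

theorem fieldIn_apply {e : OpenPartialHomeomorph M (Coord n)}
    {e' : OpenPartialHomeomorph N (Coord (n + 1))} {p : M} (hp : p ∈ e.source) :
    fieldIn ξ e e' (e p) = chartDeriv e' (φ p) (ξ p) :=
  congrArg (fun q => chartDeriv e' (φ q) (ξ q)) (e.left_inv hp)

theorem trace_weingartenIn_eq (hφ : IsIsometricImmersion g h φ)
    (hξ : IsUnitNormalField (m := n) h φ ξ)
    {e e₁ : OpenPartialHomeomorph M (Coord n)} {e' e₁' : OpenPartialHomeomorph N (Coord (n + 1))}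
    (he : e ∈ smoothCharts n M) (he' : e' ∈ smoothCharts (n + 1) N)
    (he₁ : e₁ ∈ smoothCharts n M) (he₁' : e₁' ∈ smoothCharts (n + 1) N) {p : M}
    (hp : p ∈ e.source) (hp' : φ p ∈ e'.source) (hp₁ : p ∈ e₁.source) (hp₁' : φ p ∈ e₁'.source) :
    (weingartenIn g h φ ξ e₁ e₁' p).trace = (weingartenIn g h φ ξ e e' p).trace := by
  have hx := mem_mapDomain hp hp'
  have hx₁ := mem_mapDomain hp₁ hp₁'
  have hS : IsOpen (mapDomain φ e e' ∩ mapDomain id e e₁) :=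
    (isOpen_mapDomain hφ.smooth.continuous e e').inter (isOpen_mapDomain continuous_id e e₁)
  have hxS : e p ∈ mapDomain id e e₁ := mem_mapDomain hp hp₁
  have hψ : mapIn id e e₁ (e p) = e₁ p := congrArg e₁ (e.left_inv hp)
  have hF : mapIn φ e e' (e p) = e' (φ p) := congrArg (fun q => e' (φ q)) (e.left_inv hp)
  have hV : IsOpen (mapDomain id e e₁ ∩ mapIn id e e₁ ⁻¹' mapDomain φ e₁ e₁') :=
    ContinuousOn.isOpen_inter_preimage
      (fun y hy => (contDiffAt_mapIn he he₁ contMDiff_id hy).continuousAt.continuousWithinAt)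
      (isOpen_mapDomain continuous_id e e₁) (isOpen_mapDomain hφ.smooth.continuous e₁ e₁')
  have hI := isometricChart_transition g he he₁
  have hψI : IsometricChart (mapDomain id e e₁ ∩ mapIn id e e₁ ⁻¹' mapDomain φ e₁ e₁')
      (metr (metricIn g e)) (conn (metricIn g e)) (mapDomain φ e₁ e₁') (metr (metricIn g e₁))
      (conn (metricIn g e₁)) (mapIn id e e₁) :=
    { src := ((isMetricOn_metricIn he g).mono hV fun _ hx => hx.1.1).leviCivita'
      tgt := (coordHypersurface hφ hξ he₁ he₁').src.leviCivita'
      mapsTo := fun _ hy => hy.2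
      F_smooth := fun y hy => hI.F_smooth y hy.1
      isometric := fun y hy => hI.isometric y hy.1 }
  have hcomp : mapIn φ e₁ e₁' ∘ mapIn id e e₁ =ᶠ[nhds (e p)] mapIn id e' e₁' ∘ mapIn φ e e' := by
    filter_upwards [hS.mem_nhds ⟨hx, hxS⟩] with y hy
    have h1 : e₁.symm (e₁ (e.symm y)) = e.symm y := e₁.left_inv hy.2.2
    have h2 : e'.symm (e' (φ (e.symm y))) = φ (e.symm y) := e'.left_inv hy.1.2
    simp only [Function.comp_apply, mapIn, id, h1, h2]
  have hFx : mapIn φ e e' (e p) ∈ mapDomain id e' e₁' := by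
    rw [hF]; exact mem_mapDomain hp' hp₁'
  have hζ : fieldIn ξ e₁ e₁' (mapIn id e e₁ (e p)) =
      fderiv ℝ (mapIn id e' e₁') (mapIn φ e e' (e p)) (fieldIn ξ e e' (e p)) := by
    have h2 : ∀ u, mapDeriv (m := n + 1) (k := n + 1) id (φ p) u = u := fun u => by
      rw [mapDeriv, mfderiv_id]; rfl
    rw [fderiv_mapIn he' he₁' contMDiff_id hFx, hF, hψ, fieldIn_apply hp, fieldIn_apply hp₁,
      e'.left_inv hp', h2]
    exact congrArg (chartDeriv e₁' (φ p)) (chartInv_chartDeriv he' hp' (ξ p)).symm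
  have key := (coordHypersurface hφ hξ he he').hypersurfaceChart.opTrace_eq
    (coordHypersurface hφ hξ he₁ he₁').hypersurfaceChart hψI
    (isometricChart_transition h he' he₁') hx ⟨hxS, by rw [Set.mem_preimage, hψ]; exact hx₁⟩ hFx
    hcomp hζ
  rw [hψ, weingarten, weingarten, opTrace_coordEnd, opTrace_coordEnd, ← weingartenIn_symm hx₁,
    ← weingartenIn_symm hx, e.left_inv hp, e₁.left_inv hp₁] at key
  exact key

theorem isLocallyConstant_trace {c : ℝ} (hc : HasConstantSectionalCurvature h c)
    (hφ : IsIsometricImmersion g h φ) (hξ : IsUnitNormalField (m := n) h φ ξ)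
    (hbi : IsBiharmonic g h φ) (hR : HasConstantScalarCurvature g)
    (hpc : AtMostPrincipalCurvatures 6 g h φ ξ) :
    IsLocallyConstant fun p => (weingartenIn g h φ ξ (chartAt (Coord n) p)
      (chartAt (Coord (n + 1)) (φ p)) p).trace := by
  rw [IsLocallyConstant.iff_eventually_eq]
  intro p
  have he : ∀ q : M, chartAt (Coord n) q ∈ smoothCharts n M :=
    IsManifold.chart_mem_maximalAtlas
  have he' : ∀ q : N, chartAt (Coord (n + 1)) q ∈ smoothCharts (n + 1) N :=
    IsManifold.chart_mem_maximalAtlas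
  set e := chartAt (Coord n) p with hee
  set e' := chartAt (Coord (n + 1)) (φ p) with hee'
  have hp : p ∈ e.source := mem_chart_source _ _
  have hp' : φ p ∈ e'.source := mem_chart_source _ _
  have hx := mem_mapDomain hp hp'
  obtain ⟨r, hr, hball⟩ := Metric.isOpen_iff.mp
    (isOpen_mapDomain hφ.smooth.continuous e e') _ hx
  -- In fixed charts the trace is constant on a ball, where its derivative vanishes. The charts in
  -- the statement vary with the point, which `trace_weingartenIn_eq` makes irrelevant.
  have hconst : ∀ y ∈ Metric.ball (e p) r, (weingartenIn g h φ ξ e e' (e.symm y)).trace =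
      (weingartenIn g h φ ξ e e' (e.symm (e p))).trace := by
    intro y hy
    have hd := fun y (hy : y ∈ Metric.ball (e p) r) => fderiv_trace_eq_zero hc hφ hξ hbi hR hpc (he p) (he' (φ p)) (hball hy)
    exact Metric.isOpen_ball.is_const_of_fderiv_eq_zero (𝕜 := ℝ)
      (convex_ball (e p) r).isPreconnected
      (fun y hy => (hd y hy).1.differentiableWithinAt) (fun y hy => (hd y hy).2) hy
      (Metric.mem_ball_self hr)
  filter_upwards [e.open_source.mem_nhds hp, (e'.open_source.preimage
    hφ.smooth.continuous).mem_nhds hp', (e.continuousAt hp).preimage_mem_nhds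
      (Metric.ball_mem_nhds (e p) hr)] with q hq hq' hqb
  have h1 := hconst (e q) hqb
  rw [e.left_inv hq, e.left_inv hp] at h1
  rw [← h1]
  exact trace_weingartenIn_eq hφ hξ (he p) (he' (φ p)) (he q) (he' (φ q)) hq hq'
    (mem_chart_source _ _) (mem_chart_source _ _)

end TraceInCharts
end BiharmonicHypersurface

open BiharmonicHypersurface in
theorem theorem1p1 {n : ℕ} (hn : 1 ≤ n) (c : ℝ)
    {M : Type*} [TopologicalSpace M] [ConnectedSpace M] [ChartedSpace (Coord n) M]
    [IsManifold (𝓡 n) ∞ M]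
    {N : Type*} [TopologicalSpace N] [ChartedSpace (Coord (n + 1)) N]
    [IsManifold (𝓡 (n + 1)) ∞ N]
    (g : RiemMetric n M) (h : RiemMetric (n + 1) N)
    (hc : HasConstantSectionalCurvature h c)
    (φ : M → N) (hφ : IsIsometricImmersion g h φ)
    (ξ : ∀ p : M, TangentSpace (𝓡 (n + 1)) (φ p)) (hξ : IsUnitNormalField (m := n) h φ ξ)
    (hbi : IsBiharmonic g h φ)
    (hR : HasConstantScalarCurvature g)
    (hpc : AtMostPrincipalCurvatures 6 g h φ ξ) :
    HasConstantMeanCurvature g h φ ξ := by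
  obtain ⟨p₀⟩ := (inferInstance : Nonempty M)
  refine ⟨1 / (n : ℝ) * (weingartenIn g h φ ξ (chartAt (Coord n) p₀)
    (chartAt (Coord (n + 1)) (φ p₀)) p₀).trace, fun e he e' he' p hp hp' => ?_⟩
  rw [← (isLocallyConstant_trace hc hφ hξ hbi hR hpc).apply_eq_of_preconnectedSpace p p₀]
  exact congrArg _ (trace_weingartenIn_eq hφ hξ (IsManifold.chart_mem_maximalAtlas p)
    (IsManifold.chart_mem_maximalAtlas (φ p)) he he' (mem_chart_source _ _)
    (mem_chart_source _ _) hp hp')
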